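/- **Setting.** Let $n=2^m$, $d\ge 1$, $N=n^d$, and index signals by $[n]^d=(\mathbb Z/n)^d$. Put $\omega=e^{2\pi i/n}$, $\hat x_j=N^{-1/2}\sum_i\omega^{-i^Tj}x_i$, and let $\mathcal F$ denote this transform. An algorithm has oracle access to the entries of $\hat x$; every read is one sample. Time is counted in steps of a random access machine with unit-cost arithmetic on integers, elements of $\mathbb Z/n$ and complex numbers, unit-cost elementary functions and unit-cost access to arrays. **Hashing.** Let $F=2d$ and $b=2^e$, $B=b^d$. The filter is $G_t=\prod_{s=1}^d\Big(\frac1{b-1}\sum_{|j|<b/2}\omega^{jt_s}\Big)^{F}$ and $\hat G$ is its Fourier transform. For $\Sigma\in GL_d(\mathbb Z/n)$ (odd determinant) and $q\in[n]^d$ let $\pi(i)=\Sigma(i-q)$, let $h(i)\in[b]^d$ be $\frac bn\pi(i)$ rounded, and $o_i(j)=\pi(j)-\frac nb h(i)$. For a sparse $\chi$ and $a\in[n]^d$, HashToBins$(\hat x,\chi,(\Sigma,q,a))$ computes $u_s=\sqrt N\,\mathcal F^{-1}(y)_{(n/b)s}$ for $s\in[b]^d$ by an FFT on $[b]^d$,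 where $y_i=\hat G_i\,\omega^{i^T\Sigma q}(\hat x-\hat\chi')_{\Sigma^T(i-a)}$ and $\hat\chi'\approx\hat\chi$ is computed by a semi-equispaced FFT: convolution with a flat window cut off at radius $O(c(n/b)\log N)$, followed by an FFT on a grid with $2^{O(d^2)}B$ points; the constant $c$ governs its precision. **Algorithm** ReduceInfNorm$(\hat x,\chi,k,\nu,R^*,\mu)$, with constants $\alpha\in(0,1)$, $C$, $c$. *Measurements.* Let $B=b^d\ge(2\pi)^{4dF}k/\alpha^d$ with $b$ the least possible power of two, $\Delta=2^{\lfloor\frac12\log_2\log_2n\rfloor}$, and $\mathcal H=\{0\}\cup\{\max(n\Delta^{-g},1)\,e_s:1\le g\le\lceil\log_\Delta n\rceil,\ 1\le s\le d\}$. For $r=1,\dots,\lceil (C/\sqrt\alpha)\log N\rceil$ draw $(\Sigma_r,q_r)$ uniformly and a list $\mathcal A_r$ of $\lceil C\log\log N\rceil$ uniform pairs $(\beta',\beta)\in[n]^d\times[n]^d$, and take the measurements HashToBins$(\hat x,0,(\Sigma_r,q_r,\beta'+\beta w))$ for all pairs in $\mathcal A_r$ and all $w\in\mathcal H$ (the product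 $\beta w$ is coordinatewise). *Iterations.* Start with $\chi^{(0)}=0$. For $t=0,\dots,T-1$, $T=\max(0,\lceil\log_2R^*\rceil)$ (and $T=0$ if $R^*=0$): 1. *Location.* For each $r$ turn the stored measurements into measurements of $x-\chi-\chi^{(t)}$. Then, for each bucket $j$ and each coordinate $s$, recover base-$\Delta$ digits one at a time, starting from $\mathbf f=0$. Digit number $g$ is the unique $\rho\in\{0,\dots,\Delta-1\}$ (the last base is smaller if $\Delta^g\nmid n$) such that $\big|\omega^{-w_s(\mathbf f_s+\Delta^{g-1}\rho)\beta_s}\,m_j(w)/m_j(0)-1\big|<1/3$ for at least $3/5$ of the pairs in $\mathcal A_r$. Here $w\in\mathcal H$ is the direction with index $(g,s)$, and $m_j(w)$ is the value in bucket $j$ at the point $\beta'+\beta w$; the digit adds $\Delta^{g-1}\rho$ to $\mathbf f_s$. If no unique digit exists the bucket is skipped; otherwise $\Sigma_r^{-1}\mathbf f$ is put in the list $L$. 2. *Estimation.* Draw $\lceil C\log N\rceil$ fresh uniform hashings and evaluation points $z$, with the least power of two $b$ such that $b^d\ge(2\pi)^{4dF}k/\alpha^{2d}$, and let $u$ be the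 output of HashToBins on $\hat x,\ \chi+\chi^{(t)}$. For $f\in L$ let $w_f$ be the median, in real and imaginary parts, of the numbers $G_{o_f(f)}^{-1}\omega^{-z^T\Sigma f}u_{h(f)}$. Put $\chi^{(t+1)}=\chi^{(t)}+\chi'$, where $\chi'_f=w_f$ for those $f\in L$ with $|w_f|>5(\nu2^{T-(t+1)}+\mu)$ and $\chi'$ is zero elsewhere. The output is $\chi^{(T)}$. **Lemma.** There is an absolute constant $\alpha_0\in(0,1)$ such that for all $0<\alpha\le\alpha_0$ and all $c_0\in\mathbb N$, all sufficiently large integers $c$ and all sufficiently large real $C$ (in terms of $\alpha,c_0$), there is a constant $K$ (depending on $\alpha,c_0,c,C$ only) for which the following holds. Let $d,k\ge1$ be integers and $n$ a power of two such that the numbers of buckets do not exceed $N$, i.e. $(2\pi)^{8d^2}k/\alpha^{2d}\le N$. Let $x,\chi\in\mathbb C^{[n]^d}$, $x'=x-\chi$, and let $S$ be a set of $k$ indices of largest $|x'_i|$ (ties broken arbitrarily). Let $\nu\in\mathbb R$ and $\mu,R^*\ge0$ satisfy $$\nu\ge\|x'_S\|_1/k,\qquad \mu^2\ge\|x'_{[n]^d\setminus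 S}\|_2^2/k,\qquad \|x'_{[n]^d\setminus S}\|_\infty\le\nu,$$ $$\|x'\|_\infty\le R^*(\nu+\mu),\qquad R^*\le N^{c_0},\qquad \|\chi\|_\infty\le N^{c_0}(\nu+\mu).$$ Then ReduceInfNorm$(\hat x,\chi,k,\nu,R^*,\mu)$ has the following properties. * With probability at least $1-N^{-10}$ over its internal randomness, its output $\tilde\chi$ satisfies $\|x'-\tilde\chi\|_\infty\le8(\nu+\mu)$ and $\tilde\chi_{[n]^d\setminus S}\equiv0$, and it takes at most $2^{Kd^2}\,(k+\|\chi\|_0)\,\log^{d+3}N$ time. * It always uses at most $2^{Kd^2}\,k\log^3N$ samples. -/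

import Mathlib

noncomputable section

namespace SparseFourier

/-! ### Randomized algorithms with oracle access, sample count and step count -/

/-- A randomized algorithm with output in `α` and access to the entries of an unknown vector indexed
by `X`: it returns a value, reads one entry of the vector, draws a uniformly random element of a
finite nonempty type, or performs one elementary step. -/
inductive Alg (X α : Type) : Type 1
  | done (a : α) : Alg X α
  | read (j : X) (next : ℂ → Alg X α) : Alg X α
  | draw (Ω : Type) (hf : Fintype Ω) (hn : Nonempty Ω) (next : Ω → Alg X α) : Alg X α
  | step (next : Alg X α) : Alg X α

/-- What a run of an algorithm produces: its output, the number of entries of the vector that were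
read, and the number of steps taken. -/
structure Outcome (α : Type) where
  output : α
  samples : ℕ
  time : ℕ

namespace Alg

variable {X α β ι : Type}

def bind : Alg X α → (α → Alg X β) → Alg X β
  | done a, f => f a
  | read j next, f => read j fun v => bind (next v) f
  | draw Ω hf hn next, f => draw Ω hf hn fun w => bind (next w) f
  | step next, f => step (bind next f)

instance : Monad (Alg X) where
  pure := Alg.done
  bind := Alg.bind

/-- The joint law of output, sample count and step count when the algorithm runs on the vector `v`.
Reading an entry costs one sample and one step, a random draw costs one step. -/
def law (v : X → ℂ) : Alg X α → PMF (Outcome α)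
  | done a => PMF.pure ⟨a, 0, 0⟩
  | read j next => (law v (next (v j))).map fun o => ⟨o.output, o.samples + 1, o.time + 1⟩
  | draw Ω _ _ next => (PMF.uniformOfFintype Ω).bind fun w =>
      (law v (next w)).map fun o => ⟨o.output, o.samples, o.time + 1⟩
  | step next => (law v next).map fun o => ⟨o.output, o.samples, o.time + 1⟩

/-- Spend `t` steps. -/
def charge : ℕ → Alg X Unit
  | 0 => pure ()
  | t + 1 => step (charge t)

/-- Compute the value `a` in `t` steps. The steps are those of a random access machine for which each
of the following takes a constant number of steps: arithmetic, comparisons and rounding of integers,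
of elements of `ZMod (2 ^ m)` and of complex numbers, the functions `exp`, `sin`, `sqrt` and powers,
and access to an entry of an array or of an associative array. Thus operations on vectors of length
`d` are charged order `d` steps, and products of a vector with a `d × d` matrix order `d ^ 2`. -/
def op (t : ℕ) (a : α) : Alg X α := do
  charge t
  pure a

def sample (j : X) : Alg X ℂ := read j done

def uniform (Ω : Type) [hf : Fintype Ω] [hn : Nonempty Ω] : Alg X Ω := draw Ω hf hn done

/-- Run `f` on the members of a list in turn, keeping the list of the results. -/
def collect (f : ι → Alg X α) : List ι → Alg X (List α)
  | [] => pure []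
  | i :: l => do
      let a ← f i
      charge 1
      let as ← collect f l
      pure (a :: as)

/-- Run `f` on the members of a list in turn and store the results in an array, whose entries are
zero elsewhere. -/
def tabulate [DecidableEq ι] [Zero α] (l : List ι) (f : ι → Alg X α) : Alg X (ι → α) :=
  l.foldlM (fun table i => do
    let a ← f i
    op 1 (Function.update table i a)) 0

end Alg

open Alg

/-! ### Signals and the Fourier transform -/

/-- The index set `[n]^d` with `n = 2 ^ m`, coordinates being taken modulo `n`. -/
abbrev Pt (d m : ℕ) : Type := Fin d → ZMod (2 ^ m)

/-- `N = n ^ d`. -/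
def size (d m : ℕ) : ℝ := ((2 : ℝ) ^ m) ^ d

/-- `ω ^ z` where `ω = exp (2 π i / n)`, `n = 2 ^ m`. -/
def root {m : ℕ} (z : ZMod (2 ^ m)) : ℂ := ZMod.stdAddChar z

/-- The orthonormal discrete Fourier transform. -/
def dft {d m : ℕ} (x : Pt d m → ℂ) (j : Pt d m) : ℂ :=
  (1 / (Real.sqrt (size d m) : ℂ)) * ∑ i, root (-(i ⬝ᵥ j)) * x i

def supp {d m : ℕ} (x : Pt d m → ℂ) : Finset (Pt d m) := Finset.univ.filter fun i => x i ≠ 0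

def toPt {d : ℕ} (e : ℕ) (i : Fin d → ℤ) : Pt d e := fun s => (i s : ZMod (2 ^ e))

/-! ### Fast Fourier transform -/

section Programs

variable {X : Type} {d m : ℕ}

/-- Radix-two fast Fourier transform on `[2 ^ e]^d`, without normalization: the entry of the result
at `i` is the sum over `j` of `exp (σ · 2 π i (i · j) / 2 ^ e) f j`, where `σ = ± 1`. -/
def fft (σ : ℤ) : (e : ℕ) → (Pt d e → ℂ) → Alg X (Pt d e → ℂ)
  | 0, f => op (d + 1) f
  | e + 1, f => do
      let parts ← tabulate (Finset.univ : Finset (Fin d → Fin 2)).toList fun ε =>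
        fft σ e fun j => f fun s => ((2 * (j s).val + (ε s).val : ℕ) : ZMod (2 ^ (e + 1)))
      tabulate (Finset.univ : Finset (Pt d (e + 1))).toList fun i =>
        (Finset.univ : Finset (Fin d → Fin 2)).toList.foldlM (fun total ε =>
          op (4 * d + 3) (total +
            root ((σ : ZMod (2 ^ (e + 1))) * ∑ s, i s * ((ε s).val : ZMod (2 ^ (e + 1)))) *
              parts ε (fun s => ((i s).val : ZMod (2 ^ e))))) 0

/-! ### Semi-equispaced Fourier transform -/

/-- The normalized Dirichlet kernel: the average of `ω ^ (j t)` over the integers `|j| ≤ h`,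
`ω = exp (2 π i / 2 ^ m)`. -/
def dirichlet (h : ℕ) (t : ZMod (2 ^ m)) : ℝ :=
  if t = 0 then 1
  else Real.sin ((2 * h + 1) * (Real.pi * t.val / 2 ^ m)) /
    ((2 * h + 1) * Real.sin (Real.pi * t.val / 2 ^ m))

/-- The one-dimensional flat window in time domain, not yet cut off. In frequency domain it is the
convolution of the indicator function of `|j| ≤ 3 b / 4` with `p` copies of the uniform distribution
on `|j| ≤ b / (4 p)`, `b = 2 ^ e`. So its Fourier transform has values in `[0, 1]`, equals one for
`|j| ≤ b / 2` and vanishes for `|j| > b`, and it is at most `2 b 2 ^ (-p)` at distance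
more than `4 p n / b` from `0`. -/
def window (e p : ℕ) (t : ZMod (2 ^ m)) : ℝ :=
  (2 * (3 * 2 ^ e / 4 : ℕ) + 1) * dirichlet (3 * 2 ^ e / 4) t *
    dirichlet (2 ^ e / (4 * p)) t ^ p

/-- The point `(n / 2 ^ e) l` of `[n]` for `l` in `[2 ^ e]`. -/
def gridPt (m e : ℕ) (l : ZMod (2 ^ e)) : ZMod (2 ^ m) := ((2 ^ (m - e) * l.val : ℕ) : ZMod (2 ^ m))

/-- The grid coordinates `l` in `[2 b]`, `b = 2 ^ e`, for which `(n / 2b) l` is at circular distance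
at most `4 p n / b` from `t`. -/
def near (e p : ℕ) (t : ZMod (2 ^ m)) : Finset (ZMod (2 ^ (e + 1))) :=
  Finset.univ.filter fun l =>
    (gridPt m (e + 1) l - t).valMinAbs.natAbs ≤ 4 * p * 2 ^ (m - e)

/-- Semi-equispaced Fourier transform of the sparse vector with the entries listed in `y`: an
approximation, of precision governed by `c`, to its Fourier transform at the integer vectors `i` with
`‖i‖_∞ ≤ b / 2`, `b = 2 ^ e`. The vector is convolved with the window, cut off at radius
`4 p n / b` with `p = c log₂ N`, sampled on a grid of spacing `n / 2b` and transformed by an FFT on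
`[2b]^d`. If `2 b > n`, an FFT on `[n]^d` is applied directly. -/
def semiEquispaced (c e : ℕ) (y : List (Pt d m × ℂ)) : Alg X ((Fin d → ℤ) → ℂ) :=
  if e + 1 ≤ m then do
    let p := c * (m * d)
    charge ((2 ^ (e + 1)) ^ d)
    let z ← y.foldlM (fun (z : Pt d (e + 1) → ℂ) (t, v) => do
      let win ← tabulate (List.finRange d) fun s =>
        tabulate (near e p (t s)).toList fun l => op 30 (window e p (gridPt m (e + 1) l - t s))
      (Fintype.piFinset fun s => near e p (t s)).toList.foldlM (fun z l =>
        op (2 * d + 3) (Function.update z l (z l + v * ∏ s, (win s (l s) : ℂ)))) z) 0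
    let u ← fft (-1) (e + 1) z
    let w ← tabulate (Finset.univ : Finset (Pt d (e + 1))).toList fun i =>
      op (d + 2) (u i / (((2 : ℂ) ^ (e + 1)) ^ d * (Real.sqrt (size d m) : ℂ)))
    pure fun i => w (toPt (e + 1) i)
  else do
    charge ((2 ^ m) ^ d)
    let z ← y.foldlM (fun (z : Pt d m → ℂ) (t, v) =>
      op (d + 2) (Function.update z t (z t + v))) 0
    let u ← fft (-1) m z
    let w ← tabulate (Finset.univ : Finset (Pt d m)).toList fun i =>
      op (d + 2) (u i / (Real.sqrt (size d m) : ℂ))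
    pure fun i => w (toPt m i)

/-! ### Hashing -/

/-- A random spectrum permutation `i ↦ Σ (i - q)`; a matrix over `ZMod (2 ^ m)`, `m ≥ 1`, is
invertible if and only if its determinant is odd. -/
structure Perm (d m : ℕ) where
  mat : GL (Fin d) (ZMod (2 ^ m))
  shift : Pt d m

def Perm.app (π : Perm d m) (i : Pt d m) : Pt d m := π.mat.val.mulVec (i - π.shift)

/-- The bucket `h(i)` in `[b]^d`, `b = 2 ^ e`: the rounding of `(b / n) π(i)`. -/
def bucket (e : ℕ) (π : Perm d m) (i : Pt d m) : Pt d e := fun s =>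
  ((((π.app i s).val + 2 ^ (m - e) / 2) / 2 ^ (m - e) : ℕ) : ZMod (2 ^ e))

/-- The offset `o_i(j) = π(j) - (n / b) h(i)`. -/
def offset (e : ℕ) (π : Perm d m) (i j : Pt d m) : Pt d m := fun s =>
  π.app j s - gridPt m e (bucket e π i s)

/-- The half-width of the box of `b - 1` integers `|j| < b / 2`, `b = 2 ^ e`. -/
def halfWidth (e : ℕ) : ℕ := 2 ^ e / 2 - 1

/-- The filter `G` with `B = b ^ d` buckets, `b = 2 ^ e`, and sharpness `F`, in time domain. Its
Fourier coefficients are the `d`-th tensor power of the `F`-fold convolution of the uniform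
distribution on `|j| < b / 2`. -/
def filter (e F : ℕ) (t : Pt d m) : ℝ := ∏ s, dirichlet (halfWidth e) (t s) ^ F

/-- The `F`-fold convolution of the uniform distribution on the integers `|j| ≤ h`, computed by
`F` rounds of prefix sums. -/
def filterTable (h F : ℕ) : Alg X (ℤ → ℝ) :=
  (List.range F).foldlM (fun (g : ℤ → ℝ) _ => do
    let sums ← ((List.range (2 * F * h + h + 1)).map fun i : ℕ => (i : ℤ) - (F * h : ℕ)).foldlM
      (fun (a : (ℤ → ℝ) × ℝ) j => op 3 (Function.update a.1 j (a.2 + g j), a.2 + g j)) (0, 0)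
    tabulate (Finset.Icc (-(F * h : ℕ) : ℤ) (F * h : ℕ)).toList fun j =>
      op 6 ((sums.1 (j + h) - sums.1 (j - h - 1)) / (2 * h + 1))) (Pi.single 0 1)

/-- For `y` given on the support of the filter in frequency domain, where the filter is the tensor
power of `g`, compute `√N 𝓕⁻¹(Ĝ · y)` at the points `(n / b) s`, `s ∈ [b]^d`, `b = 2 ^ e`. Here
`Ĝ = √N · (tensor power of g, taken modulo n)`. -/
def fold (m e F : ℕ) (g : ℤ → ℝ) (y : (Fin d → ℤ) → Alg X ℂ) : Alg X (Pt d e → ℂ) := do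
  charge ((2 ^ e) ^ d)
  let z ← (Fintype.piFinset fun _ : Fin d =>
      Finset.Icc (-(F * halfWidth e : ℕ) : ℤ) (F * halfWidth e : ℕ)).toList.foldlM
    (fun (z : Pt d e → ℂ) i => do
      let v ← y i
      op (4 * d + 3)
        (Function.update z (toPt e i) (z (toPt e i) + (∏ s, (g (i s) : ℂ)) * v))) 0
  let u ← fft 1 e z
  tabulate (Finset.univ : Finset (Pt d e)).toList fun s =>
    op (d + 2) ((Real.sqrt (size d m) : ℂ) * u s)

/-- Approximation to the values of `χ̂` at `Σᵀ (i - a)`, for `i` in the support of the filter with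
`2 ^ e` buckets per coordinate and sharpness `F`. -/
def sparseValues (c e F : ℕ) (π : Perm d m) (a : Pt d m) (χ : Pt d m → ℂ) :
    Alg X ((Fin d → ℤ) → ℂ) := do
  let y ← collect (fun l =>
    op (2 * d ^ 2 + 2 * d + 2)
      (π.mat.val.mulVec l, root (a ⬝ᵥ π.mat.val.mulVec l) * χ l)) (supp χ).toList
  semiEquispaced c (Nat.clog 2 (F * 2 ^ e)) y

/-- The phase `ω ^ (iᵀ Σ q)`. -/
def phase (π : Perm d m) (i : Fin d → ℤ) : ℂ := root (toPt m i ⬝ᵥ π.mat.val.mulVec π.shift)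

/-- The measurement of the sparse vector `χ`, with approximate values of `χ̂`. -/
def hashSparse (c e F : ℕ) (g : ℤ → ℝ) (χ : Pt d m → ℂ) (π : Perm d m) (a : Pt d m) :
    Alg X (Pt d e → ℂ) := do
  let w ← sparseValues c e F π a χ
  fold m e F g fun i => op (2 * d ^ 2 + 3 * d + 2) (w i * phase π i)

/-- `HashToBins`: with `(P_{Σ,a,q} y)_i = y_{Σᵀ (i - a)} ω ^ (iᵀ Σ q)`, compute
`√N 𝓕⁻¹(Ĝ · P_{Σ,a,q} (x̂ - χ̂'))` at the points `(n / b) s`, where `χ̂'` is an approximation to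
`χ̂`. The vector that is read is `x̂`. -/
def hashToBins (c e F : ℕ) (g : ℤ → ℝ) (χ : Pt d m → ℂ) (π : Perm d m) (a : Pt d m) :
    Alg (Pt d m) (Pt d e → ℂ) := do
  let w ← sparseValues c e F π a χ
  fold m e F g fun i => do
    let j ← op (2 * d ^ 2 + 2 * d) (π.mat.val.transpose.mulVec (toPt m i - a))
    let v ← sample j
    op (2 * d ^ 2 + 3 * d + 3) ((v - w i) * phase π i)

def drawPerm : Alg X (Perm d m) := do
  let A ← uniform (GL (Fin d) (ZMod (2 ^ m)))
  let q ← uniform (Pt d m)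
  op (d ^ 2 + d) ⟨A, q⟩

/-! ### Location -/

/-- `log₂ Δ = ⌊(log₂ log₂ n) / 2⌋` for `n = 2 ^ m`. -/
def digitBits (m : ℕ) : ℕ := Nat.log 2 m / 2

/-- `⌈log_Δ n⌉`. -/
def numDigits (m : ℕ) : ℕ := (m + digitBits m - 1) / digitBits m

/-- Index set of the set of directions `{0} ∪ {n Δ^(-g) e_s}`. -/
abbrev Dir (d m : ℕ) : Type := Option (Fin d × Fin (numDigits m))

/-- `n Δ^(-(g + 1))`, with exponents `0 ≤ g < ⌈log_Δ n⌉`, replaced by `1` if it is less than `1`. -/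
def scale (m g : ℕ) : ZMod (2 ^ m) := ((2 ^ (m - min ((g + 1) * digitBits m) m) : ℕ) : ZMod (2 ^ m))

def dirVec : Dir d m → Pt d m
  | none => 0
  | some (s, g) => Pi.single s (scale m g)

/-- The operation `(α₁, β₁) ⋆ (α₂, β₂) = α₁ α₂ + β₁ β₂`, coordinatewise. -/
def star (p q : Pt d m × Pt d m) : Pt d m := p.1 * q.1 + p.2 * q.2

/-- Measurements of a signal with one permutation `perm`: for evaluation points
`pts a ⋆ (1, w)`, `w` a direction, the vector of bucket values. -/
structure Measurements (d m e r : ℕ) where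
  perm : Perm d m
  pts : Fin r → Pt d m × Pt d m
  val : Fin r → Dir d m → Pt d e → ℂ

variable {e r : ℕ}

/-- Recover the next base-`Δ` digit of coordinate `s` from bucket `j`, if the digits found so far
are those of `f s`: exactly one digit has to pass the test for at least `3 / 5` of the points. For
the last digit the base is `2 ^ (m - g log₂ Δ)` if this is less than `Δ`. -/
def locateDigit (M : Measurements d m e r) (j : Pt d e) (s : Fin d) (g : Fin (numDigits m))
    (f : Pt d m) : Alg X (Option (Pt d m)) := do
  let base : ℕ := 2 ^ min (digitBits m) (m - g.val * digitBits m)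
  let good ← (List.range base).foldlM (fun (good : List ℕ) (q : ℕ) => do
    let count ← (List.finRange r).foldlM (fun (count : ℕ) a => do
      let z ← op (2 * d + 20)
        (root (-(scale m g * (f s + 2 ^ (g.val * digitBits m) * (q : ZMod (2 ^ m))) * (M.pts a).2 s)) *
          (M.val a (some (s, g)) j / M.val a none j))
      op 4 (if ‖z - 1‖ < 1 / 3 then count + 1 else count)) 0
    op 3 (if 3 * r ≤ 5 * count then q :: good else good)) []
  match good with
  | [q] => op (d + 4) (some (f + Pi.single s (2 ^ (g.val * digitBits m) * (q : ZMod (2 ^ m)))))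
  | _ => op 1 none

/-- Recover the vector hashed to bucket `j`, coordinate by coordinate and digit by digit; `none`
stands for failure. -/
def locateBucket (M : Measurements d m e r) (j : Pt d e) : Alg X (Option (Pt d m)) :=
  (List.finRange d).foldlM (fun o s =>
    (List.finRange (numDigits m)).foldlM (fun (o : Option (Pt d m)) g =>
      match o with
      | none => op 1 none
      | some f => locateDigit M j s g f) o) (some 0)

/-- `LocateSignal`: given measurements `M` of `x`, list the locations found in the buckets for the
residual signal `x - χ`, one at most for each bucket. -/
def locateSignal (c F : ℕ) (g : ℤ → ℝ) (χ : Pt d m → ℂ) (M : Measurements d m e r) :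
    Alg X (Finset (Pt d m)) := do
  let val ← tabulate (List.finRange r) fun a =>
    tabulate (Finset.univ : Finset (Dir d m)).toList fun w => do
      let z ← op (3 * d) (star (M.pts a) (1, dirVec w))
      let u ← hashSparse c e F g χ M.perm z
      op ((2 ^ e) ^ d) (M.val a w - u)
  let inverse ← op (4 * d ^ 3 + 1) (M.perm.mat⁻¹)
  (Finset.univ : Finset (Pt d e)).toList.foldlM (fun (L : Finset (Pt d m)) j => do
    let o ← locateBucket ⟨M.perm, M.pts, val⟩ j
    match o with
    | none => op 1 L
    | some f => op (2 * d ^ 2 + d + 1) (insert (inverse.val.mulVec f) L)) ∅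

/-! ### Estimation -/

/-- The median of a list of reals. -/
def median (l : List ℝ) : ℝ := (l.mergeSort fun a b => decide (a ≤ b)).getD (l.length / 2) 0

/-- The least `e` such that `B = (2 ^ e) ^ d` is at least the given number of buckets. -/
def bucketExp (d : ℕ) (B : ℝ) : ℕ := sInf {e : ℕ | B ≤ ((2 : ℝ) ^ e) ^ d}

/-- `EstimateValues`, with `ε = 1` and sharpness `2 d`: estimate the entries of `x - χ` at the
locations in `L` by medians over `r` random hashings, and keep the estimates of absolute value
greater than the threshold. -/
def estimateValues (α : ℝ) (c : ℕ) (χ : Pt d m → ℂ) (L : Finset (Pt d m)) (k : ℕ)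
    (threshold : ℝ) (r : ℕ) : Alg (Pt d m) (Pt d m → ℂ) := do
  let F := 2 * d
  let e := bucketExp d ((2 * Real.pi) ^ (4 * d * F) * k / α ^ (2 * d))
  let g ← filterTable (halfWidth e) F
  let hashes ← collect (fun _ : ℕ => do
    let π : Perm d m ← drawPerm
    let z : Pt d m ← uniform (Pt d m)
    charge d
    let u ← hashToBins c e F g χ π z
    pure (π, z, u)) (List.range r)
  L.toList.foldlM (fun (w : Pt d m → ℂ) f => do
    let ws ← collect (fun (π, z, u) =>
      op (4 * d ^ 2 + 30 * d + 10)
        ((u (bucket e π f) / (filter e F (offset e π f f) : ℂ)) *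
          root (-(z ⬝ᵥ π.mat.val.mulVec f)) : ℂ)) hashes
    let v ← op (10 * (r + 1) * (Nat.log 2 r + 1))
      (⟨median (ws.map Complex.re), median (ws.map Complex.im)⟩ : ℂ)
    op (d + 4) (if threshold < ‖v‖ then Function.update w f v else w)) 0

/-! ### Reduction of the maximum norm -/

def sumSparse (x y : Pt d m → ℂ) : Alg X (Pt d m → ℂ) :=
  op (2 * (d + 1) * ((supp x).card + (supp y).card + 1)) (x + y)

/-- Random measurements of the vector `x` (whose Fourier transform is read) for location. -/
def measure (c e F : ℕ) (g : ℤ → ℝ) (r : ℕ) : Alg (Pt d m) (Measurements d m e r) := do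
  let π ← drawPerm
  let pts ← uniform (Fin r → Pt d m × Pt d m)
  charge (2 * d * r)
  let val ← tabulate (List.finRange r) fun a =>
    tabulate (Finset.univ : Finset (Dir d m)).toList fun w => do
      let z ← op (3 * d) (star (pts a) (1, dirVec w))
      hashToBins c e F g 0 π z
  pure ⟨π, pts, val⟩

/-- `ReduceInfNorm`, with access to `x̂`. The constants `α` and `C` are those in the number of
buckets and in the numbers of repetitions, and `c` governs the precision of the semi-equispaced
Fourier transform. -/
def reduceInfNorm (α C : ℝ) (c : ℕ) (χ : Pt d m → ℂ) (k : ℕ) (ν R μ : ℝ) :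
    Alg (Pt d m) (Pt d m → ℂ) := do
  let F := 2 * d
  let e := bucketExp d ((2 * Real.pi) ^ (4 * d * F) * k / α ^ d)
  let T := ⌈Real.logb 2 R⌉₊
  let rmax := ⌈C / Real.sqrt α * Real.log (size d m)⌉₊
  let cmax := ⌈C * Real.log (Real.log (size d m))⌉₊
  let g ← filterTable (halfWidth e) F
  let Ms : List (Measurements d m e cmax) ←
    collect (fun _ : ℕ => measure c e F g cmax) (List.range rmax)
  (List.range T).foldlM (fun (χt : Pt d m → ℂ) t => do
    let current ← sumSparse χ χt
    let L ← Ms.foldlM (fun (L : Finset (Pt d m)) M => do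
      let Lr ← locateSignal c F g current M
      op ((d + 1) * (Lr.card + 1)) (L ∪ Lr)) ∅
    let w ← estimateValues α c current L k (5 * (ν * 2 ^ (T - (t + 1)) + μ))
      ⌈C * Real.log (size d m)⌉₊
    sumSparse χt w) 0

end Programs

end SparseFourier

end

/-! An algorithm is a tree of reads, draws and steps. `ev` integrates a function of output and time
over this tree, `Always` quantifies over its branches, and both compose along `bind`. They yield
three judgements: `Runs` (every run is correct and fast), `Likely` (this fails with probability at
most δ) and `Reads` (a bound for the samples). Fourier transforms, measurements and location satisfy
`Runs` whatever random objects they are given. Probability enters only where the measurements for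
location are drawn (`measurements_likely`) and where estimation draws fresh hashings
(`hashes_likely`).

Hashing. The bucket of `i`, divided by the filter value at `i`, is `x i` times a known phase plus
noise (`hashed_bucket`). The filter value at `i` is at least `(2/π)^(2d²)` (`filter_self_ge`), while
another element has expected filter value at most `192^d / B` (`avg_filter_offset_le`), because a
uniform invertible matrix sends a nonzero vector into the box of radius `t` with probability at most
`2 (3t/n)^d` (`card_small_mul_le`). Put `a = ν + μ` and `x' = x - χ`. If `α ≤ 10⁻⁷`, then except
with probability 1/100 the elements of `S` contribute at most `a/20` in absolute values and the
others have small energy (`permAvg_not_permGood`). By Parseval over the evaluation point, small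
energy means noise at most `a/20`, again except with probability 1/100 (`avg_not_pointGood`).

Dependence. The measurements are drawn once and serve all iterations, whereas the residual depends
on them. Therefore the good events do not mention the residual: they control the weighted sum of
`|x'_j| + a` over `S`. The iteration preserves `Residual`: nothing is added outside `S`, and on `S`
the residual is at most `|x'_j| + a`. Hence one event `Locates` for each `i` in `S` works for all
later residuals simultaneously (`norm_noise_le_of_permGood`, `locateSignal_residual_runs`), and the
union bound over `S` costs only `k 2^(-n)`.

Location. Dividing by the measurement at `β'` cancels the unknown entry. At points with little noise
the right digit leaves a factor close to one; a wrong digit leaves a nontrivial character of `β`,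
which is close to one with probability at most 8/15 (`avg_nearOne_le`). An exponential tail bound
over the points makes the test with threshold 3/5 decide correctly (`avg_not_digitsGood`,
`test_iff`).

Iteration. Medians estimate the residual up to `a/4` (`estimateValues_likely`). With `B = ν
2^(T-(t+1))`, `residual_step` shows that estimates outside `S` stay below the threshold, and that an
entry in `S` is either corrected to within `a/4` or was already at most `8 (B + μ)`. So each
iteration by itself ensures the bound `8 (B + μ)`, and the last one has `B = ν`. If there is no
iteration, then `R ≤ 1` and `x'` itself is small.

Costs. `Dom` records bounds `K^(d²) W^b X^p` with `X = log₂ N` and is closed under sums and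
products, so the cost bounds follow from those of their constituents (`dom_totalTime`,
`dom_totalSamples`). The power `X^d` comes from the cut-off box of the window, and the number of
evaluation points times the number of digits is only of order `log N`. -/

noncomputable section

namespace SparseFourier

open Alg

/-! ### Expectations and worst-case statements over the runs of an algorithm -/

section

namespace Alg

variable {X α β γ ι : Type} {v : X → ℂ}

/-- Expected value of a function of the output and the number of steps. -/
def ev (v : X → ℂ) : Alg X α → (α → ℕ → ℝ) → ℝ
  | done a, φ => φ a 0
  | read j next, φ => ev v (next (v j)) fun a t => φ a (t + 1)
  | draw Ω hf _ next, φ =>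
      (∑ w ∈ @Finset.univ Ω hf, ev v (next w) fun a t => φ a (t + 1)) / (@Fintype.card Ω hf : ℝ)
  | step next, φ => ev v next fun a t => φ a (t + 1)

/-- Every possible run satisfies a condition on output, sample count and step count. -/
def Always (v : X → ℂ) : Alg X α → (α → ℕ → ℕ → Prop) → Prop
  | done a, P => P a 0 0
  | read j next, P => Always v (next (v j)) fun a s t => P a (s + 1) (t + 1)
  | draw _ _ _ next, P => ∀ w, Always v (next w) fun a s t => P a s (t + 1)
  | step next, P => Always v next fun a s t => P a s (t + 1)

theorem bind_eq (A : Alg X α) (f : α → Alg X β) : A >>= f = bind A f := rfl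

theorem pure_eq (a : α) : (pure a : Alg X α) = done a := rfl

instance : LawfulMonad (Alg X) := LawfulMonad.mk'
  (id_map := fun A => by
    show A.bind (fun a => done a) = A
    induction A with
    | done a => rfl
    | read j next ih => simp only [bind, ih]
    | draw Ω hf hn next ih => simp only [bind, ih]
    | step next ih => simp only [bind, ih])
  (pure_bind := fun _ _ => rfl)
  (bind_assoc := fun A f g => by
    show (A.bind f).bind g = A.bind fun a => (f a).bind g
    induction A with
    | done a => rfl
    | read j next ih => simp only [bind, ih]
    | draw Ω hf hn next ih => simp only [bind, ih]
    | step next ih => simp only [bind, ih])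

theorem ev_bind (A : Alg X α) (f : α → Alg X β) (φ : β → ℕ → ℝ) :
    ev v (A >>= f) φ = ev v A fun a t => ev v (f a) fun b t' => φ b (t + t') := by
  rw [bind_eq]
  induction A generalizing φ with
  | done a => simp [bind, ev]
  | read j next ih => simp only [bind, ev, ih]; congr! 5; ring_nf
  | draw Ω hf hn next ih => simp only [bind, ev, ih]; congr! 8; ring_nf
  | step next ih => simp only [bind, ev, ih]; congr! 5; ring_nf

theorem ev_mono (A : Alg X α) {φ ψ : α → ℕ → ℝ} (h : ∀ a t, φ a t ≤ ψ a t) :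
    ev v A φ ≤ ev v A ψ := by
  induction A generalizing φ ψ with
  | done a => exact h _ _
  | read j next ih => exact ih _ fun a t => h _ _
  | draw Ω hf hn next ih =>
      exact div_le_div_of_nonneg_right (Finset.sum_le_sum fun w _ => ih w fun a t => h _ _)
        (Nat.cast_nonneg _)
  | step next ih => exact ih fun a t => h _ _

theorem ev_const (A : Alg X α) (c : ℝ) : ev v A (fun _ _ => c) = c := by
  induction A with
  | done a => rfl
  | read j next ih => exact ih _
  | draw Ω hf hn next ih =>
      have : (@Fintype.card Ω hf : ℝ) ≠ 0 := Nat.cast_ne_zero.2 Fintype.card_ne_zero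
      simp only [ev, ih, Finset.sum_const, nsmul_eq_mul, Finset.card_univ]
      field_simp
  | step next ih => exact ih

theorem ev_add (A : Alg X α) (φ ψ : α → ℕ → ℝ) :
    ev v A (fun a t => φ a t + ψ a t) = ev v A φ + ev v A ψ := by
  induction A generalizing φ ψ with
  | done a => rfl
  | read j next ih => exact ih _ _ _
  | draw Ω hf hn next ih => simp only [ev, ih, Finset.sum_add_distrib, add_div]
  | step next ih => exact ih _ _

theorem ev_const_mul (A : Alg X α) (c : ℝ) (φ : α → ℕ → ℝ) :
    ev v A (fun a t => c * φ a t) = c * ev v A φ := by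
  induction A generalizing φ with
  | done a => rfl
  | read j next ih => exact ih _ _
  | draw Ω hf hn next ih => simp only [ev, ih, ← Finset.mul_sum, mul_div_assoc]
  | step next ih => exact ih _

theorem ev_sum {κ : Type*} (s : Finset κ) (A : Alg X α) (φ : κ → α → ℕ → ℝ) :
    ev v A (fun a t => ∑ i ∈ s, φ i a t) = ∑ i ∈ s, ev v A (φ i) := by
  classical
  induction s using Finset.induction_on with
  | empty => simpa using ev_const A 0
  | insert i s hi ih => simp only [Finset.sum_insert hi, ev_add, ih]

theorem ev_nonneg (A : Alg X α) {φ : α → ℕ → ℝ} (h : ∀ a t, 0 ≤ φ a t) : 0 ≤ ev v A φ :=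
  (ev_const (v := v) A 0).symm.le.trans (ev_mono A h)

theorem Always.mono {A : Alg X α} {P Q : α → ℕ → ℕ → Prop} (h : Always v A P)
    (hPQ : ∀ a s t, P a s t → Q a s t) : Always v A Q := by
  induction A generalizing P Q with
  | done a => exact hPQ _ _ _ h
  | read j next ih => exact ih _ h fun a s t => hPQ _ _ _
  | draw Ω hf hn next ih => exact fun w => ih w (h w) fun a s t => hPQ _ _ _
  | step next ih => exact ih h fun a s t => hPQ _ _ _

theorem Always.bind {A : Alg X α} {f : α → Alg X β} {P : α → ℕ → ℕ → Prop}
    {Q : β → ℕ → ℕ → Prop} (h : Always v A P)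
    (hf : ∀ a s t, P a s t → Always v (f a) fun b s' t' => Q b (s + s') (t + t')) :
    Always v (A >>= f) Q := by
  rw [bind_eq]
  induction A generalizing P Q with
  | done a => exact (hf _ _ _ h).mono fun b s t => by simp
  | read j next ih =>
      refine ih _ h fun a s t hP => (hf _ _ _ hP).mono fun b s' t' => ?_
      simp only [add_right_comm]; exact id
  | draw Ω hf hn next ih =>
      refine fun w => ih w (h w) fun a s t hP => (hf _ _ _ hP).mono fun b s' t' => ?_
      simp only [add_right_comm]; exact id
  | step next ih =>
      refine ih h fun a s t hP => (hf _ _ _ hP).mono fun b s' t' => ?_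
      simp only [add_right_comm]; exact id

theorem Always.ev_le {A : Alg X α} {P : α → ℕ → ℕ → Prop} (h : Always v A P)
    {φ ψ : α → ℕ → ℝ} (hφ : ∀ a s t, P a s t → φ a t ≤ ψ a t) : ev v A φ ≤ ev v A ψ := by
  induction A generalizing P φ ψ with
  | done a => exact hφ _ _ _ h
  | read j next ih => exact ih _ h fun a s t => hφ _ _ _
  | draw Ω hf hn next ih =>
      exact div_le_div_of_nonneg_right
        (Finset.sum_le_sum fun w _ => ih w (h w) fun a s t => hφ _ _ _) (Nat.cast_nonneg _)
  | step next ih => exact ih h fun a s t => hφ _ _ _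

/-- Allows a statement to be proved for one fixed parameter and then used for all parameters on the
same run. Location needs this: the vector to be found is unknown to the algorithm. -/
theorem Always.forall {κ : Sort*} {A : Alg X α} {P : κ → α → ℕ → ℕ → Prop}
    (h : ∀ k, Always v A (P k)) : Always v A fun a s t => ∀ k, P k a s t := by
  induction A generalizing P with
  | done a => exact h
  | read j next ih => exact ih _ h
  | draw Ω hf hn next ih => exact fun w => ih w fun k => h k w
  | step next ih => exact ih h

/-- Together with `law_toOuterMeasure` this is the bridge from the recursive functionals to `law`.
The bound on samples passes through here, the probabilistic one through the next lemma. -/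
theorem Always.support {A : Alg X α} {P : α → ℕ → ℕ → Prop} (h : Always v A P) :
    ∀ o ∈ (law v A).support, P o.output o.samples o.time := by
  induction A generalizing P with
  | done a => intro o ho; simp only [law, PMF.support_pure, Set.mem_singleton_iff] at ho; subst ho; exact h
  | read j next ih =>
      intro o ho
      simp only [law, PMF.support_map, Set.mem_image] at ho
      obtain ⟨o', ho', rfl⟩ := ho
      exact ih _ h o' ho'
  | draw Ω hf hn next ih =>
      intro o ho
      simp only [law, PMF.support_bind, PMF.support_map, Set.mem_iUnion, Set.mem_image] at ho
      obtain ⟨w, -, o', ho', rfl⟩ := ho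
      exact ih w (h w) o' ho'
  | step next ih =>
      intro o ho
      simp only [law, PMF.support_map, Set.mem_image] at ho
      obtain ⟨o', ho', rfl⟩ := ho
      exact ih h o' ho'

open Classical in
theorem law_toOuterMeasure (A : Alg X α) (P : α → ℕ → Prop) :
    (law v A).toOuterMeasure {o | P o.output o.time} =
      ENNReal.ofReal (ev v A fun a t => if P a t then 1 else 0) := by
  induction A generalizing P with
  | done a =>
      simp only [law, ev, PMF.toOuterMeasure_pure_apply, Set.mem_ofPred_eq]
      split_ifs <;> simp
  | read j next ih =>
      simp only [law, ev, PMF.toOuterMeasure_map_apply, Set.preimage_ofPred_eq]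
      exact ih _ fun a t => P a (t + 1)
  | draw Ω hf hn next ih =>
      simp only [law, ev, PMF.toOuterMeasure_map_apply, PMF.toOuterMeasure_bind_apply,
        Set.preimage_ofPred_eq, tsum_fintype, PMF.uniformOfFintype_apply]
      have hc : (0 : ℝ) < (@Fintype.card Ω hf : ℝ) := Nat.cast_pos.2 Fintype.card_pos
      rw [ENNReal.ofReal_div_of_pos hc, ENNReal.ofReal_sum_of_nonneg, ENNReal.ofReal_natCast,
        div_eq_mul_inv, mul_comm, Finset.mul_sum]
      · exact Finset.sum_congr rfl fun w _ => congrArg _ (ih w fun a t => P a (t + 1))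
      · exact fun w _ => ev_nonneg _ fun a t => by split_ifs <;> norm_num
  | step next ih =>
      simp only [law, ev, PMF.toOuterMeasure_map_apply, Set.preimage_ofPred_eq]
      exact ih fun a t => P a (t + 1)

/-! ### Deterministic bounds -/

/-- Every run has output satisfying `Q` and takes at most `t` steps. -/
def Runs (v : X → ℂ) (A : Alg X α) (Q : α → Prop) (t : ℝ) : Prop :=
  Always v A fun a _ τ => Q a ∧ (τ : ℝ) ≤ t

/-- Every run reads at most `s` samples. -/
def Reads (v : X → ℂ) (A : Alg X α) (s : ℝ) : Prop := Always v A fun _ σ _ => (σ : ℝ) ≤ s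

theorem Runs.mono {A : Alg X α} {Q Q' : α → Prop} {t t' : ℝ} (h : Runs v A Q t)
    (hQ : ∀ a, Q a → Q' a) (ht : t ≤ t') : Runs v A Q' t' :=
  Always.mono h fun _ _ _ hP => ⟨hQ _ hP.1, hP.2.trans ht⟩

theorem Runs.le {A : Alg X α} {Q : α → Prop} {t t' : ℝ} (h : Runs v A Q t)
    (ht : t ≤ t') : Runs v A Q t' := h.mono (fun _ => id) ht

theorem Runs.imp {A : Alg X α} {Q Q' : α → Prop} {t : ℝ} (h : Runs v A Q t)
    (hQ : ∀ a, Q a → Q' a) : Runs v A Q' t := h.mono hQ le_rfl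

theorem Runs.pure {Q : α → Prop} {a : α} {t : ℝ} (h : Q a) (ht : 0 ≤ t) :
    Runs v (pure a : Alg X α) Q t := by
  exact ⟨h, by simpa using ht⟩

theorem Runs.bind {A : Alg X α} {f : α → Alg X β} {Q : α → Prop} {Q' : β → Prop} {t t' : ℝ}
    (h : Runs v A Q t) (hf : ∀ a, Q a → Runs v (f a) Q' t') : Runs v (A >>= f) Q' (t + t') :=
  Always.bind h fun a _ _ hP => Always.mono (hf a hP.1) fun _ _ _ hP' =>
    ⟨hP'.1, by push_cast; exact add_le_add hP.2 hP'.2⟩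

theorem Reads.le {A : Alg X α} {s s' : ℝ} (h : Reads v A s) (hs : s ≤ s') : Reads v A s' :=
  Always.mono h fun _ _ _ hP => le_trans hP hs

theorem Reads.pure {a : α} {s : ℝ} (hs : 0 ≤ s) : Reads v (pure a : Alg X α) s :=
  (by simpa using hs : ((0 : ℕ) : ℝ) ≤ s)

theorem Reads.bind {A : Alg X α} {f : α → Alg X β} {s s' : ℝ}
    (h : Reads v A s) (hf : ∀ a, Reads v (f a) s') : Reads v (A >>= f) (s + s') :=
  Always.bind h fun a _ _ hP => Always.mono (hf a) fun _ _ _ hP' => by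
    push_cast; exact add_le_add hP hP'

theorem Reads.bind_zero {A : Alg X α} {f : α → Alg X β}
    (h : Reads v A 0) (hf : ∀ a, Reads v (f a) 0) : Reads v (A >>= f) 0 :=
  (h.bind hf).le (by simp)

theorem charge_always (t : ℕ) : Always v (charge t : Alg X Unit) fun _ s τ => s = 0 ∧ τ = t := by
  induction t with
  | zero => exact ⟨rfl, rfl⟩
  | succ t ih =>
      exact Always.mono (Q := fun _ s τ => s = 0 ∧ τ + 1 = t + 1) ih fun _ _ _ h => ⟨h.1, by rw [h.2]⟩

theorem Runs.charge {n : ℕ} {t : ℝ} (h : (n : ℝ) ≤ t) :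
    Runs v (charge n : Alg X Unit) (fun _ => True) t :=
  (charge_always n).mono fun _ _ _ hP => ⟨trivial, by rw [hP.2]; exact h⟩

theorem Reads.charge {n : ℕ} {s : ℝ} (hs : 0 ≤ s) : Reads v (Alg.charge n : Alg X Unit) s :=
  (charge_always n).mono fun _ _ _ hP => by rw [hP.1]; simpa using hs

theorem Runs.op {n : ℕ} {a : α} {Q : α → Prop} {t : ℝ} (h : Q a) (ht : (n : ℝ) ≤ t) :
    Runs v (op n a : Alg X α) Q t :=
  ((Runs.charge ht).bind fun _ _ => Runs.pure h le_rfl).le (by simp)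

theorem Reads.op {n : ℕ} {a : α} {s : ℝ} (hs : 0 ≤ s) : Reads v (op n a : Alg X α) s :=
  ((Reads.charge hs).bind fun _ => Reads.pure le_rfl).le (by simp)

theorem Runs.sample {j : X} {Q : ℂ → Prop} {t : ℝ} (h : Q (v j)) (ht : 1 ≤ t) :
    Runs v (sample j) Q t := ⟨h, by simpa using ht⟩

theorem Reads.sample {j : X} : Reads v (Alg.sample j) 1 :=
  (by simp : (((0 + 1 : ℕ)) : ℝ) ≤ 1)

theorem Runs.uniform {Ω : Type} [Fintype Ω] [Nonempty Ω] {t : ℝ} (ht : 1 ≤ t) :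
    Runs v (uniform Ω) (fun _ => True) t := fun _ => ⟨trivial, by simpa using ht⟩

theorem Reads.uniform {Ω : Type} [Fintype Ω] [Nonempty Ω] {s : ℝ} (hs : 0 ≤ s) :
    Reads v (Alg.uniform Ω) s := fun _ => (by simpa using hs : ((0 : ℕ) : ℝ) ≤ s)

/-- The invariant refers to the prefix already processed, because most loops build an object indexed
by the elements seen so far. -/
theorem Runs.foldlM_rec {f : β → ι → Alg X β} {l : List ι} {b : β} {t : ℝ}
    (I : List ι → β → Prop) (h0 : I [] b)
    (h : ∀ p i q, l = p ++ i :: q → ∀ b, I p b → Runs v (f b i) (I (p ++ [i])) t) :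
    Runs v (l.foldlM f b) (I l) (l.length * t) := by
  suffices H : ∀ (q p : List ι) (b : β), l = p ++ q → I p b →
      Runs v (q.foldlM f b) (I l) (q.length * t) from H l [] b rfl h0
  intro q
  induction q with
  | nil =>
      intro p b hl hb
      simp only [List.append_nil] at hl
      subst hl
      exact Runs.pure hb (by simp)
  | cons i q ih =>
      intro p b hl hb
      rw [List.foldlM_cons]
      refine ((h p i q hl b hb).bind fun b' hb' => ih (p ++ [i]) b' (by simp [hl]) hb').le ?_
      rw [List.length_cons]; push_cast; linarith

theorem Runs.foldlM_eq {f : β → ι → Alg X β} {g : β → ι → β} {l : List ι} {b : β} {t : ℝ}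
    (h : ∀ i ∈ l, ∀ b, Runs v (f b i) (· = g b i) t) :
    Runs v (l.foldlM f b) (· = l.foldl g b) (l.length * t) :=
  (Runs.foldlM_rec (fun p c => c = p.foldl g b) rfl fun p i q hl c hc =>
    (h i (by simp [hl]) c).imp fun a ha => by subst ha hc; simp)

theorem Reads.foldlM {f : β → ι → Alg X β} {l : List ι} {s : ℝ}
    (h : ∀ i b, Reads v (f b i) s) (b : β) : Reads v (l.foldlM f b) (l.length * s) := by
  induction l generalizing b with
  | nil => exact Reads.pure (by simp)
  | cons i l ih =>
      rw [List.foldlM_cons]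
      refine ((h i b).bind ih).le ?_
      rw [List.length_cons]; push_cast; linarith

theorem Runs.collect {f : ι → Alg X α} {l : List ι} {Q : ι → α → Prop} {t : ℝ}
    (h : ∀ i ∈ l, Runs v (f i) (Q i) t) :
    Runs v (collect f l) (List.Forall₂ Q l) (l.length * (t + 1)) := by
  induction l with
  | nil => exact Runs.pure List.Forall₂.nil (by simp)
  | cons i l ih =>
      refine ((h i (by simp)).bind fun a ha => (Runs.charge (n := 1) (t := 1) (by simp)).bind
        fun _ _ => (ih fun j hj => h j (by simp [hj])).bind fun as has =>
          Runs.pure (t := 0) (List.Forall₂.cons ha has) le_rfl).le ?_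
      rw [List.length_cons]; push_cast; linarith

theorem Runs.collect_eq {f : ι → Alg X α} {l : List ι} {g : ι → α} {t : ℝ}
    (h : ∀ i ∈ l, Runs v (f i) (· = g i) t) :
    Runs v (Alg.collect f l) (· = l.map g) (l.length * (t + 1)) :=
  (Runs.collect (Q := fun i a => a = g i) h).imp fun as has => by
    induction has with
    | nil => rfl
    | cons h1 _ ih => subst h1; simp_all

theorem Reads.collect {f : ι → Alg X α} {l : List ι} {s : ℝ}
    (h : ∀ i, Reads v (f i) s) : Reads v (Alg.collect f l) (l.length * s) := by
  induction l with
  | nil => exact Reads.pure (by simp)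
  | cons i l ih =>
      refine ((h i).bind fun a => (Reads.charge (n := 1) le_rfl).bind fun _ => ih.bind fun as =>
        Reads.pure le_rfl).le ?_
      rw [List.length_cons]; push_cast; linarith

theorem Runs.tabulate [DecidableEq ι] [Zero α] {l : List ι} {f : ι → Alg X α}
    {Q : ι → α → Prop} {t : ℝ} (h : ∀ i ∈ l, Runs v (f i) (Q i) t) :
    Runs v (tabulate l f) (fun T : ι → α => (∀ i ∈ l, Q i (T i)) ∧ ∀ i ∉ l, T i = 0)
      (l.length * (t + 1)) := by
  refine Runs.foldlM_rec (fun p (T : ι → α) => (∀ i ∈ p, Q i (T i)) ∧ ∀ i ∉ p, T i = 0) (by simp)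
    fun p i q hl T hT => (h i (by simp [hl])).bind fun a ha =>
      Runs.op (n := 1) (t := 1) ⟨fun j hj => ?_, fun j hj => ?_⟩ (by simp)
  · by_cases hji : j = i
    · subst hji; simpa using ha
    · rw [Function.update_of_ne hji]
      exact hT.1 j (by simpa [hji] using hj)
  · simp only [List.mem_append, List.mem_singleton, not_or] at hj
    rw [Function.update_of_ne hj.2]
    exact hT.2 j hj.1

theorem Runs.tabulate_univ [DecidableEq ι] [Fintype ι] [Zero α] {f : ι → Alg X α}
    {Q : ι → α → Prop} {t : ℝ} (h : ∀ i, Runs v (f i) (Q i) t) :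
    Runs v (Alg.tabulate (Finset.univ : Finset ι).toList f) (fun T => ∀ i, Q i (T i))
      (Fintype.card ι * (t + 1)) :=
  ((Runs.tabulate fun i _ => h i).imp fun T hT i => hT.1 i (by simp)).le (by simp)

theorem Runs.tabulate_univ_eq [DecidableEq ι] [Fintype ι] [Zero α] {f : ι → Alg X α}
    {g : ι → α} {t : ℝ} (h : ∀ i, Runs v (f i) (· = g i) t) :
    Runs v (Alg.tabulate (Finset.univ : Finset ι).toList f) (· = g)
      (Fintype.card ι * (t + 1)) :=
  (Runs.tabulate_univ (Q := fun i a => a = g i) h).imp fun _ hT => funext hT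

theorem Reads.tabulate [DecidableEq ι] [Zero α] {l : List ι} {f : ι → Alg X α} {s : ℝ}
    (h : ∀ i, Reads v (f i) s) : Reads v (Alg.tabulate l f) (l.length * s) :=
  Reads.foldlM (fun i T => ((h i).bind fun a => Reads.op le_rfl).le (by simp)) _

/-! ### Randomized bounds -/

open Classical in
/-- With probability at least `1 - δ` the output satisfies `Q` and at most `t` steps are taken. -/
def Likely (v : X → ℂ) (A : Alg X α) (Q : α → Prop) (t δ : ℝ) : Prop :=
  ev v A (fun a τ => if Q a ∧ (τ : ℝ) ≤ t then 0 else 1) ≤ δ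

/-- Markov's inequality: a nonnegative function that is at least one whenever `P` fails dominates
the failure indicator. Taking for it a sum of products of indicators or weights performs union bound
and tail bound in one stroke. -/
theorem Runs.likely {A : Alg X α} {Q P : α → Prop} {t δ : ℝ} (h : Runs v A Q t)
    (φ : α → ℝ) (hφ : ∀ a, Q a → 0 ≤ φ a) (hφ' : ∀ a, Q a → ¬ P a → 1 ≤ φ a)
    (hδ : ev v A (fun a _ => φ a) ≤ δ) : Likely v A (fun a => Q a ∧ P a) t δ := by
  refine le_trans (Always.ev_le h fun a s τ hP => ?_) hδ
  split_ifs with h1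
  · exact hφ a hP.1
  · exact hφ' a hP.1 fun hPa => h1 ⟨⟨hP.1, hPa⟩, hP.2⟩

theorem Runs.likely_zero {A : Alg X α} {Q : α → Prop} {t : ℝ} (h : Runs v A Q t) :
    Likely v A Q t 0 := by
  refine le_trans (Always.ev_le (ψ := fun _ _ => 0) h fun a s τ hP => ?_) (ev_const A 0).le
  rw [if_pos hP]

theorem Likely.mono {A : Alg X α} {Q Q' : α → Prop} {t t' δ δ' : ℝ} (h : Likely v A Q t δ)
    (hQ : ∀ a, Q a → Q' a) (ht : t ≤ t') (hδ : δ ≤ δ') : Likely v A Q' t' δ' := by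
  refine (ev_mono A fun a τ => ?_).trans (le_trans h hδ)
  split_ifs with h1 h2 h2 <;> try norm_num
  exact h1 ⟨hQ a h2.1, h2.2.trans ht⟩

/-- The union bound. Once the first stage has failed nothing is required of the second, since the
failure indicator is at most one. -/
theorem Likely.bind {A : Alg X α} {f : α → Alg X β} {Q : α → Prop} {Q' : β → Prop}
    {t t' δ δ' : ℝ} (h : Likely v A Q t δ) (hδ' : 0 ≤ δ')
    (hf : ∀ a, Q a → Likely v (f a) Q' t' δ') :
    Likely v (A >>= f) Q' (t + t') (δ + δ') := by
  classical
  rw [Likely, ev_bind]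
  refine (ev_mono A (ψ := fun a τ => (if Q a ∧ (τ : ℝ) ≤ t then 0 else 1) + δ')
    fun a τ => ?_).trans ?_
  · split_ifs with h1
    · rw [zero_add]
      refine (ev_mono _ fun b τ' => ?_).trans (hf a h1.1)
      split_ifs with h2 h3 h3 <;> try norm_num
      exact h2 ⟨h3.1, by push_cast; exact add_le_add h1.2 h3.2⟩
    · refine (ev_mono _ (ψ := fun _ _ => 1) fun b τ' => ?_).trans ?_
      · split_ifs <;> norm_num
      · rw [ev_const]; linarith
  · rw [ev_add, ev_const]
    exact add_le_add_left h δ'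

theorem Likely.foldlM_range {f : β → ℕ → Alg X β} {n : ℕ} {b : β} {t δ : ℝ} (hδ : 0 ≤ δ)
    (I : ℕ → β → Prop) (h0 : I 0 b)
    (h : ∀ i < n, ∀ b, I i b → Likely v (f b i) (I (i + 1)) t δ) :
    Likely v ((List.range n).foldlM f b) (I n) (n * t) (n * δ) := by
  induction n with
  | zero => simpa using (Runs.pure (v := v) (t := 0) h0 le_rfl).likely_zero
  | succ n ih =>
      rw [List.range_succ, List.foldlM_append]
      refine ((ih fun i hi => h i (by omega)).bind hδ fun b hb => ?_).mono (fun _ => id)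
        (t := n * t + t) (δ := n * δ + δ) (by push_cast; linarith) (by push_cast; linarith)
      rw [List.foldlM_cons]
      simp only [List.foldlM_nil, bind_pure]
      exact h n (by omega) b hb

theorem Likely.law_le {A : Alg X α} {Q : α → Prop} {t δ : ℝ} (h : Likely v A Q t δ)
    (hδ : 0 ≤ δ) :
    1 - ENNReal.ofReal δ ≤ (law v A).toOuterMeasure {o | Q o.output ∧ (o.time : ℝ) ≤ t} := by
  classical
  rw [law_toOuterMeasure A fun a τ => Q a ∧ (τ : ℝ) ≤ t, ← ENNReal.ofReal_one,
    ← ENNReal.ofReal_sub _ hδ]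
  refine ENNReal.ofReal_le_ofReal ?_
  have h1 : ev v A (fun a τ => if Q a ∧ (τ : ℝ) ≤ t then (0 : ℝ) else 1) ≤ δ := by
    unfold Likely at h; convert h
  have h2 := ev_add (v := v) A (fun a τ => if Q a ∧ (τ : ℝ) ≤ t then (1 : ℝ) else 0)
    (fun a τ => if Q a ∧ (τ : ℝ) ≤ t then (0 : ℝ) else 1)
  have h3 : ev v A (fun a τ => (if Q a ∧ (τ : ℝ) ≤ t then (1 : ℝ) else 0) +
      if Q a ∧ (τ : ℝ) ≤ t then (0 : ℝ) else 1) = 1 := by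
    refine Eq.trans ?_ (ev_const (v := v) A 1)
    congr! 3
    split_ifs <;> norm_num
  have h4 : 1 - δ ≤ ev v A (fun a τ => if Q a ∧ (τ : ℝ) ≤ t then (1 : ℝ) else 0) := by linarith
  convert h4

/-- Independence: successive calls draw fresh randomness, so the expectation of a product over the
calls factors. -/
theorem ev_collect_prod (f : ι → Alg X α) (l : List ι) (ψ : α → ℝ) :
    ev v (collect f l) (fun as _ => (as.map ψ).prod) =
      (l.map fun i => ev v (f i) fun a _ => ψ a).prod := by
  induction l with
  | nil => simp [collect, ev, pure_eq]
  | cons i l ih =>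
      have hch : ∀ (n : ℕ) (φ : Unit → ℝ), ev v (charge n : Alg X Unit) (fun a _ => φ a) = φ () := by
        intro n φ
        induction n with
        | zero => rfl
        | succ n ih => exact ih
      simp only [collect, ev_bind, pure_eq, ev, List.map_cons, List.prod_cons, ev_const_mul, ih]
      simp only [hch, mul_comm _ (List.prod _), ev_const_mul]

end Alg

end

section

variable {X : Type} {d m : ℕ} {v : X → ℂ}

/-! ### Characters -/

theorem root_add (a b : ZMod (2 ^ m)) : root (a + b) = root a * root b :=
  AddChar.map_add_eq_mul _ _ _

@[simp] theorem root_zero : root (0 : ZMod (2 ^ m)) = 1 := AddChar.map_zero_eq_one _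

@[simp] theorem norm_root (a : ZMod (2 ^ m)) : ‖root a‖ = 1 := AddChar.norm_apply _ _

theorem root_ne_zero (a : ZMod (2 ^ m)) : root a ≠ 0 := by
  rw [← norm_pos_iff, norm_root]; norm_num

theorem root_neg (a : ZMod (2 ^ m)) : root (-a) = (root a)⁻¹ := AddChar.map_neg_eq_inv _ _

theorem root_neg_conj (a : ZMod (2 ^ m)) : root (-a) = (starRingEnd ℂ) (root a) :=
  AddChar.map_neg_eq_conj _ _

theorem root_sum {ι : Type*} (s : Finset ι) (f : ι → ZMod (2 ^ m)) :
    root (∑ i ∈ s, f i) = ∏ i ∈ s, root (f i) := by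
  classical
  induction s using Finset.induction_on with
  | empty => simp
  | insert i s hi ih => rw [Finset.sum_insert hi, Finset.prod_insert hi, root_add, ih]

theorem root_ne_one {a : ZMod (2 ^ m)} (ha : a ≠ 0) : root a ≠ 1 := by
  intro h
  exact ha (ZMod.injective_stdAddChar (h.trans (root_zero (m := m)).symm))

theorem root_intCast (k : ℤ) :
    root ((k : ℤ) : ZMod (2 ^ m)) = Complex.exp (2 * Real.pi * Complex.I * k / 2 ^ m) := by
  rw [root, ZMod.stdAddChar_coe]; push_cast; rfl

theorem root_two_mul_intCast (e : ℕ) (k : ℤ) :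
    root (((2 * k : ℤ)) : ZMod (2 ^ (e + 1))) = root ((k : ℤ) : ZMod (2 ^ e)) := by
  rw [root_intCast, root_intCast]
  congr 1
  push_cast
  rw [pow_succ]
  field_simp

theorem sum_root_mul {a : ZMod (2 ^ m)} (ha : a ≠ 0) : ∑ z : ZMod (2 ^ m), root (z * a) = 0 := by
  have h : root a * ∑ z : ZMod (2 ^ m), root (z * a) = ∑ z : ZMod (2 ^ m), root (z * a) := by
    rw [Finset.mul_sum]
    refine Eq.trans ?_ (Equiv.sum_comp (Equiv.addRight (1 : ZMod (2 ^ m))) fun z => root (z * a))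
    refine Finset.sum_congr rfl fun z _ => ?_
    rw [Equiv.coe_addRight, add_mul, one_mul, root_add, mul_comm]
  have h' : (root a - 1) * ∑ z : ZMod (2 ^ m), root (z * a) = 0 := by rw [sub_mul, h]; ring
  exact (mul_eq_zero.1 h').resolve_left (sub_ne_zero.2 (root_ne_one ha))

theorem sum_root_dotProduct (w : Pt d m) :
    ∑ z : Pt d m, root (z ⬝ᵥ w) = if w = 0 then ((2 : ℂ) ^ m) ^ d else 0 := by
  have h : ∑ z : Pt d m, root (z ⬝ᵥ w) = ∏ s, ∑ z : ZMod (2 ^ m), root (z * w s) := by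
    rw [Finset.prod_univ_sum]
    simp only [dotProduct, root_sum, Fintype.piFinset_univ]
  rw [h]
  split_ifs with hw
  · subst hw; simp [ZMod.card]
  · obtain ⟨s, hs⟩ := Function.ne_iff.1 hw
    exact Finset.prod_eq_zero (Finset.mem_univ s) (sum_root_mul hs)

/-- Parseval's identity for a trigonometric sum with distinct frequencies. -/
theorem sum_norm_sq_trig {ι : Type*} (J : Finset ι) (c : ι → ℂ) (w : ι → Pt d m)
    (hw : Set.InjOn w J) :
    ∑ z : Pt d m, ‖∑ j ∈ J, c j * root (z ⬝ᵥ w j)‖ ^ 2 = size d m * ∑ j ∈ J, ‖c j‖ ^ 2 := by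
  have key : ((∑ z : Pt d m, ‖∑ j ∈ J, c j * root (z ⬝ᵥ w j)‖ ^ 2 : ℝ) : ℂ) =
      ((size d m * ∑ j ∈ J, ‖c j‖ ^ 2 : ℝ) : ℂ) := by
    have h1 : ∀ z : Pt d m, ((‖∑ j ∈ J, c j * root (z ⬝ᵥ w j)‖ ^ 2 : ℝ) : ℂ) =
        ∑ j ∈ J, ∑ l ∈ J, c j * (starRingEnd ℂ) (c l) * root (z ⬝ᵥ (w j - w l)) := by
      intro z
      push_cast
      rw [← Complex.mul_conj', map_sum, Finset.sum_mul_sum]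
      refine Finset.sum_congr rfl fun j _ => Finset.sum_congr rfl fun l _ => ?_
      rw [map_mul, ← root_neg_conj, dotProduct_sub, sub_eq_add_neg, root_add]
      ring
    rw [Complex.ofReal_sum]
    simp only [h1]
    rw [Finset.sum_comm]
    push_cast
    rw [Finset.mul_sum]
    refine Finset.sum_congr rfl fun j hj => ?_
    rw [Finset.sum_comm, Finset.sum_eq_single j]
    · rw [← Finset.mul_sum, sum_root_dotProduct, sub_self, if_pos rfl, Complex.mul_conj', size]
      push_cast; ring
    · intro l hl hlj
      rw [← Finset.mul_sum, sum_root_dotProduct, if_neg, mul_zero]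
      exact fun h => hlj (hw hl hj (sub_eq_zero.1 h).symm)
    · exact fun h => absurd hj h
  exact_mod_cast key

theorem size_pos (d m : ℕ) : 0 < size d m := by unfold size; positivity

theorem card_Pt (d e : ℕ) : Fintype.card (Pt d e) = (2 ^ e) ^ d := by
  simp [ZMod.card]

/-! ### Fast Fourier transform -/

theorem foldl_add_eq {α ι : Type*} [AddCommMonoid α] (g : ι → α) (l : List ι) (b : α) :
    l.foldl (fun a i => a + g i) b = b + (l.map g).sum := by
  induction l generalizing b with
  | nil => simp
  | cons i l ih => simp [ih, add_assoc]

theorem foldl_add_toList {α ι : Type*} [AddCommMonoid α] (g : ι → α) (s : Finset ι) :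
    s.toList.foldl (fun a i => a + g i) 0 = ∑ i ∈ s, g i := by
  rw [foldl_add_eq, zero_add, Finset.sum_map_toList]

/-- Combine binary last digits and the remaining digits. -/
def joinBits (e : ℕ) (p : (Fin d → Fin 2) × Pt d e) : Pt d (e + 1) := fun s =>
  ((2 * (p.2 s).val + (p.1 s).val : ℕ) : ZMod (2 ^ (e + 1)))

theorem joinBits_bijective (e : ℕ) : Function.Bijective (joinBits (d := d) e) := by
  rw [Fintype.bijective_iff_injective_and_card]
  constructor
  · rintro ⟨ε, j⟩ ⟨ε', j'⟩ h
    have h' : ∀ s, 2 * (j s).val + (ε s).val = 2 * (j' s).val + (ε' s).val := by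
      intro s
      have h1 := congrFun h s
      simp only [joinBits] at h1
      rw [ZMod.natCast_eq_natCast_iff'] at h1
      have := ZMod.val_lt (j s); have := ZMod.val_lt (j' s)
      have := (ε s).isLt; have := (ε' s).isLt
      rwa [Nat.mod_eq_of_lt (by rw [pow_succ]; omega), Nat.mod_eq_of_lt (by rw [pow_succ]; omega)]
        at h1
    ext s
    · have := h' s; have := (ε s).isLt; have := (ε' s).isLt; simp only; omega
    · have := h' s; have := (ε s).isLt; have := (ε' s).isLt
      exact ZMod.val_injective _ (by simp only; omega)
  · simp only [Fintype.card_prod, card_Pt]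
    simp only [Fintype.card_pi, Fintype.card_fin, Finset.prod_const, Finset.card_univ]
    rw [pow_succ 2 e, mul_pow, mul_comm]

/-- The radix-two identity: `i · (2j + ε) = i · ε + 2 (i · j)`, and doubling the argument turns a
root of unity of order `2^(e+1)` into one of order `2^e`. -/
theorem root_mul_dotProduct_joinBits (σ : ℤ) (e : ℕ) (i : Pt d (e + 1))
    (p : (Fin d → Fin 2) × Pt d e) :
    root ((σ : ZMod (2 ^ (e + 1))) * (i ⬝ᵥ joinBits e p)) =
      root ((σ : ZMod (2 ^ (e + 1))) * ∑ s, i s * ((p.1 s).val : ZMod (2 ^ (e + 1)))) *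
        root ((σ : ZMod (2 ^ e)) * ((fun s => ((i s).val : ZMod (2 ^ e))) ⬝ᵥ p.2)) := by
  have h1 : (σ : ZMod (2 ^ e)) * ((fun s => ((i s).val : ZMod (2 ^ e))) ⬝ᵥ p.2) =
      ((σ * ∑ s, ((i s).val : ℤ) * ((p.2 s).val : ℤ) : ℤ) : ZMod (2 ^ e)) := by
    push_cast
    simp only [dotProduct, ZMod.natCast_zmod_val]
  rw [h1, ← root_two_mul_intCast, ← root_add]
  congr 1
  push_cast
  simp only [dotProduct, joinBits, ZMod.natCast_zmod_val]
  push_cast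
  simp only [Finset.mul_sum, ← Finset.sum_add_distrib]
  exact Finset.sum_congr rfl fun s _ => by ring

theorem fft_runs (σ : ℤ) (e : ℕ) (f : Pt d e → ℂ) :
    Runs v (fft σ e f) (· = fun i => ∑ j, root ((σ : ZMod (2 ^ e)) * (i ⬝ᵥ j)) * f j)
      ((e + 1) * (2 ^ e) ^ d * 2 ^ d * (4 * d + 6)) := by
  induction e with
  | zero =>
      have : Subsingleton (Pt d 0) := by
        have : Subsingleton (ZMod (2 ^ 0)) := inferInstanceAs (Subsingleton (ZMod 1))
        infer_instance
      have h3 : (1 : ℝ) ≤ 2 ^ d := one_le_pow₀ (by norm_num)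
      refine Runs.op ?_ (by push_cast; simp; nlinarith)
      funext i
      have hroot : ∀ z : ZMod (2 ^ 0), root z = 1 := by
        intro z
        have : Subsingleton (ZMod (2 ^ 0)) := inferInstanceAs (Subsingleton (ZMod 1))
        rw [Subsingleton.elim z 0, root_zero]
      rw [Fintype.sum_subsingleton _ i, hroot, one_mul]
  | succ e ih =>
      have hlen : ((Finset.univ : Finset (Fin d → Fin 2)).toList.length : ℝ) = 2 ^ d := by
        simp
      refine ((Runs.tabulate_univ_eq fun ε => ih _).bind fun parts hparts =>
        (Runs.tabulate_univ_eq (t := 2 ^ d * (4 * d + 3))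
          (g := fun i => ∑ j, root ((σ : ZMod (2 ^ (e + 1))) * (i ⬝ᵥ j)) * f j)
          fun i => ?_)).le ?_
      · refine ((Runs.foldlM_eq (t := 4 * d + 3) fun ε _ b => Runs.op rfl ?_).imp
          fun a ha => ?_).le ?_
        · push_cast; rfl
        · rw [ha, foldl_add_toList, ← (joinBits_bijective e).sum_comp, Fintype.sum_prod_type]
          refine Finset.sum_congr rfl fun ε _ => ?_
          rw [hparts, Finset.mul_sum]
          refine Finset.sum_congr rfl fun j _ => ?_
          rw [root_mul_dotProduct_joinBits, mul_assoc]
          rfl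
        · rw [hlen]
      · rw [card_Pt]
        simp only [Fintype.card_pi, Fintype.card_fin, Finset.prod_const, Finset.card_univ]
        push_cast
        have h1 : ((2 : ℝ) ^ (e + 1)) ^ d = 2 ^ d * (2 ^ e) ^ d := by
          rw [pow_succ, mul_pow, mul_comm]
        have h2 : (1 : ℝ) ≤ (2 ^ e) ^ d := one_le_pow₀ (one_le_pow₀ (by norm_num))
        have h3 : (1 : ℝ) ≤ 2 ^ d := one_le_pow₀ (by norm_num)
        rw [h1]
        generalize ((2 : ℝ) ^ e) ^ d = q at *
        generalize (2 : ℝ) ^ d = r at *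
        -- One extra step for each half-size transform and one for each output entry are both at
        -- most `r² q`. Absorbing them is what the excess of `4 d + 6` over `4 d + 3` is for.
        have h4 : r ≤ r * r * q := by nlinarith [mul_le_mul h3 h2 (by norm_num) (by linarith)]
        have h5 : r * q ≤ r * r * q := by nlinarith [mul_le_mul h3 h2 (by norm_num) (by linarith)]
        have h6 : 0 ≤ r * r * q * d := by positivity
        nlinarith

end

section

variable {X : Type} {d m : ℕ} {v : X → ℂ}

/-! ### The Dirichlet kernel -/

theorem Icc_neg_succ (h : ℕ) : Finset.Icc (-((h + 1 : ℕ) : ℤ)) ((h + 1 : ℕ) : ℤ) =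
    insert ((h : ℤ) + 1) (insert (-((h : ℤ) + 1)) (Finset.Icc (-(h : ℤ)) h)) := by
  ext j
  simp only [Finset.mem_Icc, Finset.mem_insert]
  push_cast
  omega

/-- Telescoping: the two new exponentials, times `sin θ`, are the difference of two sines whose
arguments differ by `2θ`. -/
theorem sum_exp_mul_sin (h : ℕ) (θ : ℂ) :
    (∑ j ∈ Finset.Icc (-(h : ℤ)) h, Complex.exp (2 * θ * Complex.I * j)) * Complex.sin θ =
      Complex.sin ((2 * h + 1) * θ) := by
  induction h with
  | zero => simp
  | succ h ih =>
      rw [Icc_neg_succ, Finset.sum_insert, Finset.sum_insert, add_mul, add_mul, ih]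
      · have h1 : (2 * ((h + 1 : ℕ) : ℂ) + 1) * θ = 2 * (h + 1) * θ + θ := by push_cast; ring
        have h2 : (2 * (h : ℂ) + 1) * θ = 2 * (h + 1) * θ - θ := by ring
        have h3 : 2 * θ * Complex.I * (((h : ℤ) + 1 : ℤ) : ℂ) = 2 * (h + 1) * θ * Complex.I := by
          push_cast; ring
        have h4 : 2 * θ * Complex.I * ((-((h : ℤ) + 1) : ℤ) : ℂ) =
            -(2 * (h + 1) * θ) * Complex.I := by push_cast; ring
        rw [h1, h2, h3, h4, Complex.exp_mul_I, Complex.exp_mul_I, Complex.sin_add,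
          Complex.sin_sub, Complex.cos_neg, Complex.sin_neg]
        ring
      · simp
      · simp only [Finset.mem_insert, Finset.mem_Icc]; omega

/-- Stated for any integer representative, because the kernel is defined through `val`, whereas its
estimates need the representative `valMinAbs` of least absolute value. -/
theorem sum_root_mul_sin (h : ℕ) (k : ℤ) :
    (∑ j ∈ Finset.Icc (-(h : ℤ)) h, root ((j : ZMod (2 ^ m)) * (k : ZMod (2 ^ m)))) *
      ((Real.sin (Real.pi * k / 2 ^ m) : ℝ) : ℂ) =
      ((Real.sin ((2 * h + 1) * (Real.pi * k / 2 ^ m)) : ℝ) : ℂ) := by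
  have := sum_exp_mul_sin h ((Real.pi * k / 2 ^ m : ℝ) : ℂ)
  push_cast at this ⊢
  rw [← this]
  congr 1
  refine Finset.sum_congr rfl fun j _ => ?_
  rw [← Int.cast_mul, root_intCast]
  congr 1
  push_cast
  ring

theorem abs_sin_ge {k : ℤ} (hk : 2 * |(k : ℝ)| ≤ 2 ^ m) :
    2 * |(k : ℝ)| / 2 ^ m ≤ |Real.sin (Real.pi * k / 2 ^ m)| := by
  have hpi := Real.pi_pos
  have h2 : (0 : ℝ) < 2 ^ m := by positivity
  have h1 : |Real.pi * k / 2 ^ m| = Real.pi * |(k : ℝ)| / 2 ^ m := by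
    rw [abs_div, abs_mul, abs_of_pos hpi, abs_of_pos h2]
  refine le_trans (le_of_eq ?_) (Real.mul_abs_le_abs_sin ?_)
  · rw [h1]; field_simp
  · rw [h1, div_le_iff₀ h2]; nlinarith

theorem two_mul_abs_valMinAbs (t : ZMod (2 ^ m)) : 2 * |(t.valMinAbs : ℝ)| ≤ 2 ^ m := by
  have h := ZMod.natAbs_valMinAbs_le t
  have h' : 2 * t.valMinAbs.natAbs ≤ 2 ^ m := by omega
  have h3 : ((t.valMinAbs.natAbs : ℕ) : ℝ) = |(t.valMinAbs : ℝ)| := by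
    rw [Nat.cast_natAbs, Int.cast_abs]
  rw [← h3]
  exact_mod_cast h'

theorem sum_root_eq_dirichlet (h : ℕ) (t : ZMod (2 ^ m)) :
    ∑ j ∈ Finset.Icc (-(h : ℤ)) h, root ((j : ZMod (2 ^ m)) * t) =
      (2 * h + 1) * (dirichlet h t : ℂ) := by
  by_cases ht : t = 0
  · subst ht
    simp only [dirichlet, mul_zero, root_zero, Finset.sum_const, Int.card_Icc, if_true]
    simp only [nsmul_eq_mul, mul_one, Complex.ofReal_one]
    have : ((h : ℤ) + 1 - -(h : ℤ)).toNat = 2 * h + 1 := by omega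
    rw [this]; push_cast; ring
  · have hk := sum_root_mul_sin (m := m) h (t.val : ℤ)
    have hs : Real.sin (Real.pi * t.val / 2 ^ m) ≠ 0 := by
      have h0 : 0 < t.val := Nat.pos_of_ne_zero fun h => ht ((ZMod.val_eq_zero t).1 h)
      have h1 : (t.val : ℝ) < 2 ^ m := by exact_mod_cast ZMod.val_lt t
      have h2 : (0 : ℝ) < 2 ^ m := by positivity
      have h3 : (0 : ℝ) < t.val := by exact_mod_cast h0
      refine (Real.sin_pos_of_pos_of_lt_pi (by positivity) ?_).ne'
      rw [div_lt_iff₀ h2]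
      exact mul_lt_mul_of_pos_left h1 Real.pi_pos
    push_cast [ZMod.natCast_zmod_val] at hk
    rw [dirichlet, if_neg ht]
    have hsc : Complex.sin (Real.pi * t.val / 2 ^ m) ≠ 0 := by
      exact_mod_cast hs
    have h21 : (2 * (h : ℂ) + 1) ≠ 0 := by exact_mod_cast (by omega : 2 * h + 1 ≠ 0)
    push_cast
    rw [← hk]
    field_simp

theorem dirichlet_mul_sin (h : ℕ) (t : ZMod (2 ^ m)) :
    (2 * h + 1) * dirichlet h t * Real.sin (Real.pi * t.valMinAbs / 2 ^ m) =
      Real.sin ((2 * h + 1) * (Real.pi * t.valMinAbs / 2 ^ m)) := by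
  have hk := sum_root_mul_sin (m := m) h t.valMinAbs
  rw [ZMod.coe_valMinAbs, sum_root_eq_dirichlet] at hk
  exact_mod_cast hk

theorem abs_dirichlet_le_one (h : ℕ) (t : ZMod (2 ^ m)) : |dirichlet h t| ≤ 1 := by
  have h1 : ‖∑ j ∈ Finset.Icc (-(h : ℤ)) h, root ((j : ZMod (2 ^ m)) * t)‖ ≤ 2 * h + 1 := by
    refine (norm_sum_le _ _).trans ?_
    simp only [norm_root, Finset.sum_const, Int.card_Icc, nsmul_eq_mul, mul_one]
    have : ((h : ℤ) + 1 - -(h : ℤ)).toNat = 2 * h + 1 := by omega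
    rw [this]; push_cast; exact le_rfl
  rw [sum_root_eq_dirichlet, norm_mul, Complex.norm_real, Real.norm_eq_abs] at h1
  have h2 : ‖(2 * (h : ℂ) + 1)‖ = 2 * h + 1 := by
    have : (2 * (h : ℂ) + 1) = ((2 * h + 1 : ℕ) : ℂ) := by push_cast; ring
    rw [this, Complex.norm_natCast]; push_cast; ring
  rw [h2] at h1
  have h3 : (0 : ℝ) < 2 * h + 1 := by positivity
  nlinarith

theorem dirichlet_neg (h : ℕ) (t : ZMod (2 ^ m)) : dirichlet h (-t) = dirichlet h t := by
  have h1 : ∑ j ∈ Finset.Icc (-(h : ℤ)) h, root ((j : ZMod (2 ^ m)) * -t) =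
      ∑ j ∈ Finset.Icc (-(h : ℤ)) h, root ((j : ZMod (2 ^ m)) * t) := by
    refine Finset.sum_equiv (Equiv.neg ℤ) (fun j => ?_) fun j _ => ?_
    · simp only [Finset.mem_Icc, Equiv.neg_apply]; omega
    · simp
  rw [sum_root_eq_dirichlet, sum_root_eq_dirichlet] at h1
  have h21 : (2 * (h : ℂ) + 1) ≠ 0 := by exact_mod_cast (by omega : 2 * h + 1 ≠ 0)
  exact_mod_cast mul_left_cancel₀ h21 h1

/-- The numerator of the kernel is at most one, and the sine in the denominator is bounded below by
Jordan's inequality. -/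
theorem abs_dirichlet_le (h : ℕ) (t : ZMod (2 ^ m)) (ht : t ≠ 0) :
    |dirichlet h t| ≤ 2 ^ m / ((2 * h + 1) * (2 * |(t.valMinAbs : ℝ)|)) := by
  have h0 : t.valMinAbs ≠ 0 := fun h => ht ((ZMod.valMinAbs_eq_zero t).1 h)
  have h1 : 0 < |(t.valMinAbs : ℝ)| := abs_pos.2 (by exact_mod_cast h0)
  have h2 := abs_sin_ge (two_mul_abs_valMinAbs t)
  have h3 := congrArg abs (dirichlet_mul_sin h t)
  have h4 := Real.abs_sin_le_one ((2 * h + 1) * (Real.pi * t.valMinAbs / 2 ^ m))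
  rw [← h3, abs_mul, abs_mul, abs_of_pos (by positivity : (0 : ℝ) < 2 * h + 1)] at h4
  rw [le_div_iff₀ (by positivity)]
  have h5 : (2 * (h : ℝ) + 1) * |dirichlet h t| * (2 * |(t.valMinAbs : ℝ)| / 2 ^ m) ≤ 1 :=
    le_trans (mul_le_mul_of_nonneg_left h2 (by positivity)) h4
  rw [mul_div_assoc', div_le_one (by positivity)] at h5
  linarith

/-- On this range the argument of the upper sine is at most `π/2`, so Jordan's inequality bounds it
below, while `sin x ≤ x` bounds the lower one. This is the source of the lower bound for the filter
at the element that defines the bucket. -/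
theorem two_div_pi_le_dirichlet (h : ℕ) (t : ZMod (2 ^ m))
    (ht : 2 * (2 * h + 1) * |(t.valMinAbs : ℝ)| ≤ 2 ^ m) : 2 / Real.pi ≤ dirichlet h t := by
  have hpi := Real.pi_pos
  by_cases ht0 : t = 0
  · subst ht0
    rw [dirichlet, if_pos rfl, div_le_one hpi]
    exact Real.two_le_pi
  · have h0 : t.valMinAbs ≠ 0 := fun h => ht0 ((ZMod.valMinAbs_eq_zero t).1 h)
    have key := dirichlet_mul_sin h t
    set k : ℝ := |(t.valMinAbs : ℝ)| with hk
    have h1 : 0 < k := abs_pos.2 (by exact_mod_cast h0)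
    have h2 : (0 : ℝ) < 2 ^ m := by positivity
    have key' : (2 * h + 1) * dirichlet h t * Real.sin (Real.pi * k / 2 ^ m) =
        Real.sin ((2 * h + 1) * (Real.pi * k / 2 ^ m)) := by
      rcases abs_choice (t.valMinAbs : ℝ) with hc | hc
      · rw [hk, hc]; exact key
      · rw [hk, hc]
        simp only [mul_neg, neg_div, Real.sin_neg, key]
    have hx : 0 < Real.pi * k / 2 ^ m := by positivity
    have hy : (2 * h + 1) * (Real.pi * k / 2 ^ m) ≤ Real.pi / 2 := by
      rw [mul_div_assoc', div_le_div_iff₀ h2 (by norm_num)]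
      nlinarith
    have h3 := Real.mul_le_sin (by positivity) hy
    have h4 := Real.sin_le hx.le
    rw [← key'] at h3
    have h21 : (0 : ℝ) < 2 * h + 1 := by positivity
    have h5 : 2 / Real.pi * (Real.pi * k / 2 ^ m) ≤
        dirichlet h t * Real.sin (Real.pi * k / 2 ^ m) := by nlinarith
    have h6 : 0 < dirichlet h t := by
      by_contra hneg
      have h7 : 0 ≤ Real.sin (Real.pi * k / 2 ^ m) := by
        refine Real.sin_nonneg_of_nonneg_of_le_pi hx.le ?_
        have : Real.pi * k / 2 ^ m ≤ (2 * h + 1) * (Real.pi * k / 2 ^ m) := by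
          have : (0 : ℝ) ≤ h := by positivity
          nlinarith
        linarith
      have : 0 < 2 / Real.pi * (Real.pi * k / 2 ^ m) := by positivity
      nlinarith
    have h7 : 2 / Real.pi * (Real.pi * k / 2 ^ m) ≤ dirichlet h t * (Real.pi * k / 2 ^ m) :=
      h5.trans (mul_le_mul_of_nonneg_left h4 h6.le)
    exact le_of_mul_le_mul_right h7 hx

/-! ### Trigonometric polynomials and moving averages -/

/-- The average of a sequence over windows of `2 h + 1` consecutive indices. -/
def smooth (h : ℕ) (c : ℤ → ℝ) : ℤ → ℝ := fun j =>
  (∑ i ∈ Finset.Icc (-(h : ℤ)) h, c (j + i)) / (2 * h + 1)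

/-- The trigonometric polynomial on `ZMod (2 ^ m)` with given coefficients. -/
def trig (m : ℕ) (c : ℤ → ℝ) (t : ZMod (2 ^ m)) : ℂ :=
  ∑' j : ℤ, (c j : ℂ) * root ((j : ZMod (2 ^ m)) * t)

def SupportedIn (M : ℕ) (c : ℤ → ℝ) : Prop := ∀ j : ℤ, (M : ℤ) < |j| → c j = 0

theorem SupportedIn.smooth {M h : ℕ} {c : ℤ → ℝ} (hc : SupportedIn M c) :
    SupportedIn (M + h) (smooth h c) := by
  intro j hj
  rw [SparseFourier.smooth, Finset.sum_eq_zero, zero_div]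
  intro i hi
  rw [Finset.mem_Icc] at hi
  refine hc _ ?_
  push_cast at hj
  rcases abs_cases j with ⟨h1, _⟩ | ⟨h1, _⟩ <;> rcases abs_cases (j + i) with ⟨h2, _⟩ | ⟨h2, _⟩ <;>
    omega

theorem SupportedIn.iterate {M h : ℕ} {c : ℤ → ℝ} (hc : SupportedIn M c) (p : ℕ) :
    SupportedIn (M + p * h) ((SparseFourier.smooth h)^[p] c) := by
  induction p with
  | zero => simpa using hc
  | succ p ih =>
      rw [Function.iterate_succ_apply']
      have := ih.smooth (h := h)
      convert this using 1
      ring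

theorem SupportedIn.trig_eq {M : ℕ} {c : ℤ → ℝ} (hc : SupportedIn M c) (t : ZMod (2 ^ m)) :
    trig m c t = ∑ j ∈ Finset.Icc (-(M : ℤ)) M, (c j : ℂ) * root ((j : ZMod (2 ^ m)) * t) := by
  refine tsum_eq_sum fun j hj => ?_
  rw [hc j, Complex.ofReal_zero, zero_mul]
  rw [Finset.mem_Icc] at hj
  rcases abs_cases j with ⟨h1, _⟩ | ⟨h1, _⟩ <;> omega

/-- Convolution becomes multiplication. Coefficients are indexed by `ℤ`, not by residues, so that
translation is a mere reindexing of a sum with finite support and nothing wraps around. -/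
theorem SupportedIn.trig_smooth {M h : ℕ} {c : ℤ → ℝ} (hc : SupportedIn M c)
    (t : ZMod (2 ^ m)) :
    trig m (SparseFourier.smooth h c) t = dirichlet h t * trig m c t := by
  have hsum : ∀ i : ℤ, Summable fun j : ℤ =>
      ((c (j + i) : ℂ) * root (((j + i : ℤ) : ZMod (2 ^ m)) * t)) * root (((-i : ℤ) : ZMod (2 ^ m)) * t) := by
    intro i
    refine Summable.mul_right _ ?_
    refine (Equiv.summable_iff (Equiv.addRight i)
      (f := fun j : ℤ => (c j : ℂ) * root ((j : ZMod (2 ^ m)) * t))).2 ?_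
    refine summable_of_ne_finset_zero (s := Finset.Icc (-(M : ℤ)) M) fun j hj => ?_
    rw [hc j, Complex.ofReal_zero, zero_mul]
    rw [Finset.mem_Icc] at hj
    rcases abs_cases j with ⟨h1, _⟩ | ⟨h1, _⟩ <;> omega
  have h1 : ∀ j : ℤ, ((SparseFourier.smooth h c j : ℝ) : ℂ) * root ((j : ZMod (2 ^ m)) * t) =
      (∑ i ∈ Finset.Icc (-(h : ℤ)) h,
        ((c (j + i) : ℂ) * root (((j + i : ℤ) : ZMod (2 ^ m)) * t)) *
          root (((-i : ℤ) : ZMod (2 ^ m)) * t)) / (2 * h + 1) := by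
    intro j
    rw [SparseFourier.smooth]
    push_cast
    rw [div_mul_eq_mul_div, Finset.sum_mul]
    congr 1
    refine Finset.sum_congr rfl fun i _ => ?_
    rw [mul_assoc, ← root_add]
    congr 2
    ring
  rw [trig]
  simp only [h1]
  rw [tsum_div_const, Summable.tsum_finsetSum fun i _ => hsum i]
  have h2 : ∀ i : ℤ, ∑' j : ℤ, ((c (j + i) : ℂ) * root (((j + i : ℤ) : ZMod (2 ^ m)) * t)) *
      root (((-i : ℤ) : ZMod (2 ^ m)) * t) = trig m c t * root ((i : ZMod (2 ^ m)) * -t) := by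
    intro i
    rw [tsum_mul_right]
    congr 1
    · exact Equiv.tsum_eq (Equiv.addRight i)
        (fun j : ℤ => (c j : ℂ) * root ((j : ZMod (2 ^ m)) * t))
    · push_cast; congr 1; ring
  simp only [h2]
  rw [← Finset.mul_sum, sum_root_eq_dirichlet, dirichlet_neg]
  have h21 : (2 * (h : ℂ) + 1) ≠ 0 := by exact_mod_cast (by omega : 2 * h + 1 ≠ 0)
  field_simp

theorem SupportedIn.trig_iterate {M h : ℕ} {c : ℤ → ℝ} (hc : SupportedIn M c) (p : ℕ)
    (t : ZMod (2 ^ m)) :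
    trig m ((SparseFourier.smooth h)^[p] c) t = dirichlet h t ^ p * trig m c t := by
  induction p with
  | zero => simp
  | succ p ih =>
      rw [Function.iterate_succ_apply', (hc.iterate p).trig_smooth, ih, pow_succ]; ring

theorem smooth_nonneg {h : ℕ} {c : ℤ → ℝ} (hc : ∀ j, 0 ≤ c j) (j : ℤ) : 0 ≤ smooth h c j :=
  div_nonneg (Finset.sum_nonneg fun _ _ => hc _) (by positivity)

theorem smooth_iterate_nonneg {h : ℕ} {c : ℤ → ℝ} (hc : ∀ j, 0 ≤ c j) (p : ℕ) (j : ℤ) :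
    0 ≤ (smooth h)^[p] c j := by
  induction p generalizing j with
  | zero => exact hc j
  | succ p ih => rw [Function.iterate_succ_apply']; exact smooth_nonneg ih j

/-- Each averaging shortens the plateau by `h` on both sides. The induction peels off the first
averaging, whence the general `c`. -/
theorem smooth_iterate_eq_one {h M : ℕ} {c : ℤ → ℝ} (p : ℕ)
    (hc : ∀ j : ℤ, |j| ≤ (M + p * h : ℕ) → c j = 1) (j : ℤ) (hj : |j| ≤ M) :
    (smooth h)^[p] c j = 1 := by
  induction p generalizing c with
  | zero => exact hc j (by simpa using hj)
  | succ p ih =>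
      rw [Function.iterate_succ_apply]
      refine ih fun i hi => ?_
      have h1 : ∀ l ∈ Finset.Icc (-(h : ℤ)) h, c (i + l) = 1 := by
        intro l hl
        rw [Finset.mem_Icc] at hl
        refine hc _ ?_
        have h2 : |i + l| ≤ |i| + |l| := abs_add_le i l
        have h3 : |l| ≤ h := abs_le.2 hl
        push_cast at hi ⊢
        linarith
      rw [smooth, Finset.sum_congr rfl h1]
      simp only [Finset.sum_const, Int.card_Icc, nsmul_eq_mul, mul_one]
      have : ((h : ℤ) + 1 - -(h : ℤ)).toNat = 2 * h + 1 := by omega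
      rw [this]
      push_cast
      exact div_self (by positivity)

/-! ### The flat window -/

/-- The indicator function of `|j| ≤ h`. -/
def boxInd (h : ℕ) : ℤ → ℝ := fun j => if |j| ≤ (h : ℤ) then 1 else 0

theorem boxInd_supportedIn (h : ℕ) : SupportedIn h (boxInd h) := fun j hj => by
  rw [boxInd, if_neg (not_le.2 hj)]

theorem trig_boxInd (h : ℕ) (t : ZMod (2 ^ m)) :
    trig m (boxInd h) t = (2 * h + 1) * (dirichlet h t : ℂ) := by
  rw [(boxInd_supportedIn h).trig_eq, ← sum_root_eq_dirichlet]
  refine Finset.sum_congr rfl fun j hj => ?_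
  rw [boxInd, if_pos (abs_le.2 (Finset.mem_Icc.1 hj))]
  simp

/-- The Fourier coefficients of the window. -/
def windowCoeff (e p : ℕ) : ℤ → ℝ :=
  (smooth (2 ^ e / (4 * p)))^[p] (boxInd (3 * 2 ^ e / 4))

theorem window_eq_trig (e p : ℕ) (t : ZMod (2 ^ m)) :
    (window e p t : ℂ) = trig m (windowCoeff e p) t := by
  rw [windowCoeff, (boxInd_supportedIn _).trig_iterate, trig_boxInd, window]
  push_cast
  ring

theorem mul_window_width_le (e p : ℕ) : p * (2 ^ e / (4 * p)) ≤ 2 ^ e / 4 := by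
  rw [← Nat.div_div_eq_div_mul]
  exact Nat.mul_div_le _ _

theorem windowCoeff_supportedIn (e p : ℕ) : SupportedIn (2 ^ e) (windowCoeff e p) := by
  intro j hj
  refine (boxInd_supportedIn _).iterate p j (lt_of_le_of_lt ?_ hj)
  have := mul_window_width_le e p
  generalize p * (2 ^ e / (4 * p)) = q at *
  generalize 2 ^ e = b at *
  exact_mod_cast (by omega : 3 * b / 4 + q ≤ b)

theorem windowCoeff_eq_one (e p : ℕ) (hp : 1 ≤ p) (j : ℤ) (hj : 2 * |j| ≤ 2 ^ e) :
    windowCoeff e p j = 1 := by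
  have hq := mul_window_width_le e p
  have hj' : |j| ≤ ((2 ^ e / 2 : ℕ) : ℤ) := by
    have : (((2 : ℤ) ^ e)) = ((2 ^ e : ℕ) : ℤ) := by push_cast; rfl
    rw [this] at hj
    generalize 2 ^ e = b at *
    omega
  refine smooth_iterate_eq_one (M := 2 ^ e / 2) p (fun i hi => ?_) j hj'
  rw [boxInd, if_pos (hi.trans ?_)]
  have h4 : 2 ^ e / 2 + p * (2 ^ e / (4 * p)) ≤ 3 * 2 ^ e / 4 := by
    -- When four divides `2^e` this is `1/2 + 1/4 = 3/4` without rounding. For the two smaller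
    -- exponents the width of the averaging is zero.
    rcases e with _ | _ | e
    · simp only [pow_zero] at *; omega
    · have : 2 ^ (0 + 1) / (4 * p) = 0 := Nat.div_eq_of_lt (by norm_num; omega)
      rw [this]; norm_num
    · have : 2 ^ (e + 1 + 1) = 4 * 2 ^ e := by ring
      clear hj hj' hi
      generalize p * (2 ^ (e + 1 + 1) / (4 * p)) = q at *
      generalize 2 ^ (e + 1 + 1) = b at *
      omega
  exact_mod_cast h4

/-- Beyond this distance the narrow kernel is at most 1/2, and its `p`-th power gives `2^(-p)`; the
wide factor is bounded trivially. -/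
theorem abs_window_le (e p : ℕ) (he : e ≤ m) (hp : 1 ≤ p) (t : ZMod (2 ^ m))
    (ht : 4 * p * 2 ^ (m - e) < t.valMinAbs.natAbs) : |window e p t| ≤ 4 * 2 ^ e / 2 ^ p := by
  have hb : (0 : ℝ) < 2 ^ e := by positivity
  have h1 : |(2 * (3 * 2 ^ e / 4 : ℕ) + 1 : ℝ)| ≤ 4 * 2 ^ e := by
    rw [abs_of_pos (by positivity)]
    have : 2 * (3 * 2 ^ e / 4) + 1 ≤ 4 * 2 ^ e := by have := Nat.one_le_two_pow (n := e); omega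
    exact_mod_cast this
  have h2 : |dirichlet (2 ^ e / (4 * p)) t| ≤ 1 / 2 := by
    have hmin := ZMod.natAbs_valMinAbs_le t
    have hpow : 2 ^ e * 2 ^ (m - e) = 2 ^ m := by rw [← pow_add]; congr 1; omega
    have ht0 : t ≠ 0 := by
      rintro rfl
      simp at ht
    -- Otherwise `t` would have to be farther from zero than the whole cycle is long. So the width
    -- of the narrow kernel is at least one.
    have h4p : 4 * p < 2 ^ e := by
      by_contra hcon
      push Not at hcon
      have : 2 ^ e * 2 ^ (m - e) ≤ 4 * p * 2 ^ (m - e) := Nat.mul_le_mul_right _ hcon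
      omega
    refine (abs_dirichlet_le _ t ht0).trans ?_
    have hk : ((t.valMinAbs.natAbs : ℕ) : ℝ) = |(t.valMinAbs : ℝ)| := by
      rw [Nat.cast_natAbs, Int.cast_abs]
    rw [← hk]
    set k := t.valMinAbs.natAbs
    set h := 2 ^ e / (4 * p) with hh
    have hq1 : 1 ≤ h := (Nat.one_le_div_iff (by omega)).2 h4p.le
    have hq2 : 2 ^ e < 4 * p * (h + 1) := by
      rw [mul_comm]
      exact (Nat.div_lt_iff_lt_mul (by omega)).1 (Nat.lt_succ_self _)
    have hk0 : (0 : ℝ) < k := by exact_mod_cast (by omega : 0 < k)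
    rw [div_le_div_iff₀ (by positivity) (by norm_num)]
    have : 2 ^ m * 2 ≤ 1 * ((2 * h + 1) * (2 * k)) := by
      rw [← hpow]
      have h5 : 2 ^ e * 2 ^ (m - e) ≤ 4 * p * (h + 1) * 2 ^ (m - e) :=
        Nat.mul_le_mul_right _ hq2.le
      have h6 : 4 * p * (h + 1) * 2 ^ (m - e) ≤ k * (h + 1) := by
        calc 4 * p * (h + 1) * 2 ^ (m - e) = 4 * p * 2 ^ (m - e) * (h + 1) := by ring
          _ ≤ k * (h + 1) := Nat.mul_le_mul_right _ ht.le
      nlinarith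
    exact_mod_cast this
  have h3 := abs_dirichlet_le_one (3 * 2 ^ e / 4) t
  rw [window, abs_mul, abs_mul, abs_pow]
  have h4 : |dirichlet (2 ^ e / (4 * p)) t| ^ p ≤ (1 / 2) ^ p :=
    pow_le_pow_left₀ (abs_nonneg _) h2 p
  calc |(2 * (3 * 2 ^ e / 4 : ℕ) + 1 : ℝ)| * |dirichlet (3 * 2 ^ e / 4) t| *
        |dirichlet (2 ^ e / (4 * p)) t| ^ p
      ≤ 4 * 2 ^ e * 1 * (1 / 2) ^ p := by gcongr
    _ = 4 * 2 ^ e / 2 ^ p := by rw [one_div, inv_pow]; ring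

theorem root_gridPt_mul {e : ℕ} (he : e ≤ m) (l : ZMod (2 ^ e)) (j : ℤ) :
    root ((j : ZMod (2 ^ m)) * gridPt m e l) = root (l * (j : ZMod (2 ^ e))) := by
  have h1 : (j : ZMod (2 ^ m)) * gridPt m e l =
      ((j * (2 ^ (m - e) * l.val) : ℤ) : ZMod (2 ^ m)) := by
    rw [gridPt]; push_cast; rfl
  have h2 : l * (j : ZMod (2 ^ e)) = ((l.val * j : ℤ) : ZMod (2 ^ e)) := by
    push_cast; rw [ZMod.natCast_zmod_val]
  rw [h1, h2, root_intCast, root_intCast]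
  congr 1
  have : (2 : ℂ) ^ m = 2 ^ (m - e) * 2 ^ e := by rw [← pow_add]; congr 1; omega
  rw [this]
  push_cast
  have h3 : (2 : ℂ) ^ (m - e) ≠ 0 := pow_ne_zero _ two_ne_zero
  field_simp

/-- The grid sees frequencies only modulo `2b`. The window has frequencies `|j| ≤ b`, and `|i| ≤
b/2`, so `|j - i| ≤ 3b/2 < 2b` and aliasing leaves only `j = i`, where the coefficient is one.
Before the cut-off the method is therefore exact. -/
theorem sum_window_grid (e p : ℕ) (he : e + 1 ≤ m) (hp : 1 ≤ p) (t : ZMod (2 ^ m)) (i : ℤ)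
    (hi : 2 * |i| ≤ 2 ^ e) :
    ∑ l : ZMod (2 ^ (e + 1)), (window e p (gridPt m (e + 1) l - t) : ℂ) *
      root (-((i : ZMod (2 ^ (e + 1))) * l)) = 2 ^ (e + 1) * root (-((i : ZMod (2 ^ m)) * t)) := by
  have h1 : ∀ l : ZMod (2 ^ (e + 1)), (window e p (gridPt m (e + 1) l - t) : ℂ) *
      root (-((i : ZMod (2 ^ (e + 1))) * l)) =
      ∑ j ∈ Finset.Icc (-((2 ^ e : ℕ) : ℤ)) (2 ^ e : ℕ), (windowCoeff e p j : ℂ) *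
        root (-((j : ZMod (2 ^ m)) * t)) * root (l * ((j - i : ℤ) : ZMod (2 ^ (e + 1)))) := by
    intro l
    rw [window_eq_trig, (windowCoeff_supportedIn e p).trig_eq, Finset.sum_mul]
    refine Finset.sum_congr rfl fun j _ => ?_
    rw [mul_sub, sub_eq_add_neg, root_add, root_gridPt_mul he]
    have : l * ((j - i : ℤ) : ZMod (2 ^ (e + 1))) = l * (j : ZMod (2 ^ (e + 1))) +
        -((i : ZMod (2 ^ (e + 1))) * l) := by push_cast; ring
    rw [this, root_add]
    ring
  have hpow : ((2 : ℤ) ^ e) = ((2 ^ e : ℕ) : ℤ) := by push_cast; rfl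
  simp only [h1]
  rw [Finset.sum_comm, Finset.sum_eq_single i]
  · rw [← Finset.mul_sum]
    simp [windowCoeff_eq_one e p hp i hi, ZMod.card, mul_comm]
  · intro j hj hji
    rw [← Finset.mul_sum, sum_root_mul, mul_zero]
    rw [Ne, ZMod.intCast_zmod_eq_zero_iff_dvd]
    intro hdvd
    have h2 := Int.eq_zero_of_abs_lt_dvd hdvd ?_
    · exact hji (by omega)
    · rw [Finset.mem_Icc] at hj
      push_cast at hj ⊢
      rw [pow_succ]
      have h3 : |j| ≤ 2 ^ e := abs_le.2 hj
      have h4 := abs_sub j i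
      have h5 : (0 : ℤ) < 2 ^ e := by positivity
      omega
  · intro hi'
    refine absurd ?_ hi'
    rw [Finset.mem_Icc]
    have := abs_le.1 (by have := abs_nonneg i; omega : |i| ≤ 2 ^ e)
    push_cast
    exact this

end

section

variable {X : Type} {d m : ℕ} {v : X → ℂ}

/-! ### Semi-equispaced Fourier transform -/

theorem update_add_eq {κ : Type*} [DecidableEq κ] (z : κ → ℂ) (k : κ) (a : ℂ) :
    Function.update z k (z k + a) = z + Pi.single k a := by
  ext p
  by_cases h : p = k
  · subst h; simp
  · simp [h]

theorem sum_mul_sum_single {κ ι : Type*} [Fintype κ] [DecidableEq κ] (φ : κ → ℂ) (s : Finset ι)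
    (k : ι → κ) (a : ι → ℂ) :
    ∑ p, φ p * (∑ i ∈ s, (Pi.single (k i) (a i) : κ → ℂ)) p = ∑ i ∈ s, φ (k i) * a i := by
  simp only [Finset.sum_apply, Finset.mul_sum]
  rw [Finset.sum_comm]
  refine Finset.sum_congr rfl fun i _ => ?_
  rw [Finset.sum_eq_single (k i)]
  · simp
  · intro p _ hp; simp [hp]
  · simp

theorem sum_mul_list_sum {κ ι : Type*} [Fintype κ] (φ : κ → ℂ) (l : List ι) (F : ι → κ → ℂ) :
    ∑ p, φ p * (l.map F).sum p = (l.map fun i => ∑ p, φ p * F i p).sum := by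
  induction l with
  | nil => simp
  | cons i l ih => simp [mul_add, Finset.sum_add_distrib, ih]

theorem gridPt_val {e : ℕ} (he : e ≤ m) (l : ZMod (2 ^ e)) :
    (gridPt m e l).val = 2 ^ (m - e) * l.val := by
  rw [gridPt, ZMod.val_natCast, Nat.mod_eq_of_lt]
  have h1 := ZMod.val_lt l
  have h2 : 2 ^ (m - e) * 2 ^ e = 2 ^ m := by rw [← pow_add]; congr 1; omega
  rw [← h2]
  exact Nat.mul_lt_mul_of_pos_left h1 (by positivity)

theorem gridPt_injective {e : ℕ} (he : e ≤ m) : Function.Injective (gridPt m e) := by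
  intro l l' h
  have h1 := congrArg ZMod.val h
  rw [gridPt_val he, gridPt_val he] at h1
  exact ZMod.val_injective _ (Nat.eq_of_mul_eq_mul_left (by positivity) h1)

/-- The signed distances from `t` to grid points are congruent modulo the spacing `g`. They are thus
determined by their quotients by `g`, and after the shift by `8 p g` these quotients lie in `[0, 16
p]`. -/
theorem card_near_le (e p : ℕ) (he : e + 1 ≤ m) (t : ZMod (2 ^ m)) :
    (near e p t).card ≤ 16 * p + 1 := by
  set g : ℤ := 2 ^ (m - (e + 1)) with hg
  have hg0 : 0 < g := by positivity
  have hR : ((2 ^ (m - e) : ℕ) : ℤ) = 2 * g := by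
    have : m - e = m - (e + 1) + 1 := by omega
    rw [this, hg]; push_cast; ring
  have hmem : ∀ l ∈ near e p t, |(gridPt m (e + 1) l - t).valMinAbs| ≤ 8 * p * g := by
    intro l hl
    have h1 := (Finset.mem_filter.1 hl).2
    have h2 : (((gridPt m (e + 1) l - t).valMinAbs.natAbs : ℕ) : ℤ) ≤
        ((4 * p * 2 ^ (m - e) : ℕ) : ℤ) := by exact_mod_cast h1
    rw [Int.natCast_natAbs, Nat.cast_mul, hR] at h2
    push_cast at h2
    linarith
  refine le_trans (Finset.card_le_card_of_injOn
    (fun l => ((gridPt m (e + 1) l - t).valMinAbs + 8 * p * g) / g)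
    (t := Finset.Icc (0 : ℤ) (16 * p)) ?_ ?_) ?_
  · intro l hl
    have h1 := abs_le.1 (hmem l hl)
    simp only [Finset.coe_Icc, Set.mem_Icc]
    constructor
    · exact Int.ediv_nonneg (by linarith) hg0.le
    · refine Int.ediv_le_of_le_mul hg0 ?_
      linarith
  · intro l hl l' hl' h
    simp only at h
    set a := (gridPt m (e + 1) l - t).valMinAbs with ha
    set b := (gridPt m (e + 1) l' - t).valMinAbs with hb
    have hdvd : g ∣ a - b := by
      have h1 : ((a - b - g * (l.val - l'.val) : ℤ) : ZMod (2 ^ m)) = 0 := by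
        push_cast
        rw [ha, hb, ZMod.coe_valMinAbs, ZMod.coe_valMinAbs, gridPt, gridPt, hg]
        push_cast
        ring
      rw [ZMod.intCast_zmod_eq_zero_iff_dvd] at h1
      have h2 : g ∣ ((2 ^ m : ℕ) : ℤ) := by
        push_cast
        exact pow_dvd_pow _ (by omega)
      have h3 := (h2.trans h1).add (Dvd.intro _ rfl : g ∣ g * (l.val - l'.val))
      simpa using h3
    have hab : a - b = 0 := by
      refine Int.eq_zero_of_abs_lt_dvd hdvd ?_
      have h1 := Int.emod_add_mul_ediv (a + 8 * p * g) g
      have h2 := Int.emod_add_mul_ediv (b + 8 * p * g) g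
      rw [h] at h1
      have h3 := Int.emod_nonneg (a + 8 * p * g) hg0.ne'
      have h4 := Int.emod_lt_of_pos (a + 8 * p * g) hg0
      have h5 := Int.emod_nonneg (b + 8 * p * g) hg0.ne'
      have h6 := Int.emod_lt_of_pos (b + 8 * p * g) hg0
      rw [abs_lt]
      constructor <;> linarith
    have h7 := ZMod.injective_valMinAbs (sub_eq_zero.1 hab : a = b)
    exact gridPt_injective he (sub_left_injective h7)
  · simp

/-- Bound for the number of steps of a semi-equispaced Fourier transform of a list of `len`
entries. -/
def semiTime (d p e : ℕ) (len : ℝ) : ℝ :=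
  (2 ^ (e + 1)) ^ d + (len * (d * ((16 * p + 1) * 31 + 1) + (16 * p + 1) ^ d * (2 * d + 3)) +
    ((e + 2) * (2 ^ (e + 1)) ^ d * 2 ^ d * (4 * d + 6) + (2 ^ (e + 1)) ^ d * (d + 3)))

/-- Relative precision of the semi-equispaced Fourier transform. -/
def semiErr (d m c : ℕ) : ℝ := 2 * d * (4 * 2 ^ m / 2 ^ (c * (m * d)))

theorem semiErr_nonneg (d m c : ℕ) : 0 ≤ semiErr d m c := by unfold semiErr; positivity

/-- After division by the unimodular product the difference is `∏ (1 + ε_i) - 1`, which is at most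
`exp (∑ |ε_i|) - 1`; for exponents up to one this is at most twice the exponent. -/
theorem norm_prod_add_sub_prod_le {ι : Type*} (s : Finset ι) (r δ : ι → ℂ) (ε : ℝ)
    (hr : ∀ i ∈ s, ‖r i‖ = 1) (hδ : ∀ i ∈ s, ‖δ i‖ ≤ ε) (hε : s.card * ε ≤ 1) :
    ‖∏ i ∈ s, (r i + δ i) - ∏ i ∈ s, r i‖ ≤ 2 * (s.card * ε) := by
  have h0 : ∀ i ∈ s, r i ≠ 0 := fun i hi => norm_pos_iff.1 (by rw [hr i hi]; norm_num)
  have h1 : ∏ i ∈ s, (r i + δ i) - ∏ i ∈ s, r i =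
      (∏ i ∈ s, r i) * (∏ i ∈ s, (1 + δ i / r i) - 1) := by
    rw [mul_sub, ← Finset.prod_mul_distrib, mul_one]
    congr 1
    refine Finset.prod_congr rfl fun i hi => ?_
    have := h0 i hi
    field_simp
  have h2 : ∑ i ∈ s, ‖δ i / r i‖ ≤ s.card * ε := by
    rw [← nsmul_eq_mul]
    refine Finset.sum_le_card_nsmul _ _ _ fun i hi => ?_
    rw [norm_div, hr i hi, div_one]; exact hδ i hi
  have h3 : 0 ≤ ∑ i ∈ s, ‖δ i / r i‖ := Finset.sum_nonneg fun _ _ => norm_nonneg _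
  rw [h1, norm_mul, norm_prod, Finset.prod_congr rfl hr, Finset.prod_const_one, one_mul]
  refine (Finset.norm_prod_one_add_sub_one_le s _).trans ?_
  have h4 := Real.abs_exp_sub_one_le (x := ∑ i ∈ s, ‖δ i / r i‖)
    (by rw [abs_of_nonneg h3]; linarith)
  rw [abs_of_nonneg h3] at h4
  linarith [le_abs_self (Real.exp (∑ i ∈ s, ‖δ i / r i‖) - 1)]

/-- The sum over the cut-off box factors over the coordinates. Each factor is the exact value from
`sum_window_grid` minus the contribution of the discarded grid points, which `abs_window_le` makes
tiny. -/
theorem norm_window_sum_sub_le (e p : ℕ) (he : e + 1 ≤ m) (hp : 1 ≤ p)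
    (hε : d * (4 * 2 ^ m / 2 ^ p : ℝ) ≤ 1) (t : Pt d m) (i : Fin d → ℤ)
    (hi : ∀ s, 2 * |i s| ≤ 2 ^ e) :
    ‖(∑ l ∈ Fintype.piFinset fun s => near e p (t s),
        root (((-1 : ℤ) : ZMod (2 ^ (e + 1))) * (toPt (e + 1) i ⬝ᵥ l)) *
          ∏ s, (window e p (gridPt m (e + 1) (l s) - t s) : ℂ)) / ((2 : ℂ) ^ (e + 1)) ^ d -
      root (-(toPt m i ⬝ᵥ t))‖ ≤ 2 * (d * (4 * 2 ^ m / 2 ^ p)) := by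
  have h1 : ∀ l : Pt d (e + 1), root (((-1 : ℤ) : ZMod (2 ^ (e + 1))) * (toPt (e + 1) i ⬝ᵥ l)) *
      ∏ s, (window e p (gridPt m (e + 1) (l s) - t s) : ℂ) =
      ∏ s, ((window e p (gridPt m (e + 1) (l s) - t s) : ℂ) *
        root (-((i s : ZMod (2 ^ (e + 1))) * l s))) := by
    intro l
    rw [Finset.prod_mul_distrib, ← root_sum, mul_comm]
    congr 2
    rw [dotProduct, Finset.sum_neg_distrib]
    push_cast
    rw [neg_one_mul]
    rfl
  simp only [h1]
  rw [← Finset.prod_univ_sum (t := fun s => near e p (t s)) (f := fun s l =>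
    ((window e p (gridPt m (e + 1) l - t s) : ℂ) * root (-((i s : ZMod (2 ^ (e + 1))) * l))))]
  have h2 : ((2 : ℂ) ^ (e + 1)) ^ d = ∏ _s : Fin d, (2 : ℂ) ^ (e + 1) := by simp
  rw [h2, ← Finset.prod_div_distrib, dotProduct, ← Finset.sum_neg_distrib, root_sum]
  set δ : Fin d → ℂ := fun s => -(∑ l ∈ (near e p (t s))ᶜ,
    ((window e p (gridPt m (e + 1) l - t s) : ℂ) * root (-((i s : ZMod (2 ^ (e + 1))) * l)))) /
      2 ^ (e + 1) with hδ
  have h2ne : (2 : ℂ) ^ (e + 1) ≠ 0 := pow_ne_zero _ two_ne_zero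
  have h3 : ∀ s : Fin d, (∑ l ∈ near e p (t s),
      ((window e p (gridPt m (e + 1) l - t s) : ℂ) *
        root (-((i s : ZMod (2 ^ (e + 1))) * l)))) / 2 ^ (e + 1) =
      root (-(toPt m i s * t s)) + δ s := by
    intro s
    have h4 := sum_window_grid e p he hp (t s) (i s) (hi s)
    rw [← Finset.sum_add_sum_compl (near e p (t s))] at h4
    simp only [hδ]
    rw [eq_sub_of_add_eq h4]
    field_simp
    rfl
  simp only [h3]
  have h5 := norm_prod_add_sub_prod_le Finset.univ (fun s => root (-(toPt m i s * t s))) δ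
    (4 * 2 ^ m / 2 ^ p) (fun s _ => norm_root _) (fun s _ => ?_) (by simpa using hε)
  · simpa using h5
  · simp only [hδ]
    rw [norm_div, norm_neg, norm_pow, Complex.norm_ofNat, div_le_iff₀ (by positivity)]
    refine (norm_sum_le_of_le _ (f := fun l => ((window e p (gridPt m (e + 1) l - t s) : ℂ) *
      root (-((i s : ZMod (2 ^ (e + 1))) * l)))) (n := fun _ => 4 * 2 ^ m / 2 ^ p)
        fun l hl => ?_).trans ?_
    · rw [norm_mul, norm_root, mul_one, Complex.norm_real, Real.norm_eq_abs]
      refine (abs_window_le e p (by omega) hp _ ?_).trans ?_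
      · simp only [near, Finset.mem_compl, Finset.mem_filter, Finset.mem_univ, true_and,
          not_le] at hl
        exact hl
      · gcongr
        · norm_num
        · omega
    · rw [Finset.sum_const, nsmul_eq_mul, mul_comm]
      refine mul_le_mul_of_nonneg_left ?_ (by positivity)
      have := Finset.card_le_univ (near e p (t s))ᶜ
      rw [ZMod.card] at this
      exact_mod_cast this

theorem list_sum_sub_le {ι : Type*} (l : List ι) (f g : ι → ℂ) (b : ι → ℝ)
    (h : ∀ i ∈ l, ‖f i - g i‖ ≤ b i) : ‖(l.map f).sum - (l.map g).sum‖ ≤ (l.map b).sum := by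
  induction l with
  | nil => simp
  | cons i l ih =>
      simp only [List.map_cons, List.sum_cons]
      rw [add_sub_add_comm]
      exact (norm_add_le _ _).trans (add_le_add (h i (by simp)) (ih fun j hj => h j (by simp [hj])))

theorem semiEquispaced_runs (c e : ℕ) (hc : 1 ≤ c) (hd : 1 ≤ d)
    (hε : d * (4 * 2 ^ m / 2 ^ (c * (m * d)) : ℝ) ≤ 1) (y : List (Pt d m × ℂ)) :
    Runs v (semiEquispaced c e y) (fun w => ∀ i : Fin d → ℤ, (∀ s, 2 * |i s| ≤ 2 ^ e) →
      ‖w i - (y.map fun q => q.2 * root (-(toPt m i ⬝ᵥ q.1))).sum / (Real.sqrt (size d m) : ℂ)‖ ≤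
        (y.map fun q => ‖q.2‖).sum * semiErr d m c / Real.sqrt (size d m))
      (semiTime d (c * (m * d)) e y.length) := by
  have hN : 0 < Real.sqrt (size d m) := Real.sqrt_pos.2 (size_pos d m)
  have hNc : (Real.sqrt (size d m) : ℂ) ≠ 0 := by exact_mod_cast hN.ne'
  have hy0 : 0 ≤ (y.map fun q => ‖q.2‖).sum :=
    List.sum_nonneg fun x hx => by
      obtain ⟨q, -, rfl⟩ := List.mem_map.1 hx; exact norm_nonneg _
  unfold semiEquispaced
  split_ifs with he
  · set p := c * (m * d) with hp
    have hp1 : 1 ≤ p := Nat.mul_pos hc (Nat.mul_pos (by omega) hd)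
    refine (Runs.charge (t := (2 ^ (e + 1)) ^ d) (by push_cast; rfl)).bind fun _ _ =>
      Runs.bind (Q := fun z => z = (y.map fun q =>
        ∑ l ∈ Fintype.piFinset fun s => near e p (q.1 s),
        (Pi.single l (q.2 * ∏ s, (window e p (gridPt m (e + 1) (l s) - q.1 s) : ℂ)) :
          Pt d (e + 1) → ℂ)).sum) ?_ fun z hz =>
      (fft_runs (-1) (e + 1) z).bind (t' := (2 ^ (e + 1)) ^ d * (d + 3)) (fun u hu =>
        ((Runs.tabulate_univ_eq (t := d + 2) fun i => Runs.op rfl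
          (by push_cast; rfl)).bind (t' := 0) fun w hw =>
          Runs.pure ?_ le_rfl).le ?_) |>.le ?_
    · refine ((Runs.foldlM_eq (g := fun z q => z + ∑ l ∈ Fintype.piFinset fun s => near e p (q.1 s),
        (Pi.single l (q.2 * ∏ s, (window e p (gridPt m (e + 1) (l s) - q.1 s) : ℂ)) :
          Pt d (e + 1) → ℂ))
        (t := d * ((16 * p + 1) * 31 + 1) + (16 * p + 1) ^ d * (2 * d + 3)) ?_).imp
          fun z hz => ?_)
      · rintro ⟨t, b⟩ - z
        have hcard : ∀ s, ((near e p (t s)).card : ℝ) ≤ 16 * p + 1 := fun s => by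
          exact_mod_cast card_near_le e p he (t s)
        refine ((Runs.tabulate (t := (16 * p + 1) * 31)
          (Q := fun s (W : ZMod (2 ^ (e + 1)) → ℝ) => ∀ l ∈ near e p (t s),
            W l = window e p (gridPt m (e + 1) l - t s)) fun s _ =>
          ((Runs.tabulate (t := 30) (Q := fun l a => a = window e p (gridPt m (e + 1) l - t s))
            fun l _ => Runs.op rfl (by norm_num)).mono (fun W hW l hl => hW.1 l (by simpa using hl))
            ?_)).bind fun win hwin => (Runs.foldlM_eq (t := 2 * d + 3) (g := fun z l => z +
              Pi.single l (b * ∏ s, (window e p (gridPt m (e + 1) (l s) - t s) : ℂ)))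
            fun l hl z => Runs.op ?_ ?_).imp fun a ha => ?_).le ?_
        · rw [Finset.length_toList]
          have := hcard s
          linarith
        · rw [update_add_eq]
          rw [Finset.mem_toList, Fintype.mem_piFinset] at hl
          congr 3
          exact Finset.prod_congr rfl fun s _ => by
            rw [hwin.1 s (List.mem_finRange s) _ (hl s)]
        · push_cast; rfl
        · rw [ha, foldl_add_eq, Finset.sum_map_toList]
        · rw [List.length_finRange, Finset.length_toList, Fintype.card_piFinset]
          push_cast
          gcongr
          refine (Finset.prod_le_prod (fun _ _ => Nat.cast_nonneg _) fun s _ => hcard s).trans ?_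
          simp
      · rw [hz, foldl_add_eq, zero_add]
    · intro i hi
      rw [hw]
      simp only
      rw [hu, hz]
      simp only
      rw [sum_mul_list_sum]
      simp only [sum_mul_sum_single]
      rw [div_mul_eq_div_div, ← sub_div, norm_div, Complex.norm_real, Real.norm_eq_abs,
        abs_of_pos hN]
      refine div_le_div_of_nonneg_right ?_ hN.le
      rw [← List.sum_map_mul_right, div_eq_mul_inv, ← List.sum_map_mul_right]
      refine list_sum_sub_le _ _ _ _ fun q _ => ?_
      have h6 := norm_window_sum_sub_le e p he hp1 hε q.1 i hi
      have h7 : (∑ l ∈ Fintype.piFinset fun s => near e p (q.1 s),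
          root (((-1 : ℤ) : ZMod (2 ^ (e + 1))) * (toPt (e + 1) i ⬝ᵥ l)) *
          (q.2 * ∏ s, (window e p (gridPt m (e + 1) (l s) - q.1 s) : ℂ))) *
            (((2 : ℂ) ^ (e + 1)) ^ d)⁻¹ - q.2 * root (-(toPt m i ⬝ᵥ q.1)) =
          q.2 * ((∑ l ∈ Fintype.piFinset fun s => near e p (q.1 s),
          root (((-1 : ℤ) : ZMod (2 ^ (e + 1))) * (toPt (e + 1) i ⬝ᵥ l)) *
          ∏ s, (window e p (gridPt m (e + 1) (l s) - q.1 s) : ℂ)) / ((2 : ℂ) ^ (e + 1)) ^ d -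
            root (-(toPt m i ⬝ᵥ q.1))) := by
        rw [mul_sub, div_eq_mul_inv, ← mul_assoc, Finset.mul_sum]
        congr 2
        exact Finset.sum_congr rfl fun l _ => by ring
      rw [h7, norm_mul]
      refine mul_le_mul_of_nonneg_left (h6.trans (le_of_eq ?_)) (norm_nonneg _)
      rw [semiErr]; ring
    · rw [card_Pt]; push_cast; linarith
    · push_cast; linarith
  · have hme : m ≤ e := by omega
    refine ((Runs.charge (t := (2 ^ m) ^ d) (by push_cast; rfl)).bind fun _ _ =>
      Runs.bind (Q := fun z => z = (y.map fun q => (Pi.single q.1 q.2 : Pt d m → ℂ)).sum)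
        (t := y.length * (d + 2)) ?_ fun z hz =>
      (fft_runs (-1) m z).bind (t' := (2 ^ m) ^ d * (d + 3)) (fun u hu =>
        ((Runs.tabulate_univ_eq (t := d + 2) fun i => Runs.op rfl
          (by push_cast; rfl)).bind (t' := 0) fun w hw =>
          Runs.pure ?_ le_rfl).le ?_)) |>.le ?_
    · refine ((Runs.foldlM_eq (g := fun z q => z + (Pi.single q.1 q.2 : Pt d m → ℂ))
        (t := d + 2) ?_).imp fun z hz => ?_)
      · rintro ⟨t, b⟩ - z
        exact Runs.op (update_add_eq _ _ _) (by push_cast; rfl)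
      · rw [hz, foldl_add_eq, zero_add]
    · intro i hi
      rw [hw]
      simp only
      rw [hu, hz]
      simp only
      rw [sum_mul_list_sum]
      have h8 : ∀ q : Pt d m × ℂ, ∑ p, root (((-1 : ℤ) : ZMod (2 ^ m)) * (toPt m i ⬝ᵥ p)) *
          (Pi.single q.1 q.2 : Pt d m → ℂ) p = q.2 * root (-(toPt m i ⬝ᵥ q.1)) := by
        intro q
        have := sum_mul_sum_single (fun p => root (((-1 : ℤ) : ZMod (2 ^ m)) * (toPt m i ⬝ᵥ p)))
          {()} (fun _ => q.1) (fun _ => q.2)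
        simp only [Finset.sum_singleton] at this
        rw [this]
        push_cast
        rw [neg_one_mul, mul_comm]
      simp only [h8, sub_self, norm_zero]
      have := semiErr_nonneg d m c
      positivity
    · rw [card_Pt]; push_cast; linarith
    -- The direct transform is exact and has `m ≤ e`, so it fits into the budget of the other
    -- branch.
    · rw [semiTime]
      have h9 : ((2 : ℝ) ^ m) ^ d ≤ (2 ^ (e + 1)) ^ d := by
        refine pow_le_pow_left₀ (by positivity) (pow_le_pow_right₀ (by norm_num) (by omega)) d
      have h10 : (m : ℝ) + 1 ≤ e + 2 := by exact_mod_cast (by omega : m + 1 ≤ e + 2)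
      have h11 : (d : ℝ) + 2 ≤ d * ((16 * (c * (m * d) : ℕ) + 1) * 31 + 1) +
          (16 * (c * (m * d) : ℕ) + 1) ^ d * (2 * d + 3) := by
        have h12 : (1 : ℝ) ≤ (16 * (c * (m * d) : ℕ) + 1) ^ d :=
          one_le_pow₀ (by have : (0 : ℝ) ≤ (c * (m * d) : ℕ) := Nat.cast_nonneg _; linarith)
        have h13 : (0 : ℝ) ≤ d * ((16 * (c * (m * d) : ℕ) + 1) * 31 + 1) := by positivity
        nlinarith
      gcongr

end

section

variable {X : Type} {d m : ℕ} {v : X → ℂ}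

/-! ### The table of filter coefficients -/

/-- The `F`-fold convolution of the uniform distribution on the integers `|j| ≤ h`. -/
def filterCoeff (h F : ℕ) : ℤ → ℝ := (smooth h)^[F] (Pi.single 0 1)

theorem single_supportedIn : SupportedIn 0 (Pi.single 0 1 : ℤ → ℝ) := fun j hj => by
  have : j ≠ 0 := by rintro rfl; simp at hj
  simp [this]

theorem filterCoeff_supportedIn (h F : ℕ) : SupportedIn (F * h) (filterCoeff h F) := by
  simpa [filterCoeff] using single_supportedIn.iterate (h := h) F

theorem filterCoeff_nonneg (h F : ℕ) (j : ℤ) : 0 ≤ filterCoeff h F j :=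
  smooth_iterate_nonneg (fun j => by by_cases h : j = 0 <;> simp [h]) F j

theorem trig_filterCoeff (h F : ℕ) (t : ZMod (2 ^ m)) :
    trig m (filterCoeff h F) t = dirichlet h t ^ F := by
  rw [filterCoeff, single_supportedIn.trig_iterate, single_supportedIn.trig_eq]
  simp

/-- Evaluation of the transform at zero. Total mass one is what keeps errors in the input of `fold`
from being amplified. -/
theorem sum_filterCoeff (h F : ℕ) :
    ∑ j ∈ Finset.Icc (-(F * h : ℕ) : ℤ) (F * h : ℕ), filterCoeff h F j = 1 := by
  have h1 := trig_filterCoeff (m := 0) h F 0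
  rw [(filterCoeff_supportedIn h F).trig_eq] at h1
  simp only [mul_zero, root_zero, mul_one, dirichlet, if_true] at h1
  simp only [Complex.ofReal_one, one_pow] at h1
  exact_mod_cast h1

theorem prefix_foldl (g : ℤ → ℝ) (M : ℤ) (n : ℕ) :
    ((List.range n).map fun i : ℕ => (i : ℤ) - M).foldl
      (fun (a : (ℤ → ℝ) × ℝ) j => (Function.update a.1 j (a.2 + g j), a.2 + g j)) (0, 0) =
    (fun j => if -M ≤ j ∧ j < -M + n then ∑ i ∈ Finset.Icc (-M) j, g i else 0,
      ∑ i ∈ Finset.Ico (-M) (-M + n), g i) := by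
  induction n with
  | zero =>
      simp only [List.range_zero, List.map_nil, List.foldl_nil, Nat.cast_zero, add_zero,
        Finset.Ico_self, Finset.sum_empty, Prod.mk.injEq, and_true]
      funext j
      rw [if_neg (by omega)]
      rfl
  | succ n ih =>
      rw [List.range_succ, List.map_append, List.foldl_append, ih]
      simp only [List.map_cons, List.map_nil, List.foldl_cons, List.foldl_nil]
      have h1 : ∑ i ∈ Finset.Ico (-M) (-M + n), g i + g (n - M) =
          ∑ i ∈ Finset.Icc (-M) ((n : ℤ) - M), g i := by
        have : Finset.Icc (-M) ((n : ℤ) - M) = insert ((n : ℤ) - M) (Finset.Ico (-M) (-M + n)) := by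
          ext j; simp only [Finset.mem_Icc, Finset.mem_insert, Finset.mem_Ico]; omega
        rw [this, Finset.sum_insert (by simp only [Finset.mem_Ico]; omega), add_comm]
      rw [h1]
      refine Prod.ext ?_ ?_
      · funext j
        simp only
        by_cases hj : j = n - M
        · subst hj
          rw [Function.update_self, if_pos (by push_cast; omega)]
        · rw [Function.update_of_ne hj]
          refine if_congr ?_ rfl rfl
          push_cast
          omega
      · simp only
        refine Finset.sum_congr ?_ fun _ _ => rfl
        ext j; simp only [Finset.mem_Icc, Finset.mem_Ico]; push_cast; omega

/-- Bound for the number of steps of `filterTable`. -/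
def filterTime (h F : ℕ) : ℝ := F * ((2 * F * h + h + 1) * 3 + (2 * F * h + 1) * 7)

theorem card_Icc_neg (M : ℕ) : (Finset.Icc (-(M : ℤ)) M).card = 2 * M + 1 := by
  rw [Int.card_Icc]; omega

theorem filterTable_runs (h F : ℕ) :
    Runs v (filterTable h F) (· = filterCoeff h F) (filterTime h F) := by
  have hlen : ((List.range F).length : ℝ) = F := by simp
  refine ((Runs.foldlM_rec (t := (2 * F * h + h + 1) * 3 + (2 * F * h + 1) * 7)
    (fun p g => g = (smooth h)^[p.length] (Pi.single 0 1 : ℤ → ℝ)) rfl ?_).mono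
      (fun g hg => ?_) (le_of_eq ?_))
  · intro p i q hl g hg
    have hpF : p.length < F := by
      have := congrArg List.length hl
      simp at this; omega
    have hgs : SupportedIn (F * h) g := by
      intro j hj
      rw [hg]
      refine (single_supportedIn.iterate (h := h) p.length) j (lt_of_le_of_lt ?_ hj)
      exact_mod_cast (by rw [zero_add]; exact Nat.mul_le_mul_right _ hpF.le)
    have hgs' : SupportedIn (F * h) (smooth h g) := by
      intro j hj
      rw [hg, ← Function.iterate_succ_apply' (smooth h)]
      refine (single_supportedIn.iterate (h := h) (p.length + 1)) j (lt_of_le_of_lt ?_ hj)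
      exact_mod_cast (by rw [zero_add]; exact Nat.mul_le_mul_right _ hpF)
    refine ((Runs.foldlM_eq (t := 3) fun j _ a => Runs.op rfl (by norm_num)).bind fun sums hs =>
      (Runs.tabulate (t := 6) (Q := fun j a => a = smooth h g j) fun j hj =>
        Runs.op ?_ (by norm_num)).imp fun T hT => ?_).le (le_of_eq ?_)
    · rw [Finset.mem_toList, Finset.mem_Icc] at hj
      rw [hs, prefix_foldl]
      simp only
      rw [smooth]
      congr 1
      have hsum : ∑ i ∈ Finset.Icc (-(h : ℤ)) h, g (j + i) = ∑ i ∈ Finset.Icc (j - h) (j + h), g i := by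
        refine Finset.sum_equiv (Equiv.addLeft j) (fun i => ?_) fun i _ => rfl
        simp only [Finset.mem_Icc, Equiv.coe_addLeft]; omega
      have h0 : ∀ i : ℤ, i < -((F * h : ℕ) : ℤ) → g i = 0 := fun i hi =>
        hgs i (by rw [lt_abs]; right; omega)
      rw [hsum, if_pos (by push_cast at hj ⊢; constructor <;> nlinarith)]
      generalize hM : ((F * h : ℕ) : ℤ) = M at *
      -- The index may lie left of the scanned range, where the table has its default value zero.
      -- This agrees with the empty prefix sum.
      have h2 : (if -M ≤ j - h - 1 ∧ j - h - 1 < -M + (2 * F * h + h + 1 : ℕ) then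
          ∑ i ∈ Finset.Icc (-M) (j - h - 1), g i else 0) = ∑ i ∈ Finset.Icc (-M) (j - h - 1), g i := by
        split_ifs with hc
        · rfl
        · rw [Finset.Icc_eq_empty, Finset.sum_empty]
          intro hle
          refine hc ⟨hle, ?_⟩
          push_cast at hM ⊢
          nlinarith
      rw [h2, sub_eq_iff_eq_add]
      by_cases hle : -M ≤ j - h
      · have : Finset.Icc (-M) (j + h) = Finset.Icc (j - h) (j + h) ∪ Finset.Icc (-M) (j - h - 1) := by
          ext i; simp only [Finset.mem_Icc, Finset.mem_union]; omega
        rw [this, Finset.sum_union]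
        rw [Finset.disjoint_left]
        intro i; simp only [Finset.mem_Icc]; omega
      · rw [Finset.Icc_eq_empty (a := -M) (b := j - h - 1) (by omega), Finset.sum_empty, add_zero]
        refine Finset.sum_subset (fun i => by simp only [Finset.mem_Icc]; omega) fun i hi hi' => h0 i ?_
        simp only [Finset.mem_Icc] at hi hi'
        omega
    · funext j
      rw [List.length_append, List.length_singleton, Function.iterate_succ_apply', ← hg]
      by_cases hj : j ∈ (Finset.Icc (-(F * h : ℕ) : ℤ) (F * h : ℕ)).toList
      · exact hT.1 j hj
      · rw [hT.2 j hj]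
        rw [Finset.mem_toList, Finset.mem_Icc, ← abs_le, not_le] at hj
        exact (hgs' j hj).symm
    · rw [Finset.length_toList, card_Icc_neg]
      simp only [List.length_map, List.length_range]
      push_cast; ring
  · rw [hg, List.length_range]; rfl
  · rw [hlen, filterTime]

/-! ### Hashing -/

/-- The value of bucket `s` in the exact measurement of `x` at the point `a`. -/
def hashed (e F : ℕ) (π : Perm d m) (a : Pt d m) (x : Pt d m → ℂ) (s : Pt d e) : ℂ :=
  ∑ l, (filter e F (fun r => π.app l r - gridPt m e (s r)) : ℂ) *
    (x l * root (a ⬝ᵥ π.mat.val.mulVec l))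

/-- The box of integer vectors supporting the filter in frequency domain. -/
def box (d e F : ℕ) : Finset (Fin d → ℤ) :=
  Fintype.piFinset fun _ : Fin d =>
    Finset.Icc (-(F * halfWidth e : ℕ) : ℤ) (F * halfWidth e : ℕ)

theorem card_box (d e F : ℕ) : (box d e F).card = (2 * (F * halfWidth e) + 1) ^ d := by
  rw [box, Fintype.card_piFinset, Finset.prod_congr rfl fun _ _ => card_Icc_neg _]
  simp

theorem sum_box_prod (e F : ℕ) : ∑ i ∈ box d e F, ∏ s, filterCoeff (halfWidth e) F (i s) = 1 := by
  rw [box, ← Finset.prod_univ_sum]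
  simp only [sum_filterCoeff, Finset.prod_const_one]

theorem filter_neg (e F : ℕ) (t : Pt d m) : filter e F (fun s => -t s) = filter e F t := by
  simp only [filter, dirichlet_neg]

theorem sum_box_root (e F : ℕ) (t : Pt d m) :
    ∑ i ∈ box d e F, (∏ s, (filterCoeff (halfWidth e) F (i s) : ℂ)) * root (toPt m i ⬝ᵥ t) =
      filter e F t := by
  have h1 : ∀ i ∈ box d e F, (∏ s, (filterCoeff (halfWidth e) F (i s) : ℂ)) *
      root (toPt m i ⬝ᵥ t) = ∏ s, ((filterCoeff (halfWidth e) F (i s) : ℂ) *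
        root ((i s : ZMod (2 ^ m)) * t s)) := by
    intro i _
    rw [Finset.prod_mul_distrib, dotProduct, root_sum]
    rfl
  rw [Finset.sum_congr rfl h1, box,
    ← Finset.prod_univ_sum (t := fun _ : Fin d => Finset.Icc (-(F * halfWidth e : ℕ) : ℤ)
      (F * halfWidth e : ℕ)) (f := fun s (j : ℤ) => ((filterCoeff (halfWidth e) F j : ℂ) *
        root ((j : ZMod (2 ^ m)) * t s))), filter]
  rw [Complex.ofReal_prod]
  refine Finset.prod_congr rfl fun s _ => ?_
  rw [Complex.ofReal_pow, ← trig_filterCoeff, (filterCoeff_supportedIn (halfWidth e) F).trig_eq]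

/-- Exchange the sums. The character of `[b]^d` at `s` is the character of `[n]^d` at `(n/b) s`, so
the phases combine to the negative of `π(l) - (n/b) s`; the sum over the box is the filter there,
and the filter is even. -/
theorem hashed_eq {e F : ℕ} (he : e ≤ m) (π : Perm d m) (a : Pt d m) (x : Pt d m → ℂ)
    (s : Pt d e) :
    ∑ i ∈ box d e F, root (s ⬝ᵥ toPt e i) * ((∏ r, (filterCoeff (halfWidth e) F (i r) : ℂ)) *
      ((∑ l, x l * root (a ⬝ᵥ π.mat.val.mulVec l) *
        root (-(toPt m i ⬝ᵥ π.mat.val.mulVec l))) * phase π i)) = hashed e F π a x s := by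
  have h1 : ∀ i : Fin d → ℤ, root (s ⬝ᵥ toPt e i) =
      root (toPt m i ⬝ᵥ fun r => gridPt m e (s r)) := by
    intro i
    rw [dotProduct, dotProduct, root_sum, root_sum]
    exact Finset.prod_congr rfl fun r _ => (root_gridPt_mul he (s r) (i r)).symm
  have h2 : ∀ i : Fin d → ℤ, root (s ⬝ᵥ toPt e i) *
      ((∏ r, (filterCoeff (halfWidth e) F (i r) : ℂ)) *
      ((∑ l, x l * root (a ⬝ᵥ π.mat.val.mulVec l) *
        root (-(toPt m i ⬝ᵥ π.mat.val.mulVec l))) * phase π i)) =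
      ∑ l, (x l * root (a ⬝ᵥ π.mat.val.mulVec l)) *
        ((∏ r, (filterCoeff (halfWidth e) F (i r) : ℂ)) *
          root (toPt m i ⬝ᵥ fun r => -(π.app l r - gridPt m e (s r)))) := by
    intro i
    rw [h1, Finset.sum_mul, Finset.mul_sum, Finset.mul_sum]
    refine Finset.sum_congr rfl fun l _ => ?_
    have h3 : (toPt m i ⬝ᵥ fun r => -(π.app l r - gridPt m e (s r))) =
        (toPt m i ⬝ᵥ fun r => gridPt m e (s r)) + -(toPt m i ⬝ᵥ π.mat.val.mulVec l) +
          toPt m i ⬝ᵥ π.mat.val.mulVec π.shift := by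
      have : (fun r => -(π.app l r - gridPt m e (s r))) =
          (fun r => gridPt m e (s r)) - π.mat.val.mulVec l + π.mat.val.mulVec π.shift := by
        funext r
        simp only [Perm.app, Matrix.mulVec_sub, Pi.add_apply, Pi.sub_apply]
        ring
      rw [this, dotProduct_add, dotProduct_sub]
      ring
    rw [h3, root_add, root_add, phase]
    ring
  simp only [h2]
  rw [Finset.sum_comm, hashed]
  refine Finset.sum_congr rfl fun l _ => ?_
  rw [← Finset.mul_sum, sum_box_root, filter_neg, mul_comm]

theorem fold_runs {e F : ℕ} {y : (Fin d → ℤ) → Alg X ℂ} {z₀ : (Fin d → ℤ) → ℂ} {ε t : ℝ}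
    (hy : ∀ i ∈ box d e F, Runs v (y i) (fun z => ‖z - z₀ i‖ ≤ ε) t) :
    Runs v (fold m e F (filterCoeff (halfWidth e) F) y) (fun u => ∀ s : Pt d e,
      ‖u s - Real.sqrt (size d m) * ∑ i ∈ box d e F,
        root (s ⬝ᵥ toPt e i) * ((∏ r, (filterCoeff (halfWidth e) F (i r) : ℂ)) * z₀ i)‖ ≤
          Real.sqrt (size d m) * ε)
      ((2 ^ e) ^ d + ((2 * (F * halfWidth e) + 1) ^ d * (t + (4 * d + 3)) +
        ((e + 1) * (2 ^ e) ^ d * 2 ^ d * (4 * d + 6) + (2 ^ e) ^ d * (d + 3)))) := by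
  set c : (Fin d → ℤ) → ℂ := fun i => ∏ r, (filterCoeff (halfWidth e) F (i r) : ℂ) with hc
  have hcn : ∀ i, ‖c i‖ = ∏ r, filterCoeff (halfWidth e) F (i r) := by
    intro i
    rw [hc]
    simp only
    rw [norm_prod]
    refine Finset.prod_congr rfl fun r _ => ?_
    rw [Complex.norm_real, Real.norm_eq_abs, abs_of_nonneg (filterCoeff_nonneg _ _ _)]
  have hlen : (((box d e F).toList.length : ℕ) : ℝ) = (2 * (F * halfWidth e) + 1) ^ d := by
    rw [Finset.length_toList, card_box]; push_cast; rfl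
  refine (Runs.charge (t := (2 ^ e) ^ d) (by push_cast; rfl)).bind fun _ _ =>
    (Runs.foldlM_rec (t := t + (4 * d + 3)) (l := (box d e F).toList)
      -- The error is controlled against all functionals with coefficients bounded by one, so that
      -- at the end the Fourier kernel can be inserted. The weights `‖c i‖` have sum one, hence no
      -- factor for the size of the box appears.
      (fun p z => ∀ φ : Pt d e → ℂ, (∀ k, ‖φ k‖ ≤ 1) →
      ‖∑ k, φ k * z k - (p.map fun i => φ (toPt e i) * (c i * z₀ i)).sum‖ ≤
        (p.map fun i => ‖c i‖ * ε).sum) (fun φ _ => by simp) ?_).le (le_of_eq (by rw [hlen])) |>.bind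
      fun z hz => (fft_runs 1 e z).bind fun u hu =>
        (Runs.tabulate_univ_eq (t := d + 2) fun s => Runs.op rfl (by push_cast; rfl)).mono
          (fun w hw s => ?_) (le_of_eq ?_)
  · intro p i q hl z hz
    have hi : i ∈ box d e F := by
      rw [← Finset.mem_toList, hl]; simp
    refine (hy i hi).bind fun b hb => Runs.op ?_ (by push_cast; rfl)
    intro φ hφ
    rw [update_add_eq]
    simp only [Pi.add_apply, mul_add, Finset.sum_add_distrib, List.map_append, List.sum_append,
      List.map_cons, List.map_nil, List.sum_cons, List.sum_nil, add_zero]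
    have h1 := sum_mul_sum_single φ {()} (fun _ => toPt e i) (fun _ => c i * b)
    simp only [Finset.sum_singleton] at h1
    change ‖_ + ∑ k, φ k * (Pi.single (toPt e i) (c i * b) : Pt d e → ℂ) k - _‖ ≤ _
    rw [h1, add_sub_add_comm]
    refine (norm_add_le _ _).trans (add_le_add (hz φ hφ) ?_)
    rw [← mul_sub, ← mul_sub, norm_mul, norm_mul]
    calc ‖φ (toPt e i)‖ * (‖c i‖ * ‖b - z₀ i‖) ≤ 1 * (‖c i‖ * ε) := by
          gcongr
          exact hφ _
      _ = ‖c i‖ * ε := one_mul _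
  · have h1 := hz (fun k => root (s ⬝ᵥ k)) (fun k => (norm_root _).le)
    rw [Finset.sum_map_toList, Finset.sum_map_toList, ← Finset.sum_mul] at h1
    simp only [hcn, sum_box_prod, one_mul] at h1
    rw [hw]
    simp only
    rw [hu]
    simp only [Int.cast_one, one_mul]
    rw [← mul_sub, norm_mul, Complex.norm_real, Real.norm_eq_abs, abs_of_nonneg (Real.sqrt_nonneg _)]
    exact mul_le_mul_of_nonneg_left h1 (Real.sqrt_nonneg _)
  · rw [card_Pt]; push_cast; ring

theorem sparse_sum_eq (χ : Pt d m → ℂ) (f : Pt d m → ℂ) :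
    ∑ l ∈ supp χ, χ l * f l = ∑ l, χ l * f l := by
  refine Finset.sum_subset (Finset.subset_univ _) fun l _ hl => ?_
  have : χ l = 0 := by
    by_contra h
    exact hl (by simp [supp, h])
  rw [this, zero_mul]

/-- The `ℓ¹` norm. -/
def l1 (χ : Pt d m → ℂ) : ℝ := ∑ l, ‖χ l‖

theorem l1_zero : l1 (0 : Pt d m → ℂ) = 0 := by simp [l1]

theorem sum_norm_supp (χ : Pt d m → ℂ) : ∑ l ∈ supp χ, ‖χ l‖ = l1 χ := by
  refine Finset.sum_subset (Finset.subset_univ _) fun l _ hl => ?_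
  have : χ l = 0 := by
    by_contra h
    exact hl (by simp [supp, h])
  rw [this, norm_zero]

theorem two_mul_abs_le_of_mem_box {e F : ℕ} {i : Fin d → ℤ} (hi : i ∈ box d e F) (s : Fin d) :
    2 * |i s| ≤ 2 ^ Nat.clog 2 (F * 2 ^ e) := by
  have h1 := Finset.mem_Icc.1 (Fintype.mem_piFinset.1 hi s)
  have h2 := abs_le.2 h1
  have h3 : 2 * (F * halfWidth e) ≤ 2 ^ Nat.clog 2 (F * 2 ^ e) := by
    refine le_trans ?_ (Nat.le_pow_clog (by norm_num) _)
    have : 2 * halfWidth e ≤ 2 ^ e := by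
      unfold halfWidth; generalize 2 ^ e = b; omega
    calc 2 * (F * halfWidth e) = F * (2 * halfWidth e) := by ring
      _ ≤ F * 2 ^ e := Nat.mul_le_mul_left _ this
  have h4 : ((2 * (F * halfWidth e) : ℕ) : ℤ) ≤ 2 ^ Nat.clog 2 (F * 2 ^ e) := by exact_mod_cast h3
  push_cast at h2 h4
  linarith

theorem sparseValues_runs {c e F : ℕ} (hc : 1 ≤ c) (hd : 1 ≤ d)
    (hε : d * (4 * 2 ^ m / 2 ^ (c * (m * d)) : ℝ) ≤ 1) (π : Perm d m) (a : Pt d m)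
    (χ : Pt d m → ℂ) :
    Runs v (sparseValues c e F π a χ) (fun w => ∀ i ∈ box d e F,
      ‖w i - (∑ l, χ l * root (a ⬝ᵥ π.mat.val.mulVec l) *
        root (-(toPt m i ⬝ᵥ π.mat.val.mulVec l))) / (Real.sqrt (size d m) : ℂ)‖ ≤
        l1 χ * semiErr d m c / Real.sqrt (size d m))
      ((supp χ).card * (2 * d ^ 2 + 2 * d + 3) +
        semiTime d (c * (m * d)) (Nat.clog 2 (F * 2 ^ e)) (supp χ).card) := by
  refine ((Runs.collect_eq (t := 2 * d ^ 2 + 2 * d + 2) fun l _ => Runs.op rfl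
    (by push_cast; rfl)).le (le_of_eq ?_)).bind fun y hy =>
    (semiEquispaced_runs c _ hc hd hε y).mono (fun w hw i hi => ?_) (le_of_eq ?_)
  · rw [Finset.length_toList]; ring
  · have h1 := hw i (two_mul_abs_le_of_mem_box hi)
    rw [hy, List.map_map, List.map_map, Finset.sum_map_toList, Finset.sum_map_toList] at h1
    simp only [Function.comp_apply, norm_mul, norm_root, one_mul, sum_norm_supp] at h1
    have h2 : ∑ l ∈ supp χ, root (a ⬝ᵥ π.mat.val.mulVec l) * χ l *
        root (-(toPt m i ⬝ᵥ π.mat.val.mulVec l)) = ∑ l, χ l * root (a ⬝ᵥ π.mat.val.mulVec l) *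
        root (-(toPt m i ⬝ᵥ π.mat.val.mulVec l)) := by
      simp only [mul_assoc]
      rw [← sparse_sum_eq]
      exact Finset.sum_congr rfl fun l _ => by ring
    rwa [h2] at h1
  · rw [hy, List.length_map, Finset.length_toList]

/-- Bound for the number of steps of a measurement, where `len` is the number of nonzero entries of
the known sparse vector. -/
def hashTime (d m c e F : ℕ) (len : ℝ) : ℝ :=
  len * (2 * d ^ 2 + 2 * d + 3) + semiTime d (c * (m * d)) (Nat.clog 2 (F * 2 ^ e)) len +
    ((2 ^ e) ^ d + ((2 * (F * halfWidth e) + 1) ^ d * (4 * d ^ 2 + 5 * d + 4 + (4 * d + 3)) +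
        ((e + 1) * (2 ^ e) ^ d * 2 ^ d * (4 * d + 6) + (2 ^ e) ^ d * (d + 3))))

theorem norm_phase (π : Perm d m) (i : Fin d → ℤ) : ‖phase π i‖ = 1 := norm_root _

theorem sqrt_mul_hashed {e F : ℕ} (he : e ≤ m) (π : Perm d m) (a : Pt d m) (x : Pt d m → ℂ)
    (s : Pt d e) :
    (Real.sqrt (size d m) : ℂ) * ∑ i ∈ box d e F,
      root (s ⬝ᵥ toPt e i) * ((∏ r, (filterCoeff (halfWidth e) F (i r) : ℂ)) *
      ((∑ l, x l * root (a ⬝ᵥ π.mat.val.mulVec l) *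
        root (-(toPt m i ⬝ᵥ π.mat.val.mulVec l))) / (Real.sqrt (size d m) : ℂ) * phase π i)) =
      hashed e F π a x s := by
  have hN : 0 < Real.sqrt (size d m) := Real.sqrt_pos.2 (size_pos d m)
  have hNc : (Real.sqrt (size d m) : ℂ) ≠ 0 := by exact_mod_cast hN.ne'
  rw [← hashed_eq he, Finset.mul_sum]
  refine Finset.sum_congr rfl fun i _ => ?_
  field_simp

theorem hashSparse_runs {c e F : ℕ} (hc : 1 ≤ c) (hd : 1 ≤ d) (he : e ≤ m)
    (hε : d * (4 * 2 ^ m / 2 ^ (c * (m * d)) : ℝ) ≤ 1) (χ : Pt d m → ℂ) (π : Perm d m)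
    (a : Pt d m) :
    Runs v (hashSparse c e F (filterCoeff (halfWidth e) F) χ π a)
      (fun u => ∀ s : Pt d e, ‖u s - hashed e F π a χ s‖ ≤ l1 χ * semiErr d m c)
      (hashTime d m c e F (supp χ).card) := by
  have hN : 0 < Real.sqrt (size d m) := Real.sqrt_pos.2 (size_pos d m)
  refine (sparseValues_runs hc hd hε π a χ).bind fun w hw =>
    (fold_runs (t := 4 * d ^ 2 + 5 * d + 4) (ε := l1 χ * semiErr d m c / Real.sqrt (size d m))
      (z₀ := fun i => (∑ l, χ l * root (a ⬝ᵥ π.mat.val.mulVec l) *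
        root (-(toPt m i ⬝ᵥ π.mat.val.mulVec l))) / (Real.sqrt (size d m) : ℂ) * phase π i)
      (fun i hi => Runs.op ?_ ?_)).imp fun u hu s => ?_
  · rw [← sub_mul, norm_mul, norm_phase, mul_one]; exact hw i hi
  · push_cast
    have : (0 : ℝ) ≤ d ^ 2 := by positivity
    have : (0 : ℝ) ≤ d := by positivity
    linarith
  · have h1 := hu s
    rw [sqrt_mul_hashed he] at h1
    rwa [mul_div_cancel₀ _ hN.ne'] at h1

/-- Duality: a transposed matrix acting on frequencies is the matrix acting on locations. -/
theorem dft_transpose_mulVec (x : Pt d m → ℂ) (A : Matrix (Fin d) (Fin d) (ZMod (2 ^ m)))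
    (i a : Pt d m) :
    dft x (A.transpose.mulVec (i - a)) =
      (∑ l, x l * root (a ⬝ᵥ A.mulVec l) * root (-(i ⬝ᵥ A.mulVec l))) /
        (Real.sqrt (size d m) : ℂ) := by
  rw [dft, one_div, inv_mul_eq_div]
  congr 1
  refine Finset.sum_congr rfl fun l _ => ?_
  have h1 : l ⬝ᵥ A.transpose.mulVec (i - a) = i ⬝ᵥ A.mulVec l - a ⬝ᵥ A.mulVec l := by
    rw [← sub_dotProduct, Matrix.mulVec_transpose, dotProduct_comm, Matrix.dotProduct_mulVec]
  rw [h1, neg_sub, sub_eq_add_neg, root_add]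
  ring

theorem hashed_sub (e F : ℕ) (π : Perm d m) (a : Pt d m) (x χ : Pt d m → ℂ) (s : Pt d e) :
    hashed e F π a (x - χ) s = hashed e F π a x s - hashed e F π a χ s := by
  simp only [hashed, ← Finset.sum_sub_distrib, Pi.sub_apply]
  exact Finset.sum_congr rfl fun l _ => by ring

theorem hashToBins_runs {c e F : ℕ} (hc : 1 ≤ c) (hd : 1 ≤ d) (he : e ≤ m)
    (hε : d * (4 * 2 ^ m / 2 ^ (c * (m * d)) : ℝ) ≤ 1) (x χ : Pt d m → ℂ) (π : Perm d m)
    (a : Pt d m) :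
    Runs (dft x) (hashToBins c e F (filterCoeff (halfWidth e) F) χ π a)
      (fun u => ∀ s : Pt d e, ‖u s - hashed e F π a (x - χ) s‖ ≤ l1 χ * semiErr d m c)
      (hashTime d m c e F (supp χ).card) := by
  have hN : 0 < Real.sqrt (size d m) := Real.sqrt_pos.2 (size_pos d m)
  refine (sparseValues_runs hc hd hε π a χ).bind fun w hw =>
    (fold_runs (t := 4 * d ^ 2 + 5 * d + 4) (ε := l1 χ * semiErr d m c / Real.sqrt (size d m))
      (z₀ := fun i => (∑ l, (x - χ) l * root (a ⬝ᵥ π.mat.val.mulVec l) *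
        root (-(toPt m i ⬝ᵥ π.mat.val.mulVec l))) / (Real.sqrt (size d m) : ℂ) * phase π i)
      (fun i hi => ((Runs.op (Q := fun j => j = π.mat.val.transpose.mulVec (toPt m i - a)) rfl
        (le_refl _)).bind fun j hj =>
        (Runs.sample (Q := fun b => b = dft x j) rfl le_rfl).bind fun b hb =>
          Runs.op ?_ (le_refl _)).le ?_)).imp fun u hu s => ?_
  · rw [← sub_mul, norm_mul, norm_phase, mul_one]
    refine le_trans (le_of_eq ?_) (hw i hi)
    rw [hb, hj, dft_transpose_mulVec, ← norm_neg, sub_sub, neg_sub, add_sub_right_comm]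
    have h2 : (∑ l, (x - χ) l * root (a ⬝ᵥ π.mat.val.mulVec l) *
        root (-(toPt m i ⬝ᵥ π.mat.val.mulVec l))) =
        (∑ l, x l * root (a ⬝ᵥ π.mat.val.mulVec l) *
        root (-(toPt m i ⬝ᵥ π.mat.val.mulVec l))) - (∑ l, χ l * root (a ⬝ᵥ π.mat.val.mulVec l) *
        root (-(toPt m i ⬝ᵥ π.mat.val.mulVec l))) := by
      rw [← Finset.sum_sub_distrib]
      refine Finset.sum_congr rfl fun l _ => ?_
      simp only [Pi.sub_apply]; ring
    rw [h2, sub_div]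
    congr 1
    ring
  · push_cast
    have : (0 : ℝ) ≤ d ^ 2 := by positivity
    have : (0 : ℝ) ≤ d := by positivity
    linarith
  · have h1 := hu s
    rw [sqrt_mul_hashed he] at h1
    rwa [mul_div_cancel₀ _ hN.ne'] at h1

end

section

variable {X : Type} {d m : ℕ} {v : X → ℂ}

/-! ### Averages over finite types -/

/-- The average of a function over a finite type. -/
def avg {Ω : Type*} [Fintype Ω] (f : Ω → ℝ) : ℝ := (∑ w, f w) / Fintype.card Ω

section Avg

variable {Ω Ω' : Type*} [Fintype Ω] [Fintype Ω']

theorem avg_mono {f g : Ω → ℝ} (h : ∀ w, f w ≤ g w) : avg f ≤ avg g :=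
  div_le_div_of_nonneg_right (Finset.sum_le_sum fun w _ => h w) (Nat.cast_nonneg _)

theorem avg_nonneg {f : Ω → ℝ} (h : ∀ w, 0 ≤ f w) : 0 ≤ avg f :=
  div_nonneg (Finset.sum_nonneg fun w _ => h w) (Nat.cast_nonneg _)

theorem avg_const [Nonempty Ω] (c : ℝ) : avg (fun _ : Ω => c) = c := by
  have : (Fintype.card Ω : ℝ) ≠ 0 := Nat.cast_ne_zero.2 Fintype.card_ne_zero
  rw [avg, Finset.sum_const, nsmul_eq_mul, Finset.card_univ]
  field_simp

theorem avg_le_const [Nonempty Ω] {f : Ω → ℝ} {c : ℝ} (h : ∀ w, f w ≤ c) : avg f ≤ c :=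
  (avg_mono h).trans (avg_const c).le

theorem avg_const_mul (c : ℝ) (f : Ω → ℝ) : avg (fun w => c * f w) = c * avg f := by
  rw [avg, ← Finset.mul_sum, mul_div_assoc, avg]

theorem avg_add (f g : Ω → ℝ) : avg (fun w => f w + g w) = avg f + avg g := by
  rw [avg, Finset.sum_add_distrib, add_div, avg, avg]

theorem avg_sum {ι : Type*} (s : Finset ι) (f : ι → Ω → ℝ) :
    avg (fun w => ∑ i ∈ s, f i w) = ∑ i ∈ s, avg (f i) := by
  simp only [avg]
  rw [Finset.sum_comm, Finset.sum_div]

theorem avg_comm (f : Ω → Ω' → ℝ) :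
    avg (fun w => avg (f w)) = avg (fun w' => avg fun w => f w w') := by
  simp only [avg]
  rw [← Finset.sum_div, ← Finset.sum_div, Finset.sum_comm, div_div, div_div, mul_comm]

theorem avg_equiv (e : Ω ≃ Ω') (f : Ω' → ℝ) : avg (fun w => f (e w)) = avg f := by
  rw [avg, Equiv.sum_comp e f, Fintype.card_congr e, avg]

theorem avg_prod (f : Ω × Ω' → ℝ) : avg f = avg fun w => avg fun w' => f (w, w') := by
  simp only [avg]
  rw [Fintype.sum_prod_type, ← Finset.sum_div, div_div, Fintype.card_prod, Nat.cast_mul, mul_comm]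

end Avg

theorem ev_uniform {Ω : Type} [Fintype Ω] [Nonempty Ω] (φ : Ω → ℕ → ℝ) :
    ev v (uniform Ω) φ = avg fun w => φ w 1 := rfl

/-! ### Random invertible matrices -/

theorem natAbs_valMinAbs_intCast_le (k : ℤ) :
    (k : ZMod (2 ^ m)).valMinAbs.natAbs ≤ k.natAbs := by
  refine ZMod.natAbs_min_of_le_div_two (2 ^ m) _ _ ?_ (ZMod.natAbs_valMinAbs_le _)
  rw [ZMod.coe_valMinAbs]

theorem isUnit_natCast_of_odd {k : ℕ} (hk : Odd k) : IsUnit (k : ZMod (2 ^ m)) := by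
  rw [ZMod.isUnit_iff_coprime]
  exact (Nat.coprime_two_right.2 hk).pow_right m

/-- For two vectors with an odd entry at the same place there is an invertible matrix mapping one to
the other. -/
theorem exists_GL_mulVec_eq (s : Fin d) (u w : Fin d → ℕ) (hu : Odd (u s)) (hw : Odd (w s)) :
    ∃ A : GL (Fin d) (ZMod (2 ^ m)), A.val.mulVec (fun r => (u r : ZMod (2 ^ m))) =
      fun r => (w r : ZMod (2 ^ m)) := by
  -- The identity matrix with column `s` replaced by `u` has determinant `u s`, a unit. It maps the
  -- basis vector `s` to `u`, and composing one such matrix with the inverse of another joins two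
  -- vectors.
  have key : ∀ u : Fin d → ℕ, Odd (u s) → ∃ M : GL (Fin d) (ZMod (2 ^ m)),
      M.val.mulVec (Pi.single s 1) = fun r => (u r : ZMod (2 ^ m)) := by
    intro u hu
    set M : Matrix (Fin d) (Fin d) (ZMod (2 ^ m)) :=
      (1 : Matrix (Fin d) (Fin d) (ZMod (2 ^ m))).updateCol s (fun r => (u r : ZMod (2 ^ m))) with hM
    have hdet : M.det = (u s : ZMod (2 ^ m)) := by
      rw [hM, ← Matrix.cramer_apply, Matrix.cramer_one]; rfl
    refine ⟨Matrix.GeneralLinearGroup.mk'' M (by rw [hdet]; exact isUnit_natCast_of_odd hu), ?_⟩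
    change M.mulVec _ = _
    rw [Matrix.mulVec_single_one, hM]
    funext r
    simp [Matrix.col]
  obtain ⟨M, hM⟩ := key u hu
  obtain ⟨M', hM'⟩ := key w hw
  refine ⟨M' * M⁻¹, ?_⟩
  have h1 : (M' * M⁻¹).val = M'.val * (M⁻¹).val := rfl
  rw [h1, ← hM]
  have h2 : (M⁻¹).val * M.val = 1 := by
    rw [← Units.val_mul, inv_mul_cancel]; rfl
  rw [Matrix.mulVec_mulVec, Matrix.mul_assoc, h2, Matrix.mul_one, hM']

theorem GL_mulVec_injective (A : GL (Fin d) (ZMod (2 ^ m))) : Function.Injective A.val.mulVec := by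
  intro u w h
  have h1 := congrArg (A⁻¹).val.mulVec h
  have h2 : (A⁻¹).val * A.val = 1 := by rw [← Units.val_mul, inv_mul_cancel]; rfl
  simpa [Matrix.mulVec_mulVec, h2] using h1

/-- A nonzero vector is a power of two times a vector with an odd entry. -/
theorem exists_odd_part {v : Pt d m} (hv : v ≠ 0) : ∃ (σ : ℕ) (s : Fin d) (w : Fin d → ℕ),
    σ < m ∧ Odd (w s) ∧ ∀ r, v r = ((2 ^ σ * w r : ℕ) : ZMod (2 ^ m)) := by
  classical
  have hex : ∃ σ, ¬ ∀ r, 2 ^ (σ + 1) ∣ (v r).val := by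
    obtain ⟨r, hr⟩ := Function.ne_iff.1 hv
    refine ⟨m, fun h => hr ?_⟩
    have h1 := Nat.eq_zero_of_dvd_of_lt (h r)
      ((ZMod.val_lt (v r)).trans (Nat.pow_lt_pow_right (by norm_num) (by omega)))
    exact (ZMod.val_eq_zero _).1 h1
  have hdvd : ∀ r, 2 ^ Nat.find hex ∣ (v r).val := by
    intro r
    rcases h : Nat.find hex with _ | q
    · simp
    · have := Nat.find_min hex (m := q) (by omega)
      push Not at this
      exact this r
  obtain ⟨s, hs⟩ := not_forall.1 (Nat.find_spec hex)
  refine ⟨Nat.find hex, s, fun r => (v r).val / 2 ^ Nat.find hex, ?_, ?_, fun r => ?_⟩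
  · by_contra hcon
    have h0 : (v s).val = 0 := Nat.eq_zero_of_dvd_of_lt (hdvd s) ((ZMod.val_lt _).trans_le
      (Nat.pow_le_pow_right (by norm_num) (by omega)))
    exact hs (by rw [h0]; exact dvd_zero _)
  · rw [← Nat.not_even_iff_odd, even_iff_two_dvd]
    intro h
    apply hs
    rw [pow_succ]
    exact (Nat.dvd_div_iff_mul_dvd (hdvd s)).1 h
  · rw [Nat.mul_div_cancel' (hdvd r), ZMod.natCast_zmod_val]

/-- Write `v = 2^σ w` with an odd entry of `w` at `s₀`. All fibres of `A ↦ A v` have the same size,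
so `A v` is uniform on its orbit. The orbit consists of multiples of `2^σ` and contains all `2^σ u`
with `u s₀` odd, thus at least half of these multiples; this gives the factor 2. A box of radius `t
≥ 2^σ` contains at most `(2 ⌊t/2^σ⌋ + 1)^d ≤ (3t/2^σ)^d` of them; for smaller `t` it contains only
zero, which is not in the orbit. -/
theorem card_small_mul_le {v : Pt d m} (hv : v ≠ 0) (t : ℕ) :
    (Finset.univ.filter fun A : GL (Fin d) (ZMod (2 ^ m)) =>
      ∀ s, (A.val.mulVec v s).valMinAbs.natAbs ≤ t).card * (2 ^ m) ^ d ≤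
      2 * (3 * t) ^ d * Fintype.card (GL (Fin d) (ZMod (2 ^ m))) := by
  obtain ⟨σ, s₀, w, hσ, hodd, hw⟩ := exists_odd_part hv
  set Φ : GL (Fin d) (ZMod (2 ^ m)) → Pt d m := fun A => A.val.mulVec v with hΦ
  set c := (Finset.univ.filter fun A => Φ A = v).card with hc
  have hfib : ∀ u ∈ Finset.univ.image Φ, (Finset.univ.filter fun A => Φ A = u).card = c := by
    intro u hu
    obtain ⟨A₀, -, rfl⟩ := Finset.mem_image.1 hu
    rw [hc]
    refine Finset.card_bij (fun A _ => A₀⁻¹ * A) ?_ ?_ ?_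
    · intro A hA
      have h1 := (Finset.mem_filter.1 hA).2
      refine Finset.mem_filter.2 ⟨Finset.mem_univ _, GL_mulVec_injective A₀ ?_⟩
      simp only [hΦ] at h1 ⊢
      rw [Matrix.mulVec_mulVec, ← Units.val_mul, mul_inv_cancel_left, h1]
    · intro A _ B _ h; exact mul_left_cancel h
    · intro B hB
      have h1 := (Finset.mem_filter.1 hB).2
      refine ⟨A₀ * B, Finset.mem_filter.2 ⟨Finset.mem_univ _, ?_⟩, by simp⟩
      simp only [hΦ] at h1 ⊢
      rw [Units.val_mul, ← Matrix.mulVec_mulVec, h1]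
  have hcard : Fintype.card (GL (Fin d) (ZMod (2 ^ m))) = (Finset.univ.image Φ).card * c := by
    rw [← Finset.card_univ, Finset.card_eq_sum_card_image Φ Finset.univ, Finset.sum_congr rfl hfib,
      Finset.sum_const, smul_eq_mul]
  have hsmall : (Finset.univ.filter fun A => ∀ s, (Φ A s).valMinAbs.natAbs ≤ t).card =
      ((Finset.univ.image Φ).filter fun u => ∀ s, (u s).valMinAbs.natAbs ≤ t).card * c := by
    rw [Finset.card_eq_sum_card_fiberwise (f := Φ)
      (t := (Finset.univ.image Φ).filter fun u => ∀ s, (u s).valMinAbs.natAbs ≤ t)]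
    · rw [Finset.sum_congr rfl (g := fun _ => c), Finset.sum_const, smul_eq_mul]
      intro u hu
      rw [← hfib u (Finset.mem_filter.1 hu).1]
      congr 1
      ext A
      simp only [Finset.mem_filter, Finset.mem_univ, true_and, and_iff_right_iff_imp]
      rintro rfl
      exact (Finset.mem_filter.1 hu).2
    · intro A hA
      simp only [Finset.coe_filter, Finset.mem_univ, true_and, Set.mem_ofPred_eq] at hA
      simp only [Finset.coe_filter, Set.mem_ofPred_eq]
      exact ⟨Finset.mem_image_of_mem _ (Finset.mem_univ _), hA⟩
  have hpow : 2 ^ m = 2 ^ σ * 2 ^ (m - σ) := by rw [← pow_add]; congr 1; omega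
  have hΦd : ∀ A r, ∃ y : ℤ, Φ A r = ((2 ^ σ * y : ℤ) : ZMod (2 ^ m)) := by
    intro A r
    refine ⟨((A.val.mulVec fun r => (w r : ZMod (2 ^ m))) r).val, ?_⟩
    have : v = (2 ^ σ : ZMod (2 ^ m)) • fun r => (w r : ZMod (2 ^ m)) := by
      funext r; rw [hw r]; push_cast; simp
    simp only [hΦ]
    rw [this, Matrix.mulVec_smul, Pi.smul_apply, smul_eq_mul]
    push_cast
    rw [ZMod.natCast_zmod_val]
  have hdvd : ∀ u ∈ Finset.univ.image Φ, ∀ r, (2 ^ σ : ℤ) ∣ (u r).valMinAbs := by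
    intro u hu r
    obtain ⟨A, -, rfl⟩ := Finset.mem_image.1 hu
    obtain ⟨y, hy⟩ := hΦd A r
    have h1 : (((Φ A r).valMinAbs - 2 ^ σ * y : ℤ) : ZMod (2 ^ m)) = 0 := by
      rw [Int.cast_sub, ZMod.coe_valMinAbs, hy, sub_self]
    rw [ZMod.intCast_zmod_eq_zero_iff_dvd] at h1
    have h2 : (2 ^ σ : ℤ) ∣ ((2 ^ m : ℕ) : ℤ) := by push_cast; exact pow_dvd_pow _ hσ.le
    have h3 := (h2.trans h1).add (Dvd.intro y rfl : (2 ^ σ : ℤ) ∣ 2 ^ σ * y)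
    simpa using h3
  have hlow : (2 ^ (m - σ)) ^ d ≤ (Finset.univ.image Φ).card * 2 := by
    -- Coordinate `s₀` is replaced by the odd number among `2q` and `2q + 1`. The parity lost in
    -- this way is kept in a factor `Fin 2`, which restores injectivity.
    set w' : (Fin d → Fin (2 ^ (m - σ))) → Fin d → ℕ := fun u =>
      Function.update (fun r => (u r).val) s₀ (2 * ((u s₀).val / 2) + 1) with hw'
    have h2m : 2 ^ (m - σ) = 2 * 2 ^ (m - σ - 1) := by rw [← pow_succ']; congr 1; omega
    have hlt : ∀ u r, w' u r < 2 ^ (m - σ) := by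
      intro u r
      by_cases hr : r = s₀
      · subst hr
        simp only [hw', Function.update_self]
        have := (u r).isLt
        omega
      · simp only [hw', Function.update_of_ne hr]
        exact (u r).isLt
    have := Finset.card_le_card_of_injOn
      (s := (Finset.univ : Finset (Fin d → Fin (2 ^ (m - σ)))))
      (t := (Finset.univ.image Φ) ×ˢ (Finset.univ : Finset (Fin 2)))
      (fun u => ((fun r => ((2 ^ σ * w' u r : ℕ) : ZMod (2 ^ m))),
        ⟨(u s₀).val % 2, Nat.mod_lt _ (by norm_num)⟩)) ?_ ?_
    · simpa [Finset.card_product] using this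
    · intro u _
      simp only [Finset.coe_product, Set.mem_prod, Finset.mem_coe, Finset.mem_univ, and_true,
        Finset.mem_image, true_and]
      obtain ⟨A, hA⟩ := exists_GL_mulVec_eq (m := m) s₀ w (w' u) hodd
        (by simp [hw'])
      refine ⟨A, ?_⟩
      have : v = (2 ^ σ : ZMod (2 ^ m)) • fun r => (w r : ZMod (2 ^ m)) := by
        funext r; rw [hw r]; push_cast; simp
      simp only [hΦ]
      rw [this, Matrix.mulVec_smul, hA]
      funext r
      simp
    · intro u _ u' _ h
      simp only [Prod.mk.injEq, Fin.mk.injEq] at h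
      obtain ⟨h1, h2⟩ := h
      have h3 : ∀ r, w' u r = w' u' r := by
        intro r
        have h4 := congrFun h1 r
        rw [ZMod.natCast_eq_natCast_iff', Nat.mod_eq_of_lt, Nat.mod_eq_of_lt] at h4
        · exact Nat.eq_of_mul_eq_mul_left (by positivity) h4
        · rw [hpow]; exact Nat.mul_lt_mul_of_pos_left (hlt _ _) (by positivity)
        · rw [hpow]; exact Nat.mul_lt_mul_of_pos_left (hlt _ _) (by positivity)
      funext r
      have h5 := h3 r
      by_cases hr : r = s₀
      · subst hr
        simp only [hw', Function.update_self] at h5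
        exact Fin.ext (by omega)
      · simp only [hw', Function.update_of_ne hr] at h5
        exact Fin.ext h5
  have hup : ((Finset.univ.image Φ).filter fun u => ∀ s, (u s).valMinAbs.natAbs ≤ t).card *
      (2 ^ σ) ^ d ≤ (3 * t) ^ d := by
    by_cases ht : t < 2 ^ σ
    · rw [Finset.filter_eq_empty_iff.2, Finset.card_empty, zero_mul]
      · exact Nat.zero_le _
      · intro u hu hsm
        have h0 : u = 0 := by
          funext r
          have h1 := hdvd u hu r
          have h2 := Int.eq_zero_of_abs_lt_dvd h1 (by
            have := hsm r
            rw [Int.abs_eq_natAbs]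
            exact_mod_cast this.trans_lt ht)
          exact (ZMod.valMinAbs_eq_zero _).1 h2
        obtain ⟨A, -, rfl⟩ := Finset.mem_image.1 hu
        exact hv (GL_mulVec_injective A (by rw [Matrix.mulVec_zero]; exact h0))
    · push Not at ht
      set q := t / 2 ^ σ with hq
      have hq1 : 1 ≤ q := (Nat.one_le_div_iff (by positivity)).2 ht
      have h1 : ((Finset.univ.image Φ).filter fun u => ∀ s, (u s).valMinAbs.natAbs ≤ t).card ≤
          (2 * q + 1) ^ d := by
        refine (Finset.card_le_card_of_injOn (fun u r => (u r).valMinAbs / 2 ^ σ)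
          (t := Fintype.piFinset fun _ : Fin d => Finset.Icc (-(q : ℤ)) q) ?_ ?_).trans ?_
        · intro u hu
          obtain ⟨hu1, hu2⟩ := Finset.mem_filter.1 hu
          simp only [Finset.mem_coe, Fintype.mem_piFinset, Finset.mem_Icc]
          intro r
          rw [← abs_le]
          obtain ⟨y, hy⟩ := hdvd u hu1 r
          rw [hy, Int.mul_ediv_cancel_left _ (by positivity), Int.abs_eq_natAbs]
          have h3 := hu2 r
          rw [hy, Int.natAbs_mul, Int.natAbs_pow] at h3
          have : y.natAbs ≤ q := by
            rw [hq, Nat.le_div_iff_mul_le (by positivity), mul_comm]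
            exact h3
          exact_mod_cast this
        · intro u hu u' hu' h
          obtain ⟨hu1, -⟩ := Finset.mem_filter.1 hu
          obtain ⟨hu1', -⟩ := Finset.mem_filter.1 hu'
          funext r
          have h3 := congrFun h r
          simp only at h3
          apply ZMod.injective_valMinAbs
          rw [← Int.ediv_mul_cancel (hdvd u hu1 r), h3, Int.ediv_mul_cancel (hdvd u' hu1' r)]
        · rw [Fintype.card_piFinset, Finset.prod_congr rfl fun _ _ => card_Icc_neg q]
          simp
      calc _ ≤ (2 * q + 1) ^ d * (2 ^ σ) ^ d := Nat.mul_le_mul_right _ h1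
        _ = ((2 * q + 1) * 2 ^ σ) ^ d := (mul_pow _ _ _).symm
        _ ≤ (3 * t) ^ d := by
            refine Nat.pow_le_pow_left ?_ d
            have h4 : q * 2 ^ σ ≤ t := Nat.div_mul_le_self _ _
            nlinarith [Nat.one_le_two_pow (n := σ)]
  change (Finset.univ.filter fun A => ∀ s, (Φ A s).valMinAbs.natAbs ≤ t).card * _ ≤ _
  have hpd : (2 ^ m) ^ d = (2 ^ σ) ^ d * (2 ^ (m - σ)) ^ d := by rw [hpow, mul_pow]
  rw [hsmall, hcard, hpd]
  set a := ((Finset.univ.image Φ).filter fun u => ∀ s, (u s).valMinAbs.natAbs ≤ t).card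
  set b := (Finset.univ.image Φ).card
  calc a * c * ((2 ^ σ) ^ d * (2 ^ (m - σ)) ^ d) = (a * (2 ^ σ) ^ d) * (2 ^ (m - σ)) ^ d * c := by ring
    _ ≤ (3 * t) ^ d * (b * 2) * c :=
        Nat.mul_le_mul_right _ (Nat.mul_le_mul hup hlow)
    _ = 2 * (3 * t) ^ d * (b * c) := by ring

/-! ### The filter at random points -/

theorem filter_nonneg (e d : ℕ) (t : Pt d m) : 0 ≤ filter e (2 * d) t :=
  Finset.prod_nonneg fun s _ => by rw [pow_mul]; positivity

theorem filter_le_one (e d : ℕ) (t : Pt d m) : filter e (2 * d) t ≤ 1 := by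
  refine Finset.prod_le_one (fun s _ => by rw [pow_mul]; positivity) fun s _ => ?_
  rw [← abs_of_nonneg (by rw [pow_mul]; positivity : 0 ≤ dirichlet (halfWidth e) (t s) ^ (2 * d)), abs_pow]
  exact pow_le_one₀ (abs_nonneg _) (abs_dirichlet_le_one _ _)

theorem two_mul_halfWidth (e : ℕ) (he : 1 ≤ e) : 2 * halfWidth e + 1 = 2 ^ e - 1 := by
  obtain ⟨q, rfl⟩ : ∃ q, e = q + 1 := ⟨e - 1, by omega⟩
  have := Nat.one_le_two_pow (n := q)
  rw [halfWidth, pow_succ]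
  omega

/-- Dyadic decomposition. Let `l` be least such that all coordinates of `w` are at most `2^l n/b`.
If `l > 0`, some coordinate exceeds `2^(l-1) n/b`; the offset, at most `n/(2b)`, at most halves it,
so the kernel is at most `4/2^l` there and its power `2d` is `16^d / 4^(l d)`. -/
theorem filter_add_le {e : ℕ} (he1 : 1 ≤ e) (he : e ≤ m) (o w : Pt d m)
    (ho : ∀ s, 2 * (o s).valMinAbs.natAbs ≤ 2 ^ (m - e)) :
    filter e (2 * d) (fun s => w s + o s) ≤
      ∑ l ∈ Finset.range (e + 1), if ∀ s, (w s).valMinAbs.natAbs ≤ 2 ^ l * 2 ^ (m - e) then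
        (16 : ℝ) ^ d / (4 ^ l) ^ d else 0 := by
  have hpow : 2 ^ e * 2 ^ (m - e) = 2 ^ m := by rw [← pow_add]; congr 1; omega
  have hex : ∃ l, ∀ s, (w s).valMinAbs.natAbs ≤ 2 ^ l * 2 ^ (m - e) := ⟨e, fun s => by
    rw [hpow]
    exact (ZMod.natAbs_valMinAbs_le _).trans (Nat.div_le_self _ _)⟩
  set l := Nat.find hex with hl
  have hle : l ≤ e := Nat.find_min' hex fun s => by
    rw [hpow]
    exact (ZMod.natAbs_valMinAbs_le _).trans (Nat.div_le_self _ _)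
  have hterm := Finset.single_le_sum (s := Finset.range (e + 1))
    (f := fun l => if ∀ s, (w s).valMinAbs.natAbs ≤ 2 ^ l * 2 ^ (m - e) then
        (16 : ℝ) ^ d / (4 ^ l) ^ d else 0) (fun l _ => by
          split_ifs <;> positivity) (Finset.mem_range.2 (by omega : l < e + 1))
  refine le_trans ?_ hterm
  rw [if_pos (Nat.find_spec hex)]
  rcases Nat.eq_zero_or_pos l with h0 | hpos
  · rw [h0, pow_zero, one_pow, div_one]
    exact (filter_le_one _ _ _).trans (one_le_pow₀ (by norm_num))
  · have hnot := Nat.find_min hex (m := l - 1) (by omega)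
    push Not at hnot
    obtain ⟨s, hs⟩ := hnot
    set g := 2 ^ (m - e) with hg
    have hg0 : 0 < g := by positivity
    have h2l : 2 ^ l = 2 * 2 ^ (l - 1) := by rw [← pow_succ']; congr 1; omega
    set W := (w s).valMinAbs.natAbs with hW
    set Y := (w s + o s).valMinAbs.natAbs with hY
    have hYW : W ≤ 2 * Y := by
      have h1 : (w s + o s - o s).valMinAbs.natAbs ≤ Y + (o s).valMinAbs.natAbs := by
        have h3 := natAbs_valMinAbs_intCast_le (m := m) ((w s + o s).valMinAbs - (o s).valMinAbs)
        rw [Int.cast_sub, ZMod.coe_valMinAbs, ZMod.coe_valMinAbs] at h3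
        exact h3.trans (Int.natAbs_sub_le _ _)
      rw [add_sub_cancel_right] at h1
      have h4 := ho s
      have h5 : g ≤ 2 ^ (l - 1) * g := Nat.le_mul_of_pos_left _ (by positivity)
      omega
    have hWpos : 0 < W := lt_of_le_of_lt (Nat.zero_le _) hs
    have hY0 : w s + o s ≠ 0 := by
      intro h
      rw [hY, h] at hYW
      simp at hYW
      omega
    have hD : |dirichlet (halfWidth e) (w s + o s)| ≤ 4 / 2 ^ l := by
      refine (abs_dirichlet_le _ _ hY0).trans ?_
      have hk : ((Y : ℕ) : ℝ) = |((w s + o s).valMinAbs : ℝ)| := by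
        rw [hY, Nat.cast_natAbs, Int.cast_abs]
      rw [← hk]
      have hYpos : 0 < Y := by omega
      rw [div_le_div_iff₀ (by positivity) (by positivity)]
      have h6 : 2 ^ m * 2 ^ l ≤ 4 * ((2 * halfWidth e + 1) * (2 * Y)) := by
        rw [two_mul_halfWidth e he1]
        have h7 : 2 ^ e ≤ 2 * (2 ^ e - 1) := by
          have : 2 ^ e = 2 * 2 ^ (e - 1) := by rw [← pow_succ']; congr 1; omega
          have := Nat.one_le_two_pow (n := e - 1)
          omega
        calc 2 ^ m * 2 ^ l = 2 ^ e * (2 * (2 ^ (l - 1) * g)) := by rw [← hpow, h2l]; ring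
          _ ≤ (2 * (2 ^ e - 1)) * (2 * (2 * Y)) :=
              Nat.mul_le_mul h7 (Nat.mul_le_mul_left _ (hs.le.trans hYW))
          _ = 4 * ((2 ^ e - 1) * (2 * Y)) := by ring
      exact_mod_cast h6
    calc filter e (2 * d) (fun s => w s + o s)
        ≤ ∏ r : Fin d, if r = s then ((4 : ℝ) / 2 ^ l) ^ (2 * d) else 1 := by
          refine Finset.prod_le_prod (fun r _ => by rw [pow_mul]; positivity) fun r _ => ?_
          rw [← abs_of_nonneg (by rw [pow_mul]; positivity :
            0 ≤ dirichlet (halfWidth e) (w r + o r) ^ (2 * d)), abs_pow]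
          split_ifs with hr
          · subst hr; exact pow_le_pow_left₀ (abs_nonneg _) hD _
          · exact pow_le_one₀ (abs_nonneg _) (abs_dirichlet_le_one _ _)
      _ = (16 : ℝ) ^ d / (4 ^ l) ^ d := by
          rw [Finset.prod_ite_eq' Finset.univ s, if_pos (Finset.mem_univ _), pow_mul, ← div_pow,
            div_pow, ← pow_mul, mul_comm l 2, pow_mul]
          norm_num

/-- Scale `l` occurs with probability at most `2 (3 · 2^l / b)^d`. The decay `4^(-l d)` due to the
sharpness `2d` beats this growth, leaving a geometric series with sum at most 2. -/
theorem avg_filter_le {e : ℕ} (he1 : 1 ≤ e) (he : e ≤ m) (hd : 1 ≤ d) (o : Pt d m)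
    (ho : ∀ s, 2 * (o s).valMinAbs.natAbs ≤ 2 ^ (m - e)) {w : Pt d m} (hw : w ≠ 0) :
    avg (fun A : GL (Fin d) (ZMod (2 ^ m)) =>
      filter e (2 * d) (fun s => A.val.mulVec w s + o s)) ≤ 192 ^ d / (2 ^ e) ^ d := by
  have hA : ∀ A : GL (Fin d) (ZMod (2 ^ m)), filter e (2 * d) (fun s => A.val.mulVec w s + o s) ≤
      ∑ l ∈ Finset.range (e + 1), if ∀ s, (A.val.mulVec w s).valMinAbs.natAbs ≤
        2 ^ l * 2 ^ (m - e) then (16 : ℝ) ^ d / (4 ^ l) ^ d else 0 :=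
    fun A => filter_add_le he1 he o (A.val.mulVec w) ho
  refine (avg_mono hA).trans ?_
  rw [avg_sum]
  have hterm : ∀ l ∈ Finset.range (e + 1), avg (fun A : GL (Fin d) (ZMod (2 ^ m)) =>
      if ∀ s, (A.val.mulVec w s).valMinAbs.natAbs ≤ 2 ^ l * 2 ^ (m - e) then
        (16 : ℝ) ^ d / (4 ^ l) ^ d else 0) ≤ 2 * 48 ^ d / (2 ^ e) ^ d * (1 / 2) ^ l := by
    intro l _
    have h1 := card_small_mul_le hw (2 ^ l * 2 ^ (m - e))
    have hG : (0 : ℝ) < Fintype.card (GL (Fin d) (ZMod (2 ^ m))) :=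
      Nat.cast_pos.2 Fintype.card_pos
    rw [avg, ← Finset.sum_filter, Finset.sum_const, nsmul_eq_mul, div_le_iff₀ hG]
    set a := (Finset.univ.filter fun A : GL (Fin d) (ZMod (2 ^ m)) =>
      ∀ s, (A.val.mulVec w s).valMinAbs.natAbs ≤ 2 ^ l * 2 ^ (m - e)).card
    set G := Fintype.card (GL (Fin d) (ZMod (2 ^ m)))
    have h2 : (a : ℝ) * (2 ^ m) ^ d ≤ 2 * (3 * (2 ^ l * 2 ^ (m - e))) ^ d * G := by
      exact_mod_cast h1
    have hpow : (2 : ℝ) ^ m = 2 ^ e * 2 ^ (m - e) := by rw [← pow_add]; congr 1; omega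
    have h3 : (a : ℝ) * (2 ^ e) ^ d ≤ 2 * (3 * 2 ^ l) ^ d * G := by
      rw [hpow, mul_pow, ← mul_assoc 3, mul_pow (3 * 2 ^ l : ℝ)] at h2
      have hp : (0 : ℝ) < (2 ^ (m - e)) ^ d := by positivity
      refine le_of_mul_le_mul_right ?_ hp
      linarith
    have h4 : (a : ℝ) ≤ 2 * (3 * 2 ^ l) ^ d * G / (2 ^ e) ^ d := by
      rwa [le_div_iff₀ (by positivity)]
    calc (a : ℝ) * (16 ^ d / (4 ^ l) ^ d) ≤ 2 * (3 * 2 ^ l) ^ d * G / (2 ^ e) ^ d *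
          (16 ^ d / (4 ^ l) ^ d) := by gcongr
      _ = 2 * 48 ^ d / (2 ^ e) ^ d * ((1 / 2) ^ l) ^ d * G := by
          have h5 : (48 : ℝ) ^ d = 3 ^ d * 16 ^ d := by rw [← mul_pow]; norm_num
          have h6 : ((4 : ℝ) ^ l) ^ d = (2 ^ l) ^ d * (2 ^ l) ^ d := by
            rw [← mul_pow, ← mul_pow]; norm_num
          rw [h5, h6, mul_pow, one_div, inv_pow, inv_pow]
          have : (0 : ℝ) < (2 ^ l) ^ d := by positivity
          field_simp
      _ ≤ 2 * 48 ^ d / (2 ^ e) ^ d * (1 / 2) ^ l * G := by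
          gcongr
          refine pow_le_of_le_one (by positivity) (pow_le_one₀ (by norm_num) (by norm_num)) (by omega)
  refine (Finset.sum_le_sum hterm).trans ?_
  rw [← Finset.mul_sum]
  have hgeo : ∑ l ∈ Finset.range (e + 1), ((1 : ℝ) / 2) ^ l ≤ 2 := by
    have := geom_sum_eq (x := (1 : ℝ) / 2) (by norm_num) (e + 1)
    rw [this, div_le_iff_of_neg (by norm_num)]
    have : (0 : ℝ) < (1 / 2) ^ (e + 1) := by positivity
    linarith
  have h7 : (4 : ℝ) * 48 ^ d ≤ 192 ^ d := by
    have : (192 : ℝ) ^ d = 4 ^ d * 48 ^ d := by rw [← mul_pow]; norm_num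
    rw [this]
    have h8 : (4 : ℝ) ≤ 4 ^ d := le_self_pow₀ (by norm_num) (by omega)
    gcongr
  calc 2 * 48 ^ d / (2 ^ e) ^ d * ∑ l ∈ Finset.range (e + 1), ((1 : ℝ) / 2) ^ l
      ≤ 2 * 48 ^ d / (2 ^ e) ^ d * 2 := by gcongr
    _ = 4 * 48 ^ d / (2 ^ e) ^ d := by ring
    _ ≤ 192 ^ d / (2 ^ e) ^ d := by gcongr

/-- The distance of a point to the nearest multiple of `n / b`, as computed by rounding. -/
def roundOff (e : ℕ) (u : ZMod (2 ^ m)) : ZMod (2 ^ m) :=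
  u - gridPt m e (((u.val + 2 ^ (m - e) / 2) / 2 ^ (m - e) : ℕ) : ZMod (2 ^ e))

theorem gridPt_natCast {e : ℕ} (he : e ≤ m) (k : ℕ) :
    gridPt m e (k : ZMod (2 ^ e)) = ((2 ^ (m - e) * k : ℕ) : ZMod (2 ^ m)) := by
  have hpow : 2 ^ m = 2 ^ (m - e) * 2 ^ e := by rw [← pow_add]; congr 1; omega
  rw [gridPt, ZMod.val_natCast, ZMod.natCast_eq_natCast_iff, hpow]
  exact Nat.ModEq.mul_left' _ (Nat.mod_modEq _ _)

theorem two_mul_roundOff_le {e : ℕ} (he : e ≤ m) (u : ZMod (2 ^ m)) :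
    2 * (roundOff e u).valMinAbs.natAbs ≤ 2 ^ (m - e) := by
  set g := 2 ^ (m - e) with hg
  have hg0 : 0 < g := by positivity
  set y := (u.val + g / 2) % g with hy
  have h1 : roundOff e u = (((y : ℤ) - (g / 2 : ℕ) : ℤ) : ZMod (2 ^ m)) := by
    rw [roundOff, gridPt_natCast he, ← hg]
    have h2 := Nat.div_add_mod (u.val + g / 2) g
    rw [← hy] at h2
    have h3 : ((g * ((u.val + g / 2) / g) : ℕ) : ZMod (2 ^ m)) + (y : ℕ) =
        u + ((g / 2 : ℕ) : ZMod (2 ^ m)) := by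
      rw [← Nat.cast_add, h2, Nat.cast_add, ZMod.natCast_zmod_val]
    rw [Int.cast_sub, Int.cast_natCast, Int.cast_natCast]
    linear_combination -h3
  have h2 : (((y : ℤ) - (g / 2 : ℕ) : ℤ)).natAbs * 2 ≤ g := by
    have hylt : y < g := Nat.mod_lt _ hg0
    rcases Nat.eq_zero_or_pos (m - e) with h0 | hpos
    · have : g = 1 := by rw [hg, h0, pow_zero]
      omega
    · have : g = 2 * 2 ^ (m - e - 1) := by rw [hg, ← pow_succ']; congr 1; omega
      omega
  rw [h1]
  have := natAbs_valMinAbs_intCast_le (m := m) ((y : ℤ) - (g / 2 : ℕ) : ℤ)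
  omega

theorem offset_eq (e : ℕ) (π : Perm d m) (i j : Pt d m) :
    offset e π i j = fun s => π.mat.val.mulVec (j - i) s + roundOff e (π.app i s) := by
  funext s
  simp only [offset, bucket, roundOff, Perm.app, Matrix.mulVec_sub, Pi.sub_apply]
  ring

/-- The offset of an element in its own bucket is only the rounding error, at most `n/(2b)` in each
coordinate. Each of the `2 d²` kernel factors is then at least `2/π`. -/
theorem filter_self_ge {e : ℕ} (he1 : 1 ≤ e) (he : e ≤ m) (π : Perm d m) (i : Pt d m) :
    (2 / Real.pi) ^ (2 * d ^ 2) ≤ filter e (2 * d) (offset e π i i) := by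
  have h0 : 0 < 2 / Real.pi := div_pos two_pos Real.pi_pos
  have h1 : (2 / Real.pi) ^ (2 * d ^ 2) = ∏ _s : Fin d, (2 / Real.pi) ^ (2 * d) := by
    rw [Finset.prod_const, ← pow_mul, Finset.card_univ, Fintype.card_fin]; congr 1; ring
  rw [h1, filter]
  refine Finset.prod_le_prod (fun _ _ => by positivity) fun s _ => ?_
  refine pow_le_pow_left₀ h0.le (two_div_pi_le_dirichlet _ _ ?_) _
  rw [offset_eq]
  simp only [sub_self, Matrix.mulVec_zero, Pi.zero_apply, zero_add]
  have h2 := two_mul_roundOff_le he (π.app i s)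
  set r := roundOff e (π.app i s)
  have hk : ((r.valMinAbs.natAbs : ℕ) : ℝ) = |(r.valMinAbs : ℝ)| := by
    rw [Nat.cast_natAbs, Int.cast_abs]
  rw [← hk]
  have h3 := two_mul_halfWidth e he1
  have h4 : 2 * (2 * halfWidth e + 1) * r.valMinAbs.natAbs ≤ 2 ^ m := by
    have hpow : 2 ^ e * 2 ^ (m - e) = 2 ^ m := by rw [← pow_add]; congr 1; omega
    rw [h3]
    calc 2 * (2 ^ e - 1) * r.valMinAbs.natAbs = (2 ^ e - 1) * (2 * r.valMinAbs.natAbs) := by ring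
      _ ≤ 2 ^ e * 2 ^ (m - e) := Nat.mul_le_mul (Nat.sub_le _ _) h2
      _ = 2 ^ m := hpow
  exact_mod_cast h4

/-- In expectation over the random permutation, an element contributes little to the bucket of
another one. -/
theorem avg_filter_offset_le {e : ℕ} (he1 : 1 ≤ e) (he : e ≤ m) (hd : 1 ≤ d) {i j : Pt d m}
    (hij : j ≠ i) :
    avg (fun A : GL (Fin d) (ZMod (2 ^ m)) => avg fun q : Pt d m =>
      filter e (2 * d) (offset e ⟨A, q⟩ i j)) ≤ 192 ^ d / (2 ^ e) ^ d := by
  -- For fixed `A` the point `A (i - q)` is uniform as `q` varies. Hence the rounding error may be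
  -- drawn independently of `A` and fixed before averaging over matrices.
  have h1 : ∀ A : GL (Fin d) (ZMod (2 ^ m)), (avg fun q : Pt d m =>
      filter e (2 * d) (offset e ⟨A, q⟩ i j)) = avg fun u : Pt d m =>
        filter e (2 * d) (fun s => A.val.mulVec (j - i) s + roundOff e (u s)) := by
    intro A
    have hbij : Function.Bijective fun q : Pt d m => A.val.mulVec (i - q) :=
      (Function.Injective.bijective_of_finite fun q q' h => by
        have := GL_mulVec_injective A h
        exact sub_right_injective this)
    rw [← avg_equiv (Equiv.ofBijective _ hbij) fun u : Pt d m =>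
        filter e (2 * d) (fun s => A.val.mulVec (j - i) s + roundOff e (u s))]
    congr 1
    funext q
    rw [offset_eq]
    rfl
  simp only [h1]
  rw [avg_comm]
  exact avg_le_const fun u => avg_filter_le he1 he hd _ (fun s => two_mul_roundOff_le he _)
    (sub_ne_zero.2 hij)

end

section

variable {X : Type} {d m : ℕ} {v : X → ℂ}

/-! ### Tail bounds -/

open Classical in
/-- The indicator function of a proposition. -/
def ind (P : Prop) : ℝ := if P then 1 else 0

theorem ind_nonneg (P : Prop) : 0 ≤ ind P := by unfold ind; split_ifs <;> norm_num

theorem ind_le_one (P : Prop) : ind P ≤ 1 := by unfold ind; split_ifs <;> norm_num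

theorem ind_of {P : Prop} (h : P) : ind P = 1 := if_pos h

theorem ind_of_not {P : Prop} (h : ¬ P) : ind P = 0 := if_neg h

theorem ind_mono {P Q : Prop} (h : P → Q) : ind P ≤ ind Q := by
  by_cases hP : P
  · rw [ind_of hP, ind_of (h hP)]
  · rw [ind_of_not hP]; exact ind_nonneg Q

theorem ind_or_le (P Q : Prop) : ind (P ∨ Q) ≤ ind P + ind Q := by
  by_cases hP : P
  · rw [ind_of hP]; linarith [ind_le_one (P ∨ Q), ind_nonneg Q]
  · by_cases hQ : Q
    · rw [ind_of hQ]; linarith [ind_le_one (P ∨ Q), ind_nonneg P]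
    · rw [ind_of_not (not_or.2 ⟨hP, hQ⟩)]; linarith [ind_nonneg P, ind_nonneg Q]

theorem ind_exists_le {ι : Type*} (s : Finset ι) (P : ι → Prop) :
    ind (∃ i ∈ s, P i) ≤ ∑ i ∈ s, ind (P i) := by
  by_cases h : ∃ i ∈ s, P i
  · obtain ⟨i, hi, hP⟩ := h
    rw [ind_of ⟨i, hi, hP⟩, ← ind_of hP]
    exact Finset.single_le_sum (f := fun i => ind (P i)) (fun i _ => ind_nonneg _) hi
  · rw [ind_of_not h]; exact Finset.sum_nonneg fun i _ => ind_nonneg _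

section Tail

variable {Ω : Type*} [Fintype Ω] [Nonempty Ω]

/-- Markov's inequality with a strict event, so that `a = 0` is allowed: `f` then vanishes
identically. This is needed because `ν + μ` may be zero. -/
theorem avg_ind_lt_le {f : Ω → ℝ} (hf : ∀ w, 0 ≤ f w) {a δ : ℝ} (ha : 0 ≤ a) (hδ : 0 ≤ δ)
    (h : avg f ≤ δ * a) : avg (fun w => ind (a < f w)) ≤ δ := by
  rcases ha.eq_or_lt with rfl | ha
  · have h0 : ∀ w, f w = 0 := by
      rw [mul_zero, avg] at h
      have hc : (0 : ℝ) < Fintype.card Ω := Nat.cast_pos.2 Fintype.card_pos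
      have h1 : ∑ w, f w ≤ 0 := by
        rwa [div_le_iff₀ hc, zero_mul] at h
      intro w
      exact (Finset.sum_eq_zero_iff_of_nonneg fun w _ => hf w).1
        (le_antisymm h1 (Finset.sum_nonneg fun w _ => hf w)) w (Finset.mem_univ _)
    refine avg_le_const fun w => ?_
    rw [h0, ind_of_not (lt_irrefl _)]
    exact hδ
  · have h1 : ∀ w, ind (a < f w) ≤ a⁻¹ * f w := by
      intro w
      by_cases hw : a < f w
      · rw [ind_of hw, inv_mul_eq_div, le_div_iff₀ ha]; linarith
      · rw [ind_of_not hw]; exact mul_nonneg (inv_nonneg.2 ha.le) (hf w)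
    refine (avg_mono h1).trans ?_
    rw [avg_const_mul, inv_mul_le_iff₀ ha]
    linarith

omit [Nonempty Ω] in
theorem avg_pi_prod {r : ℕ} (f : Ω → ℝ) :
    avg (fun w : Fin r → Ω => ∏ i, f (w i)) = avg f ^ r := by
  simp only [avg]
  rw [div_pow, Fintype.card_fun, Fintype.card_fin, Nat.cast_pow]
  congr 1
  have := Finset.prod_univ_sum (fun _ : Fin r => (Finset.univ : Finset Ω)) (fun _ w => f w)
  rw [Fintype.piFinset_univ] at this
  rw [← this]
  simp

theorem avg_weight_le {P : Ω → Prop} {p : ℝ} (hP : avg (fun w => ind (P w)) ≤ p) {U : ℝ}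
    (hU : 1 ≤ U) : avg (fun w => 1 + ind (P w) * (U - 1)) ≤ 1 + p * (U - 1) := by
  have : (fun w : Ω => 1 + ind (P w) * (U - 1)) = fun w => 1 + (U - 1) * ind (P w) := by
    funext w; ring
  rw [this, avg_add, avg_const, avg_const_mul]
  nlinarith

open Classical in
/-- The number of indices for which a property holds. -/
def count {r : ℕ} (P : Fin r → Prop) : ℕ := (Finset.univ.filter P).card

/-- On the event the right side is `u^(b · count - a r) ≥ 1`. The integers `a`, `b` encode the
fraction `a/b` of the trials and avoid real powers. -/
theorem ind_count_le {r : ℕ} (P : Fin r → Prop) (a b : ℕ) {u : ℝ} (hu : 1 ≤ u) :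
    ind (a * r ≤ b * count P) ≤ (∏ i, (1 + ind (P i) * (u ^ b - 1))) * ((u ^ a) ^ r)⁻¹ := by
  classical
  have hub : 1 ≤ u ^ b := one_le_pow₀ hu
  have hprod : ∏ i, (1 + ind (P i) * (u ^ b - 1)) = (u ^ b) ^ count P := by
    rw [count, ← Finset.prod_const, Finset.prod_filter]
    refine Finset.prod_congr rfl fun i _ => ?_
    split_ifs with h
    · rw [ind_of h]; ring
    · rw [ind_of_not h]; ring
  rw [hprod, ← pow_mul, ← pow_mul, ← div_eq_mul_inv]
  by_cases h : a * r ≤ b * count P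
  · rw [ind_of h, one_le_div (by positivity)]
    exact pow_le_pow_right₀ hu h
  · rw [ind_of_not h]; positivity

/-- Exponential tail bound for the number of occurrences of an event in independent trials. -/
theorem avg_count_le {P : Ω → Prop} {p : ℝ} (hP : avg (fun w => ind (P w)) ≤ p)
    (r a b : ℕ) {u : ℝ} (hu : 1 ≤ u) :
    avg (fun w : Fin r → Ω => ind (a * r ≤ b * count fun i => P (w i))) ≤
      ((1 + p * (u ^ b - 1)) / u ^ a) ^ r := by
  have hub : 1 ≤ u ^ b := one_le_pow₀ hu
  have h1 : avg (fun w : Fin r → Ω => ind (a * r ≤ b * count fun i => P (w i))) ≤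
      avg (fun w : Fin r → Ω => ((u ^ a) ^ r)⁻¹ * ∏ i, (1 + ind (P (w i)) * (u ^ b - 1))) :=
    avg_mono fun w => (ind_count_le (fun i => P (w i)) a b hu).trans (le_of_eq (mul_comm _ _))
  refine h1.trans ?_
  rw [avg_const_mul, avg_pi_prod (fun w => 1 + ind (P w) * (u ^ b - 1)), div_pow, div_eq_inv_mul]
  refine mul_le_mul_of_nonneg_left (pow_le_pow_left₀ (avg_nonneg fun w => ?_)
    (avg_weight_le hP hub) _) (by positivity)
  have := ind_nonneg (P w)
  nlinarith

end Tail

/-! ### Noise in a bucket -/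

/-- Average over a random permutation. -/
def permAvg (f : Perm d m → ℝ) : ℝ :=
  avg fun p : GL (Fin d) (ZMod (2 ^ m)) × Pt d m => f ⟨p.1, p.2⟩

theorem permAvg_mono {f g : Perm d m → ℝ} (h : ∀ π, f π ≤ g π) : permAvg f ≤ permAvg g :=
  avg_mono fun _ => h _

/-- Relative weight of `j` in the bucket of `i`. -/
def ratio (e : ℕ) (π : Perm d m) (i j : Pt d m) : ℝ :=
  filter e (2 * d) (offset e π i j) / filter e (2 * d) (offset e π i i)

/-- Bound for the expected relative weight of another element. -/
def weightBound (d e : ℕ) : ℝ := 192 ^ d * (Real.pi / 2) ^ (4 * d ^ 2) / (2 ^ e) ^ d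

section Noise

variable {e : ℕ}

theorem filter_self_pos (he1 : 1 ≤ e) (he : e ≤ m) (π : Perm d m) (i : Pt d m) :
    0 < filter e (2 * d) (offset e π i i) :=
  lt_of_lt_of_le (by have := Real.pi_pos; positivity) (filter_self_ge he1 he π i)

theorem ratio_nonneg (π : Perm d m) (i j : Pt d m) : 0 ≤ ratio e π i j :=
  div_nonneg (filter_nonneg _ _ _) (filter_nonneg _ _ _)

/-- The exponent 1 serves the sum of absolute values over the head, the exponent 2 the energy of the
tail. In both cases one filter value in the numerator suffices, since the filter is at most one. -/
theorem ratio_le (he1 : 1 ≤ e) (he : e ≤ m) (π : Perm d m) (i j : Pt d m) {p : ℕ}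
    (hp1 : 1 ≤ p) (hp2 : p ≤ 2) :
    ratio e π i j ^ p ≤ (Real.pi / 2) ^ (4 * d ^ 2) * filter e (2 * d) (offset e π i j) := by
  have hpi : 1 ≤ Real.pi / 2 := by linarith [Real.two_le_pi]
  have h1 : (filter e (2 * d) (offset e π i i))⁻¹ ≤ (Real.pi / 2) ^ (2 * d ^ 2) := by
    have h2 := filter_self_ge he1 he π i
    have h3 : (Real.pi / 2) ^ (2 * d ^ 2) = ((2 / Real.pi) ^ (2 * d ^ 2))⁻¹ := by
      rw [← inv_pow, inv_div]
    rw [h3]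
    exact inv_anti₀ (by have := Real.pi_pos; positivity) h2
  have hf0 := filter_nonneg e d (offset e π i j)
  have hf1 := filter_le_one e d (offset e π i j)
  have hinv : 0 ≤ (filter e (2 * d) (offset e π i i))⁻¹ := inv_nonneg.2 (filter_nonneg _ _ _)
  rw [ratio, div_eq_inv_mul, mul_pow]
  gcongr
  · calc (filter e (2 * d) (offset e π i i))⁻¹ ^ p ≤ ((Real.pi / 2) ^ (2 * d ^ 2)) ^ p :=
          pow_le_pow_left₀ hinv h1 p
      _ = (Real.pi / 2) ^ (2 * d ^ 2 * p) := (pow_mul _ _ _).symm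
      _ ≤ (Real.pi / 2) ^ (4 * d ^ 2) := pow_le_pow_right₀ hpi (by nlinarith [sq_nonneg d])
  · exact pow_le_of_le_one hf0 hf1 (by omega)

theorem permAvg_ratio_le (he1 : 1 ≤ e) (he : e ≤ m) (hd : 1 ≤ d) {i j : Pt d m} (hij : j ≠ i)
    {p : ℕ} (hp1 : 1 ≤ p) (hp2 : p ≤ 2) :
    permAvg (fun π => ratio e π i j ^ p) ≤ weightBound d e := by
  refine (permAvg_mono fun π => ratio_le he1 he π i j hp1 hp2).trans ?_
  rw [permAvg, avg_const_mul, avg_prod, weightBound]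
  have := avg_filter_offset_le he1 he hd hij
  calc (Real.pi / 2) ^ (4 * d ^ 2) * _ ≤ (Real.pi / 2) ^ (4 * d ^ 2) * (192 ^ d / (2 ^ e) ^ d) :=
        mul_le_mul_of_nonneg_left this (by have := Real.pi_pos; positivity)
    _ = _ := by ring

theorem permAvg_sum_ratio_le (he1 : 1 ≤ e) (he : e ≤ m) (hd : 1 ≤ d) (i : Pt d m)
    (J : Finset (Pt d m)) (hi : i ∉ J) (c : Pt d m → ℝ) (hc : ∀ j, 0 ≤ c j)
    {p : ℕ} (hp1 : 1 ≤ p) (hp2 : p ≤ 2) :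
    permAvg (fun π => ∑ j ∈ J, ratio e π i j ^ p * c j) ≤ weightBound d e * ∑ j ∈ J, c j := by
  rw [permAvg, avg_sum, Finset.mul_sum]
  refine Finset.sum_le_sum fun j hj => ?_
  have h1 : (fun q : GL (Fin d) (ZMod (2 ^ m)) × Pt d m => ratio e ⟨q.1, q.2⟩ i j ^ p * c j) =
      fun q => c j * ratio e ⟨q.1, q.2⟩ i j ^ p := by funext q; ring
  have hij : j ≠ i := by rintro rfl; exact hi hj
  rw [h1, avg_const_mul, mul_comm]
  exact mul_le_mul_of_nonneg_right (permAvg_ratio_le he1 he hd hij hp1 hp2) (hc j)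

/-- The part of bucket `h(i)`, divided by the filter value at `i`, that comes from `J`. -/
def noise (e : ℕ) (π : Perm d m) (i : Pt d m) (J : Finset (Pt d m)) (x : Pt d m → ℂ)
    (z : Pt d m) : ℂ :=
  ∑ j ∈ J, ((ratio e π i j : ℂ) * x j) * root (z ⬝ᵥ π.mat.val.mulVec j)

/-- The normal form on which location and estimation rest: the summand of `i` is split off and the
filter value at `i` factored out, which leaves relative weights for the other elements. -/
theorem hashed_bucket (he1 : 1 ≤ e) (he : e ≤ m) (π : Perm d m) (i : Pt d m) (x : Pt d m → ℂ)
    (z : Pt d m) :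
    hashed e (2 * d) π z x (bucket e π i) = (filter e (2 * d) (offset e π i i) : ℂ) *
      (x i * root (z ⬝ᵥ π.mat.val.mulVec i) + noise e π i (Finset.univ.erase i) x z) := by
  have hpos := filter_self_pos he1 he π i
  have hne : (filter e (2 * d) (offset e π i i) : ℂ) ≠ 0 := by exact_mod_cast hpos.ne'
  have h1 : hashed e (2 * d) π z x (bucket e π i) =
      ∑ l, (filter e (2 * d) (offset e π i i) : ℂ) * (((ratio e π i l : ℂ) * x l) *
        root (z ⬝ᵥ π.mat.val.mulVec l)) := by
    refine Finset.sum_congr rfl fun l _ => ?_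
    have : (filter e (2 * d) (fun r => π.app l r - gridPt m e (bucket e π i r)) : ℂ) =
        (filter e (2 * d) (offset e π i i) : ℂ) * (ratio e π i l : ℂ) := by
      rw [ratio]; push_cast; field_simp; rfl
    rw [this]
    ring
  rw [h1, ← Finset.mul_sum, ← Finset.add_sum_erase _ _ (Finset.mem_univ i)]
  congr 3
  rw [ratio, div_self hpos.ne', Complex.ofReal_one, one_mul]

theorem norm_noise_le (π : Perm d m) (i : Pt d m) (J : Finset (Pt d m)) (x : Pt d m → ℂ)
    (z : Pt d m) : ‖noise e π i J x z‖ ≤ ∑ j ∈ J, ratio e π i j ^ 1 * ‖x j‖ := by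
  refine norm_sum_le_of_le _ fun j _ => ?_
  rw [norm_mul, norm_root, mul_one, norm_mul, Complex.norm_real, Real.norm_eq_abs,
    abs_of_nonneg (ratio_nonneg π i j), pow_one]

/-- The energy of the noise. -/
def energy (e : ℕ) (π : Perm d m) (i : Pt d m) (J : Finset (Pt d m)) (x : Pt d m → ℂ) : ℝ :=
  ∑ j ∈ J, ratio e π i j ^ 2 * ‖x j‖ ^ 2

/-- Parseval in the evaluation point: the frequencies `Σ j` are distinct because `Σ` is invertible.
-/
theorem avg_norm_noise_sq (π : Perm d m) (i : Pt d m) (J : Finset (Pt d m)) (x : Pt d m → ℂ) :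
    avg (fun z : Pt d m => ‖noise e π i J x z‖ ^ 2) = energy e π i J x := by
  have h := sum_norm_sq_trig J (fun j => (ratio e π i j : ℂ) * x j) (fun j => π.mat.val.mulVec j)
    (GL_mulVec_injective π.mat).injOn
  rw [avg]
  simp only [noise]
  rw [h, card_Pt, size]
  push_cast
  rw [mul_div_assoc, mul_comm, div_mul_cancel₀ _ (by positivity), energy]
  refine Finset.sum_congr rfl fun j _ => ?_
  rw [norm_mul, Complex.norm_real, mul_pow, Real.norm_eq_abs, sq_abs]

theorem avg_noise_gt_le (π : Perm d m) (i : Pt d m) (J : Finset (Pt d m)) (x : Pt d m → ℂ)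
    {a δ : ℝ} (ha : 0 ≤ a) (hδ : 0 ≤ δ) (h : energy e π i J x ≤ δ * a ^ 2) :
    avg (fun z : Pt d m => ind (a < ‖noise e π i J x z‖)) ≤ δ := by
  refine (avg_mono fun z => ind_mono (Q := a ^ 2 < ‖noise e π i J x z‖ ^ 2) fun hz => ?_).trans
    (avg_ind_lt_le (fun z => by positivity) (sq_nonneg a) hδ
      (by rw [avg_norm_noise_sq]; exact h))
  exact pow_lt_pow_left₀ hz ha (by norm_num)

end Noise

end

section

variable {X : Type} {d m e r : ℕ} {v : X → ℂ}

/-! ### Recovery of digits -/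

theorem count_mono {P Q : Fin r → Prop} (h : ∀ a, P a → Q a) : count P ≤ count Q := by
  classical
  exact Finset.card_le_card fun a ha => by
    simp only [Finset.mem_filter, Finset.mem_univ, true_and] at ha ⊢; exact h a ha

theorem count_add_count_not (P : Fin r → Prop) : count P + count (fun a => ¬ P a) = r := by
  classical
  have := Finset.card_filter_add_card_filter_not (s := (Finset.univ : Finset (Fin r))) P
  rw [Finset.card_univ, Fintype.card_fin] at this
  simp only [count]
  convert this

theorem foldl_count (P : Fin r → Prop) [DecidablePred P] :
    (List.finRange r).foldl (fun (c : ℕ) a => if P a then c + 1 else c) 0 = count P := by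
  have h1 : (fun (c : ℕ) a => if P a then c + 1 else c) =
      fun c a => c + if P a then 1 else 0 := by
    funext c a; split_ifs <;> rfl
  rw [h1, foldl_add_eq, zero_add, ← Fin.sum_univ_def, count, Finset.card_filter]
  refine Finset.sum_congr rfl fun a _ => ?_
  by_cases h : P a <;> simp [h]

theorem foldl_range_eq_singleton (P : ℕ → Prop) [DecidablePred P] (q₀ n : ℕ)
    (h : ∀ q < n, P q ↔ q = q₀) :
    (List.range n).foldl (fun (l : List ℕ) q => if P q then q :: l else l) [] =
      if q₀ < n then [q₀] else [] := by
  induction n with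
  | zero => simp
  | succ n ih =>
      rw [List.range_succ, List.foldl_append, ih fun q hq => h q (by omega)]
      simp only [List.foldl_cons, List.foldl_nil]
      have h1 := h n (by omega)
      by_cases hn : n = q₀
      · rw [if_pos (h1.2 hn), if_neg (by omega), if_pos (by omega), hn]
      · rw [if_neg (fun h' => hn (h1.1 h'))]
        exact if_congr (by omega) rfl rfl

/-- The number formed by the first `g` digits. -/
def lowDigits (m g : ℕ) (t : ZMod (2 ^ m)) : ℕ := t.val % 2 ^ (g * digitBits m)

/-- Digit number `g`. -/
def digit (m g : ℕ) (t : ZMod (2 ^ m)) : ℕ := t.val / 2 ^ (g * digitBits m) % 2 ^ digitBits m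

/-- The base of digit number `g`. -/
def digitBase (m g : ℕ) : ℕ := 2 ^ min (digitBits m) (m - g * digitBits m)

theorem lowDigits_succ (g : ℕ) (t : ZMod (2 ^ m)) :
    lowDigits m (g + 1) t = lowDigits m g t + 2 ^ (g * digitBits m) * digit m g t := by
  rw [lowDigits, lowDigits, digit, add_mul, one_mul, pow_add, Nat.mod_mul]

theorem lowDigits_zero (t : ZMod (2 ^ m)) : lowDigits m 0 t = 0 := by
  simp [lowDigits, Nat.mod_one]

theorem digit_mul_lt (g : ℕ) (hg : g < numDigits m) : g * digitBits m < m := by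
  unfold numDigits at hg
  rcases Nat.eq_zero_or_pos (digitBits m) with h0 | hpos
  · rw [h0] at hg; simp at hg
  · have h1 : (g + 1) * digitBits m ≤ m + digitBits m - 1 :=
      (Nat.le_div_iff_mul_le hpos).1 hg
    rw [add_mul, one_mul] at h1
    omega

theorem lowDigits_numDigits (hdb : 1 ≤ digitBits m) (t : ZMod (2 ^ m)) :
    lowDigits m (numDigits m) t = t.val := by
  refine Nat.mod_eq_of_lt ((ZMod.val_lt t).trans_le (Nat.pow_le_pow_right (by norm_num) ?_))
  have h1 := Nat.div_add_mod (m + digitBits m - 1) (digitBits m)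
  have h2 := Nat.mod_lt (m + digitBits m - 1) hdb
  unfold numDigits
  rw [mul_comm] at h1
  omega

theorem div_mod_digitBase (g : ℕ) (t : ZMod (2 ^ m)) :
    t.val / 2 ^ (g * digitBits m) % digitBase m g = digit m g t := by
  unfold digitBase digit
  rcases le_total (digitBits m) (m - g * digitBits m) with h | h
  · rw [min_eq_left h]
  · rw [min_eq_right h]
    have h1 : t.val / 2 ^ (g * digitBits m) < 2 ^ (m - g * digitBits m) := by
      rw [Nat.div_lt_iff_lt_mul (by positivity), ← pow_add]
      exact (ZMod.val_lt t).trans_le (Nat.pow_le_pow_right (by norm_num) (by omega))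
    rw [Nat.mod_eq_of_lt h1,
      Nat.mod_eq_of_lt (h1.trans_le (Nat.pow_le_pow_right (by norm_num) h))]

theorem digit_lt_digitBase (g : ℕ) (t : ZMod (2 ^ m)) : digit m g t < digitBase m g := by
  rw [← div_mod_digitBase]
  exact Nat.mod_lt _ (by unfold digitBase; positivity)

/-- The frequency tested when `q` is proposed as digit number `g` of `t`. -/
def digitFreq (m g : ℕ) (t : ZMod (2 ^ m)) (q : ℕ) : ZMod (2 ^ m) :=
  scale m g * (t - ((lowDigits m g t : ℕ) : ZMod (2 ^ m)) - 2 ^ (g * digitBits m) * (q : ZMod (2 ^ m)))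

/-- Removing the known low digits leaves `Δ^g D`, and multiplication by the scale turns the
difference into `(n / base) (D - q)`. This vanishes modulo `n` exactly if the base divides `D - q`.
-/
theorem digitFreq_eq_zero_iff (g : ℕ) (hg : g < numDigits m) (t : ZMod (2 ^ m)) (q : ℕ)
    (hq : q < digitBase m g) : digitFreq m g t q = 0 ↔ q = digit m g t := by
  set db := digitBits m with hdb
  have hgm := digit_mul_lt g hg
  rw [← hdb] at hgm
  set bb := min db (m - g * db) with hbb
  have hmin : min ((g + 1) * db) m = g * db + bb := by rw [add_mul, one_mul]; omega
  set D := t.val / 2 ^ (g * db) with hD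
  have h1 : digitFreq m g t q =
      ((2 ^ (m - bb) * ((D : ℤ) - q) : ℤ) : ZMod (2 ^ m)) := by
    have h2 : (t : ZMod (2 ^ m)) = ((lowDigits m g t + 2 ^ (g * db) * D : ℕ) : ZMod (2 ^ m)) := by
      rw [lowDigits, ← hdb, hD, Nat.mod_add_div, ZMod.natCast_zmod_val]
    have h3 : (2 : ℤ) ^ (m - bb) = 2 ^ (m - min ((g + 1) * db) m) * 2 ^ (g * db) := by
      rw [← pow_add]; congr 1; omega
    rw [digitFreq, scale, ← hdb]
    nth_rewrite 1 [h2]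
    rw [h3]
    push_cast
    ring
  have h4 : ((2 ^ m : ℕ) : ℤ) = 2 ^ (m - bb) * ((2 ^ bb : ℕ) : ℤ) := by
    push_cast; rw [← pow_add]; congr 1; omega
  rw [h1, ZMod.intCast_zmod_eq_zero_iff_dvd, h4, mul_dvd_mul_iff_left (by positivity),
    ← div_mod_digitBase]
  have hb : digitBase m g = 2 ^ bb := rfl
  rw [hb] at hq ⊢
  rw [← hdb, ← hD, ← Nat.modEq_iff_dvd]
  unfold Nat.ModEq
  rw [Nat.mod_eq_of_lt hq]

/-- The event that a wrong proposal looks right. -/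
def NearOne (s : Fin d) (b : ZMod (2 ^ m)) (p : Pt d m × Pt d m) : Prop :=
  ‖root (b * p.2 s) - 1‖ < 1 / 2

/-- The evaluation points allow to recover the digits of `u`, if `good a w` means that there is
little noise at the point with index `a` and direction `w`. -/
def DigitsGood (u : Pt d m) (good : Fin r → Dir d m → Prop) (pts : Fin r → Pt d m × Pt d m) :
    Prop :=
  ∀ (s : Fin d) (g : Fin (numDigits m)),
    5 * count (fun a => ¬ (good a none ∧ good a (some (s, g)))) < 2 * r ∧
    ∀ q < digitBase m g, digitFreq m g (u s) q ≠ 0 →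
      5 * count (fun a => ¬ (good a none ∧ good a (some (s, g))) ∨
        NearOne s (digitFreq m g (u s) q) (pts a)) < 3 * r

theorem DigitsGood.mono {u : Pt d m} {good good' : Fin r → Dir d m → Prop}
    {pts : Fin r → Pt d m × Pt d m} (h : DigitsGood u good pts)
    (hg : ∀ a w, good a w → good' a w) : DigitsGood u good' pts := by
  intro s g
  obtain ⟨h1, h2⟩ := h s g
  have key : ∀ a, ¬ (good' a none ∧ good' a (some (s, g))) →
      ¬ (good a none ∧ good a (some (s, g))) :=
    fun a ha hn => ha ⟨hg _ _ hn.1, hg _ _ hn.2⟩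
  exact ⟨lt_of_le_of_lt (Nat.mul_le_mul_left _ (count_mono key)) h1,
    fun q hq hq0 => lt_of_le_of_lt
      (Nat.mul_le_mul_left _ (count_mono fun a ha => ha.imp_left (key a))) (h2 q hq hq0)⟩

theorem norm_div_sub_one_le {p q : ℂ} (hp : ‖p - 1‖ ≤ 1 / 40) (hq : ‖q - 1‖ ≤ 1 / 40) :
    ‖p / q - 1‖ ≤ 1 / 12 := by
  have h1 : (39 : ℝ) / 40 ≤ ‖q‖ := by
    have := norm_sub_norm_le (1 : ℂ) (1 - q)
    rw [norm_one, norm_sub_rev, sub_sub_cancel] at this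
    linarith
  have hq0 : q ≠ 0 := norm_pos_iff.1 (by linarith)
  have h2 : p / q - 1 = ((p - 1) - (q - 1)) / q := by field_simp; ring
  rw [h2, norm_div, div_le_iff₀ (by linarith)]
  have := norm_sub_le (p - 1) (q - 1)
  linarith

/-- The value compared with one in the test of a digit. -/
def testValue (M : Measurements d m e r) (j : Pt d e) (s : Fin d) (g : Fin (numDigits m))
    (f : Pt d m) (q : ℕ) (a : Fin r) : ℂ :=
  root (-(scale m g * (f s + 2 ^ (g.val * digitBits m) * (q : ZMod (2 ^ m))) * (M.pts a).2 s)) *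
    (M.val a (some (s, g)) j / M.val a none j)

theorem star_dotProduct (p : Pt d m × Pt d m) (w : Dir d m) (u : Pt d m) :
    star p (1, dirVec w) ⬝ᵥ u = p.1 ⬝ᵥ u +
      match w with
      | none => 0
      | some (s, g) => p.2 s * scale m g * u s := by
  rcases w with _ | ⟨s, g⟩
  · simp [star, dirVec]
  · simp only [star, dirVec, mul_one, add_dotProduct]
    congr 1
    rw [dotProduct, Finset.sum_eq_single s]
    · simp
    · intro b _ hb; simp [hb]
    · simp

section Test

variable {M : Measurements d m e r} {j : Pt d e} {u : Pt d m} {y₀ : ℂ}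
  {good : Fin r → Dir d m → Prop}

/-- The quotient of the two measurements cancels `y₀` and the phase of the first point. The phase
still present is the character of frequency `digitFreq`, and two relative errors of 1/40 make at
most 1/12. -/
theorem testValue_eq (hy : y₀ ≠ 0) (hgood : ∀ a w, good a w →
    ‖M.val a w j - y₀ * root (star (M.pts a) (1, dirVec w) ⬝ᵥ u)‖ ≤ ‖y₀‖ / 40)
    (s : Fin d) (g : Fin (numDigits m)) (f : Pt d m)
    (hf : f s = ((lowDigits m g (u s) : ℕ) : ZMod (2 ^ m))) (q : ℕ) (a : Fin r)
    (ha : good a none ∧ good a (some (s, g))) :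
    ∃ δ : ℂ, ‖δ - 1‖ ≤ 1 / 12 ∧
      testValue M j s g f q a = root (digitFreq m g (u s) q * (M.pts a).2 s) * δ := by
  have key : ∀ w, good a w → ∃ p : ℂ, ‖p - 1‖ ≤ 1 / 40 ∧
      M.val a w j = y₀ * root (star (M.pts a) (1, dirVec w) ⬝ᵥ u) * p := by
    intro w hw
    have hr := root_ne_zero (star (M.pts a) (1, dirVec w) ⬝ᵥ u)
    refine ⟨M.val a w j / (y₀ * root (star (M.pts a) (1, dirVec w) ⬝ᵥ u)), ?_, ?_⟩
    · rw [div_sub_one (mul_ne_zero hy hr), norm_div, norm_mul, norm_root, mul_one,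
        div_le_iff₀ (norm_pos_iff.2 hy)]
      exact (hgood a w hw).trans (le_of_eq (by ring))
    · field_simp
  obtain ⟨p, hp, hpv⟩ := key none ha.1
  obtain ⟨p', hp', hpv'⟩ := key (some (s, g)) ha.2
  refine ⟨p' / p, norm_div_sub_one_le hp' hp, ?_⟩
  have hp0 : p ≠ 0 := by
    rintro rfl
    norm_num at hp
  have h1 : digitFreq m g (u s) q * (M.pts a).2 s =
      -(scale m g * (f s + 2 ^ (g.val * digitBits m) * (q : ZMod (2 ^ m))) * (M.pts a).2 s) +
        (M.pts a).2 s * scale m g * u s := by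
    rw [digitFreq, hf]; ring
  have hr := root_ne_zero ((M.pts a).1 ⬝ᵥ u)
  rw [testValue, hpv, hpv', star_dotProduct, star_dotProduct, h1]
  simp only [root_add, root_zero, mul_one]
  field_simp

/-- The right digit fails only at noisy points, fewer than 2/5 of all, since `1/12 < 1/3`. A wrong
digit passes only at points that are noisy or where its character is within `1/3 + 1/12 < 1/2` of
one, fewer than 3/5 of all. -/
theorem test_iff (hy : y₀ ≠ 0) (hgood : ∀ a w, good a w →
    ‖M.val a w j - y₀ * root (star (M.pts a) (1, dirVec w) ⬝ᵥ u)‖ ≤ ‖y₀‖ / 40)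
    (hD : DigitsGood u good M.pts) (s : Fin d) (g : Fin (numDigits m)) (f : Pt d m)
    (hf : f s = ((lowDigits m g (u s) : ℕ) : ZMod (2 ^ m))) (q : ℕ) (hq : q < digitBase m g) :
    3 * r ≤ 5 * count (fun a => ‖testValue M j s g f q a - 1‖ < 1 / 3) ↔ q = digit m g (u s) := by
  obtain ⟨h1, h2⟩ := hD s g
  rw [← digitFreq_eq_zero_iff g g.isLt (u s) q hq]
  constructor
  · intro h
    by_contra h0
    have h3 := h2 q hq h0
    have h4 : count (fun a => ‖testValue M j s g f q a - 1‖ < 1 / 3) ≤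
        count (fun a => ¬ (good a none ∧ good a (some (s, g))) ∨
          NearOne s (digitFreq m g (u s) q) (M.pts a)) := by
      refine count_mono fun a ha => ?_
      by_contra hcon
      rw [not_or, not_not] at hcon
      obtain ⟨δ, hδ, hδv⟩ := testValue_eq hy hgood s g f hf q a hcon.1
      apply hcon.2
      rw [hδv] at ha
      set R := root (digitFreq m g (u s) q * (M.pts a).2 s) with hR
      have hRn : ‖R‖ = 1 := norm_root _
      have h5 : R - 1 = (R * δ - 1) - R * (δ - 1) := by ring
      have h6 := norm_sub_le (R * δ - 1) (R * (δ - 1))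
      rw [norm_mul, hRn, one_mul, ← h5] at h6
      show ‖R - 1‖ < 1 / 2
      linarith
    omega
  · intro h0
    have h3 : count (fun a => ¬ ‖testValue M j s g f q a - 1‖ < 1 / 3) ≤
        count (fun a => ¬ (good a none ∧ good a (some (s, g)))) := by
      refine count_mono fun a ha hg => ha ?_
      obtain ⟨δ, hδ, hδv⟩ := testValue_eq hy hgood s g f hf q a hg
      rw [hδv, h0, zero_mul, root_zero, one_mul]
      linarith
    have h4 := count_add_count_not (fun a => ‖testValue M j s g f q a - 1‖ < 1 / 3)
    omega

end Test

/-- Bound for the number of steps of `locateDigit`. -/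
def digitTime (d m r : ℕ) : ℝ := 2 ^ digitBits m * (r * (2 * d + 24) + 3) + (d + 4)

theorem locateDigit_runs (M : Measurements d m e r) (j : Pt d e) (s : Fin d)
    (g : Fin (numDigits m)) (f u : Pt d m) :
    Runs v (locateDigit M j s g f) (fun o =>
      (∀ q < digitBase m g, 3 * r ≤ 5 * count (fun a => ‖testValue M j s g f q a - 1‖ < 1 / 3) ↔
        q = digit m g (u s)) →
      o = some (f + Pi.single s (2 ^ (g.val * digitBits m) * (digit m g (u s) : ZMod (2 ^ m)))))
      (digitTime d m r) := by
  classical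
  unfold locateDigit
  refine Runs.le (Runs.bind (t := 2 ^ digitBits m * (r * (2 * d + 24) + 3))
    (Q := fun l => l = (List.range (digitBase m g)).foldl (fun (l : List ℕ) q =>
      if 3 * r ≤ 5 * count (fun a => ‖testValue M j s g f q a - 1‖ < 1 / 3) then q :: l else l) [])
    (Runs.le (Runs.foldlM_eq (t := r * (2 * d + 24) + 3) fun q _ l => ?_) ?_)
    (t' := d + 4) fun l hl => ?_) le_rfl
  · refine Runs.bind (Q := fun c => c = count (fun a => ‖testValue M j s g f q a - 1‖ < 1 / 3))
      (Runs.mono (Runs.foldlM_eq (t := 2 * d + 24) (g := fun c a =>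
        if ‖testValue M j s g f q a - 1‖ < 1 / 3 then c + 1 else c) fun a _ c => ?_)
        (fun c hc => ?_) (le_of_eq (by rw [List.length_finRange])))
      fun c hc => Runs.op ?_ (by norm_num)
    · refine ((Runs.op (Q := fun z => z = testValue M j s g f q a) rfl le_rfl).bind
        fun z hz => Runs.op (t := 4) ?_ (by norm_num)).le ?_
      · rw [hz]
      · push_cast; linarith
    · rw [hc, foldl_count]
    · rw [hc]
  · rw [List.length_range]
    refine mul_le_mul_of_nonneg_right ?_ (by positivity)
    push_cast
    exact pow_le_pow_right₀ (by norm_num) (min_le_left _ _)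
  · have hdef : ∀ l : List ℕ, Runs v (match l with
        | [q] => op (d + 4) (some (f + Pi.single s (2 ^ (g.val * digitBits m) * (q : ZMod (2 ^ m)))))
        | _ => op 1 none : Alg X (Option (Pt d m))) (fun o => ∀ q, l = [q] →
          o = some (f + Pi.single s (2 ^ (g.val * digitBits m) * (q : ZMod (2 ^ m))))) (d + 4) := by
      intro l
      have hd0 : (0 : ℝ) ≤ d := Nat.cast_nonneg d
      rcases l with _ | ⟨q, _ | ⟨q', l⟩⟩
      · exact Runs.op (by simp) (by push_cast; linarith)
      · exact Runs.op (fun q' hq' => by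
          simp only [List.cons.injEq, and_true] at hq'; rw [hq']) (by push_cast; rfl)
      · exact Runs.op (by simp) (by push_cast; linarith)
    refine (hdef l).imp fun o ho hyp => ho (digit m g (u s)) ?_
    rw [hl, foldl_range_eq_singleton _ _ _ hyp, if_pos (digit_lt_digitBase g (u s))]

theorem length_of_finRange_eq {n : ℕ} {p q : List (Fin n)} {i : Fin n}
    (h : List.finRange n = p ++ i :: q) : p.length = i.val := by
  have h1 := congrArg (fun l => (l[p.length]?)) h
  have hlen := congrArg List.length h
  simp only [List.length_finRange, List.length_append, List.length_cons] at hlen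
  simp only [List.getElem?_append_right (le_refl p.length), Nat.sub_self,
    List.getElem?_cons_zero] at h1
  rw [List.getElem?_eq_getElem (by rw [List.length_finRange]; omega)] at h1
  simp only [List.getElem_finRange, Option.some.injEq] at h1
  rw [← h1]
  simp

/-- Bound for the number of steps of `locateBucket`. -/
def bucketTime (d m r : ℕ) : ℝ := d * (numDigits m * digitTime d m r)

theorem one_le_digitTime (d m r : ℕ) : 1 ≤ digitTime d m r := by
  unfold digitTime
  have h1 : (0 : ℝ) ≤ 2 ^ digitBits m * (r * (2 * d + 24) + 3) := by positivity
  have h2 : (0 : ℝ) ≤ d := Nat.cast_nonneg d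
  linarith

theorem locateBucket_runs (hdb : 1 ≤ digitBits m) (M : Measurements d m e r) (j : Pt d e) :
    Runs v (locateBucket M j) (fun o => ∀ (u : Pt d m) (y₀ : ℂ) (good : Fin r → Dir d m → Prop),
      y₀ ≠ 0 → (∀ a w, good a w →
        ‖M.val a w j - y₀ * root (star (M.pts a) (1, dirVec w) ⬝ᵥ u)‖ ≤ ‖y₀‖ / 40) →
      DigitsGood u good M.pts → o = some u) (bucketTime d m r) := by
  -- The run does not depend on `u`, so a fixed `u` may be analysed and `Always.forall` then
  -- applied.
  suffices H : ∀ u : Pt d m, Runs v (locateBucket M j) (fun o =>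
      (∀ (s : Fin d) (g : Fin (numDigits m)) (f : Pt d m), f s = ((lowDigits m g (u s) : ℕ) : ZMod (2 ^ m)) →
        ∀ q < digitBase m g, (3 * r ≤ 5 * count (fun a => ‖testValue M j s g f q a - 1‖ < 1 / 3) ↔
        q = digit m g (u s))) → o = some u) (bucketTime d m r) by
    have hall : Always v (locateBucket M j) fun o _ τ => ∀ u : Pt d m, ((∀ (s : Fin d) (g : Fin (numDigits m)) (f : Pt d m),
        f s = ((lowDigits m g (u s) : ℕ) : ZMod (2 ^ m)) → ∀ q < digitBase m g,
        (3 * r ≤ 5 * count (fun a => ‖testValue M j s g f q a - 1‖ < 1 / 3) ↔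
        q = digit m g (u s))) → o = some u) ∧ (τ : ℝ) ≤ bucketTime d m r :=
      Always.forall fun u => H u
    refine Always.mono hall fun o _ τ ho => ⟨fun u y₀ good hy hgood hD => (ho u).1 ?_, (ho 0).2⟩
    exact fun s g f hf q hq => test_iff hy hgood hD s g f hf q hq
  intro u
  set H : Prop := ∀ (s : Fin d) (g : Fin (numDigits m)) (f : Pt d m), f s = ((lowDigits m g (u s) : ℕ) : ZMod (2 ^ m)) →
        ∀ q < digitBase m g, (3 * r ≤ 5 * count (fun a => ‖testValue M j s g f q a - 1‖ < 1 / 3) ↔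
        q = digit m g (u s)) with hH
  unfold locateBucket
  refine Runs.mono (Runs.foldlM_rec (t := numDigits m * digitTime d m r)
    -- Coordinates not yet treated are zero. This provides the start of the digit recursion for the
    -- next coordinate, where no low digit is known.
    (fun p o => H → ∃ f : Pt d m, o = some f ∧ (∀ s ∈ p, f s = u s) ∧ ∀ s ∉ p, f s = 0)
    (fun _ => ⟨0, rfl, by simp, by simp⟩) fun p s q hl o ho => ?_) (fun o ho h => ?_) ?_
  · have hsp : s ∉ p := by
      have hnd := List.nodup_finRange d
      rw [hl] at hnd
      intro hs
      exact (List.nodup_append.1 hnd).2.2 s hs s (by simp) rfl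
    refine Runs.mono (Runs.foldlM_rec (t := digitTime d m r)
      (fun p' o => H → ∃ f : Pt d m, o = some f ∧ (∀ s ∈ p, f s = u s) ∧
        (∀ s' ∉ p, s' ≠ s → f s' = 0) ∧ f s = ((lowDigits m p'.length (u s) : ℕ) : ZMod (2 ^ m)))
      (fun h => ?_) fun p' g q' hl' o' ho' => ?_) (fun o' ho' h => ?_)
        (le_of_eq (by rw [List.length_finRange]))
    · obtain ⟨f, hf1, hf2, hf3⟩ := ho h
      exact ⟨f, hf1, hf2, fun s' hs' _ => hf3 s' hs', by
        rw [hf3 s hsp, List.length_nil, lowDigits_zero, Nat.cast_zero]⟩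
    · have hglen := length_of_finRange_eq hl'
      rcases o' with _ | f
      · refine Runs.op (fun h => ?_) (by push_cast; exact one_le_digitTime _ _ _)
        obtain ⟨f, hf, -⟩ := ho' h
        exact absurd hf (by simp)
      · refine (locateDigit_runs M j s g f u).imp fun o'' ho'' h => ?_
        obtain ⟨f', hf1, hf2, hf3, hf4⟩ := ho' h
        obtain rfl : f = f' := Option.some.inj hf1
        rw [hglen] at hf4
        refine ⟨_, ho'' (h s g f hf4), fun s' hs' => ?_, fun s' hs' hss => ?_, ?_⟩
        · have hne : s' ≠ s := by rintro rfl; exact hsp hs'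
          simp [hne, hf2 s' hs']
        · simp [hss, hf3 s' hs' hss]
        · rw [List.length_append, List.length_singleton, hglen, lowDigits_succ]
          simp [hf4]
    · obtain ⟨f, hf1, hf2, hf3, hf4⟩ := ho' h
      refine ⟨f, hf1, fun s' hs' => ?_, fun s' hs' => ?_⟩
      · rw [List.mem_append, List.mem_singleton] at hs'
        rcases hs' with hs' | rfl
        · exact hf2 s' hs'
        · rw [hf4, List.length_finRange, lowDigits_numDigits hdb, ZMod.natCast_zmod_val]
      · rw [List.mem_append, List.mem_singleton, not_or] at hs'
        exact hf3 s' hs'.1 hs'.2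
  · obtain ⟨f, hf1, hf2, -⟩ := ho h
    rw [hf1]
    congr 1
    funext s
    exact hf2 s (List.mem_finRange s)
  · rw [List.length_finRange, bucketTime]

/-! ### Location -/

/-- Bound for the number of steps of `locateSignal`. -/
def locateTime (d m c e r : ℕ) (len : ℝ) : ℝ :=
  r * ((1 + d * numDigits m) * (3 * d + hashTime d m c e (2 * d) len + (2 ^ e) ^ d + 1) + 1) +
    (4 * d ^ 3 + 1) + (2 ^ e) ^ d * (bucketTime d m r + (2 * d ^ 2 + d + 1))

/-- The measurements are those of `x`. -/
def Measurements.Valid (M : Measurements d m e r) (x : Pt d m → ℂ) : Prop :=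
  ∀ a w s, M.val a w s = hashed e (2 * d) M.perm (star (M.pts a) (1, dirVec w)) x s

theorem card_Dir (d m : ℕ) : Fintype.card (Dir d m) = 1 + d * numDigits m := by
  simp [add_comm]

/-- By linearity, subtracting the approximate measurement of `χ` from that of `x` measures `x - χ`.
`locateBucket_runs` is applied with `y₀` the filter value times the entry, so the noise plus the
approximation error has to be at most a fortieth of it. -/
theorem locateSignal_runs {c : ℕ} (hc : 1 ≤ c) (hd : 1 ≤ d) (he1 : 1 ≤ e) (he : e ≤ m)
    (hdb : 1 ≤ digitBits m) (hε : d * (4 * 2 ^ m / 2 ^ (c * (m * d)) : ℝ) ≤ 1)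
    (x χ : Pt d m → ℂ) (M : Measurements d m e r) (hM : M.Valid x) :
    Runs v (locateSignal c (2 * d) (filterCoeff (halfWidth e) (2 * d)) χ M) (fun L =>
      L.card ≤ (2 ^ e) ^ d ∧ ∀ i, (x - χ) i ≠ 0 → DigitsGood (M.perm.mat.val.mulVec i)
        (fun a w => filter e (2 * d) (offset e M.perm i i) *
          ‖noise e M.perm i (Finset.univ.erase i) (x - χ) (star (M.pts a) (1, dirVec w))‖ +
          l1 χ * semiErr d m c ≤ filter e (2 * d) (offset e M.perm i i) * ‖(x - χ) i‖ / 40) M.pts →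
        i ∈ L)
      (locateTime d m c e r (supp χ).card) := by
  unfold locateSignal
  refine Runs.le (Runs.bind
    (t := r * ((1 + d * numDigits m) * (3 * d + hashTime d m c e (2 * d) (supp χ).card +
      (2 ^ e) ^ d + 1) + 1))
    (Q := fun val : Fin r → Dir d m → Pt d e → ℂ => ∀ a w s,
      ‖val a w s - hashed e (2 * d) M.perm (star (M.pts a) (1, dirVec w)) (x - χ) s‖ ≤
        l1 χ * semiErr d m c) ?_ fun val hval => Runs.bind (t := 4 * d ^ 3 + 1)
      (Q := fun A => A = M.perm.mat⁻¹) (Runs.op rfl (by push_cast; rfl)) fun A hA =>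
      Runs.mono (Runs.foldlM_rec (t := bucketTime d m r + (2 * d ^ 2 + d + 1))
        (fun p (L : Finset (Pt d m)) => L.card ≤ p.length ∧ ∀ i, bucket e M.perm i ∈ p →
          (x - χ) i ≠ 0 → DigitsGood (M.perm.mat.val.mulVec i)
          (fun a w => filter e (2 * d) (offset e M.perm i i) *
          ‖noise e M.perm i (Finset.univ.erase i) (x - χ) (star (M.pts a) (1, dirVec w))‖ +
          l1 χ * semiErr d m c ≤ filter e (2 * d) (offset e M.perm i i) * ‖(x - χ) i‖ / 40) M.pts →
        i ∈ L) (by simp) fun p j q hl L hL => ?_) (fun L hL => ?_) le_rfl) ?_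
  · refine Runs.mono (Runs.tabulate (t := (1 + d * numDigits m) * (3 * d +
      hashTime d m c e (2 * d) (supp χ).card + (2 ^ e) ^ d + 1))
      (Q := fun a (W : Dir d m → Pt d e → ℂ) => ∀ w s,
        ‖W w s - hashed e (2 * d) M.perm (star (M.pts a) (1, dirVec w)) (x - χ) s‖ ≤
        l1 χ * semiErr d m c) fun a _ => ?_) (fun val hval a => hval.1 a (List.mem_finRange a))
        (le_of_eq (by rw [List.length_finRange]))
    refine (Runs.tabulate_univ (t := 3 * d + hashTime d m c e (2 * d) (supp χ).card + (2 ^ e) ^ d)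
      (Q := fun w (W : Pt d e → ℂ) => ∀ s,
        ‖W s - hashed e (2 * d) M.perm (star (M.pts a) (1, dirVec w)) (x - χ) s‖ ≤
        l1 χ * semiErr d m c) fun w => ?_).le (le_of_eq (by rw [card_Dir]; push_cast; ring))
    refine ((Runs.op (t := 3 * d) (Q := fun z => z = star (M.pts a) (1, dirVec w)) rfl
      (by push_cast; rfl)).bind fun z hz => (hashSparse_runs hc hd he hε χ M.perm z).bind
      (t' := (2 ^ e) ^ d) fun u hu => Runs.op ?_ (by push_cast; rfl)).le (by linarith)
    intro s
    rw [Pi.sub_apply, hM a w s, hashed_sub, ← hz, sub_sub_sub_cancel_left, norm_sub_rev]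
    exact hu s
  · refine (locateBucket_runs hdb _ j).bind (t' := 2 * d ^ 2 + d + 1) fun o ho => ?_
    have hd2 : (0 : ℝ) ≤ 2 * d ^ 2 + d := by positivity
    have hloc : ∀ i, bucket e M.perm i = j → (x - χ) i ≠ 0 → DigitsGood (M.perm.mat.val.mulVec i)
          (fun a w => filter e (2 * d) (offset e M.perm i i) *
          ‖noise e M.perm i (Finset.univ.erase i) (x - χ) (star (M.pts a) (1, dirVec w))‖ +
          l1 χ * semiErr d m c ≤ filter e (2 * d) (offset e M.perm i i) * ‖(x - χ) i‖ / 40) M.pts →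
        o = some (M.perm.mat.val.mulVec i) := by
      intro i hij hi hD
      have hpos := filter_self_pos he1 he M.perm i
      refine ho _ ((filter e (2 * d) (offset e M.perm i i) : ℂ) * (x - χ) i) _
        (mul_ne_zero (by exact_mod_cast hpos.ne') hi) (fun a w haw => ?_) hD
      have h1 := hval a w j
      rw [← hij, hashed_bucket he1 he, mul_add] at h1
      rw [norm_mul, Complex.norm_real, Real.norm_eq_abs, abs_of_pos hpos]
      refine le_trans ?_ haw
      rw [← hij]
      set G := filter e (2 * d) (offset e M.perm i i)
      set nz := noise e M.perm i (Finset.univ.erase i) (x - χ) (star (M.pts a) (1, dirVec w))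
      have h2 : ‖(G : ℂ) * nz‖ = G * ‖nz‖ := by
        rw [norm_mul, Complex.norm_real, Real.norm_eq_abs, abs_of_pos hpos]
      have h3 := norm_add_le ((G : ℂ) * nz) (val a w (bucket e M.perm i) -
        ((G : ℂ) * ((x - χ) i * root (star (M.pts a) (1, dirVec w) ⬝ᵥ M.perm.mat.val.mulVec i)) +
          (G : ℂ) * nz))
      rw [h2] at h3
      refine le_trans (le_of_eq ?_) (h3.trans (add_le_add_right h1 _))
      congr 1
      ring
    rcases o with _ | f
    · refine Runs.op ⟨by simp; omega, fun i hi hi0 hD => ?_⟩ (by push_cast; linarith)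
      rw [List.mem_append, List.mem_singleton] at hi
      rcases hi with hi | hi
      · exact hL.2 i hi hi0 hD
      · exact absurd (hloc i hi hi0 hD) (by simp)
    · refine Runs.op ⟨?_, fun i hi hi0 hD => ?_⟩ (by push_cast; linarith)
      · refine (Finset.card_insert_le _ _).trans ?_
        simp only [List.length_append, List.length_singleton]
        omega
      · rw [List.mem_append, List.mem_singleton] at hi
        rcases hi with hi | hi
        · exact Finset.mem_insert_of_mem (hL.2 i hi hi0 hD)
        · have h1 := Option.some.inj (hloc i hi hi0 hD)
          rw [h1, hA, Matrix.mulVec_mulVec, ← Units.val_mul, inv_mul_cancel]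
          simp
  · refine ⟨hL.1.trans (by simp), fun i hi0 hD => hL.2 i (by simp) hi0 hD⟩
  · rw [locateTime, Finset.length_toList, Finset.card_univ, card_Pt]
    push_cast
    linarith

end

section

variable {X : Type} {d m e r : ℕ} {v : X → ℂ}

/-! ### Probability of location -/

/-- `x` is the sum of a vector supported on `S` of small average and of a vector of small energy. -/
structure HeadTail (S : Finset (Pt d m)) (x : Pt d m → ℂ) (a : ℝ) : Prop where
  nonneg : 0 ≤ a
  head : ∑ j ∈ S, ‖x j‖ ≤ S.card * a
  tail : ∑ j ∈ Sᶜ, ‖x j‖ ^ 2 ≤ S.card * a ^ 2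

/-- The permutation puts little of the rest of the signal into the bucket of `i`. -/
def PermGood (e : ℕ) (S : Finset (Pt d m)) (x : Pt d m → ℂ) (a : ℝ) (i : Pt d m)
    (π : Perm d m) : Prop :=
  ∑ j ∈ S.erase i, ratio e π i j ^ 1 * (‖x j‖ + a) ≤ a / 20 ∧
    energy e π i (Sᶜ.erase i) x ≤ 1 / 100 * (a / 20) ^ 2

/-- The evaluation point adds little noise to the bucket of `i`. -/
def PointGood (e : ℕ) (S : Finset (Pt d m)) (x : Pt d m → ℂ) (a : ℝ) (i : Pt d m)
    (π : Perm d m) (z : Pt d m) : Prop :=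
  ‖noise e π i (Sᶜ.erase i) x z‖ ≤ a / 20

section Noise

variable {S : Finset (Pt d m)} {x : Pt d m → ℂ} {a : ℝ}

theorem permAvg_not_permGood (he1 : 1 ≤ e) (he : e ≤ m) (hd : 1 ≤ d) (h : HeadTail S x a)
    (hS : weightBound d e * S.card ≤ 1 / 10 ^ 7) (i : Pt d m) :
    permAvg (fun π => ind (¬ PermGood e S x a i π)) ≤ 1 / 100 := by
  have hw : 0 ≤ weightBound d e := by unfold weightBound; have := Real.pi_pos; positivity
  have ha := h.nonneg
  have h1 : permAvg (fun π => ∑ j ∈ S.erase i, ratio e π i j ^ 1 * (‖x j‖ + a)) ≤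
      1 / 1000 * (a / 20) := by
    refine (permAvg_sum_ratio_le he1 he hd i _ (Finset.notMem_erase i S) (fun j => ‖x j‖ + a)
      (fun j => by positivity) le_rfl (by norm_num)).trans ?_
    have h2 : ∑ j ∈ S.erase i, (‖x j‖ + a) ≤ S.card * (2 * a) := by
      refine (Finset.sum_le_sum_of_subset_of_nonneg (Finset.erase_subset i S)
        fun j _ _ => by positivity).trans ?_
      rw [Finset.sum_add_distrib, Finset.sum_const, nsmul_eq_mul]
      linarith [h.head]
    refine (mul_le_mul_of_nonneg_left h2 hw).trans ?_
    rw [← mul_assoc]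
    refine (mul_le_mul_of_nonneg_right hS (by positivity)).trans ?_
    linarith
  -- This requirement determines the constant `10^7`: `1/200 · 1/100 · (1/20)²` is `1.25 · 10⁻⁷`.
  -- The head leaves much more room.
  have h3 : permAvg (fun π => energy e π i (Sᶜ.erase i) x) ≤
      1 / 200 * (1 / 100 * (a / 20) ^ 2) := by
    refine (permAvg_sum_ratio_le he1 he hd i _ (Finset.notMem_erase i Sᶜ) (fun j => ‖x j‖ ^ 2)
      (fun j => by positivity) (by norm_num) le_rfl).trans ?_
    have h2 : ∑ j ∈ Sᶜ.erase i, ‖x j‖ ^ 2 ≤ S.card * a ^ 2 :=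
      (Finset.sum_le_sum_of_subset_of_nonneg (Finset.erase_subset i Sᶜ)
        fun j _ _ => by positivity).trans h.tail
    refine (mul_le_mul_of_nonneg_left h2 hw).trans ?_
    rw [← mul_assoc]
    refine (mul_le_mul_of_nonneg_right hS (by positivity)).trans ?_
    nlinarith [sq_nonneg a]
  have h4 := avg_ind_lt_le (f := fun p : GL (Fin d) (ZMod (2 ^ m)) × Pt d m =>
    ∑ j ∈ S.erase i, ratio e ⟨p.1, p.2⟩ i j ^ 1 * (‖x j‖ + a))
    (fun p => Finset.sum_nonneg fun j _ => mul_nonneg (pow_nonneg (ratio_nonneg _ _ _) _)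
      (by positivity)) (by positivity) (by norm_num) h1
  have h5 := avg_ind_lt_le (f := fun p : GL (Fin d) (ZMod (2 ^ m)) × Pt d m =>
    energy e ⟨p.1, p.2⟩ i (Sᶜ.erase i) x)
    (fun p => Finset.sum_nonneg fun j _ => by positivity) (by positivity) (by norm_num) h3
  have h6 := add_le_add h4 h5
  rw [← avg_add] at h6
  refine (avg_mono fun p => ?_).trans (h6.trans (by norm_num))
  refine (ind_mono fun hp => ?_).trans (ind_or_le _ _)
  rw [PermGood, not_and_or, not_le, not_le] at hp
  exact hp

theorem avg_not_pointGood (π : Perm d m) (i : Pt d m) (ha : 0 ≤ a) (h : PermGood e S x a i π) :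
    avg (fun z => ind (¬ PointGood e S x a i π z)) ≤ 1 / 100 := by
  refine (avg_mono fun z => ind_mono fun hz => ?_).trans
    (avg_noise_gt_le π i (Sᶜ.erase i) x (a := a / 20) (by positivity) (by norm_num) h.2)
  exact not_le.1 hz

/-- The noise for a residual signal. -/
theorem norm_noise_le_of_permGood {π : Perm d m} {i : Pt d m} (h : PermGood e S x a i π)
    {y : Pt d m → ℂ} (hS : ∀ j ∈ S, ‖y j‖ ≤ ‖x j‖ + a) (hS' : ∀ j ∉ S, y j = x j) {z : Pt d m}
    (hz : PointGood e S x a i π z) :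
    ‖noise e π i (Finset.univ.erase i) y z‖ ≤ a / 10 := by
  have h1 : noise e π i (Finset.univ.erase i) y z =
      noise e π i (S.erase i) y z + noise e π i (Sᶜ.erase i) x z := by
    have h2 : noise e π i (Sᶜ.erase i) x z = noise e π i (Sᶜ.erase i) y z := by
      refine Finset.sum_congr rfl fun j hj => ?_
      rw [hS' j (Finset.mem_compl.1 (Finset.mem_of_mem_erase hj))]
    rw [h2, noise, noise, noise, ← Finset.sum_union
      (Finset.disjoint_of_subset_left (Finset.erase_subset _ _)
        (Finset.disjoint_of_subset_right (Finset.erase_subset _ _) disjoint_compl_right)),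
      ← Finset.erase_union_distrib, Finset.union_compl]
  have h3 := norm_noise_le (e := e) π i (S.erase i) y z
  -- Here the arbitrary residual `y` is replaced by the majorant in `PermGood`. Thus the event does
  -- not depend on `y` and may be used for residuals that depend on the measurements themselves.
  have h4 : ∑ j ∈ S.erase i, ratio e π i j ^ 1 * ‖y j‖ ≤
      ∑ j ∈ S.erase i, ratio e π i j ^ 1 * (‖x j‖ + a) :=
    Finset.sum_le_sum fun j hj => mul_le_mul_of_nonneg_left (hS j (Finset.mem_of_mem_erase hj))
      (pow_nonneg (ratio_nonneg _ _ _) _)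
  rw [h1]
  refine (norm_add_le _ _).trans ?_
  have h5 := h.1
  have h6 : _ ≤ _ := hz
  linarith

end Noise

/-- For fixed second component the point is a translate of the first one and therefore uniform. -/
theorem avg_star (w : Dir d m) (f : Pt d m → ℝ) :
    avg (fun p : Pt d m × Pt d m => f (star p (1, dirVec w))) = avg f := by
  rw [avg_prod, avg_comm]
  have h1 : ∀ p₂ : Pt d m, (avg fun p₁ : Pt d m => f (star (p₁, p₂) (1, dirVec w))) = avg f := by
    intro p₂
    rw [← avg_equiv (Equiv.addRight (p₂ * dirVec w)) f]
    simp [star]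
  simp only [h1]
  exact avg_const _

/-- The real part of a nontrivial character has mean zero. The indicator is at most `8/15 (1 + Re)`,
because a unimodular number within 1/2 of one has real part at least 7/8. -/
theorem avg_nearOne_le (s : Fin d) {b : ZMod (2 ^ m)} (hb : b ≠ 0) :
    avg (fun p : Pt d m × Pt d m => ind (NearOne s b p)) ≤ 8 / 15 := by
  have h0 : ∑ p : Pt d m, root (p ⬝ᵥ Pi.single s b) = 0 := by
    rw [sum_root_dotProduct, if_neg]
    intro h
    exact hb (by simpa using congrFun h s)
  have h1 : avg (fun p : Pt d m => (root (b * p s)).re) = 0 := by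
    have h2 := congrArg Complex.re h0
    rw [Complex.re_sum, Complex.zero_re] at h2
    rw [avg, div_eq_zero_iff]
    left
    rw [← h2]
    refine Finset.sum_congr rfl fun p _ => ?_
    rw [dotProduct_single, mul_comm]
  rw [avg_prod]
  refine avg_le_const fun _ => ?_
  have h3 : ∀ p : Pt d m, ind (NearOne s b ((0 : Pt d m), p)) ≤
      8 / 15 + 8 / 15 * (root (b * p s)).re := by
    intro p
    have hn := norm_root (b * p s)
    have hsq : (root (b * p s)).re ^ 2 + (root (b * p s)).im ^ 2 = 1 := by
      have := Complex.sq_norm (root (b * p s))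
      rw [hn, Complex.normSq_apply] at this
      linarith
    by_cases h : NearOne s b ((0 : Pt d m), p)
    · rw [ind_of h]
      have h4 : ‖root (b * p s) - 1‖ ^ 2 ≤ (1 / 2) ^ 2 := pow_le_pow_left₀ (norm_nonneg _)
        (le_of_lt h) 2
      rw [Complex.sq_norm, Complex.normSq_apply] at h4
      simp only [Complex.sub_re, Complex.one_re, Complex.sub_im, Complex.one_im, sub_zero] at h4
      nlinarith
    · rw [ind_of_not h]
      nlinarith [sq_nonneg (root (b * p s)).im]
  refine (avg_mono h3).trans (le_of_eq ?_)
  rw [avg_add, avg_const, avg_const_mul, h1]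
  norm_num

/-- Bound for the probability that the evaluation points do not allow to recover a location. -/
def digitFailure (d m r : ℕ) : ℝ :=
  d * (numDigits m * ((1 + 2 ^ digitBits m) * (999 / 1000) ^ r))

theorem avg_not_digitsGood (Q : Pt d m → Prop) (hQ : avg (fun z => ind (¬ Q z)) ≤ 1 / 100)
    (u : Pt d m) :
    avg (fun pts : Fin r → Pt d m × Pt d m => ind (¬ DigitsGood u
      (fun a w => Q (star (pts a) (1, dirVec w))) pts)) ≤ digitFailure d m r := by
  classical
  have hpair : ∀ (s : Fin d) (g : Fin (numDigits m)), avg (fun p : Pt d m × Pt d m =>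
      ind (¬ (Q (star p (1, dirVec none)) ∧ Q (star p (1, dirVec (some (s, g))))))) ≤ 1 / 50 := by
    intro s g
    have h1 : avg (fun p : Pt d m × Pt d m => ind (¬ Q (star p (1, dirVec none))) +
        ind (¬ Q (star p (1, dirVec (some (s, g)))))) ≤ 1 / 50 := by
      rw [avg_add, avg_star none fun z => ind (¬ Q z), avg_star (some (s, g)) fun z => ind (¬ Q z)]
      linarith
    refine (avg_mono fun p => ?_).trans h1
    rw [not_and_or]
    exact ind_or_le _ _
  have hcount : ∀ (s : Fin d) (g : Fin (numDigits m)),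
      avg (fun pts : Fin r → Pt d m × Pt d m => ind (2 * r ≤ 5 * count fun a =>
        ¬ (Q (star (pts a) (1, dirVec none)) ∧ Q (star (pts a) (1, dirVec (some (s, g))))))) ≤
      (999 / 1000) ^ r := by
    intro s g
    -- With probability 1/50 and fraction 2/5 the base `u = 2` gives `(1 + 31/50)/4`, far below one.
    refine (avg_count_le (hpair s g) r 2 5 (u := 2) (by norm_num)).trans ?_
    exact pow_le_pow_left₀ (by norm_num) (by norm_num) r
  have hcount' : ∀ (s : Fin d) (g : Fin (numDigits m)) (q : ℕ), digitFreq m g (u s) q ≠ 0 →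
      avg (fun pts : Fin r → Pt d m × Pt d m => ind (3 * r ≤ 5 * count fun a =>
        ¬ (Q (star (pts a) (1, dirVec none)) ∧ Q (star (pts a) (1, dirVec (some (s, g))))) ∨
          NearOne s (digitFreq m g (u s) q) (pts a))) ≤ (999 / 1000) ^ r := by
    intro s g q hq
    have h1 : avg (fun p : Pt d m × Pt d m =>
        ind (¬ (Q (star p (1, dirVec none)) ∧ Q (star p (1, dirVec (some (s, g))))) ∨
          NearOne s (digitFreq m g (u s) q) p)) ≤ 1 / 50 + 8 / 15 := by
      refine (avg_mono fun p => ind_or_le _ _).trans ?_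
      rw [avg_add]
      exact add_le_add (hpair s g) (avg_nearOne_le s hq)
    -- The probability `1/50 + 8/15 = 83/150` is only slightly below 3/5, so `u` has to be close to
    -- one.
    refine (avg_count_le h1 r 3 5 (u := 103 / 100) (by norm_num)).trans ?_
    exact pow_le_pow_left₀ (by norm_num) (by norm_num) r
  have hbad : ∀ pts : Fin r → Pt d m × Pt d m, ind (¬ DigitsGood u
      (fun a w => Q (star (pts a) (1, dirVec w))) pts) ≤
      ∑ s : Fin d, ∑ g : Fin (numDigits m), (ind (2 * r ≤ 5 * count fun a =>
        ¬ (Q (star (pts a) (1, dirVec none)) ∧ Q (star (pts a) (1, dirVec (some (s, g)))))) +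
        ∑ q ∈ (Finset.range (digitBase m g)).filter fun q => digitFreq m g (u s) q ≠ 0,
        ind (3 * r ≤ 5 * count fun a =>
        ¬ (Q (star (pts a) (1, dirVec none)) ∧ Q (star (pts a) (1, dirVec (some (s, g))))) ∨
          NearOne s (digitFreq m g (u s) q) (pts a))) := by
    intro pts
    set E : Fin d → Fin (numDigits m) → Prop := fun s g => (2 * r ≤ 5 * count fun a =>
        ¬ (Q (star (pts a) (1, dirVec none)) ∧ Q (star (pts a) (1, dirVec (some (s, g)))))) ∨
        ∃ q ∈ (Finset.range (digitBase m g)).filter fun q => digitFreq m g (u s) q ≠ 0,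
        (3 * r ≤ 5 * count fun a =>
        ¬ (Q (star (pts a) (1, dirVec none)) ∧ Q (star (pts a) (1, dirVec (some (s, g))))) ∨
          NearOne s (digitFreq m g (u s) q) (pts a)) with hE
    refine (ind_mono (Q := ∃ s ∈ Finset.univ, ∃ g ∈ Finset.univ, E s g) fun h => ?_).trans
      ((ind_exists_le _ _).trans (Finset.sum_le_sum fun s _ =>
        (ind_exists_le _ _).trans (Finset.sum_le_sum fun g _ => ?_)))
    · by_contra hcon
      refine h fun s g => ?_
      have h1 : ¬ E s g := fun hE => hcon ⟨s, Finset.mem_univ s, g, Finset.mem_univ g, hE⟩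
      have h2 := not_or.1 h1
      exact ⟨not_le.1 h2.1, fun q hq hq0 => not_le.1 fun hc => h2.2 ⟨q, by simp [hq, hq0], hc⟩⟩
    · exact (ind_or_le _ _).trans (add_le_add le_rfl (ind_exists_le _ _))
  refine (avg_mono hbad).trans ?_
  rw [avg_sum, digitFailure]
  refine (Finset.sum_le_card_nsmul _ _ (numDigits m * ((1 + 2 ^ digitBits m) * (999 / 1000) ^ r) : ℝ)
    fun s _ => ?_).trans (le_of_eq (by simp))
  rw [avg_sum]
  refine (Finset.sum_le_card_nsmul _ _ ((1 + 2 ^ digitBits m) * (999 / 1000) ^ r : ℝ)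
    fun g _ => ?_).trans (le_of_eq (by simp))
  rw [avg_add, avg_sum, add_mul, one_mul]
  refine add_le_add (hcount s g) ?_
  refine (Finset.sum_le_card_nsmul _ _ ((999 / 1000) ^ r : ℝ) fun q hq =>
    hcount' s g q (Finset.mem_filter.1 hq).2).trans ?_
  rw [nsmul_eq_mul]
  refine mul_le_mul_of_nonneg_right ?_ (by positivity)
  have h1 := (Finset.card_filter_le (Finset.range (digitBase m g))
    (fun q => digitFreq m g (u s) q ≠ 0)).trans (le_of_eq (Finset.card_range _))
  have h2 : digitBase m g ≤ 2 ^ digitBits m :=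
    Nat.pow_le_pow_right (by norm_num) (min_le_left _ _)
  exact_mod_cast h1.trans h2

/-! ### Measurements -/

theorem ev_op_const (n : ℕ) (a : X) (φ : X → ℝ) {Y : Type} {v : Y → ℂ} :
    ev v (op n a : Alg Y X) (fun b _ => φ b) = φ a := by
  have h : Runs v (op n a : Alg Y X) (· = a) n := Runs.op rfl le_rfl
  apply le_antisymm
  · refine (Always.ev_le (ψ := fun _ _ => φ a) h fun b s t hb => ?_).trans (ev_const _ _).le
    rw [hb.1]
  · refine (ev_const _ _).symm.le.trans (Always.ev_le (φ := fun _ _ => φ a) h fun b s t hb => ?_)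
    rw [hb.1]

theorem ev_drawPerm (φ : Perm d m → ℝ) :
    ev v (drawPerm : Alg X (Perm d m)) (fun π _ => φ π) = permAvg φ := by
  rw [drawPerm, ev_bind, ev_uniform, permAvg, avg_prod]
  congr 1
  funext A
  rw [ev_bind, ev_uniform]
  congr 1
  funext q
  exact ev_op_const _ _ φ

/-- The measurements allow to find `i`. -/
def Locates (S : Finset (Pt d m)) (x : Pt d m → ℂ) (a : ℝ) (i : Pt d m)
    (M : Measurements d m e r) : Prop :=
  PermGood e S x a i M.perm ∧ DigitsGood (M.perm.mat.val.mulVec i)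
    (fun t w => PointGood e S x a i M.perm (star (M.pts t) (1, dirVec w))) M.pts

theorem ev_measure_not_locates {w : Pt d m → ℂ} {S : Finset (Pt d m)} {x : Pt d m → ℂ} {a : ℝ}
    (c F : ℕ) (g : ℤ → ℝ)
    (he1 : 1 ≤ e) (he : e ≤ m) (hd : 1 ≤ d) (h : HeadTail S x a)
    (hS : weightBound d e * S.card ≤ 1 / 10 ^ 7) (hr : digitFailure d m r ≤ 1 / 4)
    (i : Pt d m) :
    ev w (measure c e F g r : Alg (Pt d m) (Measurements d m e r))
      (fun M _ => ind (¬ Locates S x a i M)) ≤ 1 / 2 := by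
  set φ : Perm d m → (Fin r → Pt d m × Pt d m) → ℝ := fun π pts =>
    ind (¬ (PermGood e S x a i π ∧ DigitsGood (π.mat.val.mulVec i)
      (fun t w => PointGood e S x a i π (star (pts t) (1, dirVec w))) pts)) with hφ
  -- The event involves the permutation and the evaluation points only, not the values measured, so
  -- everything after the two draws integrates to a constant.
  have h1 : ev w (measure c e F g r : Alg (Pt d m) (Measurements d m e r))
      (fun M _ => ind (¬ Locates S x a i M)) = permAvg fun π => avg (φ π) := by
    rw [measure, ev_bind, ← ev_drawPerm (v := w)]
    congr 1
    funext π _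
    rw [ev_bind, ev_uniform]
    congr 1
    funext pts
    rw [ev_bind]
    refine Eq.trans ?_ (ev_const (v := w) (charge (2 * d * r)) _)
    congr 1
    funext _ _
    rw [ev_bind]
    show ev w _ (fun _ _ => φ π pts) = φ π pts
    exact ev_const _ _
  rw [h1]
  have h2 : ∀ π, avg (φ π) ≤ ind (¬ PermGood e S x a i π) + 1 / 4 := by
    intro π
    by_cases hπ : PermGood e S x a i π
    · have h3 := ind_nonneg (¬ PermGood e S x a i π)
      have h4 := avg_not_digitsGood (r := r) (PointGood e S x a i π)
        (avg_not_pointGood π i h.nonneg hπ) (π.mat.val.mulVec i)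
      refine (avg_mono fun pts => ind_mono fun hn => ?_).trans (h4.trans (by linarith))
      exact fun hD => hn ⟨hπ, hD⟩
    · rw [ind_of hπ]
      refine avg_le_const fun pts => (ind_le_one _).trans (by norm_num)
  refine (permAvg_mono h2).trans ?_
  have h5 := permAvg_not_permGood he1 he hd h hS i
  rw [permAvg] at h5 ⊢
  rw [avg_add, avg_const]
  linarith

/-- Bound for the number of steps of `measure`. -/
def measureTime (d m c e r : ℕ) : ℝ :=
  (d ^ 2 + d + 2) + (1 + (2 * d * r + r * ((1 + d * numDigits m) *
    (3 * d + hashTime d m c e (2 * d) 0 + 1) + 1)))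

theorem drawPerm_runs : Runs v (drawPerm : Alg X (Perm d m)) (fun _ => True) (d ^ 2 + d + 2) :=
  ((Runs.uniform le_rfl).bind fun _ _ => (Runs.uniform le_rfl).bind fun _ _ =>
    Runs.op (t := d ^ 2 + d) trivial (by push_cast; rfl)).le (by linarith)

/-- With `χ = 0` the error bound is zero, so the stored values are exact. Approximation errors arise
only when a known vector is subtracted later. -/
theorem measure_runs {c : ℕ} (hc : 1 ≤ c) (hd : 1 ≤ d) (he : e ≤ m)
    (hε : d * (4 * 2 ^ m / 2 ^ (c * (m * d)) : ℝ) ≤ 1) (x : Pt d m → ℂ) :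
    Runs (dft x) (measure c e (2 * d) (filterCoeff (halfWidth e) (2 * d)) r)
      (fun M : Measurements d m e r => M.Valid x) (measureTime d m c e r) := by
  unfold measure
  refine (drawPerm_runs.bind fun π _ => (Runs.uniform (t := 1) le_rfl).bind fun pts _ =>
    (Runs.charge (t := 2 * d * r) (by push_cast; rfl)).bind fun _ _ =>
    (Runs.tabulate (t := (1 + d * numDigits m) * (3 * d + hashTime d m c e (2 * d) 0 + 1))
      (Q := fun t (W : Dir d m → Pt d e → ℂ) => ∀ w s,
        W w s = hashed e (2 * d) π (star (pts t) (1, dirVec w)) x s) fun t _ => ?_).bind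
      (t' := 0) fun val hval => Runs.pure ?_ le_rfl).le ?_
  · refine (Runs.tabulate_univ (t := 3 * d + hashTime d m c e (2 * d) 0)
      (Q := fun w (W : Pt d e → ℂ) => ∀ s,
        W s = hashed e (2 * d) π (star (pts t) (1, dirVec w)) x s) fun w => ?_).le
      (le_of_eq (by rw [card_Dir]; push_cast; ring))
    refine (Runs.op (t := 3 * d) (Q := fun z => z = star (pts t) (1, dirVec w)) rfl
      (by push_cast; rfl)).bind fun z hz => (hashToBins_runs hc hd he hε x 0 π z).mono
        (fun u hu s => ?_) (by simp [supp])
    have h1 := hu s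
    rw [l1_zero, zero_mul, sub_zero, hz] at h1
    exact sub_eq_zero.1 (norm_le_zero_iff.1 h1)
  · exact fun t w s => hval.1 t (List.mem_finRange t) w s
  · rw [measureTime, List.length_finRange]
    linarith

theorem forall₂_const {α β : Type*} {Q : β → Prop} {l : List α} {l' : List β}
    (h : List.Forall₂ (fun _ b => Q b) l l') : l'.length = l.length ∧ ∀ b ∈ l', Q b := by
  induction h with
  | nil => simp
  | cons h1 _ ih => exact ⟨by simp [ih.1], by simpa using ⟨h1, ih.2⟩⟩

theorem list_prod_ind_eq_one {α : Type*} {l : List α} {P : α → Prop} (h : ∀ b ∈ l, P b) :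
    (l.map fun b => ind (P b)).prod = 1 := by
  induction l with
  | nil => simp
  | cons b l ih =>
      rw [List.map_cons, List.prod_cons, ind_of (h b (by simp)), one_mul,
        ih fun b hb => h b (by simp [hb])]

/-- For each `i` in `S` the product of the failure indicators of the `n` independent measurements
has expectation at most `2^(-n)`. The majorant is the sum of these products over `S`. -/
theorem measurements_likely {c n : ℕ} (hc : 1 ≤ c) (hd : 1 ≤ d) (he1 : 1 ≤ e) (he : e ≤ m)
    (hε : d * (4 * 2 ^ m / 2 ^ (c * (m * d)) : ℝ) ≤ 1) (x : Pt d m → ℂ)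
    {S : Finset (Pt d m)} {x' : Pt d m → ℂ} {a : ℝ} (h : HeadTail S x' a)
    (hS : weightBound d e * S.card ≤ 1 / 10 ^ 7) (hr : digitFailure d m r ≤ 1 / 4) :
    Likely (dft x) (collect (fun _ : ℕ =>
        measure c e (2 * d) (filterCoeff (halfWidth e) (2 * d)) r) (List.range n))
      (fun Ms : List (Measurements d m e r) => (Ms.length = n ∧ ∀ M ∈ Ms, M.Valid x) ∧
        ∀ i ∈ S, ∃ M ∈ Ms, Locates S x' a i M)
      (n * (measureTime d m c e r + 1)) (S.card * (1 / 2) ^ n) := by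
  refine Runs.likely (((Runs.collect fun _ _ => measure_runs hc hd he hε x).imp
      fun Ms hMs => ?_).le (le_of_eq (by rw [List.length_range])))
    (fun Ms => ∑ i ∈ S, (Ms.map fun M => ind (¬ Locates S x' a i M)).prod)
    (fun Ms _ => Finset.sum_nonneg fun i _ => List.prod_nonneg fun b hb => ?_)
    (fun Ms _ hn => ?_) ?_
  · simpa using forall₂_const hMs
  · obtain ⟨M, -, rfl⟩ := List.mem_map.1 hb
    exact ind_nonneg _
  · push Not at hn
    obtain ⟨i, hi, hM⟩ := hn
    refine le_trans ?_ (Finset.single_le_sum (f := fun i =>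
      (Ms.map fun M => ind (¬ Locates S x' a i M)).prod) (fun i _ =>
        List.prod_nonneg fun b hb => ?_) hi)
    · rw [list_prod_ind_eq_one hM]
    · obtain ⟨M, -, rfl⟩ := List.mem_map.1 hb
      exact ind_nonneg _
  · rw [ev_sum, ← nsmul_eq_mul]
    refine Finset.sum_le_card_nsmul _ _ _ fun i _ => ?_
    rw [ev_collect_prod, List.map_const', List.prod_replicate, List.length_range]
    exact pow_le_pow_left₀ (ev_nonneg _ fun _ _ => ind_nonneg _)
      (ev_measure_not_locates _ _ _ he1 he hd h hS hr i) n

/-- Location of the large entries of a residual signal. -/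
theorem locateSignal_residual_runs {c : ℕ} (hc : 1 ≤ c) (hd : 1 ≤ d) (he1 : 1 ≤ e) (he : e ≤ m)
    (hdb : 1 ≤ digitBits m) (hε : d * (4 * 2 ^ m / 2 ^ (c * (m * d)) : ℝ) ≤ 1)
    (x χ : Pt d m → ℂ) (M : Measurements d m e r) (hM : M.Valid x)
    {S : Finset (Pt d m)} {x' : Pt d m → ℂ} {a : ℝ} (ha : 0 ≤ a)
    (hy : ∀ j ∈ S, ‖(x - χ) j‖ ≤ ‖x' j‖ + a) (hy' : ∀ j ∉ S, (x - χ) j = x' j)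
    (herr : l1 χ * semiErr d m c ≤ (2 / Real.pi) ^ (2 * d ^ 2) * (a / 10)) :
    Runs v (locateSignal c (2 * d) (filterCoeff (halfWidth e) (2 * d)) χ M) (fun L =>
      L.card ≤ (2 ^ e) ^ d ∧ ∀ i, Locates S x' a i M → 8 * a < ‖(x - χ) i‖ → i ∈ L)
      (locateTime d m c e r (supp χ).card) := by
  refine (locateSignal_runs hc hd he1 he hdb hε x χ M hM).imp fun L hL =>
    ⟨hL.1, fun i hi hbig => hL.2 i (norm_pos_iff.1 (by linarith)) ?_⟩
  -- The factor 8 comes from here: noise `a/10` and approximation error `a/10`, both times the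
  -- filter value, add up to `8a/40`.
  refine hi.2.mono fun t w hw => ?_
  have h1 := norm_noise_le_of_permGood hi.1 hy hy' hw
  have hG := filter_self_ge he1 he M.perm i
  have hG0 := filter_self_pos he1 he M.perm i
  have h2 := herr.trans (mul_le_mul_of_nonneg_right hG (by positivity))
  have h3 := mul_le_mul_of_nonneg_left h1 hG0.le
  have h4 := mul_le_mul_of_nonneg_left hbig.le hG0.le
  linarith

end

section

variable {X : Type} {d m e r : ℕ} {v : X → ℂ}

/-! ### Medians -/

/-- If the median were off by more than `ε`, all entries on its far side in the sorted list would be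
off as well, and together with the median these are at least half of the list. -/
theorem median_le {l : List ℝ} {y ε : ℝ} (h : 2 * l.countP (fun t => ε < |t - y|) < l.length) :
    |median l - y| ≤ ε := by
  set l' := l.mergeSort fun a b => decide (a ≤ b) with hl'
  have hperm : l'.Perm l := List.mergeSort_perm _ _
  have hlen : l'.length = l.length := hperm.length_eq
  have hsort : l'.Pairwise (· ≤ ·) := List.pairwise_mergeSort' (· ≤ ·) l
  have hcnt : l'.countP (fun t => ε < |t - y|) = l.countP (fun t => ε < |t - y|) :=
    hperm.countP_eq _
  have hn : l.length / 2 < l'.length := by omega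
  have hmed : median l = l'[l.length / 2] := by
    rw [median, ← hl', List.getD_eq_getElem?_getD, List.getElem?_eq_getElem hn, Option.getD_some]
  by_contra hcon
  rw [not_le, hmed] at hcon
  rw [List.pairwise_iff_getElem] at hsort
  have hmono : ∀ (i j : ℕ) (hi : i < l'.length) (hj : j < l'.length), i ≤ j → l'[i] ≤ l'[j] := by
    intro i j hi hj hij
    rcases hij.eq_or_lt with rfl | hij
    · exact le_rfl
    · exact hsort i j hi hj hij
  rcases le_total (l'[l.length / 2]) y with hy | hy
  · rw [abs_of_nonpos (by linarith)] at hcon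
    have h1 : (l'.take (l.length / 2 + 1)).countP (fun t => ε < |t - y|) =
        (l'.take (l.length / 2 + 1)).length := by
      rw [List.countP_eq_length]
      intro t ht
      obtain ⟨i, hi, rfl⟩ := List.getElem_of_mem ht
      rw [List.length_take] at hi
      rw [List.getElem_take, decide_eq_true_eq]
      have := hmono i (l.length / 2) (by omega) hn (by omega)
      rw [abs_of_nonpos (by linarith)]
      linarith
    have h2 := (List.take_sublist (l.length / 2 + 1) l').countP_le (p := fun t => ε < |t - y|)
    rw [h1, hcnt, List.length_take] at h2
    omega
  · rw [abs_of_nonneg (by linarith)] at hcon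
    have h1 : (l'.drop (l.length / 2)).countP (fun t => ε < |t - y|) =
        (l'.drop (l.length / 2)).length := by
      rw [List.countP_eq_length]
      intro t ht
      obtain ⟨i, hi, rfl⟩ := List.getElem_of_mem ht
      rw [List.length_drop] at hi
      rw [List.getElem_drop, decide_eq_true_eq]
      have := hmono (l.length / 2) (l.length / 2 + i) hn (by omega) (by omega)
      rw [abs_of_nonneg (by linarith)]
      linarith
    have h2 := (List.drop_sublist (l.length / 2) l').countP_le (p := fun t => ε < |t - y|)
    rw [h1, hcnt, List.length_drop] at h2
    omega

theorem median_map_le {ι : Type*} {l : List ι} {f : ι → ℝ} {y ε : ℝ} {P : ι → Prop}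
    [DecidablePred P] (hP : ∀ i ∈ l, ¬ P i → |f i - y| ≤ ε)
    (h : 2 * l.countP (fun i => P i) < l.length) : |median (l.map f) - y| ≤ ε := by
  refine median_le (lt_of_le_of_lt (Nat.mul_le_mul_left 2 ?_) (h.trans_eq (by simp)))
  rw [List.countP_map]
  refine List.countP_mono_left fun i hi hfi => ?_
  simp only [Function.comp, decide_eq_true_eq] at hfi ⊢
  by_contra hn
  exact absurd (hP i hi hn) (not_le.2 hfi)

theorem list_prod_weight {ι : Type*} (P : ι → Prop) [DecidablePred P] (U : ℝ) (l : List ι) :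
    (l.map fun i => 1 + ind (P i) * (U - 1)).prod = U ^ l.countP (fun i => P i) := by
  induction l with
  | nil => simp
  | cons i l ih =>
      rw [List.map_cons, List.prod_cons, ih, List.countP_cons]
      by_cases h : P i
      · simp [h, ind_of, pow_succ]; ring
      · simp [h, ind_of_not]

/-! ### Estimation -/

/-- One hashing with a random permutation and a random evaluation point. -/
def randomHash (c e F : ℕ) (g : ℤ → ℝ) (χ : Pt d m → ℂ) :
    Alg (Pt d m) (Perm d m × Pt d m × (Pt d e → ℂ)) := do
  let π : Perm d m ← drawPerm
  let z : Pt d m ← uniform (Pt d m)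
  charge d
  let u ← hashToBins c e F g χ π z
  pure (π, z, u)

/-- A random hashing puts much noise into the bucket of `i`. -/
def HashBad (S : Finset (Pt d m)) (x : Pt d m → ℂ) (a : ℝ) (i : Pt d m)
    (h : Perm d m × Pt d m × (Pt d e → ℂ)) : Prop :=
  ¬ (PermGood e S x a i h.1 ∧ PointGood e S x a i h.1 h.2.1)

theorem ev_randomHash_bad {w : Pt d m → ℂ} {S : Finset (Pt d m)} {x : Pt d m → ℂ} {a : ℝ}
    (c F : ℕ) (g : ℤ → ℝ) (χ : Pt d m → ℂ)
    (he1 : 1 ≤ e) (he : e ≤ m) (hd : 1 ≤ d) (h : HeadTail S x a)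
    (hS : weightBound d e * S.card ≤ 1 / 10 ^ 7) (i : Pt d m) :
    ev w (randomHash c e F g χ) (fun o _ => ind (HashBad S x a i o)) ≤ 1 / 50 := by
  set φ : Perm d m → Pt d m → ℝ := fun π z =>
    ind (¬ (PermGood e S x a i π ∧ PointGood e S x a i π z)) with hφ
  have h1 : ev w (randomHash c e F g χ) (fun o _ => ind (HashBad S x a i o)) =
      permAvg fun π => avg (φ π) := by
    rw [randomHash, ev_bind, ← ev_drawPerm (v := w)]
    congr 1
    funext π _
    rw [ev_bind, ev_uniform]
    congr 1
    funext z
    rw [ev_bind]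
    refine Eq.trans ?_ (ev_const (v := w) (charge d) _)
    congr 1
    funext _ _
    rw [ev_bind]
    show ev w _ (fun _ _ => φ π z) = φ π z
    exact ev_const _ _
  rw [h1]
  have h2 : ∀ π, avg (φ π) ≤ ind (¬ PermGood e S x a i π) + 1 / 100 := by
    intro π
    by_cases hπ : PermGood e S x a i π
    · have h3 := ind_nonneg (¬ PermGood e S x a i π)
      refine (avg_mono fun z => ind_mono fun hn => ?_).trans
        ((avg_not_pointGood π i h.nonneg hπ).trans (by linarith))
      exact fun hz => hn ⟨hπ, hz⟩
    · rw [ind_of hπ]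
      exact avg_le_const fun z => (ind_le_one _).trans (by norm_num)
  refine (permAvg_mono h2).trans ?_
  have h5 := permAvg_not_permGood he1 he hd h hS i
  rw [permAvg] at h5 ⊢
  rw [avg_add, avg_const]
  linarith

/-- The estimate of the entry at `f` from one hashing. -/
def estimate (f : Pt d m) (h : Perm d m × Pt d m × (Pt d e → ℂ)) : ℂ :=
  (h.2.2 (bucket e h.1 f) / (filter e (2 * d) (offset e h.1 f f) : ℂ)) *
    root (-(h.2.1 ⬝ᵥ h.1.mat.val.mulVec f))

/-- Noise `a/10` plus approximation error `a/40`, the latter divided by the filter value; the lower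
bound for the filter is built into the hypothesis on `ε`. -/
theorem norm_estimate_sub_le (he1 : 1 ≤ e) (he : e ≤ m) {S : Finset (Pt d m)}
    {x y : Pt d m → ℂ} {a ε : ℝ} (hS : ∀ j ∈ S, ‖y j‖ ≤ ‖x j‖ + a) (hS' : ∀ j ∉ S, y j = x j)
    (herr : ε ≤ (2 / Real.pi) ^ (2 * d ^ 2) * (a / 40)) (ha : 0 ≤ a) (f : Pt d m)
    (h : Perm d m × Pt d m × (Pt d e → ℂ))
    (hu : ∀ s, ‖h.2.2 s - hashed e (2 * d) h.1 h.2.1 y s‖ ≤ ε) (hg : ¬ HashBad S x a f h) :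
    ‖estimate f h - y f‖ ≤ a / 8 := by
  obtain ⟨π, z, u⟩ := h
  simp only [HashBad, not_not] at hg hu
  simp only [estimate]
  have h1 := norm_noise_le_of_permGood hg.1 hS hS' hg.2
  have hG := filter_self_ge he1 he π f
  have hG0 := filter_self_pos he1 he π f
  have h2 := hu (bucket e π f)
  rw [hashed_bucket he1 he] at h2
  set G := filter e (2 * d) (offset e π f f)
  set R := root (z ⬝ᵥ π.mat.val.mulVec f) with hR
  have hR0 : R ≠ 0 := root_ne_zero _
  have hRn : ‖R‖ = 1 := norm_root _
  set nz := noise e π f (Finset.univ.erase f) y z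
  have hGc : (G : ℂ) ≠ 0 := by exact_mod_cast hG0.ne'
  rw [root_neg, ← hR]
  have h3 : u (bucket e π f) / (G : ℂ) * R⁻¹ - y f =
      ((u (bucket e π f) - (G : ℂ) * (y f * R + nz)) / G + nz) * R⁻¹ := by
    field_simp
    ring
  rw [h3, norm_mul, norm_inv, hRn, inv_one, mul_one]
  refine (norm_add_le _ _).trans ?_
  rw [norm_div, Complex.norm_real, Real.norm_eq_abs, abs_of_pos hG0]
  have h4 : ‖u (bucket e π f) - (G : ℂ) * (y f * R + nz)‖ / G ≤ a / 40 := by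
    rw [div_le_iff₀ hG0]
    refine h2.trans (herr.trans ?_)
    rw [mul_comm (a / 40)]
    exact mul_le_mul_of_nonneg_right hG (by positivity)
  linarith

/-- Bound for the number of steps of `randomHash`. -/
def randomHashTime (d m c e : ℕ) (len : ℝ) : ℝ :=
  (d ^ 2 + d + 2) + (1 + (d + hashTime d m c e (2 * d) len))

theorem randomHash_runs {c : ℕ} (hc : 1 ≤ c) (hd : 1 ≤ d) (he : e ≤ m)
    (hε : d * (4 * 2 ^ m / 2 ^ (c * (m * d)) : ℝ) ≤ 1) (x χ : Pt d m → ℂ) :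
    Runs (dft x) (randomHash c e (2 * d) (filterCoeff (halfWidth e) (2 * d)) χ)
      (fun h => ∀ s, ‖h.2.2 s - hashed e (2 * d) h.1 h.2.1 (x - χ) s‖ ≤ l1 χ * semiErr d m c)
      (randomHashTime d m c e (supp χ).card) := by
  unfold randomHash
  refine (drawPerm_runs.bind fun π _ => (Runs.uniform (t := 1) le_rfl).bind fun z _ =>
    (Runs.charge (t := d) le_rfl).bind fun _ _ =>
    (hashToBins_runs hc hd he hε x χ π z).bind (t' := 0) fun u hu => Runs.pure hu le_rfl).le ?_
  rw [randomHashTime]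
  linarith

/-- All medians of estimates are accurate. -/
def Accurate (S : Finset (Pt d m)) (x : Pt d m → ℂ) (a : ℝ)
    (hs : List (Perm d m × Pt d m × (Pt d e → ℂ))) : Prop :=
  ∀ f, ∃ P : Perm d m × Pt d m × (Pt d e → ℂ) → Bool,
    (∀ h, P h = false → ¬ HashBad S x a f h) ∧ 2 * hs.countP P < hs.length

/-- A majority of bad hashings at a location has probability at most `2^(-n)`. The union bound is
over all `N` locations, so the result does not depend on the list to be estimated. -/
theorem hashes_likely {c n : ℕ} (hc : 1 ≤ c) (hd : 1 ≤ d) (he1 : 1 ≤ e) (he : e ≤ m)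
    (hε : d * (4 * 2 ^ m / 2 ^ (c * (m * d)) : ℝ) ≤ 1) (x χ : Pt d m → ℂ)
    {S : Finset (Pt d m)} {x' : Pt d m → ℂ} {a : ℝ} (h : HeadTail S x' a)
    (hS : weightBound d e * S.card ≤ 1 / 10 ^ 7) :
    Likely (dft x) (collect (fun _ : ℕ =>
        randomHash c e (2 * d) (filterCoeff (halfWidth e) (2 * d)) χ) (List.range n))
      (fun hs => (hs.length = n ∧ ∀ h ∈ hs, ∀ s,
        ‖h.2.2 s - hashed e (2 * d) h.1 h.2.1 (x - χ) s‖ ≤ l1 χ * semiErr d m c) ∧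
        Accurate S x' a hs)
      (n * (randomHashTime d m c e (supp χ).card + 1)) (size d m * (1 / 2) ^ n) := by
  classical
  have hψ0 : ∀ i (o : Perm d m × Pt d m × (Pt d e → ℂ)),
      0 ≤ 1 + ind (HashBad S x' a i o) * ((9 : ℝ) - 1) := fun i o => by
    have := ind_nonneg (HashBad S x' a i o); linarith
  have hprod0 : ∀ i (hs : List (Perm d m × Pt d m × (Pt d e → ℂ))),
      0 ≤ (1 / 3 : ℝ) ^ n *
        (hs.map fun o => 1 + ind (HashBad S x' a i o) * ((9 : ℝ) - 1)).prod := by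
    intro i hs
    refine mul_nonneg (by positivity) (List.prod_nonneg fun b hb => ?_)
    obtain ⟨o, -, rfl⟩ := List.mem_map.1 hb
    exact hψ0 i o
  refine Runs.likely (((Runs.collect fun _ _ => randomHash_runs hc hd he hε x χ).imp
      fun hs hhs => ?_).le (le_of_eq (by rw [List.length_range])))
    -- Each summand is `3^(2 · count - n)`, at least one if half of the hashings are bad. Its
    -- expectation is at most `((1 + 8/50)/3)^n ≤ 2^(-n)`.
    (fun hs => ∑ i : Pt d m, (1 / 3 : ℝ) ^ n *
      (hs.map fun o => 1 + ind (HashBad S x' a i o) * ((9 : ℝ) - 1)).prod)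
    (fun hs _ => Finset.sum_nonneg fun i _ => hprod0 i hs)
    (fun hs hhs hn => ?_) ?_
  · simpa using forall₂_const hhs
  · rw [Accurate] at hn
    push Not at hn
    obtain ⟨i, hi⟩ := hn
    have h1 := hi (fun o => decide (HashBad S x' a i o)) fun o ho => by simpa using ho
    refine le_trans ?_ (Finset.single_le_sum (f := fun i : Pt d m => (1 / 3 : ℝ) ^ n *
      (hs.map fun o => 1 + ind (HashBad S x' a i o) * ((9 : ℝ) - 1)).prod)
      (fun i _ => hprod0 i hs) (Finset.mem_univ i))
    rw [list_prod_weight, show (9 : ℝ) = 3 ^ 2 by norm_num, ← pow_mul, one_div, inv_pow,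
      inv_mul_eq_div, one_le_div (by positivity)]
    exact pow_le_pow_right₀ (by norm_num) (hhs.1 ▸ h1)
  · rw [ev_sum, show size d m = ((Finset.univ : Finset (Pt d m)).card : ℝ) by
      rw [Finset.card_univ, card_Pt, size]; push_cast; rfl, ← nsmul_eq_mul]
    refine Finset.sum_le_card_nsmul _ _ _ fun i _ => ?_
    rw [ev_const_mul, ev_collect_prod, List.map_const', List.prod_replicate, List.length_range,
      ← mul_pow]
    refine pow_le_pow_left₀ (mul_nonneg (by norm_num) (ev_nonneg _ fun o _ => hψ0 i o)) ?_ n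
    have h1 := ev_randomHash_bad (w := dft x) c (2 * d) (filterCoeff (halfWidth e) (2 * d)) χ
      he1 he hd h hS i
    have h2 : ev (dft x) (randomHash c e (2 * d) (filterCoeff (halfWidth e) (2 * d)) χ)
        (fun o _ => 1 + ind (HashBad S x' a i o) * ((9 : ℝ) - 1)) =
        1 + (9 - 1) * ev (dft x) (randomHash c e (2 * d) (filterCoeff (halfWidth e) (2 * d)) χ)
          (fun o _ => ind (HashBad S x' a i o)) := by
      rw [← ev_const_mul, ← ev_const (v := dft x)
        (randomHash c e (2 * d) (filterCoeff (halfWidth e) (2 * d)) χ) (1 : ℝ), ← ev_add]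
      simp only [ev_const, mul_comm]
    rw [h2]
    linarith

/-- Bound for the number of steps of `estimateValues` with `2 ^ e` buckets per coordinate. -/
def estimateTime (d m c e r : ℕ) (len size : ℝ) : ℝ :=
  filterTime (halfWidth e) (2 * d) + (r * (randomHashTime d m c e len + 1) +
    size * (r * (4 * d ^ 2 + 30 * d + 10 + 1) + (10 * (r + 1) * (Nat.log 2 r + 1) + (d + 4))))

theorem norm_sub_le_of_re_im {z w : ℂ} {ε : ℝ} (h1 : |z.re - w.re| ≤ ε) (h2 : |z.im - w.im| ≤ ε) :
    ‖z - w‖ ≤ 2 * ε := by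
  have := Complex.norm_le_abs_re_add_abs_im (z - w)
  rw [Complex.sub_re, Complex.sub_im] at this
  linarith

theorem estimateValues_likely {α : ℝ} {c k : ℕ} (hc : 1 ≤ c) (hd : 1 ≤ d)
    (hek : e = bucketExp d ((2 * Real.pi) ^ (4 * d * (2 * d)) * k / α ^ (2 * d)))
    (he1 : 1 ≤ e) (he : e ≤ m)
    (hε : d * (4 * 2 ^ m / 2 ^ (c * (m * d)) : ℝ) ≤ 1) (x χ : Pt d m → ℂ)
    {S : Finset (Pt d m)} {x' : Pt d m → ℂ} {a : ℝ} (h : HeadTail S x' a)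
    (hS : weightBound d e * S.card ≤ 1 / 10 ^ 7)
    (hy : ∀ j ∈ S, ‖(x - χ) j‖ ≤ ‖x' j‖ + a) (hy' : ∀ j ∉ S, (x - χ) j = x' j)
    (herr : l1 χ * semiErr d m c ≤ (2 / Real.pi) ^ (2 * d ^ 2) * (a / 40))
    (L : Finset (Pt d m)) (threshold : ℝ) (r : ℕ) :
    Likely (dft x) (estimateValues α c χ L k threshold r)
      (fun w => (∀ f ∉ L, w f = 0) ∧ ∀ f ∈ L, ∃ v : ℂ, ‖v - (x - χ) f‖ ≤ a / 4 ∧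
        w f = if threshold < ‖v‖ then v else 0)
      (estimateTime d m c e r (supp χ).card L.card) (size d m * (1 / 2) ^ r) := by
  classical
  subst hek
  unfold estimateValues
  set e := bucketExp d ((2 * Real.pi) ^ (4 * d * (2 * d)) * k / α ^ (2 * d)) with hek
  have hN := size_pos d m
  refine Likely.mono (Likely.bind (δ := 0) (δ' := size d m * (1 / 2) ^ r)
    (t' := r * (randomHashTime d m c e (supp χ).card + 1) +
      L.card * (r * (4 * d ^ 2 + 30 * d + 10 + 1) +
        (10 * (r + 1) * (Nat.log 2 r + 1) + (d + 4))))
    (filterTable_runs (halfWidth e) (2 * d)).likely_zero (by positivity)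
    fun g hg => ?_) (fun _ => id) le_rfl (zero_add _).le
  subst hg
  refine Likely.mono (Likely.bind (δ' := 0) (hashes_likely hc hd he1 he hε x χ h hS) le_rfl
    fun hs hhs => Runs.likely_zero ?_) (fun _ => id) le_rfl (add_zero _).le
  obtain ⟨⟨hlen, hval⟩, hacc⟩ := hhs
  -- The medians of real and imaginary parts are taken separately, each within `a/8`.
  have hmed : ∀ f : Pt d m, ‖(⟨median ((hs.map (estimate f)).map Complex.re),
      median ((hs.map (estimate f)).map Complex.im)⟩ : ℂ) - (x - χ) f‖ ≤ a / 4 := by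
    intro f
    obtain ⟨P, hP, hcnt⟩ := hacc f
    have hest : ∀ o ∈ hs, ¬ (P o = true) → ‖estimate f o - (x - χ) f‖ ≤ a / 8 := fun o ho hPo =>
      norm_estimate_sub_le he1 he hy hy' herr h.nonneg f o (hval o ho) (hP o (by simpa using hPo))
    refine (norm_sub_le_of_re_im (ε := a / 8) ?_ ?_).trans (le_of_eq (by ring))
    · show |median ((hs.map (estimate f)).map Complex.re) - ((x - χ) f).re| ≤ a / 8
      rw [List.map_map]
      refine median_map_le (P := fun o => P o = true) (fun o ho hPo => ?_) (by simpa using hcnt)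
      exact (Complex.abs_re_le_norm _).trans (hest o ho hPo)
    · show |median ((hs.map (estimate f)).map Complex.im) - ((x - χ) f).im| ≤ a / 8
      rw [List.map_map]
      refine median_map_le (P := fun o => P o = true) (fun o ho hPo => ?_) (by simpa using hcnt)
      exact (Complex.abs_im_le_norm _).trans (hest o ho hPo)
  refine Runs.mono (Runs.foldlM_rec (t := r * (4 * d ^ 2 + 30 * d + 10 + 1) +
      (10 * (r + 1) * (Nat.log 2 r + 1) + (d + 4)))
    (fun p (w : Pt d m → ℂ) => (∀ f ∉ p, w f = 0) ∧ ∀ f ∈ p, ∃ v : ℂ,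
      ‖v - (x - χ) f‖ ≤ a / 4 ∧ w f = if threshold < ‖v‖ then v else 0) (by simp)
    fun p f q hl w hw => ?_) (fun w hw => ?_) (by rw [Finset.length_toList])
  · have hfp : f ∉ p := by
      have hnd := L.nodup_toList
      rw [hl] at hnd
      intro hf
      exact (List.nodup_append.1 hnd).2.2 f hf f (by simp) rfl
    refine Runs.le (Runs.bind (Q := fun ws => ws = hs.map (estimate f))
      (Runs.le (Runs.collect_eq (t := 4 * d ^ 2 + 30 * d + 10) fun o _ =>
        Runs.op rfl (by push_cast; rfl)) (le_of_eq (by rw [hlen])))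
      fun ws hws => Runs.bind (Q := fun v => v = (⟨median ((hs.map (estimate f)).map Complex.re),
        median ((hs.map (estimate f)).map Complex.im)⟩ : ℂ)) (t := 10 * (r + 1) * (Nat.log 2 r + 1))
        (Runs.op (by rw [hws]) (by push_cast; rfl)) fun v hv =>
        Runs.op (t := d + 4) ?_ (by push_cast; rfl)) le_rfl
    refine ⟨fun f' hf' => ?_, fun f' hf' => ?_⟩
    · rw [List.mem_append, List.mem_singleton, not_or] at hf'
      have h1 := hw.1 f' hf'.1
      split_ifs
      · rw [Function.update_of_ne hf'.2, h1]
      · exact h1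
    · rw [List.mem_append, List.mem_singleton] at hf'
      by_cases hff : f' = f
      · subst hff
        refine ⟨v, hv ▸ hmed f', ?_⟩
        split_ifs
        · simp
        · exact hw.1 f' hfp
      · obtain ⟨v', hv1, hv2⟩ := hw.2 f' (hf'.resolve_right hff)
        refine ⟨v', hv1, ?_⟩
        rw [← hv2]
        split_ifs
        · rw [Function.update_of_ne hff]
        · rfl
  · simpa using hw

end

section

variable {X : Type} {d m e r : ℕ} {v : X → ℂ}

/-! ### Monotonicity of the time bounds -/

theorem hashTime_mono (d m c e F : ℕ) {s t : ℝ} (h : s ≤ t) :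
    hashTime d m c e F s ≤ hashTime d m c e F t := by
  unfold hashTime semiTime
  gcongr

theorem locateTime_mono (d m c e r : ℕ) {s t : ℝ} (h : s ≤ t) :
    locateTime d m c e r s ≤ locateTime d m c e r t := by
  have := hashTime_mono d m c e (2 * d) h
  unfold locateTime
  gcongr

theorem estimateTime_mono (d m c e r : ℕ) {s t s' t' : ℝ} (h : s ≤ t) (h' : s' ≤ t') :
    estimateTime d m c e r s s' ≤ estimateTime d m c e r t t' := by
  have := hashTime_mono d m c e (2 * d) h
  unfold estimateTime randomHashTime
  gcongr

/-! ### The iteration -/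

theorem sumSparse_runs (x y : Pt d m → ℂ) {p q : ℝ} (hx : (supp x).card ≤ p)
    (hy : (supp y).card ≤ q) :
    Runs v (sumSparse x y : Alg X (Pt d m → ℂ)) (· = x + y) (2 * (d + 1) * (p + q + 1)) := by
  refine Runs.op rfl ?_
  push_cast
  gcongr

theorem card_supp_le_of_subset {x : Pt d m → ℂ} {S : Finset (Pt d m)} (h : ∀ i ∉ S, x i = 0) :
    (supp x).card ≤ S.card := by
  refine Finset.card_le_card fun i hi => ?_
  by_contra hiS
  exact (Finset.mem_filter.1 hi).2 (h i hiS)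

theorem card_supp_add_le (x y : Pt d m → ℂ) :
    (supp (x + y)).card ≤ (supp x).card + (supp y).card := by
  classical
  refine (Finset.card_le_card fun i hi => ?_).trans (Finset.card_union_le _ _)
  rw [Finset.mem_union]
  by_contra hcon
  rw [not_or] at hcon
  simp only [supp, Finset.mem_filter, Finset.mem_univ, true_and, not_not, Pi.add_apply] at hcon hi
  exact hi (by rw [hcon.1, hcon.2, add_zero])

/-- Bound for the number of steps of one iteration of `reduceInfNorm`. -/
def iterationTime (d m c e₁ e₂ r n n' k : ℕ) (len : ℝ) : ℝ :=
  2 * (d + 1) * (len + k + 1) +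
    (n * (locateTime d m c e₁ r (len + k) + (d + 1) * ((2 ^ e₁) ^ d + 1)) +
      (estimateTime d m c e₂ n' (len + k) (n * (2 ^ e₁) ^ d) + 2 * (d + 1) * (k + k + 1)))

/-- The residual signal is at most as large as the signal, and it is unchanged outside `S`. -/
structure Residual (S : Finset (Pt d m)) (x' χt : Pt d m → ℂ) (a : ℝ) : Prop where
  zero : ∀ j ∉ S, χt j = 0
  le : ∀ j ∈ S, ‖x' j - χt j‖ ≤ ‖x' j‖ + a

theorem locate_all_runs {c : ℕ} (hc : 1 ≤ c) (hd : 1 ≤ d) (he1 : 1 ≤ e) (he : e ≤ m)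
    (hdb : 1 ≤ digitBits m) (hε : d * (4 * 2 ^ m / 2 ^ (c * (m * d)) : ℝ) ≤ 1)
    (x χ : Pt d m → ℂ) (Ms : List (Measurements d m e r)) (hMs : ∀ M ∈ Ms, M.Valid x)
    {S : Finset (Pt d m)} {x' : Pt d m → ℂ} {a : ℝ} (ha : 0 ≤ a)
    (hy : ∀ j ∈ S, ‖(x - χ) j‖ ≤ ‖x' j‖ + a) (hy' : ∀ j ∉ S, (x - χ) j = x' j)
    (herr : l1 χ * semiErr d m c ≤ (2 / Real.pi) ^ (2 * d ^ 2) * (a / 10)) :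
    Runs v (Ms.foldlM (fun (L : Finset (Pt d m)) M => do
        let Lr ← locateSignal c (2 * d) (filterCoeff (halfWidth e) (2 * d)) χ M
        op ((d + 1) * (Lr.card + 1)) (L ∪ Lr)) ∅)
      (fun L => L.card ≤ Ms.length * (2 ^ e) ^ d ∧
        ∀ i, (∃ M ∈ Ms, Locates S x' a i M) → 8 * a < ‖(x - χ) i‖ → i ∈ L)
      (Ms.length * (locateTime d m c e r (supp χ).card + (d + 1) * ((2 ^ e) ^ d + 1))) := by
  refine Runs.foldlM_rec (fun p (L : Finset (Pt d m)) => L.card ≤ p.length * (2 ^ e) ^ d ∧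
    ∀ i, (∃ M ∈ p, Locates S x' a i M) → 8 * a < ‖(x - χ) i‖ → i ∈ L) (by simp)
    fun p M q hl L hL => (locateSignal_residual_runs hc hd he1 he hdb hε x χ M
      (hMs M (by simp [hl])) ha hy hy' herr).bind fun Lr hLr => Runs.op ⟨?_, ?_⟩ ?_
  · refine (Finset.card_union_le _ _).trans ?_
    rw [List.length_append, List.length_singleton, add_mul, one_mul]
    exact add_le_add hL.1 hLr.1
  · rintro i ⟨M', hM', hloc⟩ hbig
    rw [List.mem_append, List.mem_singleton] at hM'
    rw [Finset.mem_union]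
    rcases hM' with hM' | rfl
    · exact Or.inl (hL.2 i ⟨M', hM', hloc⟩ hbig)
    · exact Or.inr (hLr.2 i hloc hbig)
  · have h1 : (Lr.card : ℝ) ≤ (2 ^ e) ^ d := by exact_mod_cast hLr.1
    push_cast
    gcongr

/-- Effect of one iteration on the entries. -/
theorem residual_step {S L : Finset (Pt d m)} {x' χt w : Pt d m → ℂ} {ν μ B : ℝ}
    (hν : 0 ≤ ν) (hμ : 0 ≤ μ) (hB : ν ≤ B) (hx' : ∀ i ∉ S, ‖x' i‖ ≤ ν)
    (h : Residual S x' χt (ν + μ))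
    (hL : ∀ i ∈ S, 8 * (ν + μ) < ‖x' i - χt i‖ → i ∈ L) (hw : ∀ f ∉ L, w f = 0)
    (hw' : ∀ f ∈ L, ∃ v : ℂ, ‖v - (x' f - χt f)‖ ≤ (ν + μ) / 4 ∧
      w f = if 5 * (B + μ) < ‖v‖ then v else 0) :
    Residual S x' (χt + w) (ν + μ) ∧ (∀ j ∉ S, w j = 0) ∧
      ∀ i ∈ S, ‖x' i - (χt + w) i‖ ≤ 8 * (B + μ) := by
  -- Outside `S` an estimate is at most `ν + (ν + μ)/4`, which is below the threshold.
  have hz : ∀ j ∉ S, w j = 0 := by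
    intro j hj
    by_cases hjL : j ∈ L
    · obtain ⟨v, hv, hwv⟩ := hw' j hjL
      rw [hwv, if_neg]
      rw [not_lt]
      rw [h.zero j hj, sub_zero] at hv
      have h1 := norm_add_le (v - x' j) (x' j)
      rw [sub_add_cancel] at h1
      linarith [hx' j hj]
    · exact hw j hjL
  -- Three cases. A corrected entry has residual at most `(ν + μ)/4`; one below the threshold has at
  -- most `5 (B + μ) + (ν + μ)/4`; one that is not located has at most `8 (ν + μ)`. The second and
  -- third are unchanged and keep their earlier bound.
  have key : ∀ i ∈ S, ‖x' i - (χt + w) i‖ ≤ ‖x' i‖ + (ν + μ) ∧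
      ‖x' i - (χt + w) i‖ ≤ 8 * (B + μ) := by
    intro i hi
    have h0 := h.le i hi
    have hn := norm_nonneg (x' i)
    by_cases hiL : i ∈ L
    · obtain ⟨v, hv, hwv⟩ := hw' i hiL
      rw [Pi.add_apply, hwv]
      split_ifs with hvt
      · have h1 : x' i - (χt i + v) = -(v - (x' i - χt i)) := by ring
        rw [h1, norm_neg]
        constructor <;> linarith
      · rw [add_zero]
        refine ⟨h0, ?_⟩
        have h1 := norm_sub_le v (v - (x' i - χt i))
        rw [sub_sub_cancel] at h1
        rw [not_lt] at hvt
        linarith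
    · rw [Pi.add_apply, hw i hiL, add_zero]
      refine ⟨h0, ?_⟩
      by_contra hcon
      exact hiL (hL i hi (by linarith))
  exact ⟨⟨fun j hj => by rw [Pi.add_apply, h.zero j hj, hz j hj, add_zero], fun j hj => (key j hj).1⟩,
    hz, fun i hi => (key i hi).2⟩

section Iteration

variable {α : ℝ} {c k e₁ e₂ n n' : ℕ} {x χ : Pt d m → ℂ} {S : Finset (Pt d m)} {ν μ : ℝ}

/-- A crude bound, `N` times the maximum, is enough: the precision of the semi-equispaced transform
outweighs any fixed power of `N`. -/
theorem l1_add_le {χt : Pt d m → ℂ} {a Z : ℝ} (ha : 0 ≤ a) (hZ : 1 ≤ Z)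
    (hx : ∀ i, ‖(x - χ) i‖ ≤ Z * a) (hχ : ∀ i, ‖χ i‖ ≤ Z * a)
    (h : Residual S (x - χ) χt a) : l1 (χ + χt) ≤ size d m * (4 * (Z * a)) := by
  have hsize : size d m = ((Finset.univ : Finset (Pt d m)).card : ℝ) := by
    rw [Finset.card_univ, card_Pt, size]; push_cast; rfl
  rw [hsize, ← nsmul_eq_mul]
  refine Finset.sum_le_card_nsmul _ _ _ fun i _ => ?_
  have hZa : a ≤ Z * a := le_mul_of_one_le_left ha hZ
  have h1 : ‖χt i‖ ≤ 3 * (Z * a) := by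
    by_cases hi : i ∈ S
    · have h2 := norm_sub_le ((x - χ) i) ((x - χ) i - χt i)
      rw [sub_sub_cancel] at h2
      linarith [h.le i hi, hx i]
    · rw [h.zero i hi, norm_zero]; linarith
  refine (norm_add_le _ _).trans ?_
  linarith [hχ i]

/-- Given good measurements the location phase is certain to succeed, so only the fresh hashings of
the estimation contribute to the probability of failure. -/
theorem iteration_likely (hc : 1 ≤ c) (hd : 1 ≤ d) (he1 : 1 ≤ e₁) (he1m : e₁ ≤ m)
    (hek : e₂ = bucketExp d ((2 * Real.pi) ^ (4 * d * (2 * d)) * k / α ^ (2 * d)))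
    (he2 : 1 ≤ e₂) (he2m : e₂ ≤ m) (hdb : 1 ≤ digitBits m)
    (hε : d * (4 * 2 ^ m / 2 ^ (c * (m * d)) : ℝ) ≤ 1)
    (hSk : S.card = k) (hν : 0 ≤ ν) (hμ : 0 ≤ μ) (h : HeadTail S (x - χ) (ν + μ))
    (hw₂ : weightBound d e₂ * S.card ≤ 1 / 10 ^ 7)
    (hx' : ∀ i ∉ S, ‖(x - χ) i‖ ≤ ν) {B : ℝ} (hB : ν ≤ B) {χt : Pt d m → ℂ}
    (hR : Residual S (x - χ) χt (ν + μ))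
    (herr : l1 (χ + χt) * semiErr d m c ≤ (2 / Real.pi) ^ (2 * d ^ 2) * ((ν + μ) / 40))
    (Ms : List (Measurements d m e₁ r)) (hlen : Ms.length = n) (hMs : ∀ M ∈ Ms, M.Valid x)
    (hloc : ∀ i ∈ S, ∃ M ∈ Ms, Locates S (x - χ) (ν + μ) i M) :
    Likely (dft x) (do
        let current ← sumSparse χ χt
        let L ← Ms.foldlM (fun (L : Finset (Pt d m)) M => do
          let Lr ← locateSignal c (2 * d) (filterCoeff (halfWidth e₁) (2 * d)) current M
          op ((d + 1) * (Lr.card + 1)) (L ∪ Lr)) ∅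
        let w ← estimateValues α c current L k (5 * (B + μ)) n'
        sumSparse χt w)
      (fun χt' => Residual S (x - χ) χt' (ν + μ) ∧
        ∀ i ∈ S, ‖(x - χ) i - χt' i‖ ≤ 8 * (B + μ))
      (iterationTime d m c e₁ e₂ r n n' k (supp χ).card)
      (size d m * (1 / 2) ^ n') := by
  have hN := size_pos d m
  have hpi := Real.pi_pos
  have hy : ∀ j ∈ S, ‖(x - (χ + χt)) j‖ ≤ ‖(x - χ) j‖ + (ν + μ) := fun j hj => by
    rw [← sub_sub]; exact hR.le j hj
  have hy' : ∀ j ∉ S, (x - (χ + χt)) j = (x - χ) j := fun j hj => by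
    rw [← sub_sub, Pi.sub_apply, hR.zero j hj, sub_zero]
  have hkt : ((supp χt).card : ℝ) ≤ k := by
    rw [← hSk]; exact_mod_cast card_supp_le_of_subset hR.zero
  have hcard : ((supp (χ + χt)).card : ℝ) ≤ (supp χ).card + k := by
    have h1 : ((supp (χ + χt)).card : ℝ) ≤ (supp χ).card + (supp χt).card := by
      exact_mod_cast card_supp_add_le χ χt
    linarith
  refine Likely.mono (Likely.bind (δ := 0) (δ' := size d m * (1 / 2) ^ n')
    (sumSparse_runs χ χt le_rfl hkt).likely_zero (by positivity) fun current hcur => ?_)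
    (fun _ => id) le_rfl (zero_add _).le
  subst hcur
  refine Likely.mono (Likely.bind (δ := 0) (δ' := size d m * (1 / 2) ^ n')
    (t' := estimateTime d m c e₂ n' ((supp χ).card + k) (n * (2 ^ e₁) ^ d) +
      2 * (d + 1) * (k + k + 1))
    (locate_all_runs hc hd he1 he1m hdb hε x (χ + χt) Ms hMs h.nonneg hy hy'
      (herr.trans (by gcongr; norm_num))).likely_zero (by positivity) fun L hL =>
    Likely.mono (Likely.bind (δ' := 0)
      (estimateValues_likely hc hd hek he2 he2m hε x (χ + χt) h hw₂ hy hy' herr L (5 * (B + μ)) n')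
      le_rfl fun w hw => Likely.mono (Runs.likely_zero (sumSparse_runs χt w hkt (q := k) ?_))
        (fun χt' hχt' => ?_) le_rfl le_rfl) (fun _ => id) (add_le_add_left (estimateTime_mono _ _ _ _ _ hcard ?_) _) (add_zero _).le)
    (fun _ => id) ?_ (zero_add _).le
  · have hstep := residual_step hν hμ hB hx' hR (fun i hi hbig => hL.2 i (hloc i hi)
      (by rw [← sub_sub]; exact hbig)) hw.1 (fun f hf => by
        have := hw.2 f hf; rwa [← sub_sub] at this)
    rw [← hSk]
    exact_mod_cast card_supp_le_of_subset hstep.2.1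
  · have hstep := residual_step hν hμ hB hx' hR (fun i hi hbig => hL.2 i (hloc i hi)
      (by rw [← sub_sub]; exact hbig)) hw.1 (fun f hf => by
        have := hw.2 f hf; rwa [← sub_sub] at this)
    rw [hχt']
    exact ⟨hstep.1, hstep.2.2⟩
  · have h1 := hL.1
    rw [hlen] at h1
    exact_mod_cast h1
  · rw [hlen]
    gcongr
    exact locateTime_mono _ _ _ _ _ hcard

/-- Bound for the number of steps of `reduceInfNorm`. -/
def totalTime (d m c e₁ e₂ r n n' k T : ℕ) (len : ℝ) : ℝ :=
  filterTime (halfWidth e₁) (2 * d) + (n * (measureTime d m c e₁ r + 1) +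
    T * iterationTime d m c e₁ e₂ r n n' k len)

theorem reduceInfNorm_likely {C R Z : ℝ} {T : ℕ} (hc : 1 ≤ c) (hd : 1 ≤ d)
    (hek₁ : e₁ = bucketExp d ((2 * Real.pi) ^ (4 * d * (2 * d)) * k / α ^ d))
    (hek₂ : e₂ = bucketExp d ((2 * Real.pi) ^ (4 * d * (2 * d)) * k / α ^ (2 * d)))
    (hr : r = ⌈C * Real.log (Real.log (size d m))⌉₊)
    (hn : n = ⌈C / Real.sqrt α * Real.log (size d m)⌉₊)
    (hn' : n' = ⌈C * Real.log (size d m)⌉₊) (hT : T = ⌈Real.logb 2 R⌉₊)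
    (he1 : 1 ≤ e₁) (he1m : e₁ ≤ m) (he2 : 1 ≤ e₂) (he2m : e₂ ≤ m) (hdb : 1 ≤ digitBits m)
    (hε : d * (4 * 2 ^ m / 2 ^ (c * (m * d)) : ℝ) ≤ 1)
    (hw₁ : weightBound d e₁ * S.card ≤ 1 / 10 ^ 7)
    (hw₂ : weightBound d e₂ * S.card ≤ 1 / 10 ^ 7)
    (hfail : digitFailure d m r ≤ 1 / 4)
    (hSk : S.card = k) (hν : 0 ≤ ν) (hμ : 0 ≤ μ) (h : HeadTail S (x - χ) (ν + μ))
    (hx' : ∀ i ∉ S, ‖(x - χ) i‖ ≤ ν)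
    (hxR : ∀ i, ‖(x - χ) i‖ ≤ R * (ν + μ))
    (hZ : 1 ≤ Z) (hxZ : ∀ i, ‖(x - χ) i‖ ≤ Z * (ν + μ)) (hχZ : ∀ i, ‖χ i‖ ≤ Z * (ν + μ))
    (herr : size d m * (4 * Z) * semiErr d m c ≤ (2 / Real.pi) ^ (2 * d ^ 2) / 40) :
    Likely (dft x) (reduceInfNorm α C c χ k ν R μ)
      (fun χ' => (∀ i, ‖(x - χ) i - χ' i‖ ≤ 8 * (ν + μ)) ∧ ∀ i ∉ S, χ' i = 0)
      (totalTime d m c e₁ e₂ r n n' k T (supp χ).card)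
      (k * (1 / 2) ^ n + T * (size d m * (1 / 2) ^ n')) := by
  have hN := size_pos d m
  have ha := h.nonneg
  subst hek₁ hr hn hT hn'
  unfold reduceInfNorm
  set e₁ := bucketExp d ((2 * Real.pi) ^ (4 * d * (2 * d)) * k / α ^ d) with he₁
  set r := ⌈C * Real.log (Real.log (size d m))⌉₊ with hr
  set n := ⌈C / Real.sqrt α * Real.log (size d m)⌉₊ with hn
  set n' := ⌈C * Real.log (size d m)⌉₊ with hn'
  set T := ⌈Real.logb 2 R⌉₊ with hT
  refine Likely.mono (Likely.bind (δ := 0)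
    (δ' := k * (1 / 2) ^ n + T * (size d m * (1 / 2) ^ n'))
    (filterTable_runs (halfWidth e₁) (2 * d)).likely_zero (by positivity)
    fun g hg => ?_) (fun _ => id) le_rfl (zero_add _).le
  subst hg
  refine Likely.bind (hSk ▸ measurements_likely hc hd he1 he1m hε x h hw₁ hfail)
    (by positivity) fun Ms hMs => ?_
  obtain ⟨⟨hlen, hval⟩, hloc⟩ := hMs
  refine Likely.mono (Likely.foldlM_range (by positivity)
    (fun t χt => Residual S (x - χ) χt (ν + μ) ∧
      -- Each iteration establishes this bound anew and uses only `Residual` from the preceding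
      -- state. At the start it is not claimed.
      (1 ≤ t → ∀ i ∈ S, ‖(x - χ) i - χt i‖ ≤ 8 * (ν * 2 ^ (T - t) + μ)))
    ⟨⟨by simp, fun j _ => by simp [ha]⟩, by simp⟩ fun t ht χt hχt =>
      Likely.mono (iteration_likely (n := n) (B := ν * 2 ^ (T - (t + 1))) hc hd he1 he1m hek₂
        he2 he2m hdb hε hSk hν hμ h
        hw₂ hx' (le_mul_of_one_le_right hν (one_le_pow₀ (by norm_num))) hχt.1 ?_ Ms hlen hval hloc)
        (fun χt' h' => ⟨h'.1, fun _ => h'.2⟩) le_rfl le_rfl)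
    (fun χ' hχ' => ⟨fun i => ?_, hχ'.1.zero⟩) le_rfl le_rfl
  · have h1 := l1_add_le ha hZ hxZ hχZ hχt.1
    refine (mul_le_mul_of_nonneg_right h1 (semiErr_nonneg d m c)).trans ?_
    have h2 := mul_le_mul_of_nonneg_right herr ha
    refine le_trans (le_of_eq (by ring)) (h2.trans (le_of_eq (by ring)))
  · by_cases hi : i ∈ S
    · rcases Nat.eq_zero_or_pos T with hT0 | hT0
      · have hR1 : R ≤ 1 := by
          by_contra hR1
          rw [not_le] at hR1
          have h2 := Real.logb_pos (b := 2) (by norm_num) hR1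
          rw [hT, Nat.ceil_eq_zero] at hT0
          linarith
        have h3 : ‖(x - χ) i‖ ≤ ν + μ :=
          (hxR i).trans (mul_le_of_le_one_left ha hR1)
        linarith [hχ'.1.le i hi]
      · have h2 := hχ'.2 hT0 i hi
        rwa [Nat.sub_self, pow_zero, mul_one] at h2
    · rw [hχ'.1.zero i hi, sub_zero]
      linarith [hx' i hi]

end Iteration

end

section

/-! ### Number of samples -/

namespace Alg

variable {X α β ι : Type} {v : X → ℂ}

theorem Reads.foldlM_zero {f : β → ι → Alg X β} {l : List ι} {b : β}
    (h : ∀ i b, Reads v (f b i) 0) : Reads v (l.foldlM f b) 0 :=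
  (Reads.foldlM h b).le (by simp)

theorem Reads.collect_zero {f : ι → Alg X α} {l : List ι} (h : ∀ i, Reads v (f i) 0) :
    Reads v (Alg.collect f l) 0 :=
  (Reads.collect h).le (by simp)

theorem Reads.tabulate_zero [DecidableEq ι] [Zero α] {l : List ι} {f : ι → Alg X α}
    (h : ∀ i, Reads v (f i) 0) : Reads v (Alg.tabulate l f) 0 :=
  (Reads.tabulate h).le (by simp)

theorem Reads.zero_bind {A : Alg X α} {f : α → Alg X β} {s : ℝ}
    (h : Reads v A 0) (hf : ∀ a, Reads v (f a) s) : Reads v (A >>= f) s :=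
  (h.bind hf).le (zero_add _).le

theorem Reads.bind_of_zero {A : Alg X α} {f : α → Alg X β} {s : ℝ}
    (h : Reads v A s) (hf : ∀ a, Reads v (f a) 0) : Reads v (A >>= f) s :=
  (h.bind hf).le (add_zero _).le

end Alg

variable {X : Type} {d m e r : ℕ} {v : X → ℂ}

theorem fft_reads (σ : ℤ) (e : ℕ) (f : Pt d e → ℂ) :
    Reads v (fft σ e f : Alg X (Pt d e → ℂ)) 0 := by
  induction e with
  | zero => exact Reads.op le_rfl
  | succ e ih =>
      exact Reads.bind_zero (Reads.tabulate_zero fun _ => ih _) fun _ =>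
        Reads.tabulate_zero fun _ => Reads.foldlM_zero fun _ _ => Reads.op le_rfl

theorem semiEquispaced_reads (c e : ℕ) (y : List (Pt d m × ℂ)) :
    Reads v (semiEquispaced c e y : Alg X ((Fin d → ℤ) → ℂ)) 0 := by
  unfold semiEquispaced
  split_ifs
  · refine Reads.bind_zero (Reads.charge le_rfl) fun _ => Reads.bind_zero
      (Reads.foldlM_zero fun i _ => ?_) fun _ => Reads.bind_zero (fft_reads _ _ _) fun _ =>
        Reads.bind_zero (Reads.tabulate_zero fun _ => Reads.op le_rfl) fun _ => Reads.pure le_rfl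
    exact Reads.bind_zero (Reads.tabulate_zero fun _ => Reads.tabulate_zero fun _ =>
      Reads.op le_rfl) fun _ => Reads.foldlM_zero fun _ _ => Reads.op le_rfl
  · exact Reads.bind_zero (Reads.charge le_rfl) fun _ => Reads.bind_zero
      (Reads.foldlM_zero fun i _ => Reads.op le_rfl) fun _ => Reads.bind_zero (fft_reads _ _ _)
        fun _ => Reads.bind_zero (Reads.tabulate_zero fun _ => Reads.op le_rfl) fun _ =>
          Reads.pure le_rfl

theorem filterTable_reads (h F : ℕ) : Reads v (filterTable h F : Alg X (ℤ → ℝ)) 0 :=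
  Reads.foldlM_zero fun _ _ => Reads.bind_zero (Reads.foldlM_zero fun _ _ => Reads.op le_rfl)
    fun _ => Reads.tabulate_zero fun _ => Reads.op le_rfl

theorem sparseValues_reads (c e F : ℕ) (π : Perm d m) (a : Pt d m) (χ : Pt d m → ℂ) :
    Reads v (sparseValues c e F π a χ : Alg X ((Fin d → ℤ) → ℂ)) 0 :=
  Reads.bind_zero (Reads.collect_zero fun _ => Reads.op le_rfl) fun _ => semiEquispaced_reads _ _ _

theorem fold_reads (m e F : ℕ) (g : ℤ → ℝ) (y : (Fin d → ℤ) → Alg X ℂ) {s : ℝ}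
    (hy : ∀ i, Reads v (y i) s) :
    Reads v (fold m e F g y) ((box d e F).card * s) := by
  unfold fold
  refine Reads.zero_bind (Reads.charge le_rfl) fun _ => Reads.bind_of_zero
    ((Reads.foldlM (fun i _ => Reads.bind_of_zero (hy i) fun _ => Reads.op le_rfl) _).le
      (le_of_eq (by rw [Finset.length_toList, box]))) fun _ => Reads.bind_zero (fft_reads _ _ _)
        fun _ => Reads.tabulate_zero fun _ => Reads.op le_rfl

theorem hashSparse_reads (c e F : ℕ) (g : ℤ → ℝ) (χ : Pt d m → ℂ) (π : Perm d m) (a : Pt d m) :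
    Reads v (hashSparse c e F g χ π a : Alg X (Pt d e → ℂ)) 0 :=
  Reads.bind_zero (sparseValues_reads _ _ _ _ _ _) fun _ =>
    (fold_reads m e F g _ fun _ => Reads.op le_rfl).le (by simp)

theorem hashToBins_reads {v : Pt d m → ℂ} (c e F : ℕ) (g : ℤ → ℝ) (χ : Pt d m → ℂ) (π : Perm d m)
    (a : Pt d m) : Reads v (hashToBins c e F g χ π a) (box d e F).card :=
  Reads.zero_bind (sparseValues_reads _ _ _ _ _ _) fun _ =>
    (fold_reads m e F g _ fun _ => Reads.zero_bind (Reads.op le_rfl) fun _ =>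
      Reads.bind_of_zero Reads.sample fun _ => Reads.op le_rfl).le (by simp)

theorem drawPerm_reads : Reads v (drawPerm : Alg X (Perm d m)) 0 :=
  Reads.bind_zero (Reads.uniform le_rfl) fun _ => Reads.bind_zero (Reads.uniform le_rfl)
    fun _ => Reads.op le_rfl

theorem locateDigit_reads (M : Measurements d m e r) (j : Pt d e) (s : Fin d)
    (g : Fin (numDigits m)) (f : Pt d m) : Reads v (locateDigit M j s g f) 0 := by
  unfold locateDigit
  refine Reads.bind_zero (Reads.foldlM_zero fun _ _ => Reads.bind_zero
    (Reads.foldlM_zero fun _ _ => Reads.bind_zero (Reads.op le_rfl) fun _ => Reads.op le_rfl)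
    fun _ => Reads.op le_rfl) fun l => ?_
  rcases l with _ | ⟨q, _ | ⟨q', l⟩⟩ <;> exact Reads.op le_rfl

theorem locateBucket_reads (M : Measurements d m e r) (j : Pt d e) :
    Reads v (locateBucket M j) 0 := by
  refine Reads.foldlM_zero fun s o => Reads.foldlM_zero fun g o => ?_
  rcases o with _ | f
  · exact Reads.op le_rfl
  · exact locateDigit_reads _ _ _ _ _

theorem locateSignal_reads (c F : ℕ) (g : ℤ → ℝ) (χ : Pt d m → ℂ) (M : Measurements d m e r) :
    Reads v (locateSignal c F g χ M) 0 := by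
  refine Reads.bind_zero (Reads.tabulate_zero fun _ => Reads.tabulate_zero fun _ =>
    Reads.bind_zero (Reads.op le_rfl) fun _ => Reads.bind_zero (hashSparse_reads _ _ _ _ _ _ _)
      fun _ => Reads.op le_rfl) fun _ => Reads.bind_zero (Reads.op le_rfl) fun _ =>
    Reads.foldlM_zero fun j _ => Reads.bind_zero (locateBucket_reads _ _) fun o => ?_
  rcases o with _ | f <;> exact Reads.op le_rfl

theorem estimateValues_reads {v : Pt d m → ℂ} (α : ℝ) (c : ℕ) (χ : Pt d m → ℂ)
    (L : Finset (Pt d m)) (k : ℕ) (threshold : ℝ) (r : ℕ) :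
    Reads v (estimateValues α c χ L k threshold r) (r * (box d (bucketExp d
      ((2 * Real.pi) ^ (4 * d * (2 * d)) * k / α ^ (2 * d))) (2 * d)).card) := by
  unfold estimateValues
  refine Reads.zero_bind (filterTable_reads _ _) fun g => Reads.bind_of_zero
    ((Reads.collect fun _ => Reads.zero_bind drawPerm_reads fun _ => Reads.zero_bind
      (Reads.uniform le_rfl) fun _ => Reads.zero_bind (Reads.charge le_rfl) fun _ =>
        Reads.bind_of_zero (hashToBins_reads _ _ _ _ _ _ _) fun _ => Reads.pure le_rfl).le
      (by rw [List.length_range])) fun hs => Reads.foldlM_zero fun _ _ => Reads.bind_zero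
        (Reads.collect_zero fun _ => Reads.op le_rfl) fun _ => Reads.bind_zero (Reads.op le_rfl)
          fun _ => Reads.op le_rfl

theorem measure_reads {v : Pt d m → ℂ} (c e F : ℕ) (g : ℤ → ℝ) (r : ℕ) :
    Reads v (measure c e F g r : Alg (Pt d m) (Measurements d m e r))
      (r * ((1 + d * numDigits m) * (box d e F).card)) := by
  unfold measure
  refine Reads.zero_bind drawPerm_reads fun _ => Reads.zero_bind (Reads.uniform le_rfl) fun _ =>
    Reads.zero_bind (Reads.charge le_rfl) fun _ => Reads.bind_of_zero
      ((Reads.tabulate fun _ => Reads.tabulate fun _ => Reads.zero_bind (Reads.op le_rfl) fun _ =>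
        hashToBins_reads _ _ _ _ _ _ _).le ?_) fun _ => Reads.pure le_rfl
  rw [List.length_finRange, Finset.length_toList, Finset.card_univ, card_Dir]
  push_cast
  exact le_rfl

/-- Bound for the number of samples of `reduceInfNorm`. -/
def totalSamples (d m e₁ e₂ r n n' T : ℕ) : ℝ :=
  n * (r * ((1 + d * numDigits m) * (box d e₁ (2 * d)).card)) +
    T * (n' * (box d e₂ (2 * d)).card)

/-- Only the initial measurements and the estimation read entries. Location in later iterations
updates the stored values by transforms of known vectors. -/
theorem reduceInfNorm_reads {v : Pt d m → ℂ} (α C : ℝ) (c : ℕ) (χ : Pt d m → ℂ) (k : ℕ)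
    (ν R μ : ℝ) :
    Reads v (reduceInfNorm α C c χ k ν R μ) (totalSamples d m
      (bucketExp d ((2 * Real.pi) ^ (4 * d * (2 * d)) * k / α ^ d))
      (bucketExp d ((2 * Real.pi) ^ (4 * d * (2 * d)) * k / α ^ (2 * d)))
      ⌈C * Real.log (Real.log (size d m))⌉₊ ⌈C / Real.sqrt α * Real.log (size d m)⌉₊
      ⌈C * Real.log (size d m)⌉₊ ⌈Real.logb 2 R⌉₊) := by
  unfold reduceInfNorm totalSamples
  refine Reads.zero_bind (filterTable_reads _ _) fun g => Reads.bind
    ((Reads.collect fun _ => measure_reads _ _ _ _ _).le (by rw [List.length_range])) fun Ms =>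
    (Reads.foldlM (s := ⌈C * Real.log (size d m)⌉₊ * (box d (bucketExp d
      ((2 * Real.pi) ^ (4 * d * (2 * d)) * k / α ^ (2 * d))) (2 * d)).card) (fun t χt => ?_) _).le
      (by rw [List.length_range])
  exact Reads.zero_bind (Reads.op le_rfl) fun _ => Reads.zero_bind (Reads.foldlM_zero fun _ _ =>
    Reads.bind_zero (locateSignal_reads _ _ _ _ _) fun _ => Reads.op le_rfl) fun _ =>
    Reads.bind_of_zero (estimateValues_reads _ _ _ _ _ _ _) fun _ => Reads.op le_rfl

end

section

/-! ### Estimates of the costs, uniform in the parameters -/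

/-- The parameters on which the costs depend, with bounds in terms of the constant `A`. -/
structure Params (A : ℝ) where
  (d m k s T e₁ e₂ r n n' : ℕ)
  one_le_d : 1 ≤ d
  one_le_k : 1 ≤ k
  one_le_m : 1 ≤ m
  one_le_digitBits : 1 ≤ digitBits m
  e₁_le : e₁ ≤ m
  e₂_le : e₂ ≤ m
  buckets₁ : ((2 : ℝ) ^ e₁) ^ d ≤ A ^ d ^ 2 * k
  buckets₂ : ((2 : ℝ) ^ e₂) ^ d ≤ A ^ d ^ 2 * k
  T_le : (T : ℝ) ≤ A * (d * m)
  n_le : (n : ℝ) ≤ A * (d * m)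
  n'_le : (n' : ℝ) ≤ A * (d * m)
  r_le : (r : ℝ) ≤ A * (d * m)
  digits_le : (r : ℝ) * numDigits m ≤ A * (d * m)

namespace Params

variable {A : ℝ}

/-- The sparsity. -/
def W (i : Params A) : ℝ := i.k + i.s

/-- The binary logarithm of the size. -/
def X (i : Params A) : ℝ := i.d * i.m

theorem one_le_W (i : Params A) : 1 ≤ i.W := by
  have h1 : (1 : ℝ) ≤ i.k := by exact_mod_cast i.one_le_k
  have h2 : (0 : ℝ) ≤ i.s := Nat.cast_nonneg _
  rw [W]; linarith

theorem one_le_X (i : Params A) : 1 ≤ i.X := by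
  have h1 : (1 : ℝ) ≤ i.d := by exact_mod_cast i.one_le_d
  have h2 : (1 : ℝ) ≤ i.m := by exact_mod_cast i.one_le_m
  exact one_le_mul_of_one_le_of_one_le h1 h2

end Params

/-- `f` is at most `K ^ d² W ^ b X ^ p` with a constant `K`. -/
def Dom {A : ℝ} (b : ℕ) (p : Params A → ℕ) (f : Params A → ℝ) : Prop :=
  ∃ K : ℝ, 1 ≤ K ∧ ∀ i, 0 ≤ f i ∧ f i ≤ K ^ i.d ^ 2 * (i.W ^ b * i.X ^ p i)

section Dom

variable {A : ℝ} {b b' : ℕ} {p p' : Params A → ℕ} {f g : Params A → ℝ}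

theorem Dom.le (h : Dom b p f) (hb : b ≤ b') (hp : ∀ i, p i ≤ p' i) : Dom b' p' f := by
  obtain ⟨K, hK, hf⟩ := h
  refine ⟨K, hK, fun i => ⟨(hf i).1, (hf i).2.trans ?_⟩⟩
  have h1 := pow_le_pow_right₀ i.one_le_W hb
  have h2 := pow_le_pow_right₀ i.one_le_X (hp i)
  have h3 := i.one_le_W
  have h4 := i.one_le_X
  gcongr

theorem Dom.of_le (h : Dom b p f) (h0 : ∀ i, 0 ≤ g i) (hg : ∀ i, g i ≤ f i) : Dom b p g := by
  obtain ⟨K, hK, hf⟩ := h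
  exact ⟨K, hK, fun i => ⟨h0 i, (hg i).trans (hf i).2⟩⟩

theorem Dom.mul (hf : Dom b p f) (hg : Dom b' p' g) :
    Dom (b + b') (fun i => p i + p' i) (fun i => f i * g i) := by
  obtain ⟨K, hK, hf⟩ := hf
  obtain ⟨K', hK', hg⟩ := hg
  refine ⟨K * K', one_le_mul_of_one_le_of_one_le hK hK', fun i =>
    ⟨mul_nonneg (hf i).1 (hg i).1, ?_⟩⟩
  have h3 := i.one_le_W
  have h4 := i.one_le_X
  refine (mul_le_mul (hf i).2 (hg i).2 (hg i).1 (by positivity)).trans (le_of_eq ?_)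
  rw [mul_pow, pow_add, pow_add]
  ring

theorem Dom.add (hf : Dom b p f) (hg : Dom b' p' g) :
    Dom (max b b') (fun i => max (p i) (p' i)) (fun i => f i + g i) := by
  obtain ⟨K, hK, hf⟩ := hf.le (le_max_left b b') (fun i => le_max_left (p i) (p' i))
  obtain ⟨K', hK', hg⟩ := hg.le (le_max_right b b') (fun i => le_max_right (p i) (p' i))
  refine ⟨K + K', by linarith, fun i => ⟨add_nonneg (hf i).1 (hg i).1, ?_⟩⟩
  have h3 := i.one_le_W
  have h4 := i.one_le_X
  refine (add_le_add (hf i).2 (hg i).2).trans ?_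
  rw [← add_mul]
  refine mul_le_mul_of_nonneg_right ?_ (by positivity)
  -- A positive exponent is needed for `K^(d²) + K'^(d²) ≤ (K + K')^(d²)`.
  have h5 : i.d ^ 2 ≠ 0 := pow_ne_zero 2 (by have := i.one_le_d; omega)
  exact pow_add_pow_le (by linarith) (by linarith) h5

theorem dom_const {c : ℝ} (hc : 0 ≤ c) : Dom (A := A) 0 (fun _ => 0) (fun _ => c) := by
  refine ⟨max c 1, le_max_right _ _, fun i => ⟨hc, ?_⟩⟩
  have h5 : i.d ^ 2 ≠ 0 := pow_ne_zero 2 (by have := i.one_le_d; omega)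
  simpa using (le_max_left c 1).trans (le_self_pow₀ (le_max_right c 1) h5)

theorem Dom.pow (h : Dom b p f) (q : ℕ) : Dom (q * b) (fun i => q * p i) (fun i => f i ^ q) := by
  obtain ⟨K, hK, hf⟩ := h
  refine ⟨K ^ q, one_le_pow₀ hK, fun i => ⟨pow_nonneg (hf i).1 q, ?_⟩⟩
  refine (pow_le_pow_left₀ (hf i).1 (hf i).2 q).trans (le_of_eq ?_)
  beta_reduce
  rw [mul_pow, mul_pow, ← pow_mul, ← pow_mul, ← pow_mul, ← pow_mul, mul_comm q (i.d ^ 2),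
    mul_comm q b, mul_comm q (p i)]

/-- The `d`-th power of a function of order `K ^ d X ^ q`. -/
theorem dom_pow_d {K : ℝ} {q : ℕ} (hK : 1 ≤ K) (h0 : ∀ i, 0 ≤ f i)
    (h : ∀ i, f i ≤ K ^ i.d * i.X ^ q) : Dom 0 (fun i => q * i.d) (fun i => f i ^ i.d) := by
  refine ⟨K, hK, fun i => ⟨pow_nonneg (h0 i) _, ?_⟩⟩
  refine (pow_le_pow_left₀ (h0 i) (h i) _).trans (le_of_eq ?_)
  rw [mul_pow, ← pow_mul, ← pow_mul, sq, pow_zero, one_mul]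

theorem dom_d : Dom (A := A) 0 (fun _ => 0) (fun i => (i.d : ℝ)) := by
  refine ⟨2, by norm_num, fun i => ⟨Nat.cast_nonneg _, ?_⟩⟩
  have h1 : i.d < 2 ^ i.d ^ 2 := lt_of_le_of_lt (by nlinarith [i.one_le_d]) Nat.lt_two_pow_self
  simpa using (by exact_mod_cast h1.le : (i.d : ℝ) ≤ 2 ^ i.d ^ 2)

theorem dom_const_pow_d {c : ℝ} (hc : 1 ≤ c) : Dom (A := A) 0 (fun _ => 0) (fun i => c ^ i.d) := by
  refine ⟨c, hc, fun i => ⟨by positivity, ?_⟩⟩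
  simpa using pow_le_pow_right₀ hc (by nlinarith [i.one_le_d] : i.d ≤ i.d ^ 2)

theorem dom_linear (hA : 1 ≤ A) (h0 : ∀ i, 0 ≤ f i) (h : ∀ i, f i ≤ A * (i.d * i.m)) :
    Dom 0 (fun _ => 1) f := by
  refine ⟨A, hA, fun i => ⟨h0 i, (h i).trans ?_⟩⟩
  have h5 : i.d ^ 2 ≠ 0 := pow_ne_zero 2 (by have := i.one_le_d; omega)
  have h1 := le_self_pow₀ hA h5
  have h2 := i.one_le_X
  rw [pow_zero, one_mul, pow_one]
  rw [Params.X] at h2 ⊢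
  exact mul_le_mul_of_nonneg_right h1 (by linarith)

theorem dom_m : Dom (A := A) 0 (fun _ => 1) (fun i => (i.m : ℝ)) := by
  refine ⟨1, le_rfl, fun i => ⟨Nat.cast_nonneg _, ?_⟩⟩
  have h1 : (1 : ℝ) ≤ i.d := by exact_mod_cast i.one_le_d
  rw [one_pow, one_mul, pow_zero, one_mul, pow_one]
  exact le_mul_of_one_le_left (Nat.cast_nonneg _) h1

theorem dom_k : Dom (A := A) 1 (fun _ => 0) (fun i => (i.k : ℝ)) :=
  ⟨1, le_rfl, fun i => ⟨Nat.cast_nonneg _, by simp [Params.W]⟩⟩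

theorem dom_s : Dom (A := A) 1 (fun _ => 0) (fun i => (i.s : ℝ)) :=
  ⟨1, le_rfl, fun i => ⟨Nat.cast_nonneg _, by simp [Params.W]⟩⟩

theorem dom_buckets (hA : 1 ≤ A) {e : Params A → ℕ}
    (h : ∀ i, ((2 : ℝ) ^ e i) ^ i.d ≤ A ^ i.d ^ 2 * i.k) :
    Dom 1 (fun _ => 0) (fun i => ((2 : ℝ) ^ e i) ^ i.d) := by
  refine ⟨A, hA, fun i => ⟨by positivity, (h i).trans ?_⟩⟩
  rw [pow_one, pow_zero, mul_one, Params.W]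
  have : (0 : ℝ) ≤ i.s := Nat.cast_nonneg _
  exact mul_le_mul_of_nonneg_left (by linarith) (by positivity)

theorem numDigits_le (hdb : 1 ≤ digitBits m) (hm : 1 ≤ m) : numDigits m ≤ m := by
  unfold numDigits
  refine Nat.div_le_of_le_mul ?_
  obtain ⟨a, ha⟩ : ∃ a, digitBits m = a + 1 := ⟨_, (Nat.sub_add_cancel hdb).symm⟩
  obtain ⟨b, rfl⟩ : ∃ b, m = b + 1 := ⟨_, (Nat.sub_add_cancel hm).symm⟩
  rw [ha, add_mul, mul_add]
  have := Nat.zero_le (a * b)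
  omega

theorem two_pow_digitBits_le (hm : 1 ≤ m) : 2 ^ digitBits m ≤ m :=
  (Nat.pow_le_pow_right (by norm_num) (Nat.div_le_self _ _)).trans
    (Nat.pow_log_le_self 2 (by omega))

theorem dom_numDigits : Dom (A := A) 0 (fun _ => 1) (fun i => (numDigits i.m : ℝ)) :=
  dom_m.of_le (fun i => Nat.cast_nonneg _) fun i => by
    exact_mod_cast numDigits_le i.one_le_digitBits i.one_le_m

theorem dom_digitBase : Dom (A := A) 0 (fun _ => 1) (fun i => (2 : ℝ) ^ digitBits i.m) :=
  dom_m.of_le (fun i => by positivity) fun i => by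
    exact_mod_cast two_pow_digitBits_le i.one_le_m

/-! ### Hashing -/

section Hash

variable {e : Params A → ℕ} (hB : Dom 1 (fun _ => 0) (fun i : Params A => ((2 : ℝ) ^ e i) ^ i.d))
  (he : ∀ i, e i ≤ i.m)

include hB in
theorem dom_box : Dom 1 (fun _ => 0) (fun i => ((box i.d (e i) (2 * i.d)).card : ℝ)) := by
  have h1 : Dom (A := A) 0 (fun i => 0 * i.d) (fun i => (4 * i.d : ℝ) ^ i.d) :=
    dom_pow_d (K := 8) (by norm_num) (fun i => by positivity) fun i => by
      have h2 : 4 * i.d ≤ 8 ^ i.d := by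
        have := Nat.lt_two_pow_self (n := i.d)
        calc 4 * i.d ≤ 4 ^ i.d * 2 ^ i.d := Nat.mul_le_mul (Nat.le_self_pow (by
              have := i.one_le_d; omega) 4) this.le
          _ = 8 ^ i.d := by rw [← mul_pow]; norm_num
      simpa using (by exact_mod_cast h2 : (4 * i.d : ℝ) ≤ 8 ^ i.d)
  refine ((h1.mul hB).of_le (fun i => Nat.cast_nonneg _) fun i => ?_).le le_rfl (fun i => by simp)
  rw [card_box, ← mul_pow]
  push_cast
  refine pow_le_pow_left₀ (by positivity) ?_ _
  have h3 : halfWidth (e i) + 1 ≤ 2 ^ e i := by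
    unfold halfWidth
    have := Nat.one_le_two_pow (n := e i)
    omega
  have h4 : ((halfWidth (e i) : ℕ) : ℝ) + 1 ≤ 2 ^ e i := by exact_mod_cast h3
  have h5 : (1 : ℝ) ≤ i.d := by exact_mod_cast i.one_le_d
  nlinarith

include hB in
theorem dom_two_pow : Dom 1 (fun _ => 0) (fun i => (2 : ℝ) ^ e i) :=
  hB.of_le (fun i => by positivity) fun i =>
    le_self_pow₀ (one_le_pow₀ (by norm_num)) (by have := i.one_le_d; omega)

include hB in
theorem dom_filterTime :
    Dom 1 (fun _ => 0) (fun i => filterTime (halfWidth (e i)) (2 * i.d)) := by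
  have h1 : Dom 1 (fun _ => 0) (fun i => (halfWidth (e i) : ℝ)) :=
    (dom_two_pow hB).of_le (fun i => Nat.cast_nonneg _) fun i => by
      have h3 : halfWidth (e i) ≤ 2 ^ e i := (Nat.sub_le _ _).trans (Nat.div_le_self _ _)
      exact_mod_cast h3
  have hd := dom_d (A := A)
  unfold filterTime
  push_cast
  apply Dom.le
  · repeat' first
      | assumption
      | exact dom_const (by norm_num)
      | apply Dom.add
      | apply Dom.mul
  · decide
  · intro i; simp

-- Rounding `2d · 2^e` up to a power of two and doubling the grid costs at most a factor 4 per
-- coordinate. The resulting `(8d)^d` is absorbed by `K^(d²)`.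
include hB in
theorem dom_grid : Dom 1 (fun _ => 0)
    (fun i => ((2 : ℝ) ^ (Nat.clog 2 (2 * i.d * 2 ^ e i) + 1)) ^ i.d) := by
  have h1 : Dom (A := A) 0 (fun i => 0 * i.d) (fun i => (8 * i.d : ℝ) ^ i.d) :=
    dom_pow_d (K := 16) (by norm_num) (fun i => by positivity) fun i => by
      have h2 : 8 * i.d ≤ 16 ^ i.d := by
        have := Nat.lt_two_pow_self (n := i.d)
        calc 8 * i.d ≤ 8 ^ i.d * 2 ^ i.d := Nat.mul_le_mul (Nat.le_self_pow (by
              have := i.one_le_d; omega) 8) this.le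
          _ = 16 ^ i.d := by rw [← mul_pow]; norm_num
      simpa using (by exact_mod_cast h2 : (8 * i.d : ℝ) ≤ 16 ^ i.d)
  refine ((h1.mul hB).of_le (fun i => by positivity) fun i => ?_).le le_rfl (fun i => by simp)
  rw [← mul_pow]
  refine pow_le_pow_left₀ (by positivity) ?_ _
  have hd := i.one_le_d
  have hpos := Nat.one_le_two_pow (n := e i)
  have h2 : 1 < 2 * i.d * 2 ^ e i := by nlinarith
  have h3 := Nat.pow_pred_clog_lt_self (b := 2) (by norm_num) h2
  have h4 : 0 < Nat.clog 2 (2 * i.d * 2 ^ e i) := Nat.clog_pos (by norm_num) h2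
  obtain ⟨q, hq⟩ : ∃ q, Nat.clog 2 (2 * i.d * 2 ^ e i) = q + 1 := ⟨_, (Nat.succ_pred_eq_of_pos h4).symm⟩
  rw [hq] at h3 ⊢
  rw [Nat.pred_eq_sub_one, Nat.add_sub_cancel] at h3
  have h5 : (2 : ℝ) ^ q ≤ 2 * i.d * 2 ^ e i := by exact_mod_cast h3.le
  rw [pow_succ, pow_succ]
  linarith

include he in
theorem dom_clog : Dom 0 (fun _ => 1)
    (fun i => ((Nat.clog 2 (2 * i.d * 2 ^ e i) : ℕ) : ℝ)) := by
  have h1 : Dom (A := A) 0 (fun _ => 1) (fun i => 2 * (i.d : ℝ) + i.m) :=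
    (((dom_const (c := 2) (by norm_num)).mul dom_d).add dom_m).le le_rfl (by simp)
  refine h1.of_le (fun i => Nat.cast_nonneg _) fun i => ?_
  have h2 : Nat.clog 2 (2 * i.d * 2 ^ e i) ≤ 2 * i.d + i.m := by
    refine Nat.clog_le_of_le_pow ?_
    rw [pow_add]
    exact Nat.mul_le_mul Nat.lt_two_pow_self.le (Nat.pow_le_pow_right (by norm_num) (he i))
  exact_mod_cast h2

-- The power `X^d` stems from the `(16p + 1)^d` grid points near each entry, with `p = c log₂ N`.
-- All other terms contain `X` at most once.
include hB he in
theorem dom_hashTime (c : ℕ) {len : Params A → ℝ} (hlen : Dom 1 (fun _ => 0) len) :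
    Dom 1 (fun i => i.d) (fun i => hashTime i.d i.m c (e i) (2 * i.d) (len i)) := by
  have hd := dom_d (A := A)
  have hm := dom_m (A := A)
  have hgrid := dom_grid hB
  have hclog := dom_clog he
  have h2 : Dom (A := A) 0 (fun _ => 0) (fun i => (2 : ℝ) ^ i.d) := dom_const_pow_d (by norm_num)
  have hbox : Dom 1 (fun _ => 0)
      (fun i => (2 * (2 * (i.d : ℝ) * (halfWidth (e i) : ℝ)) + 1) ^ i.d) := by
    have := dom_box hB
    simp only [card_box] at this
    push_cast at this
    exact this
  have he' : Dom 0 (fun _ => 1) (fun i => (e i : ℝ)) :=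
    hm.of_le (fun i => Nat.cast_nonneg _) fun i => by exact_mod_cast he i
  have hp : Dom (A := A) 0 (fun i => 1 * i.d)
      (fun i => (16 * ((c : ℝ) * ((i.m : ℝ) * i.d)) + 1) ^ i.d) := by
    refine dom_pow_d (K := 16 * c + 1) (by linarith [(Nat.cast_nonneg c : (0 : ℝ) ≤ c)])
      (fun i => by positivity) fun i => ?_
    have h3 := i.one_le_X
    have h4 : (16 * (c : ℝ) + 1) ≤ (16 * c + 1) ^ i.d := le_self_pow₀
      (by linarith [(Nat.cast_nonneg c : (0 : ℝ) ≤ c)]) (by have := i.one_le_d; omega)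
    calc 16 * ((c : ℝ) * ((i.m : ℝ) * i.d)) + 1 ≤ (16 * c + 1) * i.X := by
          rw [Params.X] at h3 ⊢; linarith
      _ ≤ _ := by rw [pow_one]; exact mul_le_mul_of_nonneg_right h4 (by linarith)
  unfold hashTime semiTime
  push_cast
  apply Dom.le
  · repeat' first
      | assumption
      | exact dom_const (by norm_num)
      | apply Dom.pow
      | apply Dom.add
      | apply Dom.mul
  · decide
  · intro i; have := i.one_le_d; omega

end Hash

/-! ### Location, estimation and iteration -/

theorem dom_bucketTime (hA : 1 ≤ A) :
    Dom 0 (fun _ => 2) (fun i : Params A => bucketTime i.d i.m i.r) := by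
  have hd := dom_d (A := A)
  have hnum := dom_numDigits (A := A)
  have hbase := dom_digitBase (A := A)
  have hrd : Dom 0 (fun _ => 1) (fun i : Params A => (i.r : ℝ) * numDigits i.m) :=
    dom_linear hA (fun i => by positivity) fun i => i.digits_le
  -- The terms are regrouped so that `r` occurs only in the product with the number of digits. This
  -- product is of order `X`, and separate bounds would lose a logarithm.
  have h : (fun i : Params A => bucketTime i.d i.m i.r) = fun i =>
      (i.d : ℝ) * (((i.r : ℝ) * numDigits i.m) * (2 ^ digitBits i.m * (2 * i.d + 24)) +
        numDigits i.m * (2 ^ digitBits i.m * 3 + (i.d + 4))) := by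
    funext i
    rw [bucketTime, digitTime]
    ring
  rw [h]
  apply Dom.le
  · repeat' first
      | assumption
      | exact dom_const (by norm_num)
      | apply Dom.add
      | apply Dom.mul
  · decide
  · intro i; omega

theorem dom_iterationTime (hA : 1 ≤ A) (c : ℕ) : Dom 1 (fun i => i.d + 2) (fun i : Params A =>
    iterationTime i.d i.m c i.e₁ i.e₂ i.r i.n i.n' i.k i.s) := by
  have hd := dom_d (A := A)
  have hk := dom_k (A := A)
  have hs := dom_s (A := A)
  have hnum := dom_numDigits (A := A)
  have hrd : Dom 0 (fun _ => 1) (fun i : Params A => (i.r : ℝ) * numDigits i.m) :=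
    dom_linear hA (fun i => by positivity) fun i => i.digits_le
  have hr : Dom 0 (fun _ => 1) (fun i : Params A => (i.r : ℝ)) :=
    dom_linear hA (fun i => by positivity) fun i => i.r_le
  have hn : Dom 0 (fun _ => 1) (fun i : Params A => (i.n : ℝ)) :=
    dom_linear hA (fun i => by positivity) fun i => i.n_le
  have hn' : Dom 0 (fun _ => 1) (fun i : Params A => (i.n' : ℝ)) :=
    dom_linear hA (fun i => by positivity) fun i => i.n'_le
  have hlog : Dom 0 (fun _ => 1) (fun i : Params A => ((Nat.log 2 i.n' : ℕ) : ℝ)) :=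
    hn'.of_le (fun i => by positivity) fun i => by exact_mod_cast Nat.log_le_self 2 i.n'
  have hB₁ := dom_buckets hA fun i : Params A => i.buckets₁
  have hB₂ := dom_buckets hA fun i : Params A => i.buckets₂
  have hlen : Dom 1 (fun _ => 0) (fun i : Params A => (i.s : ℝ) + i.k) := hs.add hk
  have hh₁ := dom_hashTime hB₁ (fun i => i.e₁_le) c hlen
  have hh₂ := dom_hashTime hB₂ (fun i => i.e₂_le) c hlen
  have hf := dom_filterTime hB₂
  have hbt := dom_bucketTime hA
  -- Again `r` times the number of digits is kept together. This holds the exponent at `d + 2`: one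
  -- from the repetitions, one from this product and `d` from each measurement.
  have h : (fun i : Params A => iterationTime i.d i.m c i.e₁ i.e₂ i.r i.n i.n' i.k i.s) = fun i =>
      2 * ((i.d : ℝ) + 1) * ((i.s : ℝ) + i.k + 1) +
      (i.n * (((i.r + i.d * ((i.r : ℝ) * numDigits i.m)) *
          (3 * i.d + hashTime i.d i.m c i.e₁ (2 * i.d) ((i.s : ℝ) + i.k) +
            ((2 : ℝ) ^ i.e₁) ^ i.d + 1) + i.r +
        (4 * (i.d : ℝ) ^ 3 + 1) + ((2 : ℝ) ^ i.e₁) ^ i.d * (bucketTime i.d i.m i.r +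
          (2 * (i.d : ℝ) ^ 2 + i.d + 1))) + ((i.d : ℝ) + 1) * (((2 : ℝ) ^ i.e₁) ^ i.d + 1)) +
      (filterTime (halfWidth i.e₂) (2 * i.d) + (i.n' * (((i.d : ℝ) ^ 2 + i.d + 2) +
        (1 + (i.d + hashTime i.d i.m c i.e₂ (2 * i.d) ((i.s : ℝ) + i.k))) + 1) +
        i.n * ((2 : ℝ) ^ i.e₁) ^ i.d * (i.n' * (4 * (i.d : ℝ) ^ 2 + 30 * i.d + 10 + 1) +
          (10 * ((i.n' : ℝ) + 1) * (((Nat.log 2 i.n' : ℕ) : ℝ) + 1) + (i.d + 4)))) +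
        2 * ((i.d : ℝ) + 1) * ((i.k : ℝ) + i.k + 1))) := by
    funext i
    rw [iterationTime, locateTime, estimateTime, randomHashTime]
    ring
  rw [h]
  apply Dom.le
  · repeat' first
      | assumption
      | exact dom_const (by norm_num)
      | apply Dom.pow
      | apply Dom.add
      | apply Dom.mul
  · decide
  · intro i; have := i.one_le_d; omega

theorem dom_totalTime (hA : 1 ≤ A) (c : ℕ) : Dom 1 (fun i => i.d + 3) (fun i : Params A =>
    totalTime i.d i.m c i.e₁ i.e₂ i.r i.n i.n' i.k i.T i.s) := by
  have hd := dom_d (A := A)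
  have hit := dom_iterationTime hA c
  have hrd : Dom 0 (fun _ => 1) (fun i : Params A => (i.r : ℝ) * numDigits i.m) :=
    dom_linear hA (fun i => by positivity) fun i => i.digits_le
  have hr : Dom 0 (fun _ => 1) (fun i : Params A => (i.r : ℝ)) :=
    dom_linear hA (fun i => by positivity) fun i => i.r_le
  have hn : Dom 0 (fun _ => 1) (fun i : Params A => (i.n : ℝ)) :=
    dom_linear hA (fun i => by positivity) fun i => i.n_le
  have hT : Dom 0 (fun _ => 1) (fun i : Params A => (i.T : ℝ)) :=
    dom_linear hA (fun i => by positivity) fun i => i.T_le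
  have hB₁ := dom_buckets hA fun i : Params A => i.buckets₁
  have hh₁ := dom_hashTime hB₁ (fun i => i.e₁_le) c ((dom_const le_rfl).le (by norm_num) (by simp))
  have hf := dom_filterTime hB₁
  have h : (fun i : Params A => totalTime i.d i.m c i.e₁ i.e₂ i.r i.n i.n' i.k i.T i.s) = fun i =>
      filterTime (halfWidth i.e₁) (2 * i.d) + (i.n * (((i.d : ℝ) ^ 2 + i.d + 2) +
        (1 + (2 * i.d * i.r + (i.r + i.d * ((i.r : ℝ) * numDigits i.m)) *
          (3 * i.d + hashTime i.d i.m c i.e₁ (2 * i.d) 0 + 1) + i.r)) + 1) +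
        i.T * iterationTime i.d i.m c i.e₁ i.e₂ i.r i.n i.n' i.k i.s) := by
    funext i
    rw [totalTime, measureTime]
    ring
  rw [h]
  apply Dom.le
  · repeat' first
      | assumption
      | exact dom_const (by norm_num)
      | apply Dom.pow
      | apply Dom.add
      | apply Dom.mul
  · decide
  · intro i; have := i.one_le_d; omega

theorem dom_totalSamples (hA : 1 ≤ A) : Dom 1 (fun _ => 3) (fun i : Params A =>
    totalSamples i.d i.m i.e₁ i.e₂ i.r i.n i.n' i.T) := by
  have hd := dom_d (A := A)
  have hnum := dom_numDigits (A := A)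
  have hr : Dom 0 (fun _ => 1) (fun i : Params A => (i.r : ℝ)) :=
    dom_linear hA (fun i => by positivity) fun i => i.r_le
  have hn : Dom 0 (fun _ => 1) (fun i : Params A => (i.n : ℝ)) :=
    dom_linear hA (fun i => by positivity) fun i => i.n_le
  have hn' : Dom 0 (fun _ => 1) (fun i : Params A => (i.n' : ℝ)) :=
    dom_linear hA (fun i => by positivity) fun i => i.n'_le
  have hT : Dom 0 (fun _ => 1) (fun i : Params A => (i.T : ℝ)) :=
    dom_linear hA (fun i => by positivity) fun i => i.T_le
  have hb₁ := dom_box (dom_buckets hA fun i : Params A => i.buckets₁)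
  have hb₂ := dom_box (dom_buckets hA fun i : Params A => i.buckets₂)
  unfold totalSamples
  apply Dom.le
  · repeat' first
      | assumption
      | exact dom_const (by norm_num)
      | apply Dom.add
      | apply Dom.mul
  · decide
  · intro i; omega

/-- Passage from a bound of order `K ^ d² W X ^ p` to a power of two. -/
theorem Dom.exists_two_pow {b : ℕ} {p : Params A → ℕ} {f : Params A → ℝ} (h : Dom b p f)
    (hp : ∀ i, p i ≤ i.d + 3) : ∃ κ : ℕ, ∀ (i : Params A) (l : ℝ), i.X ≤ 2 * l →
      f i ≤ 2 ^ (κ * i.d ^ 2) * i.W ^ b * l ^ p i := by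
  obtain ⟨K, hK, hf⟩ := h
  obtain ⟨q, hq⟩ := pow_unbounded_of_one_lt K (one_lt_two : (1 : ℝ) < 2)
  -- The summand 4 pays for replacing `X` by `2 l`, since `2^p ≤ 2^(d + 3) ≤ 2^(4 d²)`.
  refine ⟨q + 4, fun i l hl => (hf i).2.trans ?_⟩
  have h3 := i.one_le_W
  have h4 := i.one_le_X
  have hl0 : 0 ≤ l := by linarith
  have hd := i.one_le_d
  calc K ^ i.d ^ 2 * (i.W ^ b * i.X ^ p i)
      ≤ (2 ^ q) ^ i.d ^ 2 * (i.W ^ b * (2 * l) ^ p i) := by gcongr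
    _ = (2 ^ q) ^ i.d ^ 2 * 2 ^ p i * (i.W ^ b * l ^ p i) := by rw [mul_pow]; ring
    _ ≤ (2 ^ q) ^ i.d ^ 2 * 2 ^ (4 * i.d ^ 2) * (i.W ^ b * l ^ p i) := by
        have h5 : p i ≤ 4 * i.d ^ 2 := (hp i).trans (by nlinarith)
        have h6 : (2 : ℝ) ^ p i ≤ 2 ^ (4 * i.d ^ 2) := pow_le_pow_right₀ (by norm_num) h5
        gcongr
    _ = _ := by rw [add_mul, pow_add, pow_mul]; ring

end Dom

end

section

/-! ### Choice of the parameters -/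

/-- Minimality: the next smaller power misses `B`, so the overshoot is at most `2^d`. The strict
bound `1 < B` excludes the exponent zero, for which the filter estimates fail. -/
theorem bucketExp_spec {d m : ℕ} {B : ℝ} (hB : 1 < B) (hBN : B ≤ size d m) :
    1 ≤ bucketExp d B ∧ bucketExp d B ≤ m ∧ B ≤ ((2 : ℝ) ^ bucketExp d B) ^ d ∧
      ((2 : ℝ) ^ bucketExp d B) ^ d ≤ 2 ^ d * B := by
  have hm : m ∈ {e : ℕ | B ≤ ((2 : ℝ) ^ e) ^ d} := hBN
  have hmem : B ≤ ((2 : ℝ) ^ bucketExp d B) ^ d := Nat.sInf_mem ⟨m, hm⟩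
  have h1 : 1 ≤ bucketExp d B := by
    by_contra h
    have h0 : bucketExp d B = 0 := by omega
    rw [h0, pow_zero, one_pow] at hmem
    linarith
  refine ⟨h1, Nat.sInf_le hm, hmem, ?_⟩
  have h2 : bucketExp d B - 1 ∉ {e : ℕ | B ≤ ((2 : ℝ) ^ e) ^ d} :=
    Nat.notMem_of_lt_sInf (by change bucketExp d B - 1 < bucketExp d B; omega)
  have h3 : ((2 : ℝ) ^ (bucketExp d B - 1)) ^ d ≤ B := (not_le.1 h2).le
  obtain ⟨q, hq⟩ : ∃ q, bucketExp d B = q + 1 := ⟨_, (Nat.sub_add_cancel h1).symm⟩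
  rw [hq, Nat.add_sub_cancel] at h3
  rw [hq, pow_succ', mul_pow]
  exact mul_le_mul_of_nonneg_left h3 (by positivity)

theorem size_eq_two_pow (d m : ℕ) : size d m = 2 ^ (d * m) := by
  rw [size, ← pow_mul, mul_comm]

/-! ### Consequences of the bound on the number of buckets -/

section Facts

variable {d m k : ℕ} {α : ℝ} (hd : 1 ≤ d) (hk : 1 ≤ k) (hα : 0 < α) (hα1 : α ≤ 1)
  (hN : (2 * Real.pi) ^ (8 * d ^ 2) * (k : ℝ) / α ^ (2 * d) ≤ size d m)

theorem four_le_two_pi : (4 : ℝ) ≤ 2 * Real.pi := by linarith [Real.two_le_pi]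

include hk hα hα1 hN

theorem buckets_le_size {j : ℕ} (hj : j ≤ 2 * d) :
    (2 * Real.pi) ^ (8 * d ^ 2) * (k : ℝ) / α ^ j ≤ size d m := by
  refine le_trans ?_ hN
  have h1 := pow_le_pow_of_le_one hα.le hα1 hj
  have := Real.pi_pos
  gcongr

theorem sparsity_le_size : (k : ℝ) ≤ size d m := by
  have h1 := buckets_le_size hk hα hα1 hN (Nat.zero_le (2 * d))
  rw [pow_zero, div_one] at h1
  have h2 : (1 : ℝ) ≤ (2 * Real.pi) ^ (8 * d ^ 2) := one_le_pow₀ (by linarith [four_le_two_pi])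
  exact (le_mul_of_one_le_left (Nat.cast_nonneg k) h2).trans h1

-- Since `2π ≥ 4`, the bound on the number of buckets gives `2^(16 d²) ≤ 2^(d m)`. Every later
-- estimate that needs `N` large relies on this.
include hd in
theorem sixteen_mul_le : 16 * d ≤ m := by
  have h1 := buckets_le_size hk hα hα1 hN (Nat.zero_le (2 * d))
  rw [pow_zero, div_one, size_eq_two_pow] at h1
  have hk1 : (1 : ℝ) ≤ k := by exact_mod_cast hk
  have h2 : (2 : ℝ) ^ (16 * d ^ 2) ≤ 2 ^ (d * m) := by
    calc (2 : ℝ) ^ (16 * d ^ 2) = 4 ^ (8 * d ^ 2) := by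
          rw [show (4 : ℝ) = 2 ^ 2 by norm_num, ← pow_mul]; congr 1; ring
      _ ≤ (2 * Real.pi) ^ (8 * d ^ 2) := pow_le_pow_left₀ (by norm_num) four_le_two_pi _
      _ ≤ (2 * Real.pi) ^ (8 * d ^ 2) * k :=
          le_mul_of_one_le_right (by have := Real.pi_pos; positivity) hk1
      _ ≤ _ := h1
  have h3 := (pow_le_pow_iff_right₀ (by norm_num : (1 : ℝ) < 2)).1 h2
  refine Nat.le_of_mul_le_mul_left ?_ (show 0 < d by omega)
  calc d * (16 * d) = 16 * d ^ 2 := by ring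
    _ ≤ d * m := h3

omit hN in
include hd in
theorem one_lt_buckets (j : ℕ) : 1 < (2 * Real.pi) ^ (8 * d ^ 2) * (k : ℝ) / α ^ j := by
  have h1 : α ^ j ≤ 1 := pow_le_one₀ hα.le hα1
  have hk1 : (1 : ℝ) ≤ k := by exact_mod_cast hk
  rw [one_lt_div (by positivity)]
  have h2 : (4 : ℝ) ≤ (2 * Real.pi) ^ (8 * d ^ 2) := four_le_two_pi.trans
    (le_self_pow₀ (by linarith [four_le_two_pi]) (by positivity))
  nlinarith

-- The factor `(2π)^(8d²)` in the number of buckets is consumed here: one half pays for `192^d ≤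
-- 4^(4d)`, the other for the inverse filter values `(π/2)^(4d²)`. What remains is a power of `α`.
omit hN hk in
theorem weightBound_mul_le {e j : ℕ} (hj : 1 ≤ j)
    (he : (2 * Real.pi) ^ (8 * d ^ 2) * (k : ℝ) / α ^ j ≤ ((2 : ℝ) ^ e) ^ d) :
    weightBound d e * k ≤ α := by
  have hpi := Real.pi_pos
  have h1 : (192 : ℝ) ^ d * (Real.pi / 2) ^ (4 * d ^ 2) ≤ (2 * Real.pi) ^ (8 * d ^ 2) := by
    have h2 : (192 : ℝ) ^ d ≤ (2 * Real.pi) ^ (4 * d ^ 2) := by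
      calc (192 : ℝ) ^ d ≤ (4 ^ 4) ^ d := pow_le_pow_left₀ (by norm_num) (by norm_num) _
        _ = 4 ^ (4 * d) := (pow_mul _ _ _).symm
        _ ≤ (2 * Real.pi) ^ (4 * d) := pow_le_pow_left₀ (by norm_num) four_le_two_pi _
        _ ≤ _ := pow_le_pow_right₀ (by linarith [four_le_two_pi])
            (Nat.mul_le_mul_left 4 (Nat.le_self_pow two_ne_zero d))
    have h3 : (Real.pi / 2) ^ (4 * d ^ 2) ≤ (2 * Real.pi) ^ (4 * d ^ 2) :=
      pow_le_pow_left₀ (by positivity) (by linarith) _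
    calc _ ≤ (2 * Real.pi) ^ (4 * d ^ 2) * (2 * Real.pi) ^ (4 * d ^ 2) :=
          mul_le_mul h2 h3 (by positivity) (by positivity)
      _ = _ := by rw [← pow_add]; congr 1; ring
  rw [weightBound, div_mul_eq_mul_div, div_le_iff₀ (by positivity)]
  rw [div_le_iff₀ (by positivity)] at he
  have h4 : α ^ j ≤ α := pow_le_of_le_one hα.le hα1 (by omega)
  calc _ ≤ (2 * Real.pi) ^ (8 * d ^ 2) * k := mul_le_mul_of_nonneg_right h1 (Nat.cast_nonneg k)
    _ ≤ ((2 : ℝ) ^ e) ^ d * α ^ j := he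
    _ ≤ α * ((2 : ℝ) ^ e) ^ d := by
        rw [mul_comm]; exact mul_le_mul_of_nonneg_right h4 (by positivity)

omit hN hk in
theorem buckets_le_pow {A : ℝ} (hA : 2 * (2 * Real.pi) ^ 8 / α ^ 2 ≤ A) {e j : ℕ} (hj : j ≤ 2 * d)
    (he : ((2 : ℝ) ^ e) ^ d ≤ 2 ^ d * ((2 * Real.pi) ^ (8 * d ^ 2) * (k : ℝ) / α ^ j)) :
    ((2 : ℝ) ^ e) ^ d ≤ A ^ d ^ 2 * k := by
  have hpi := Real.pi_pos
  have hdd : d ≤ d ^ 2 := Nat.le_self_pow two_ne_zero d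
  have h1 : (2 : ℝ) ^ d ≤ 2 ^ d ^ 2 := pow_le_pow_right₀ (by norm_num) hdd
  have h2 : α ^ (2 * d ^ 2) ≤ α ^ j :=
    pow_le_pow_of_le_one hα.le hα1 (hj.trans (Nat.mul_le_mul_left 2 hdd))
  calc ((2 : ℝ) ^ e) ^ d ≤ 2 ^ d * ((2 * Real.pi) ^ (8 * d ^ 2) * (k : ℝ) / α ^ j) := he
    _ ≤ 2 ^ d ^ 2 * ((2 * Real.pi) ^ (8 * d ^ 2) * (k : ℝ) / α ^ (2 * d ^ 2)) := by gcongr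
    _ = (2 * (2 * Real.pi) ^ 8 / α ^ 2) ^ d ^ 2 * k := by
        rw [div_pow, mul_pow 2 ((2 * Real.pi) ^ 8), ← pow_mul, ← pow_mul]; ring
    _ ≤ A ^ d ^ 2 * k := by gcongr

end Facts

/-! ### Repetitions, precision and failure probability in terms of `log N` -/

section Logs

variable {d m : ℕ} (hd : 1 ≤ d) (hm : 16 * d ≤ m)

theorem log_size (d m : ℕ) : Real.log (size d m) = d * m * Real.log 2 := by
  rw [size_eq_two_pow, Real.log_pow]; push_cast; ring

theorem mul_le_two_mul_log_size (d m : ℕ) : (d * m : ℝ) ≤ 2 * Real.log (size d m) := by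
  rw [log_size]
  have h1 := Real.log_two_gt_d9
  have h2 : (0 : ℝ) ≤ d * m := by positivity
  nlinarith

theorem log_size_le (d m : ℕ) : Real.log (size d m) ≤ d * m := by
  rw [log_size]
  have h1 := Real.log_two_lt_d9
  have h2 : (0 : ℝ) ≤ d * m := by positivity
  nlinarith

include hd hm

theorem sixteen_le_mul : (16 : ℝ) ≤ d * m := by
  have : 16 ≤ d * m := by nlinarith
  exact_mod_cast this

theorem eight_le_log_size : 8 ≤ Real.log (size d m) := by
  linarith [mul_le_two_mul_log_size d m, sixteen_le_mul hd hm]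

theorem two_le_digitBits : 2 ≤ digitBits m := by
  have h1 : 4 ≤ Nat.log 2 m := Nat.le_log_of_pow_le (by norm_num) (by omega)
  unfold digitBits
  omega

theorem digitFailure_le {C : ℝ} (hC : 4000 ≤ C) :
    digitFailure d m ⌈C * Real.log (Real.log (size d m))⌉₊ ≤ 1 / 4 := by
  set L := Real.log (size d m) with hL
  have hL8 : 8 ≤ L := eight_le_log_size hd hm
  have hLpos : 0 < L := by linarith
  have hLL : 0 ≤ Real.log L := Real.log_nonneg (by linarith)
  -- `C ≥ 4000` turns the decay per point into `L^(-4)`. The union bound over coordinates, digits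
  -- and candidates costs at most `8 L²`, and `L ≥ 8`.
  have h1 : (999 / 1000 : ℝ) ^ ⌈C * Real.log L⌉₊ ≤ (L ^ 4)⁻¹ := by
    have h2 : (999 / 1000 : ℝ) ≤ Real.exp (-(1 / 1000)) := by
      have := Real.add_one_le_exp (-(1 / 1000 : ℝ)); linarith
    refine (pow_le_pow_left₀ (by norm_num) h2 _).trans ?_
    rw [← Real.exp_nat_mul]
    have h3 : (L ^ 4)⁻¹ = Real.exp (-(4 * Real.log L)) := by
      rw [Real.exp_neg, show (4 : ℝ) = ((4 : ℕ) : ℝ) by norm_num, Real.exp_nat_mul,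
        Real.exp_log hLpos]
    rw [h3]
    apply Real.exp_le_exp.2
    have h4 := Nat.le_ceil (C * Real.log L)
    have h5 := mul_le_mul_of_nonneg_right hC hLL
    linarith
  have hm1 : 1 ≤ m := by omega
  have hdb := two_le_digitBits hd hm
  have h5 : (numDigits m : ℝ) ≤ m := by exact_mod_cast numDigits_le (by omega) hm1
  have h6 : (2 : ℝ) ^ digitBits m ≤ m := by exact_mod_cast two_pow_digitBits_le hm1
  have hd1 : (1 : ℝ) ≤ d := by exact_mod_cast hd
  have hm1' : (1 : ℝ) ≤ m := by exact_mod_cast hm1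
  have hX := mul_le_two_mul_log_size d m
  rw [← hL] at hX
  calc digitFailure d m ⌈C * Real.log L⌉₊ ≤ d * (m * ((1 + m) * (L ^ 4)⁻¹)) := by
        unfold digitFailure; gcongr
    _ ≤ (d * m) * (2 * (d * m)) * (L ^ 4)⁻¹ := by
        have h7 : (1 + m : ℝ) ≤ 2 * (d * m) := by nlinarith
        calc _ = (d * m) * (1 + m) * (L ^ 4)⁻¹ := by ring
          _ ≤ _ := by gcongr
    _ ≤ (2 * L) * (2 * (2 * L)) * (L ^ 4)⁻¹ := by gcongr
    _ = 8 / L ^ 2 := by field_simp; ring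
    _ ≤ 1 / 4 := by
        rw [div_le_iff₀ (by positivity)]
        nlinarith

/-- The base of the digits is chosen so that `log₂ Δ` has the order of `log log N`: as `d ≤ m`, also
`log N` is at most a power of `m`. Digits count about `m / log₂ Δ`, which cancels the number of
evaluation points. -/
theorem repetitions_mul_digits_le {C : ℝ} (hC : 0 ≤ C) :
    (⌈C * Real.log (Real.log (size d m))⌉₊ : ℝ) * numDigits m ≤ (18 * C + 2) * (d * m) := by
  set L := Real.log (size d m) with hL
  have hL8 : 8 ≤ L := eight_le_log_size hd hm
  have hdb := two_le_digitBits hd hm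
  have hm1 : 1 ≤ m := by omega
  have hLL : 0 ≤ Real.log L := Real.log_nonneg (by linarith)
  have h1 : Real.log L ≤ 9 * digitBits m := by
    have h2 : m < 2 ^ (Nat.log 2 m + 1) := Nat.lt_pow_succ_log_self (by norm_num) m
    have h3 : d * m ≤ 2 ^ (2 * (Nat.log 2 m + 1)) := by
      rw [two_mul, pow_add]
      exact Nat.mul_le_mul (by omega) h2.le
    have h4 : L ≤ 2 ^ (2 * (Nat.log 2 m + 1)) :=
      (log_size_le d m).trans (by exact_mod_cast h3)
    have h5 := Real.log_le_log (by linarith) h4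
    rw [Real.log_pow] at h5
    have h6 : 2 * (Nat.log 2 m + 1) ≤ 9 * digitBits m := by
      unfold digitBits at hdb ⊢
      omega
    have h7 : ((2 * (Nat.log 2 m + 1) : ℕ) : ℝ) ≤ 9 * digitBits m := by exact_mod_cast h6
    have h8 := Real.log_two_lt_d9
    have h9 : (0 : ℝ) ≤ ((2 * (Nat.log 2 m + 1) : ℕ) : ℝ) := Nat.cast_nonneg _
    nlinarith
  have h2 : ((digitBits m : ℕ) : ℝ) * numDigits m ≤ 2 * m := by
    have h3 : digitBits m * numDigits m ≤ 2 * m := by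
      unfold numDigits
      refine (Nat.mul_div_le _ _).trans ?_
      have h4 : digitBits m ≤ m := (Nat.div_le_self _ _).trans (Nat.log_le_self 2 m)
      omega
    exact_mod_cast h3
  have h3 : (⌈C * Real.log L⌉₊ : ℝ) ≤ (9 * C + 1) * digitBits m := by
    have h4 := Nat.ceil_lt_add_one (mul_nonneg hC hLL)
    have h5 := mul_le_mul_of_nonneg_left h1 hC
    have h6 : (2 : ℝ) ≤ digitBits m := by exact_mod_cast hdb
    linarith
  have hd1 : (1 : ℝ) ≤ d := by exact_mod_cast hd
  have hmd : (m : ℝ) ≤ d * m := le_mul_of_one_le_left (Nat.cast_nonneg m) hd1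
  calc (⌈C * Real.log L⌉₊ : ℝ) * numDigits m ≤ (9 * C + 1) * digitBits m * numDigits m :=
        mul_le_mul_of_nonneg_right h3 (Nat.cast_nonneg _)
    _ = (9 * C + 1) * (digitBits m * numDigits m) := by ring
    _ ≤ (9 * C + 1) * (2 * m) := by gcongr
    _ ≤ (9 * C + 1) * (2 * (d * m)) := by gcongr
    _ = _ := by ring

theorem ceil_mul_log_le {C : ℝ} (hC : 0 ≤ C) :
    (⌈C * Real.log (size d m)⌉₊ : ℝ) ≤ (C + 1) * (d * m) := by
  have hL8 := eight_le_log_size hd hm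
  have h1 := Nat.ceil_lt_add_one (mul_nonneg hC (by linarith : 0 ≤ Real.log (size d m)))
  have h2 := mul_le_mul_of_nonneg_left (log_size_le d m) hC
  linarith [sixteen_le_mul hd hm]

theorem ceil_mul_loglog_le {C : ℝ} (hC : 0 ≤ C) :
    (⌈C * Real.log (Real.log (size d m))⌉₊ : ℝ) ≤ (C + 1) * (d * m) := by
  have hL8 := eight_le_log_size hd hm
  have h0 : 0 ≤ Real.log (Real.log (size d m)) := Real.log_nonneg (by linarith)
  have h1 := Nat.ceil_lt_add_one (mul_nonneg hC h0)
  have h3 := Real.log_le_self (by linarith : 0 ≤ Real.log (size d m))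
  have h2 := mul_le_mul_of_nonneg_left (h3.trans (log_size_le d m)) hC
  linarith [sixteen_le_mul hd hm]

theorem two_pow_16_le_size : (2 : ℝ) ^ 16 ≤ size d m := by
  rw [size_eq_two_pow]
  exact pow_le_pow_right₀ (by norm_num) (by nlinarith)

omit hm in
theorem two_pow_le_size : (2 : ℝ) ^ m ≤ size d m := by
  rw [size_eq_two_pow]
  exact pow_le_pow_right₀ (by norm_num) (by nlinarith)

theorem cast_le_size : (d : ℝ) ≤ size d m := by
  rw [size_eq_two_pow]
  have h1 : d < 2 ^ d := Nat.lt_two_pow_self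
  have h2 : 2 ^ d ≤ 2 ^ (d * m) := Nat.pow_le_pow_right (by norm_num) (by nlinarith)
  exact_mod_cast h1.le.trans h2

omit hm hd in
theorem two_pow_mul_eq (c : ℕ) : (2 : ℝ) ^ (c * (m * d)) = size d m ^ c := by
  rw [size_eq_two_pow, ← pow_mul]; congr 1; ring

theorem precision_le_one {c : ℕ} (hc : 3 ≤ c) :
    d * (4 * 2 ^ m / 2 ^ (c * (m * d)) : ℝ) ≤ 1 := by
  have h1 := two_pow_16_le_size hd hm
  have hpos := size_pos d m
  rw [two_pow_mul_eq, mul_div_assoc', div_le_one (by positivity)]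
  calc (d : ℝ) * (4 * 2 ^ m) ≤ size d m * (size d m * size d m) := by
        have h2 := cast_le_size hd hm
        have h3 := two_pow_le_size (m := m) hd
        have h4 : (4 : ℝ) ≤ size d m := by linarith
        gcongr
    _ = size d m ^ 3 := by ring
    _ ≤ size d m ^ c := pow_le_pow_right₀ (by linarith) hc

/-- The five extra powers of `N` dominate the factors `N`, `1280 = 4 · 2 · 4 · 40`, `d`, `n` and
`(π/2)^(2d²)`. -/
theorem precision_le {c c₀ : ℕ} (hc : c₀ + 5 ≤ c) :
    size d m * (4 * size d m ^ c₀) * semiErr d m c ≤ (2 / Real.pi) ^ (2 * d ^ 2) / 40 := by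
  have hpi := Real.pi_pos
  have h1 := two_pow_16_le_size hd hm
  have hpos := size_pos d m
  have h2 := cast_le_size hd hm
  have h3 := two_pow_le_size (m := m) hd
  have h4 : (1280 : ℝ) ≤ size d m := by linarith
  have h5 : (Real.pi / 2) ^ (2 * d ^ 2) ≤ size d m := by
    calc (Real.pi / 2) ^ (2 * d ^ 2) ≤ 2 ^ (2 * d ^ 2) :=
          pow_le_pow_left₀ (by positivity) (by linarith [Real.pi_le_four]) _
      _ ≤ 2 ^ (d * m) := pow_le_pow_right₀ (by norm_num) (by nlinarith)
      _ = size d m := (size_eq_two_pow d m).symm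
  have h6 : (2 / Real.pi) ^ (2 * d ^ 2) = ((Real.pi / 2) ^ (2 * d ^ 2))⁻¹ := by
    rw [← inv_pow, inv_div]
  have h7 : size d m ^ c₀ * size d m ^ 5 ≤ size d m ^ c := by
    rw [← pow_add]; exact pow_le_pow_right₀ (by linarith) hc
  rw [semiErr, two_pow_mul_eq, h6, inv_eq_one_div, div_div, le_div_iff₀ (by positivity)]
  have h8 : size d m * (4 * size d m ^ c₀) * (2 * d * (4 * 2 ^ m / size d m ^ c)) *
      ((Real.pi / 2) ^ (2 * d ^ 2) * 40) =
      size d m ^ c₀ * (size d m * 1280 * d * 2 ^ m * (Real.pi / 2) ^ (2 * d ^ 2)) / size d m ^ c := by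
    field_simp
    ring
  rw [h8, div_le_one (by positivity)]
  refine le_trans ?_ h7
  refine mul_le_mul_of_nonneg_left ?_ (by positivity)
  calc size d m * 1280 * d * 2 ^ m * (Real.pi / 2) ^ (2 * d ^ 2) ≤
        size d m * size d m * size d m * size d m * size d m := by gcongr
    _ = size d m ^ 5 := by ring

omit hd hm in
theorem iterations_le {c₀ : ℕ} {R : ℝ} (hR : 0 ≤ R) (hRN : R ≤ size d m ^ c₀) :
    ⌈Real.logb 2 R⌉₊ ≤ c₀ * (d * m) := by
  refine Nat.ceil_le.2 ?_
  rcases hR.eq_or_lt with rfl | hR0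
  · rw [Real.logb_zero]; positivity
  · rw [size_eq_two_pow, ← pow_mul] at hRN
    rw [Real.logb_le_iff_le_rpow (by norm_num) hR0, Real.rpow_natCast]
    rwa [mul_comm c₀]

theorem half_pow_le {C : ℝ} {q n : ℕ} (hC : 2 * q ≤ C) (hn : C * Real.log (size d m) ≤ n) :
    (1 / 2 : ℝ) ^ n ≤ (size d m ^ q)⁻¹ := by
  rw [size_eq_two_pow, ← pow_mul, one_div, inv_pow]
  refine inv_anti₀ (by positivity) (pow_le_pow_right₀ (by norm_num) ?_)
  have h1 := mul_le_two_mul_log_size d m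
  have h0 : 0 ≤ Real.log (size d m) := by linarith [eight_le_log_size hd hm]
  have h2 := mul_le_mul_of_nonneg_right hC h0
  have h3 : (q : ℝ) * (d * m) ≤ q * (2 * Real.log (size d m)) :=
    mul_le_mul_of_nonneg_left h1 (Nat.cast_nonneg q)
  have h4 : ((d * m * q : ℕ) : ℝ) ≤ n := by push_cast; linarith
  exact_mod_cast h4

theorem failure_le {α C : ℝ} {c₀ k T : ℕ} (hα : 0 < α) (hα1 : α ≤ 1) (hC : 4000 + 2 * c₀ ≤ C)
    (hk : (k : ℝ) ≤ size d m) (hT : T ≤ c₀ * (d * m)) :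
    k * (1 / 2 : ℝ) ^ ⌈C / Real.sqrt α * Real.log (size d m)⌉₊ +
      T * (size d m * (1 / 2) ^ ⌈C * Real.log (size d m)⌉₊) ≤ 1 / size d m ^ 10 := by
  have hpos := size_pos d m
  have h16 := two_pow_16_le_size hd hm
  have hL := eight_le_log_size hd hm
  have hs : 0 < Real.sqrt α := Real.sqrt_pos.2 hα
  have hs1 : Real.sqrt α ≤ 1 := Real.sqrt_le_one.2 hα1
  have hc0 : (0 : ℝ) ≤ c₀ := Nat.cast_nonneg _
  -- Both failure terms are at most `N^(c₀ + 2) N^(-(c₀ + 13)) = N^(-11)`. The spare factor `N`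
  -- absorbs the 2.
  have hC2 : 2 * ((c₀ + 13 : ℕ) : ℝ) ≤ C := by push_cast; linarith
  have hCs : C ≤ C / Real.sqrt α := by rw [le_div_iff₀ hs]; nlinarith
  have h1 := half_pow_le hd hm (hC2.trans hCs) (Nat.le_ceil _)
  have h2 := half_pow_le hd hm hC2 (Nat.le_ceil _)
  have hT' : (T : ℝ) ≤ size d m ^ c₀ * size d m := by
    have h3 : c₀ ≤ 2 ^ c₀ := Nat.lt_two_pow_self.le
    have h4 : d * m ≤ 2 ^ (d * m) := Nat.lt_two_pow_self.le
    calc (T : ℝ) ≤ c₀ * ((d * m : ℕ) : ℝ) := by exact_mod_cast hT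
      _ ≤ 2 ^ c₀ * 2 ^ (d * m) := by
          have h5 : (c₀ : ℝ) ≤ 2 ^ c₀ := by exact_mod_cast h3
          have h6 : ((d * m : ℕ) : ℝ) ≤ 2 ^ (d * m) := by exact_mod_cast h4
          gcongr
      _ ≤ size d m ^ c₀ * size d m := by
          rw [← size_eq_two_pow]
          have h7 : (2 : ℝ) ≤ size d m := by linarith
          gcongr
  have h1N : (1 : ℝ) ≤ size d m := by linarith
  calc _ ≤ size d m * (size d m ^ (c₀ + 13))⁻¹ +
        size d m ^ c₀ * size d m * (size d m * (size d m ^ (c₀ + 13))⁻¹) := by gcongr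
    _ ≤ size d m ^ c₀ * size d m * (size d m * (size d m ^ (c₀ + 13))⁻¹) +
        size d m ^ c₀ * size d m * (size d m * (size d m ^ (c₀ + 13))⁻¹) := by
        refine add_le_add (le_mul_of_one_le_left (by positivity) ?_) le_rfl
        exact one_le_mul_of_one_le_of_one_le (one_le_pow₀ h1N) h1N
    _ = 2 / size d m * (1 / size d m ^ 10) := by
        rw [pow_add]; field_simp; ring
    _ ≤ 1 / size d m ^ 10 := by
        refine mul_le_of_le_one_left (by positivity) ?_
        rw [div_le_one hpos]; linarith

end Logs

/-- The constant in the bounds for the parameters. -/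
def paramConst (α C : ℝ) (c₀ : ℕ) : ℝ :=
  (18 * C + 2) + C / Real.sqrt α + c₀ + 2 * (2 * Real.pi) ^ 8 / α ^ 2

/-- The parameters in a run of `reduceInfNorm`. -/
def runParams {α C : ℝ} {c₀ d m k : ℕ} (s T : ℕ) (hα : 0 < α) (hα1 : α ≤ 1) (hC : 0 ≤ C)
    (hd : 1 ≤ d) (hk : 1 ≤ k)
    (hN : (2 * Real.pi) ^ (8 * d ^ 2) * (k : ℝ) / α ^ (2 * d) ≤ size d m)
    (hT : T ≤ c₀ * (d * m)) : Params (paramConst α C c₀) where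
  d := d
  m := m
  k := k
  s := s
  T := T
  e₁ := bucketExp d ((2 * Real.pi) ^ (4 * d * (2 * d)) * k / α ^ d)
  e₂ := bucketExp d ((2 * Real.pi) ^ (4 * d * (2 * d)) * k / α ^ (2 * d))
  r := ⌈C * Real.log (Real.log (size d m))⌉₊
  n := ⌈C / Real.sqrt α * Real.log (size d m)⌉₊
  n' := ⌈C * Real.log (size d m)⌉₊
  one_le_d := hd
  one_le_k := hk
  one_le_m := by have := sixteen_mul_le hd hk hα hα1 hN; omega
  one_le_digitBits := by
    have := two_le_digitBits hd (sixteen_mul_le hd hk hα hα1 hN); omega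
  e₁_le := by
    rw [show 4 * d * (2 * d) = 8 * d ^ 2 by ring]
    exact (bucketExp_spec (one_lt_buckets hd hk hα hα1 d)
      (buckets_le_size hk hα hα1 hN (by omega))).2.1
  e₂_le := by
    rw [show 4 * d * (2 * d) = 8 * d ^ 2 by ring]
    exact (bucketExp_spec (one_lt_buckets hd hk hα hα1 _) hN).2.1
  buckets₁ := by
    rw [show 4 * d * (2 * d) = 8 * d ^ 2 by ring]
    refine buckets_le_pow hα hα1 (le_add_of_nonneg_left (by positivity))
      (by omega : d ≤ 2 * d) ?_
    exact (bucketExp_spec (one_lt_buckets hd hk hα hα1 d)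
      (buckets_le_size hk hα hα1 hN (by omega))).2.2.2
  buckets₂ := by
    rw [show 4 * d * (2 * d) = 8 * d ^ 2 by ring]
    refine buckets_le_pow hα hα1 (le_add_of_nonneg_left (by positivity)) le_rfl ?_
    exact (bucketExp_spec (one_lt_buckets hd hk hα hα1 _) hN).2.2.2
  T_le := by
    have h1 : (T : ℝ) ≤ c₀ * (d * m) := by exact_mod_cast hT
    refine h1.trans (mul_le_mul_of_nonneg_right ?_ (by positivity))
    have h2 : 0 ≤ (18 * C + 2) + C / Real.sqrt α := by positivity
    have h3 : 0 ≤ 2 * (2 * Real.pi) ^ 8 / α ^ 2 := by have := Real.pi_pos; positivity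
    rw [paramConst]; linarith
  n_le := by
    refine (ceil_mul_log_le hd (sixteen_mul_le hd hk hα hα1 hN) (by positivity)).trans
      (mul_le_mul_of_nonneg_right ?_ (by positivity))
    have h3 : 0 ≤ c₀ + 2 * (2 * Real.pi) ^ 8 / α ^ 2 := by have := Real.pi_pos; positivity
    rw [paramConst]; linarith
  n'_le := by
    refine (ceil_mul_log_le hd (sixteen_mul_le hd hk hα hα1 hN) hC).trans
      (mul_le_mul_of_nonneg_right ?_ (by positivity))
    have h3 : 0 ≤ C / Real.sqrt α + c₀ + 2 * (2 * Real.pi) ^ 8 / α ^ 2 := by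
      have := Real.pi_pos; positivity
    rw [paramConst]; linarith
  r_le := by
    refine (ceil_mul_loglog_le hd (sixteen_mul_le hd hk hα hα1 hN) hC).trans
      (mul_le_mul_of_nonneg_right ?_ (by positivity))
    have h3 : 0 ≤ C / Real.sqrt α + c₀ + 2 * (2 * Real.pi) ^ 8 / α ^ 2 := by
      have := Real.pi_pos; positivity
    rw [paramConst]; linarith
  digits_le := by
    refine (repetitions_mul_digits_le hd (sixteen_mul_le hd hk hα hα1 hN) hC).trans
      (mul_le_mul_of_nonneg_right ?_ (by positivity))
    have h3 : 0 ≤ C / Real.sqrt α + c₀ + 2 * (2 * Real.pi) ^ 8 / α ^ 2 := by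
      have := Real.pi_pos; positivity
    rw [paramConst]; linarith

theorem one_le_paramConst {α C : ℝ} (c₀ : ℕ) (hC : 0 ≤ C) : 1 ≤ paramConst α C c₀ := by
  have h3 : 0 ≤ C / Real.sqrt α + c₀ + 2 * (2 * Real.pi) ^ 8 / α ^ 2 := by
    have := Real.pi_pos; positivity
  rw [paramConst]; linarith

end

end SparseFourier

end

/-! ### Assembly of the theorem -/

theorem mainTheorem6 :
    ∃ α₀ : ℝ, 0 < α₀ ∧ α₀ < 1 ∧
    ∀ α : ℝ, 0 < α → α ≤ α₀ → ∀ c₀ : ℕ,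
    ∃ (c₁ : ℕ) (C₁ : ℝ), ∀ c : ℕ, c₁ ≤ c → ∀ C : ℝ, C₁ ≤ C →
    ∃ K : ℕ,
    ∀ (d m k : ℕ), 1 ≤ d → 1 ≤ k →
      (2 * Real.pi) ^ (8 * d ^ 2) * (k : ℝ) / α ^ (2 * d) ≤ SparseFourier.size d m →
    ∀ (x χ : SparseFourier.Pt d m → ℂ) (ν μ R : ℝ) (S : Finset (SparseFourier.Pt d m)),
      S.card = k →
      (∀ i ∈ S, ∀ j ∉ S, ‖x j - χ j‖ ≤ ‖x i - χ i‖) →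
      (∑ i ∈ S, ‖x i - χ i‖) / k ≤ ν →
      0 ≤ μ →
      (∑ i ∈ Sᶜ, ‖x i - χ i‖ ^ 2) / k ≤ μ ^ 2 →
      (∀ i ∉ S, ‖x i - χ i‖ ≤ ν) →
      0 ≤ R →
      R ≤ SparseFourier.size d m ^ c₀ →
      (∀ i, ‖x i - χ i‖ ≤ R * (ν + μ)) →
      (∀ i, ‖χ i‖ ≤ SparseFourier.size d m ^ c₀ * (ν + μ)) →
      1 - ENNReal.ofReal (1 / SparseFourier.size d m ^ 10) ≤
        ((SparseFourier.reduceInfNorm α C c χ k ν R μ).law (SparseFourier.dft x)).toOuterMeasure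
          {o | (∀ i, ‖x i - χ i - o.output i‖ ≤ 8 * (ν + μ)) ∧
            (∀ i ∉ S, o.output i = 0) ∧
            (o.time : ℝ) ≤ 2 ^ (K * d ^ 2) * (k + ((SparseFourier.supp χ).card : ℝ)) *
              Real.log (SparseFourier.size d m) ^ (d + 3)} ∧
      ∀ o ∈ ((SparseFourier.reduceInfNorm α C c χ k ν R μ).law (SparseFourier.dft x)).support,
        (o.samples : ℝ) ≤ 2 ^ (K * d ^ 2) * k * Real.log (SparseFourier.size d m) ^ 3 := by
  -- `10⁻⁷` is the expected relative weight per bucket tolerated by `permAvg_not_permGood`. The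
  -- summand 5 is explained at `precision_le`; 4000 makes the digit test reliable, and `2 c₀`
  -- compensates for up to `N^(c₀ + 1)` iterations.
  refine ⟨1 / 10 ^ 7, by norm_num, by norm_num, fun α hα hα0 c₀ =>
    ⟨c₀ + 5, 4000 + 2 * c₀, fun c hc C hC => ?_⟩⟩
  have hα1 : α ≤ 1 := hα0.trans (by norm_num)
  have hc0 : (0 : ℝ) ≤ c₀ := Nat.cast_nonneg _
  have hC0 : 0 ≤ C := by linarith
  have hA := SparseFourier.one_le_paramConst (α := α) c₀ hC0
  obtain ⟨κ₁, hκ₁⟩ := (SparseFourier.dom_totalTime hA c).exists_two_pow fun i => le_rfl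
  obtain ⟨κ₂, hκ₂⟩ := (SparseFourier.dom_totalSamples hA).exists_two_pow fun i => by omega
  refine ⟨max κ₁ κ₂, fun d m k hd hk hN x χ ν μ R S hSk _ hν hμ hμ2 hx' hR hRN hxR hχ => ?_⟩
  have hm := SparseFourier.sixteen_mul_le hd hk hα hα1 hN
  have hT := SparseFourier.iterations_le (m := m) (d := d) hR hRN
  have hX := SparseFourier.mul_le_two_mul_log_size d m
  have hL := SparseFourier.eight_le_log_size hd hm
  have hkpos : (0 : ℝ) < k := by exact_mod_cast hk
  have hν0 : 0 ≤ ν := le_trans (by positivity) hν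
  constructor
  · have hexp : 4 * d * (2 * d) = 8 * d ^ 2 := by ring
    have hB₁ := SparseFourier.bucketExp_spec (SparseFourier.one_lt_buckets hd hk hα hα1 d)
      (SparseFourier.buckets_le_size hk hα hα1 hN (by omega))
    have hB₂ := SparseFourier.bucketExp_spec
      (SparseFourier.one_lt_buckets hd hk hα hα1 (2 * d)) hN
    rw [← hexp] at hB₁ hB₂
    -- Head and tail are both measured by `ν + μ`, which exceeds `ν` and `μ` separately.
    have hheadtail : SparseFourier.HeadTail S (x - χ) (ν + μ) := by
      refine ⟨by linarith, ?_, ?_⟩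
      · rw [div_le_iff₀ hkpos] at hν
        simp only [Pi.sub_apply]
        rw [hSk]
        nlinarith
      · rw [div_le_iff₀ hkpos] at hμ2
        simp only [Pi.sub_apply]
        rw [hSk]
        nlinarith [mul_nonneg hkpos.le (mul_nonneg hν0 hμ), mul_nonneg hkpos.le (sq_nonneg ν)]
    have hmain := SparseFourier.reduceInfNorm_likely (c := c) (C := C) (x := x) (χ := χ) (R := R)
      (by omega) hd rfl rfl rfl rfl rfl rfl hB₁.1 hB₁.2.1 hB₂.1 hB₂.2.1
      (by have := SparseFourier.two_le_digitBits hd hm; omega)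
      (SparseFourier.precision_le_one hd hm (by omega))
      (by rw [hSk]
          exact (SparseFourier.weightBound_mul_le hα hα1 hd (j := d) (by have h := hB₁.2.2.1; rw [hexp] at h ⊢; exact h)).trans hα0)
      (by rw [hSk]
          exact (SparseFourier.weightBound_mul_le hα hα1 (j := 2 * d) (by omega)
            (by have h := hB₂.2.2.1; rw [hexp] at h ⊢; exact h)).trans hα0)
      (SparseFourier.digitFailure_le hd hm (by linarith))
      hSk hν0 hμ hheadtail hx' hxR
      (one_le_pow₀ (by linarith [SparseFourier.two_pow_16_le_size hd hm]))
      (fun i => (hxR i).trans (mul_le_mul_of_nonneg_right hRN (by linarith))) hχ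
      (SparseFourier.precision_le hd hm hc)
    have hlaw := SparseFourier.Alg.Likely.law_le (hmain.mono (fun _ => id) le_rfl
      (SparseFourier.failure_le hd hm hα hα1 hC
        (SparseFourier.sparsity_le_size hk hα hα1 hN) hT))
      (by have := SparseFourier.size_pos d m; positivity)
    refine hlaw.trans (MeasureTheory.measure_mono ?_)
    rintro o ⟨⟨ho1, ho2⟩, ho3⟩
    refine ⟨ho1, ho2, ho3.trans ((hκ₁ (SparseFourier.runParams (SparseFourier.supp χ).card _ hα hα1
      hC0 hd hk hN hT) _ hX).trans ?_)⟩
    rw [pow_one]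
    show 2 ^ (κ₁ * d ^ 2) * ((k : ℝ) + (SparseFourier.supp χ).card) *
      Real.log (SparseFourier.size d m) ^ (d + 3) ≤ _
    gcongr
    · norm_num
    · exact le_max_left _ _
  · intro o ho
    -- The sample count does not involve the support of `χ`, so the parameters are taken with `s =
    -- 0` and `W = k`.
    refine ((SparseFourier.reduceInfNorm_reads α C c χ k ν R μ).support o ho).trans
      ((hκ₂ (SparseFourier.runParams 0 _ hα hα1 hC0 hd hk hN hT) _ hX).trans ?_)
    rw [pow_one]
    show 2 ^ (κ₂ * d ^ 2) * ((k : ℝ) + (0 : ℕ)) *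
      Real.log (SparseFourier.size d m) ^ 3 ≤ _
    rw [Nat.cast_zero, add_zero]
    gcongr
    · norm_num
    · exact le_max_right _ _
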